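/- Let $n\ge 1$, let $D\subset\mathbb R^{n+1}$ be the open unit disk and let $g$ be a smooth Riemannian metric on $D$ with $-\kappa\le \sec_g\le\kappa$ for a constant $\kappa>0$. Let $\operatorname{injrad}(g)\in(0,\infty]$ be the injectivity radius of $g$ at the origin, i.e. the supremum of all $\rho>0$ for which $\exp_0$ is defined on the ball of radius $\rho$ in $T_0D$ and is a diffeomorphism from it onto an open subset of $D$, and put $R=\min\bigl(\operatorname{injrad}(g),\tfrac1{2\sqrt\kappa}\bigr)$. Write $B(0,r)$ for the open ball of radius $r$ about the origin in the Riemannian distance of $g$. Let $S\subset D$ be a smooth embedded hypersurface, possibly with boundary $\partial S$, which is a closed subset of $D$, passes through the origin, satisfies $\partial S\cap B(0,R)=\emptyset$, and is area-minimizing with respect to $g$: for some orientation of $S$, the current $[\![S]\!]$ of integration over $S$ satisfies $\mathbf M_W([\![S]\!])\le \mathbf M_W([\![S]\!]+T)$ for every open $W$ with compact closure in $D$ and every integral $n$-current $T$ with $\partial T=0$ and compact support in $W$, where $\mathbf M_W$ denotes the mass in $W$ with respect to $g$. Let $f(r)=r^n\exp(-\sqrt\kappa\,n^2r)$, let $\operatorname{vol}$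 denote the $n$-dimensional Riemannian volume on $S$, and let $w_n$ be the Lebesgue measure of the unit ball in $\mathbb R^n$. Then: 1. $\operatorname{vol}(B(0,r)\cap S)$ is finite for $r\in(0,R)$, and the function $$\alpha(r)=\frac{\operatorname{vol}(B(0,r)\cap S)}{f(r)}$$ is monotonically increasing (non-decreasing) on $(0,R)$. 2. $\alpha(r)\to w_n$ as $r\to0^+$. 3. $\operatorname{vol}(B(0,r)\cap S)\ge w_n f(r)$ for all $r\in(0,R)$. 4. For all $r>0$ with $r\le\tfrac12\min\bigl(\operatorname{injrad}(g),\tfrac1{n^2\sqrt\kappa}\bigr)$, $$\operatorname{vol}(B(0,r)\cap S)\ \ge\ w_nf(r)=w_nr^n\exp(-n^2\sqrt\kappa\,r)\ \ge\ e^{-1}w_nr^n .$$ -/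

import Mathlib

open Set Filter Topology MeasureTheory
open scoped ENNReal ContDiff

noncomputable section

/-! # Riemannian geometry on an open subset of Euclidean space -/

/-- Euclidean space of dimension `m`. -/
abbrev Eu (m : ℕ) : Type := EuclideanSpace ℝ (Fin m)

/-- The `i`-th standard basis vector. -/
def stdVec {m : ℕ} (i : Fin m) : Eu m := EuclideanSpace.single i (1 : ℝ)

/-- A smooth Riemannian metric on the (open) set `D`. The values of `inner` outside `D` are
irrelevant. -/
structure RiemMetric {m : ℕ} (D : Set (Eu m)) where
  inner : Eu m → Eu m →L[ℝ] Eu m →L[ℝ] ℝ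
  symm : ∀ x ∈ D, ∀ u v, inner x u v = inner x v u
  pos : ∀ x ∈ D, ∀ v, v ≠ 0 → 0 < inner x v v
  smooth : ContDiffOn ℝ ∞ inner D

namespace RiemMetric

variable {m : ℕ} {D : Set (Eu m)} (g : RiemMetric D)

/-- The coordinate matrix `g_ij` of the metric at `x`. -/
def gram (x : Eu m) : Matrix (Fin m) (Fin m) ℝ :=
  Matrix.of fun i j => g.inner x (stdVec i) (stdVec j)

/-- The Christoffel symbol of the first kind,
`Γ(u, v; w) = ½ (∂_u g(v, w) + ∂_v g(u, w) - ∂_w g(u, v))`. -/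
def christoffelLow (x u v w : Eu m) : ℝ :=
  (1 / 2) * (fderiv ℝ g.inner x u v w + fderiv ℝ g.inner x v u w - fderiv ℝ g.inner x w u v)

/-- The Christoffel symbol of the second kind, `Γ(u, v) = ∇_u v` for constant vector fields
`u`, `v`: the vector with coordinates `Γ^k = ∑ l, g^{kl} Γ(u, v; e_l)`. -/
def christoffel (x u v : Eu m) : Eu m :=
  ∑ k, (∑ l, (g.gram x)⁻¹ k l * g.christoffelLow x u v (stdVec l)) • stdVec k

/-- The Riemann curvature tensor `R(u, v)w = ∇_u ∇_v w - ∇_v ∇_u w` for constant vector fields. -/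
def curvature (x u v w : Eu m) : Eu m :=
  fderiv ℝ (fun y => g.christoffel y v w) x u - fderiv ℝ (fun y => g.christoffel y u w) x v
    + g.christoffel x u (g.christoffel x v w) - g.christoffel x v (g.christoffel x u w)

/-- The sectional curvature at `x` of the plane spanned by `u` and `v`. -/
def sec (x u v : Eu m) : ℝ :=
  g.inner x (g.curvature x u v v) u /
    (g.inner x u u * g.inner x v v - g.inner x u v ^ 2)

/-- `γ` is a geodesic of `(D, g)` at all times in `s`. -/
def IsGeodesicOn (γ : ℝ → Eu m) (s : Set ℝ) : Prop :=
  ∀ t ∈ s, γ t ∈ D ∧ ContDiffAt ℝ ∞ γ t ∧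
    deriv (deriv γ) t + g.christoffel (γ t) (deriv γ t) (deriv γ t) = 0

/-- The exponential map at `p` is defined on the ball of radius `ρ` about `0` in the tangent space
at `p` and is a diffeomorphism from that ball onto an open subset of `D`. Here `Φ` is the
exponential map: `t ↦ Φ (t • v)` is, on `[0, 1]`, the geodesic that starts at `p` with
velocity `v`. -/
def ExpIsDiffeo (p : Eu m) (ρ : ℝ) : Prop :=
  ∃ Φ : OpenPartialHomeomorph (Eu m) (Eu m),
    Φ.source = {v | g.inner p v v < ρ ^ 2} ∧
    ContDiffOn ℝ ∞ Φ Φ.source ∧ ContDiffOn ℝ ∞ Φ.symm Φ.target ∧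
    ∀ v ∈ Φ.source, g.IsGeodesicOn (fun t => Φ (t • v)) (Icc 0 1) ∧
      Φ 0 = p ∧ deriv (fun t : ℝ => Φ (t • v)) 0 = v

/-- The injectivity radius at `p`. -/
def injRad (p : Eu m) : ℝ≥0∞ :=
  ⨆ (ρ : ℝ) (_ : 0 < ρ ∧ g.ExpIsDiffeo p ρ), ENNReal.ofReal ρ

/-- The length of the curve `γ` on `[0, 1]`. -/
def length (γ : ℝ → Eu m) : ℝ≥0∞ :=
  ∫⁻ t in Icc (0 : ℝ) 1, ENNReal.ofReal (√(g.inner (γ t) (deriv γ t) (deriv γ t)))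

/-- The Riemannian distance: the infimum of the lengths of the `C¹` curves in `D` from
`p` to `q`. -/
def edist (p q : Eu m) : ℝ≥0∞ :=
  ⨅ (γ : ℝ → Eu m) (_ : ContDiffOn ℝ 1 γ (Icc 0 1) ∧ MapsTo γ (Icc 0 1) D ∧ γ 0 = p ∧ γ 1 = q),
    g.length γ

/-- The open metric ball `B(p, r)` of `(D, g)`. -/
def ball (p : Eu m) (r : ℝ) : Set (Eu m) :=
  {x | x ∈ D ∧ g.edist p x < ENNReal.ofReal r}

end RiemMetric

/-! # Hypersurfaces with boundary -/

/-- `p` is an interior point of `S ⊆ ℝ^(n+1)`: near `p` some diffeomorphism takes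
`S` to the hyperplane on which the last coordinate vanishes. -/
def IsInteriorPt {n : ℕ} (S : Set (Eu (n + 1))) (p : Eu (n + 1)) : Prop :=
  p ∈ S ∧ ∃ Φ : OpenPartialHomeomorph (Eu (n + 1)) (Eu (n + 1)),
    p ∈ Φ.source ∧ ContDiffOn ℝ ∞ Φ Φ.source ∧ ContDiffOn ℝ ∞ Φ.symm Φ.target ∧
    ∀ x ∈ Φ.source, x ∈ S ↔ Φ x (Fin.last n) = 0

/-- `p` is a boundary point of `S ⊆ ℝ^(n+1)`, where `n ≥ 1`: near `p` some diffeomorphism takes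
`S` to a half of the hyperplane on which the last coordinate vanishes, and `p` to a point of the
boundary of that half-hyperplane. -/
def IsBoundaryPt {n : ℕ} (S : Set (Eu (n + 1))) (p : Eu (n + 1)) : Prop :=
  p ∈ S ∧ ∃ Φ : OpenPartialHomeomorph (Eu (n + 1)) (Eu (n + 1)),
    p ∈ Φ.source ∧ ContDiffOn ℝ ∞ Φ Φ.source ∧ ContDiffOn ℝ ∞ Φ.symm Φ.target ∧
    Φ p 0 = 0 ∧ ∀ x ∈ Φ.source, x ∈ S ↔ Φ x (Fin.last n) = 0 ∧ 0 ≤ Φ x 0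

/-- The boundary `∂S` of the hypersurface `S`. -/
def hypBoundary {n : ℕ} (S : Set (Eu (n + 1))) : Set (Eu (n + 1)) :=
  {p | IsBoundaryPt S p}

/-- `S` is a smooth embedded hypersurface, possibly with boundary, of the open set `D`, and it is a
closed subset of `D`. -/
structure IsHypersurface {n : ℕ} (D S : Set (Eu (n + 1))) : Prop where
  subset : S ⊆ D
  closed : closure S ∩ D ⊆ S
  local_form : ∀ p ∈ S, IsInteriorPt S p ∨ IsBoundaryPt S p

/-- The tangent space of `S` at `x`. -/
def tangentSpaceAt {m : ℕ} (S : Set (Eu m)) (x : Eu m) : Submodule ℝ (Eu m) :=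
  Submodule.span ℝ (tangentConeAt ℝ S x)

/-- The factor by which `g` changes the Euclidean area element of `S` at `x`: the square root of the
Gram determinant, with respect to `g`, of a Euclidean orthonormal basis of the tangent space. -/
def areaDensity {m : ℕ} {D : Set (Eu m)} (g : RiemMetric D) (S : Set (Eu m)) (x : Eu m) : ℝ :=
  √(Matrix.det (Matrix.of fun i j =>
    g.inner x (stdOrthonormalBasis ℝ (tangentSpaceAt S x) i : Eu m)
      (stdOrthonormalBasis ℝ (tangentSpaceAt S x) j : Eu m)))

/-- The `n`-dimensional Riemannian volume of `A ∩ S`, for a hypersurface `S` of `(D, g)`. The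
measure `μHE[n]` is the `n`-dimensional Hausdorff measure of Euclidean space, normalized
to agree with Lebesgue measure on `n`-dimensional subspaces. -/
def hypVol {n : ℕ} {D : Set (Eu (n + 1))} (g : RiemMetric D) (S A : Set (Eu (n + 1))) : ℝ≥0∞ :=
  ∫⁻ x in A ∩ S, ENNReal.ofReal (areaDensity g S x) ∂μHE[n]

/-! # Currents -/

/-- Differential forms of degree `n` on `ℝ^m`. -/
abbrev DForm (m n : ℕ) : Type := Eu m → Eu m [⋀^Fin n]→L[ℝ] ℝ

/-- The smooth `n`-forms with compact support in `W`. -/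
def testForms {m : ℕ} (n : ℕ) (W : Set (Eu m)) : Set (DForm m n) :=
  {α | ContDiff ℝ ∞ α ∧ HasCompactSupport α ∧ tsupport α ⊆ W}

/-- `n`-dimensional currents, as functionals on `n`-forms; only their values on smooth forms with
compact support matter. -/
abbrev Current (m n : ℕ) : Type := DForm m n → ℝ

/-- The mass of `T` in `W` with respect to `g`: the supremum of `T α` over the smooth forms `α` with
compact support in `W` and with pointwise comass at most one. -/
def mass {m n : ℕ} {D : Set (Eu m)} (g : RiemMetric D) (W : Set (Eu m)) (T : Current m n) : ℝ≥0∞ :=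
  ⨆ (α : DForm m n) (_ : α ∈ testForms n W ∧
    ∀ x ∈ W, ∀ v : Fin n → Eu m, (∀ i j, g.inner x (v i) (v j) = if i = j then 1 else 0) →
      |α x v| ≤ 1),
    ENNReal.ofReal (T α)

/-- The pull-back of `α` along `φ : ℝⁿ → ℝ^m` at `y`, evaluated on the standard basis. -/
def pullbackAt {m n : ℕ} (φ : Eu n → Eu m) (α : DForm m n) (y : Eu n) : ℝ :=
  α (φ y) (fun i => fderiv ℝ φ y (stdVec i))

/-- The Euclidean Jacobian of `φ : ℝⁿ → ℝ^m` at `y`. -/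
def jacobian {m n : ℕ} (φ : Eu n → Eu m) (y : Eu n) : ℝ :=
  √(Matrix.det (Matrix.of fun i j : Fin n =>
    inner ℝ (fderiv ℝ φ y (stdVec i)) (fderiv ℝ φ y (stdVec j))))

/-- `T` is an integer rectifiable `n`-current of finite mass, carried by the set `K`: a sum
`∑ i, (φ i)_# [[A i]]` of push-forwards of bounded measurable subsets of `ℝⁿ` under
Lipschitz maps, with finite total mass. Integer multiplicities arise by repeating summands, and
opposite orientations by composing with a reflection of `ℝⁿ`. -/
def IsIntegerRectifiable {m n : ℕ} (K : Set (Eu m)) (T : Current m n) : Prop :=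
  ∃ (A : ℕ → Set (Eu n)) (φ : ℕ → Eu n → Eu m),
    (∀ i, MeasurableSet (A i) ∧ Bornology.IsBounded (A i) ∧ (∃ C, LipschitzWith C (φ i)) ∧
      MapsTo (φ i) (A i) K) ∧
    (∑' i, ∫⁻ y in A i, ENNReal.ofReal (jacobian (φ i) y)) < ⊤ ∧
    ∀ α ∈ testForms n univ, T α = ∑' i, ∫ y in A i, pullbackAt (φ i) α y

/-- `∂T = 0`, that is, `T (dη) = 0` for all smooth `η` with compact support. -/
def IsCycle {m : ℕ} : {n : ℕ} → Current m n → Prop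
  | 0, _ => True
  | k + 1, T => ∀ η ∈ testForms k (univ : Set (Eu m)), T (extDeriv η) = 0

/-- `ν` is a continuous unit normal vector field along `S`. On a hypersurface of an open
subset of `ℝ^(n+1)` this is the same as an orientation. -/
def IsUnitNormal {m : ℕ} (S : Set (Eu m)) (ν : Eu m → Eu m) : Prop :=
  ContinuousOn ν S ∧ ∀ x ∈ S, ‖ν x‖ = 1 ∧ ∀ v ∈ tangentSpaceAt S x, inner ℝ (ν x) v = 0

/-- The current `[[S]]` of integration over `S`, oriented by `ν`. The integrand is the value of
`α` at `(e_1, …, e_n)`, where `(ν, e_1, …, e_n)` is a positively oriented orthonormal basis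
of `ℝ^(n+1)`; it equals the value of `ν ∧ α` on the standard basis. -/
def integrationCurrent {n : ℕ} (S : Set (Eu (n + 1))) (ν : Eu (n + 1) → Eu (n + 1)) :
    Current (n + 1) n := fun α =>
  ∫ x in S, (∑ i : Fin (n + 1), (-1 : ℝ) ^ (i : ℕ) * ν x i *
    α x (fun j => stdVec (i.succAbove j))) ∂μHE[n]

/-- The hypersurface `S` is area-minimizing in `(D, g)`: for some orientation, the current `[[S]]`
is mass-minimizing, that is, `M_W([[S]]) ≤ M_W([[S]] + T)` whenever `W` is open and relatively
compact in `D` and `T` is an integral current without boundary and with compact support in `W`. -/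
def IsAreaMinimizing {n : ℕ} {D : Set (Eu (n + 1))} (g : RiemMetric D) (S : Set (Eu (n + 1))) :
    Prop :=
  ∃ ν, IsUnitNormal S ν ∧
    ∀ W : Set (Eu (n + 1)), IsOpen W → IsCompact (closure W) → closure W ⊆ D →
    ∀ K ⊆ W, IsCompact K →
    ∀ T : Current (n + 1) n, IsIntegerRectifiable K T → IsCycle T →
      mass g W (integrationCurrent S ν) ≤ mass g W (integrationCurrent S ν + T)

/-- The open unit disk in `ℝ^m`. -/
def unitDisk (m : ℕ) : Set (Eu m) := Metric.ball 0 1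

/-- The volume of the Euclidean unit ball of dimension `n`. -/
def unitBallVol (n : ℕ) : ℝ := volume.real (Metric.ball (0 : Eu n) 1)

/-- The comparison function `r^n exp(-√κ n² r)`. -/
def monoWeight (n : ℕ) (κ r : ℝ) : ℝ := r ^ n * Real.exp (-√κ * n ^ 2 * r)

end

/-!
The bounds follow from the monotonicity of the area ratio about the centre, which is the first
variation formula tested with radial vector fields, and from the fact that the density of a smooth
hypersurface at an interior point is one.

Area-minimality is given in terms of currents, so the first variation has to be extracted from it.
In a chart of `S`, with a smooth retraction `χ` onto the parameter domain, moving a compact piece of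
`S` along a vector field changes the current of integration by a rectifiable cycle
(`isIntegerRectifiable_sub`, `isCycle_sub`). The mass of the new current is at most the area of the
moved hypersurface, because a form of comass one is bounded by the area element
(`enorm_pullbackAt_le`). The mass of the old one is at least the area of `S`, because the area form
of `S` extends along the fibres of `χ` to a form of comass one (`SurfChart.calibration`). Hence the
area does not decrease (`SurfChart.area_le`), its derivative vanishes, and a partition of unity gives
`∫ div_S X = 0` for every `X` whose support is compact and avoids the boundary of `S`
(`integral_divS_eq_zero`). Areas in charts are related to the Hausdorff measure by the area formula
`euclideanHausdorffMeasure_image_eq`.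

Within the injectivity radius, metric balls are geodesic balls
(`RiemMetric.IsExpChart.ball_eq`), and the squared distance `r²` is smooth. The field `r ∂/∂r` has
divergence at least `n (1 - κ r²)` along `S`, since the upper curvature bound `κ` bounds the growth of
Jacobi fields from below (`rauch_comparison`, `RiemMetric.IsExpChart.comparison`). Together with the
Gauss lemma, the field `η(r²) r ∂/∂r` with a non-increasing cutoff `η` has divergence at least
`n η (1 - κ r²) + 2 r² η'` (`RiemMetric.IsExpChart.divS_radialField_ge`). The vanishing of its integral
is a differential inequality for the area `V` of balls, whose integrated form is
`V(a) / a ^ k ≤ V(b) / b ^ k` for `a ≤ b`, where `k = n (1 - κ b²)`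
(`RiemMetric.IsExpChart.hypVol_ball_mul_le`). For `b ≤ 2 a` and `√κ b ≤ 1/2`, the exponential factor of
the weight compensates for the difference between `k` and `n`
(`RiemMetric.IsExpChart.areaRatio_le`). This gives the monotonicity, and with the blow-up
`RiemMetric.IsExpChart.tendsto_hypVol_div_pow` the lower bounds.

All this needs that the radius `R` is positive, that is, that the exponential map is a
diffeomorphism near the origin (`RiemMetric.injRad_pos`). Its smoothness is obtained by solving the
geodesic equation for the acceleration with the inverse function theorem in the Banach space of
continuous functions on `[-1, 1]` (`exists_acceleration`).
-/

noncomputable section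

/-! ### Gram matrices of bilinear forms -/

section Gram

variable {V : Type*} [NormedAddCommGroup V] [NormedSpace ℝ V] {ι : Type*}

/-- The matrix `B (v i) (v j)` of a bilinear form on a family of vectors. -/
def gramOf (B : V →L[ℝ] V →L[ℝ] ℝ) (v : ι → V) : Matrix ι ι ℝ :=
  Matrix.of fun i j => B (v i) (v j)

/-- The family `i ↦ ∑ j, A i j • v j`. -/
def combo [Fintype ι] (A : Matrix ι ι ℝ) (v : ι → V) : ι → V := fun i => ∑ j, A i j • v j

theorem gramOf_combo [Fintype ι] (B : V →L[ℝ] V →L[ℝ] ℝ) (A : Matrix ι ι ℝ) (v : ι → V) :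
    gramOf B (combo A v) = A * gramOf B v * A.transpose := by
  ext i j
  simp only [gramOf, combo, Matrix.of_apply, Matrix.mul_apply, Matrix.transpose_apply, map_sum,
    map_smul, _root_.sum_apply, _root_.smul_apply, smul_eq_mul,
    Finset.sum_mul, Finset.mul_sum]
  exact Finset.sum_congr rfl fun x _ => Finset.sum_congr rfl fun y _ => by ring

theorem det_gramOf_combo [Fintype ι] [DecidableEq ι] (B : V →L[ℝ] V →L[ℝ] ℝ) (A : Matrix ι ι ℝ)
    (v : ι → V) : (gramOf B (combo A v)).det = A.det ^ 2 * (gramOf B v).det := by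
  rw [gramOf_combo, Matrix.det_mul, Matrix.det_mul, Matrix.det_transpose]; ring

theorem sqrt_det_gramOf_combo [Fintype ι] [DecidableEq ι] (B : V →L[ℝ] V →L[ℝ] ℝ)
    (A : Matrix ι ι ℝ) (v : ι → V) :
    √(gramOf B (combo A v)).det = |A.det| * √(gramOf B v).det := by
  rw [det_gramOf_combo, Real.sqrt_mul (sq_nonneg _), Real.sqrt_sq_eq_abs]

theorem combo_combo [Fintype ι] (A A' : Matrix ι ι ℝ) (v : ι → V) :
    combo A (combo A' v) = combo (A * A') v := by
  ext i
  simp only [combo, Finset.smul_sum, smul_smul, Matrix.mul_apply, Finset.sum_smul]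
  rw [Finset.sum_comm]

theorem combo_one [Fintype ι] [DecidableEq ι] (v : ι → V) : combo (1 : Matrix ι ι ℝ) v = v := by
  ext i
  simp [combo, Matrix.one_apply]

/-- A symmetric positive definite bilinear form. -/
structure IsInnerForm (B : V →L[ℝ] V →L[ℝ] ℝ) : Prop where
  symm : ∀ u v, B u v = B v u
  pos : ∀ v, v ≠ 0 → 0 < B v v

theorem IsInnerForm.nonneg {B : V →L[ℝ] V →L[ℝ] ℝ} (hB : IsInnerForm B) (v : V) : 0 ≤ B v v := by
  by_cases h : v = 0
  · simp [h]
  · exact (hB.pos v h).le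

theorem IsInnerForm.posDef_gramOf [Fintype ι] {B : V →L[ℝ] V →L[ℝ] ℝ} (hB : IsInnerForm B)
    {v : ι → V} (hv : LinearIndependent ℝ v) : (gramOf B v).PosDef := by
  refine Matrix.PosDef.of_dotProduct_mulVec_pos ?_ ?_
  · ext i j
    simp [gramOf, Matrix.conjTranspose_apply, hB.symm (v j) (v i)]
  · intro x hx
    have h1 : star x ⬝ᵥ (gramOf B v).mulVec x = B (∑ i, x i • v i) (∑ i, x i • v i) := by
      simp only [dotProduct, Matrix.mulVec, gramOf, Matrix.of_apply, map_sum, map_smul,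
        _root_.sum_apply, _root_.smul_apply, smul_eq_mul, star_trivial,
        Finset.mul_sum]
      rw [Finset.sum_comm]
      exact Finset.sum_congr rfl fun x _ => Finset.sum_congr rfl fun y _ => by ring
    rw [h1]
    apply hB.pos
    intro h0
    exact hx (funext fun i => (Fintype.linearIndependent_iff.1 hv) x h0 i)

open scoped MatrixOrder in
theorem exists_eq_mul_transpose_of_posDef [Fintype ι] [DecidableEq ι] {G : Matrix ι ι ℝ}
    (hG : G.PosDef) : ∃ A : Matrix ι ι ℝ, IsUnit A.det ∧ G = A * A.transpose := by
  obtain ⟨C, hC⟩ := CStarAlgebra.nonneg_iff_eq_star_mul_self.1 hG.posSemidef.nonneg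
  refine ⟨C.transpose, ?_, ?_⟩
  · have h := hG.det_pos
    rw [hC, Matrix.det_mul] at h
    rw [Matrix.det_transpose]
    exact isUnit_iff_ne_zero.2 fun h0 => by simp [h0] at h
  · rw [hC, Matrix.transpose_transpose]; rfl

/-- Gram–Schmidt for an arbitrary inner product: an independent family is obtained from an
orthonormal one by an invertible matrix. -/
theorem IsInnerForm.exists_orthonormal [Fintype ι] [DecidableEq ι] {B : V →L[ℝ] V →L[ℝ] ℝ}
    (hB : IsInnerForm B) {v : ι → V} (hv : LinearIndependent ℝ v) :
    ∃ (u : ι → V) (A : Matrix ι ι ℝ), IsUnit A.det ∧ gramOf B u = 1 ∧ v = combo A u ∧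
      u = combo A⁻¹ v := by
  obtain ⟨A, hA, hG⟩ := exists_eq_mul_transpose_of_posDef (hB.posDef_gramOf hv)
  refine ⟨combo A⁻¹ v, A, hA, ?_, ?_, rfl⟩
  · rw [gramOf_combo, hG, Matrix.transpose_nonsing_inv, ← Matrix.mul_assoc,
      Matrix.nonsing_inv_mul _ hA, Matrix.one_mul, Matrix.mul_nonsing_inv]
    rwa [Matrix.det_transpose]
  · rw [combo_combo, Matrix.mul_nonsing_inv _ hA, combo_one]

theorem det_gramOf_nonneg [Fintype ι] [DecidableEq ι] {B : V →L[ℝ] V →L[ℝ] ℝ}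
    (hB : IsInnerForm B) (v : ι → V) : 0 ≤ (gramOf B v).det := by
  by_cases hv : LinearIndependent ℝ v
  · exact (hB.posDef_gramOf hv).det_pos.le
  · obtain ⟨x, h0, i, hi⟩ := Fintype.not_linearIndependent_iff.1 hv
    apply le_of_eq
    symm
    apply Matrix.exists_mulVec_eq_zero_iff.1
    refine ⟨x, fun h => hi (congrFun h i), ?_⟩
    ext j
    simp only [Matrix.mulVec, dotProduct, gramOf, Matrix.of_apply, Pi.zero_apply]
    have := congrArg (B (v j)) h0
    simpa [mul_comm] using this

/-- The families are images of the rows of `A` and of the standard basis under a linear map from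
`ι → ℝ`, where every form of top degree is a multiple of the determinant. -/
theorem AlternatingMap.map_combo [Fintype ι] [DecidableEq ι] (α : V [⋀^ι]→ₗ[ℝ] ℝ)
    (A : Matrix ι ι ℝ) (v : ι → V) : α (combo A v) = A.det * α v := by
  let T : (ι → ℝ) →ₗ[ℝ] V := Fintype.linearCombination ℝ v
  have h := (α.compLinearMap T).eq_smul_basis_det (Pi.basisFun ℝ ι)
  have h1 := congrArg (fun β : (ι → ℝ) [⋀^ι]→ₗ[ℝ] ℝ => β A) h
  simp only [AlternatingMap.compLinearMap_apply, Pi.basisFun_apply] at h1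
  have h2 : (fun i => T (A i)) = combo A v := by
    ext i; simp [T, Fintype.linearCombination_apply, combo]
  have h3 : (fun i => T (Pi.single i 1)) = v := by
    ext i; simp [T, Fintype.linearCombination_apply_single]
  rw [← h2]
  calc α (fun i => T (A i)) = _ := h1
    _ = α v * (Pi.basisFun ℝ ι).det A := by rw [h3]; rfl
    _ = _ := by rw [mul_comm]; congr 1; exact Pi.basisFun_det_apply (R := ℝ) (ι := ι) A

/-- A form of comass at most one is bounded by the volume of the parallelepiped. -/
theorem abs_alternating_le_sqrt_det_gramOf [Fintype ι] [DecidableEq ι] {B : V →L[ℝ] V →L[ℝ] ℝ}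
    (hB : IsInnerForm B) (α : V [⋀^ι]→L[ℝ] ℝ)
    (hα : ∀ u : ι → V, (∀ i j, B (u i) (u j) = if i = j then 1 else 0) → |α u| ≤ 1) (v : ι → V) :
    |α v| ≤ √(gramOf B v).det := by
  by_cases hv : LinearIndependent ℝ v
  · obtain ⟨u, A, hA, hu, rfl, -⟩ := hB.exists_orthonormal hv
    rw [sqrt_det_gramOf_combo, hu, Matrix.det_one, Real.sqrt_one, mul_one]
    have h1 : α (combo A u) = A.det * α u := α.toAlternatingMap.map_combo A u
    rw [h1, abs_mul]
    refine mul_le_of_le_one_right (abs_nonneg _) (hα u fun i j => ?_)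
    have := congrFun (congrFun hu i) j
    simpa [gramOf, Matrix.one_apply] using this
  · have h1 : α v = 0 := α.toAlternatingMap.map_linearDependent v hv
    rw [h1, abs_zero]
    exact Real.sqrt_nonneg _

/-- Bessel's inequality. -/
theorem IsInnerForm.bessel [Fintype ι] [DecidableEq ι] {B : V →L[ℝ] V →L[ℝ] ℝ}
    (hB : IsInnerForm B) {u : ι → V} (hu : gramOf B u = 1) (x : V) :
    ∑ i, B x (u i) ^ 2 ≤ B x x := by
  have hu' : ∀ i j, B (u i) (u j) = if i = j then 1 else 0 := fun i j => by
    simpa [gramOf, Matrix.one_apply] using congrFun (congrFun hu i) j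
  have h := hB.nonneg (x - ∑ i, B x (u i) • u i)
  have h1 : B (∑ i, B x (u i) • u i) x = ∑ i, B x (u i) ^ 2 := by
    simp only [map_sum, map_smul, _root_.sum_apply, _root_.smul_apply,
      smul_eq_mul]
    exact Finset.sum_congr rfl fun i _ => by rw [hB.symm (u i) x, sq]
  have h2 : B (∑ i, B x (u i) • u i) (∑ i, B x (u i) • u i) = ∑ i, B x (u i) ^ 2 := by
    simp only [map_sum, map_smul, _root_.sum_apply, _root_.smul_apply,
      smul_eq_mul, hu']
    exact Finset.sum_congr rfl fun i _ => by simp [sq]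
  have h3 : B x (∑ i, B x (u i) • u i) = ∑ i, B x (u i) ^ 2 := by rw [hB.symm, h1]
  simp only [map_sub, _root_.sub_apply, h1, h2, h3] at h
  linarith

/-- The determinant of the pairing of two orthonormal families is at most one, by Hadamard's
inequality. -/
theorem IsInnerForm.abs_det_pairing_le_one {n : ℕ} {B : V →L[ℝ] V →L[ℝ] ℝ}
    (hB : IsInnerForm B) {u v : Fin n → V} (hu : gramOf B u = 1) (hv : gramOf B v = 1) :
    |(Matrix.of fun i j => B (u i) (v j)).det| ≤ 1 := by
  let b := EuclideanSpace.basisFun (Fin n) ℝ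
  have : Fact (Module.finrank ℝ (Eu n) = n) := ⟨by simp⟩
  let o := b.toBasis.orientation
  let w : Fin n → Eu n := fun i => WithLp.toLp 2 fun j => B (u i) (v j)
  have h := o.abs_volumeForm_apply_le w
  rw [o.volumeForm_robust' b] at h
  have h1 : b.toBasis.det w = (Matrix.of fun i j => B (u i) (v j)).det := by
    rw [Module.Basis.det_apply, ← Matrix.det_transpose]
    congr 1
  rw [h1] at h
  refine h.trans (Finset.prod_le_one (fun _ _ => norm_nonneg _) fun i _ => ?_)
  rw [EuclideanSpace.norm_eq, Real.sqrt_le_one]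
  have h2 := hB.bessel hv (u i)
  have h3 : B (u i) (u i) = 1 := by
    simpa [gramOf] using congrFun (congrFun hu i) i
  simpa [w, h3] using h2

/-- Cauchy–Schwarz for Gram determinants. -/
theorem IsInnerForm.abs_det_pairing_le {n : ℕ} {B : V →L[ℝ] V →L[ℝ] ℝ}
    (hB : IsInnerForm B) {e v : Fin n → V} (he : LinearIndependent ℝ e) (hv : gramOf B v = 1) :
    |(Matrix.of fun i j => B (e i) (v j)).det| ≤ √(gramOf B e).det := by
  obtain ⟨u, A, hA, hu, rfl, -⟩ := hB.exists_orthonormal he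
  have h1 : (Matrix.of fun i j => B (combo A u i) (v j)) =
      A * Matrix.of fun i j => B (u i) (v j) := by
    ext i j
    simp [combo, Matrix.mul_apply]
  rw [h1, Matrix.det_mul, abs_mul, sqrt_det_gramOf_combo, hu, Matrix.det_one, Real.sqrt_one]
  exact mul_le_mul_of_nonneg_left (hB.abs_det_pairing_le_one hu hv) (abs_nonneg _)

/-- The trace, with respect to the inner product `B`, of the bilinear form `C` on the span of the
independent family `e`. -/
def traceOn [Fintype ι] [DecidableEq ι] (B C : V →L[ℝ] V →L[ℝ] ℝ) (e : ι → V) : ℝ :=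
  ((gramOf B e)⁻¹ * gramOf C e).trace

theorem traceOn_combo [Fintype ι] [DecidableEq ι] (B C : V →L[ℝ] V →L[ℝ] ℝ) {A : Matrix ι ι ℝ}
    (hA : IsUnit A.det) (e : ι → V) : traceOn B C (combo A e) = traceOn B C e := by
  have hA' : IsUnit A.transpose.det := by rwa [Matrix.det_transpose]
  rw [traceOn, gramOf_combo, gramOf_combo, Matrix.mul_inv_rev, Matrix.mul_inv_rev, traceOn,
    Matrix.mul_assoc, Matrix.trace_mul_comm]
  congr 1
  calc (gramOf B e)⁻¹ * A⁻¹ * (A * gramOf C e * A.transpose) * A.transpose⁻¹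
      = (gramOf B e)⁻¹ * (A⁻¹ * A) * gramOf C e * (A.transpose * A.transpose⁻¹) := by
        simp only [Matrix.mul_assoc]
    _ = _ := by rw [Matrix.nonsing_inv_mul _ hA, Matrix.mul_nonsing_inv _ hA', Matrix.mul_one,
        Matrix.mul_one]

theorem traceOn_orthonormal [Fintype ι] [DecidableEq ι] (B C : V →L[ℝ] V →L[ℝ] ℝ) {u : ι → V}
    (hu : gramOf B u = 1) : traceOn B C u = ∑ i, C (u i) (u i) := by
  rw [traceOn, hu, inv_one, Matrix.one_mul]
  rfl

theorem traceOn_comp_equiv {κ : Type*} [Fintype ι] [DecidableEq ι] [Fintype κ] [DecidableEq κ]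
    (B C : V →L[ℝ] V →L[ℝ] ℝ) (e : ι → V) (σ : κ ≃ ι) :
    traceOn B C (e ∘ σ) = traceOn B C e := by
  have h : ∀ D : V →L[ℝ] V →L[ℝ] ℝ, gramOf D (e ∘ σ) = (gramOf D e).submatrix σ σ :=
    fun D => rfl
  rw [traceOn, traceOn, h, h, Matrix.inv_submatrix_equiv, Matrix.submatrix_mul_equiv,
    Matrix.trace, Matrix.trace]
  exact σ.sum_comp fun i => ((gramOf B e)⁻¹ * gramOf C e) i i

theorem traceOn_sum {κ : Type*} [Fintype ι] [DecidableEq ι] (B : V →L[ℝ] V →L[ℝ] ℝ)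
    (s : Finset κ) (C : κ → V →L[ℝ] V →L[ℝ] ℝ) (e : ι → V) :
    traceOn B (∑ k ∈ s, C k) e = ∑ k ∈ s, traceOn B (C k) e := by
  have h : gramOf (∑ k ∈ s, C k) e = ∑ k ∈ s, gramOf (C k) e := by
    ext i j
    simp [gramOf, Matrix.sum_apply]
  rw [traceOn, h, Finset.mul_sum, Matrix.trace_sum]
  rfl

/-- Two families with the same span, one of them independent, differ by an invertible matrix. -/
theorem exists_combo_of_span_eq [Fintype ι] [DecidableEq ι] {v w : ι → V}
    (hv : LinearIndependent ℝ v)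
    (h : Submodule.span ℝ (range w) = Submodule.span ℝ (range v)) :
    ∃ A : Matrix ι ι ℝ, IsUnit A.det ∧ w = combo A v := by
  have h1 : ∀ i, ∃ c : ι → ℝ, ∑ j, c j • v j = w i := fun i =>
    (Submodule.mem_span_range_iff_exists_fun ℝ).1 (h ▸ Submodule.subset_span (mem_range_self i))
  have h2 : ∀ i, ∃ c : ι → ℝ, ∑ j, c j • w j = v i := fun i =>
    (Submodule.mem_span_range_iff_exists_fun ℝ).1 (h ▸ Submodule.subset_span (mem_range_self i))
  choose A hA using h1
  choose C hC using h2
  have hA' : combo (Matrix.of A) v = w := funext hA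
  have hC' : combo (Matrix.of C) w = v := funext hC
  refine ⟨Matrix.of A, ?_, hA'.symm⟩
  have h3 : combo (Matrix.of C * Matrix.of A) v = combo (1 : Matrix ι ι ℝ) v := by
    rw [← combo_combo, hA', hC', combo_one]
  have h4 : Matrix.of C * Matrix.of A = 1 := by
    ext i j
    have h5 := congrFun h3 i
    simp only [combo] at h5
    have h6 := Fintype.linearIndependent_iff.1 hv
      (fun j => (Matrix.of C * Matrix.of A) i j - (1 : Matrix ι ι ℝ) i j)
      (by simp only [sub_smul, Finset.sum_sub_distrib, h5, sub_self]) j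
    linarith
  exact (Matrix.isUnit_det_of_left_inverse h4)

end Gram

/-! ### Alternating forms on Euclidean space -/

theorem basisFun_eq_stdVec {m : ℕ} (i : Fin m) : EuclideanSpace.basisFun (Fin m) ℝ i = stdVec i := by
  simp [stdVec]

/-- The evaluations of an alternating form on tuples of standard basis vectors. -/
def evalForm (m n : ℕ) : (Eu m [⋀^Fin n]→L[ℝ] ℝ) →ₗ[ℝ] ((Fin n → Fin m) → ℝ) where
  toFun α s := α fun i => stdVec (s i)
  map_add' _ _ := rfl
  map_smul' _ _ := rfl

theorem evalForm_injective (m n : ℕ) : Function.Injective (evalForm m n) := by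
  intro α β h
  apply ContinuousAlternatingMap.toAlternatingMap_injective
  refine Module.Basis.ext_alternating (EuclideanSpace.basisFun (Fin m) ℝ).toBasis fun s _ => ?_
  have h1 := congrFun h s
  simp only [OrthonormalBasis.coe_toBasis, basisFun_eq_stdVec]
  exact h1

theorem exists_evalForm_leftInverse (m n : ℕ) :
    ∃ L : ((Fin n → Fin m) → ℝ) →L[ℝ] (Eu m [⋀^Fin n]→L[ℝ] ℝ), ∀ α, L (evalForm m n α) = α := by
  have : FiniteDimensional ℝ (Eu m [⋀^Fin n]→L[ℝ] ℝ) :=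
    FiniteDimensional.of_injective _ (evalForm_injective m n)
  obtain ⟨L, hL⟩ := LinearMap.exists_leftInverse_of_injective (evalForm m n)
    (LinearMap.ker_eq_bot.2 (evalForm_injective m n))
  exact ⟨LinearMap.toContinuousLinearMap L, fun α => LinearMap.congr_fun hL α⟩

/-- A differential form is smooth as soon as its coefficients are. -/
theorem contDiffOn_form {F : Type*} [NormedAddCommGroup F] [NormedSpace ℝ F] {m n : ℕ}
    {k : WithTop ℕ∞} {α : F → Eu m [⋀^Fin n]→L[ℝ] ℝ} {s : Set F}
    (h : ∀ v : Fin n → Eu m, ContDiffOn ℝ k (fun x => α x v) s) : ContDiffOn ℝ k α s := by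
  obtain ⟨L, hL⟩ := exists_evalForm_leftInverse m n
  have h1 : ContDiffOn ℝ k (fun x => evalForm m n (α x)) s :=
    contDiffOn_pi.2 fun t => h fun i => stdVec (t i)
  exact (L.contDiff.comp_contDiffOn h1).congr fun x _ => (hL (α x)).symm

theorem contDiff_form {F : Type*} [NormedAddCommGroup F] [NormedSpace ℝ F] {m n : ℕ}
    {k : WithTop ℕ∞} {α : F → Eu m [⋀^Fin n]→L[ℝ] ℝ}
    (h : ∀ v : Fin n → Eu m, ContDiff ℝ k (fun x => α x v)) : ContDiff ℝ k α := by
  rw [← contDiffOn_univ]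
  exact contDiffOn_form fun v => (h v).contDiffOn

theorem form_apply_eq_sum {m n : ℕ} (α : Eu m [⋀^Fin n]→L[ℝ] ℝ) (w : Fin n → Eu m) :
    α w = ∑ s : Fin n → Fin m, (∏ i, w i (s i)) * evalForm m n α s := by
  have h2 : w = fun i => ∑ j, w i j • (stdVec j : Eu m) := by
    ext1 i
    conv_lhs => rw [← (EuclideanSpace.basisFun (Fin m) ℝ).sum_repr (w i)]
    simp only [basisFun_eq_stdVec, EuclideanSpace.basisFun_repr]
  conv_lhs => rw [h2]
  have h3 := α.toContinuousMultilinearMap.map_sum (fun i j => w i j • (stdVec j : Eu m))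
  refine h3.trans (Finset.sum_congr rfl fun s _ => ?_)
  exact α.toContinuousMultilinearMap.map_smul_univ (fun i => w i (s i)) (fun i => stdVec (s i))

theorem evalForm_continuous (m n : ℕ) : ∃ L : (Eu m [⋀^Fin n]→L[ℝ] ℝ) →L[ℝ] ((Fin n → Fin m) → ℝ),
    ∀ α, L α = evalForm m n α := by
  have hfin : FiniteDimensional ℝ (Eu m [⋀^Fin n]→L[ℝ] ℝ) :=
    FiniteDimensional.of_injective _ (evalForm_injective m n)
  exact ⟨LinearMap.toContinuousLinearMap (evalForm m n), fun _ => rfl⟩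

/-- The value of a smooth form on smooth vector fields is smooth. -/
theorem contDiff_form_apply {F : Type*} [NormedAddCommGroup F] [NormedSpace ℝ F] {m n : ℕ}
    {k : WithTop ℕ∞} {α : F → Eu m [⋀^Fin n]→L[ℝ] ℝ} {w : Fin n → F → Eu m}
    (hα : ContDiff ℝ k α) (hw : ∀ i, ContDiff ℝ k (w i)) :
    ContDiff ℝ k (fun x => α x fun i => w i x) := by
  obtain ⟨L, hL⟩ := evalForm_continuous m n
  simp only [form_apply_eq_sum, ← hL]
  refine ContDiff.sum fun s _ => ContDiff.mul (contDiff_prod fun i _ => ?_) ?_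
  · exact (contDiff_euclidean.1 (hw i)) (s i)
  · exact contDiff_pi.1 (L.contDiff.comp hα) s

theorem continuousOn_form_apply {F : Type*} [TopologicalSpace F] {m n : ℕ} {U : Set F}
    {α : F → Eu m [⋀^Fin n]→L[ℝ] ℝ} {w : Fin n → F → Eu m}
    (hα : ContinuousOn α U) (hw : ∀ i, ContinuousOn (w i) U) :
    ContinuousOn (fun x => α x fun i => w i x) U := by
  obtain ⟨L, hL⟩ := evalForm_continuous m n
  simp only [form_apply_eq_sum, ← hL]
  refine continuousOn_finsetSum _ fun s _ => ContinuousOn.mul (continuousOn_finsetProd _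
    fun i _ => ?_) ?_
  · exact (EuclideanSpace.proj (𝕜 := ℝ) (s i)).continuous.comp_continuousOn (hw i)
  · exact continuousOn_pi.1 (L.continuous.comp_continuousOn hα) s

/-- The integral over `ℝⁿ` of a directional derivative of a compactly supported function is `0`. -/
theorem integral_fderiv_apply_eq_zero {n : ℕ} {f : Eu n → ℝ} (hf : ContDiff ℝ 1 f)
    (hc : HasCompactSupport f) (v : Eu n) : ∫ x, fderiv ℝ f x v = 0 := by
  have h := integral_mul_fderiv_eq_neg_fderiv_mul_of_integrable (μ := (volume : Measure (Eu n)))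
    (f := fun _ => (1 : ℝ)) (g := f) (v := v) ?_ ?_ ?_ ?_ ?_
  · simpa using h
  · simp
  · have h1 : Continuous fun x => fderiv ℝ f x v :=
      (hf.continuous_fderiv (by simp)).clm_apply continuous_const
    simpa using h1.integrable_of_hasCompactSupport (hc.fderiv_apply (𝕜 := ℝ) v)
  · simpa using hf.continuous.integrable_of_hasCompactSupport hc
  · exact fun _ _ => differentiableAt_const _
  · exact fun x _ => hf.differentiable (by simp) x

/-- Stokes' theorem for compactly supported forms of degree `k` on `ℝ^(k+1)`. -/
theorem integral_extDeriv_eq_zero {k : ℕ} {η : DForm (k + 1) k} (hη : ContDiff ℝ 1 η)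
    (hc : HasCompactSupport η) : ∫ y, extDeriv η y (fun i => stdVec i) = 0 := by
  have h1 : ∀ y, extDeriv η y (fun i => stdVec i) = ∑ i : Fin (k + 1), (-1 : ℝ) ^ (i : ℕ) *
      fderiv ℝ (fun x => η x (i.removeNth fun i => stdVec i)) y (stdVec i) := fun y => by
    rw [extDeriv_apply (hη.differentiable (by simp) y)]
    exact Finset.sum_congr rfl fun i _ => by rw [zsmul_eq_mul]; push_cast; rfl
  have h2 : ∀ i : Fin (k + 1), ContDiff ℝ 1
      (fun x => η x (i.removeNth fun i => (stdVec i : Eu (k + 1)))) := fun i =>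
    contDiff_form_apply hη fun _ => contDiff_const
  have h3 : ∀ i : Fin (k + 1), HasCompactSupport
      (fun x => η x (i.removeNth fun i => (stdVec i : Eu (k + 1)))) := fun i =>
    hc.comp_left (g := fun α : Eu (k + 1) [⋀^Fin k]→L[ℝ] ℝ =>
      α (i.removeNth fun i => (stdVec i : Eu (k + 1)))) rfl
  simp only [h1]
  rw [integral_finsetSum]
  · refine Finset.sum_eq_zero fun i _ => ?_
    rw [integral_const_mul, integral_fderiv_apply_eq_zero (h2 i) (h3 i), mul_zero]
  · intro i _
    refine Integrable.const_mul ?_ _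
    have h4 : Continuous fun y =>
        fderiv ℝ (fun x => η x (i.removeNth fun i => stdVec i)) y (stdVec i) :=
      ((h2 i).continuous_fderiv (by simp)).clm_apply continuous_const
    exact h4.integrable_of_hasCompactSupport ((h3 i).fderiv_apply (𝕜 := ℝ) _)

/-- The density of the current of integration over an oriented hypersurface with unit
normal `ν`. -/
def normalPairing {n : ℕ} (ν : Eu (n + 1)) (α : Eu (n + 1) [⋀^Fin n]→L[ℝ] ℝ) : ℝ :=
  ∑ i : Fin (n + 1), (-1 : ℝ) ^ (i : ℕ) * ν i * α fun j => stdVec (i.succAbove j)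

/-- The matrix with rows `ν, v 0, …, v (n-1)`. -/
def frameMat {n : ℕ} (ν : Eu (n + 1)) (v : Fin n → Eu (n + 1)) :
    Matrix (Fin (n + 1)) (Fin (n + 1)) ℝ :=
  Matrix.of fun i j => (Fin.cons ν v : Fin (n + 1) → Eu (n + 1)) i j

/-- On vectors orthogonal to `ν`, the form `α` is the determinant times the normal pairing: both
sides are values of the top degree form `ν ∧ α`. -/
theorem form_eq_det_mul_normalPairing {n : ℕ} {ν : Eu (n + 1)} (hν : ‖ν‖ = 1)
    (α : Eu (n + 1) [⋀^Fin n]→L[ℝ] ℝ) {v : Fin n → Eu (n + 1)}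
    (hv : ∀ i, inner ℝ ν (v i) = 0) :
    α v = (frameMat ν v).det * normalPairing ν α := by
  let β : Eu (n + 1) [⋀^Fin (n + 1)]→L[ℝ] ℝ :=
    ContinuousAlternatingMap.alternatizeUncurryFin ((innerSL ℝ ν).smulRight α)
  have hβ : ∀ w : Fin (n + 1) → Eu (n + 1),
      β w = ∑ i : Fin (n + 1), (-1 : ℝ) ^ (i : ℕ) * (inner ℝ ν (w i) * α (i.removeNth w)) :=
    fun w => by
      simp only [β, ContinuousAlternatingMap.alternatizeUncurryFin_apply]
      refine Finset.sum_congr rfl fun i _ => ?_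
      rw [zsmul_eq_mul]
      push_cast
      rfl
  let b := (EuclideanSpace.basisFun (Fin (n + 1)) ℝ).toBasis
  have h1 := congrArg (fun γ : Eu (n + 1) [⋀^Fin (n + 1)]→ₗ[ℝ] ℝ =>
    γ (Fin.cons ν v : Fin (n + 1) → Eu (n + 1))) (β.toAlternatingMap.eq_smul_basis_det b)
  have h2 : β (Fin.cons ν v : Fin (n + 1) → Eu (n + 1)) = α v := by
    rw [hβ, Fin.sum_univ_succ]
    simp only [Fin.cons_succ, hv, zero_mul, mul_zero, Finset.sum_const_zero, add_zero,
      Fin.cons_zero, Fin.val_zero, pow_zero, one_mul]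
    rw [real_inner_self_eq_norm_sq, hν]
    simp [Fin.removeNth_zero]
  have h3 : β (fun i => b i) = normalPairing ν α := by
    rw [hβ]
    refine Finset.sum_congr rfl fun i _ => ?_
    have h4 : ∀ i, b i = stdVec i := fun i => by
      simp only [b, OrthonormalBasis.coe_toBasis, basisFun_eq_stdVec]
    have h5 : inner ℝ ν (b i) = ν i := by rw [h4, stdVec, EuclideanSpace.inner_single_right]; simp
    rw [h5, ← mul_assoc]
    congr 2
    ext1 j
    rw [← h4]
    rfl
  have h6 : b.det (Fin.cons ν v : Fin (n + 1) → Eu (n + 1)) = (frameMat ν v).det := by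
    rw [Module.Basis.det_apply, ← Matrix.det_transpose]
    congr 1
  calc α v = β (Fin.cons ν v : Fin (n + 1) → Eu (n + 1)) := h2.symm
    _ = β (fun i => b i) * b.det (Fin.cons ν v : Fin (n + 1) → Eu (n + 1)) := h1
    _ = _ := by rw [h3, h6, mul_comm]

theorem det_frameMat_sq {n : ℕ} {ν : Eu (n + 1)} (hν : ‖ν‖ = 1) {v : Fin n → Eu (n + 1)}
    (hv : ∀ i, inner ℝ ν (v i) = 0) :
    (frameMat ν v).det ^ 2 = (gramOf (innerSL ℝ) v).det := by
  have h1 : (frameMat ν v).det ^ 2 = (frameMat ν v * (frameMat ν v).transpose).det := by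
    rw [Matrix.det_mul, Matrix.det_transpose, sq]
  have h2 : ∀ i j, (frameMat ν v * (frameMat ν v).transpose) i j =
      inner ℝ ((Fin.cons ν v : Fin (n + 1) → Eu (n + 1)) i)
        ((Fin.cons ν v : Fin (n + 1) → Eu (n + 1)) j) := fun i j => by
    rw [Matrix.mul_apply, PiLp.inner_apply]
    exact Finset.sum_congr rfl fun k _ => by simp [frameMat, mul_comm]
  rw [h1, Matrix.det_succ_row_zero, Fin.sum_univ_succ]
  have h3 : ∀ j : Fin n, (frameMat ν v * (frameMat ν v).transpose) 0 j.succ = 0 := fun j => by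
    rw [h2]; simp [hv]
  simp only [h3, mul_zero, zero_mul, Finset.sum_const_zero, add_zero]
  rw [h2, Fin.cons_zero, real_inner_self_eq_norm_sq, hν]
  simp only [Fin.val_zero, pow_zero, one_pow, one_mul]
  congr 1
  ext i j
  rw [Matrix.submatrix_apply, h2]
  simp only [Fin.succAbove_zero, Fin.cons_succ]
  rfl

theorem jacobian_eq {m n : ℕ} (φ : Eu n → Eu m) (y : Eu n) :
    jacobian φ y = √(gramOf (innerSL ℝ) fun i => fderiv ℝ φ y (stdVec i)).det := rfl

theorem isInnerForm_innerSL {V : Type*} [NormedAddCommGroup V] [InnerProductSpace ℝ V] :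
    IsInnerForm (innerSL ℝ (E := V)) where
  symm u v := real_inner_comm v u
  pos v hv := by rw [innerSL_apply_apply]; exact real_inner_self_pos.2 hv

/-! ### The area formula -/

theorem sum_smul_stdVec {m : ℕ} (v : Eu m) : ∑ j, v j • (stdVec j : Eu m) = v := by
  conv_rhs => rw [← (EuclideanSpace.basisFun (Fin m) ℝ).sum_repr v]
  simp only [basisFun_eq_stdVec, EuclideanSpace.basisFun_repr]

theorem linearIndependent_map_stdVec {n : ℕ} {V : Type*} [NormedAddCommGroup V] [NormedSpace ℝ V]
    {L : Eu n →L[ℝ] V} (hL : Function.Injective L) :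
    LinearIndependent ℝ fun i => L (stdVec i) := by
  rw [Fintype.linearIndependent_iff]
  intro c hc i
  have h1 : L (∑ i, c i • stdVec i) = 0 := by rw [← hc, map_sum]; simp only [map_smul]
  have h2 := sum_smul_stdVec (WithLp.toLp 2 c : Eu n)
  have h3 : (WithLp.toLp 2 c : Eu n) = 0 :=
    h2.symm.trans ((injective_iff_map_eq_zero L).1 hL _ h1)
  exact congrFun (congrArg WithLp.ofLp h3) i

theorem norm_sq_sum_smul {n : ℕ} {W : Type*} [NormedAddCommGroup W] [InnerProductSpace ℝ W]
    {w : Fin n → W} (hw : ∀ i j, inner ℝ (w i) (w j) = if i = j then (1 : ℝ) else 0)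
    (c : Fin n → ℝ) : ‖∑ j, c j • w j‖ ^ 2 = ∑ j, c j ^ 2 := by
  rw [← real_inner_self_eq_norm_sq]
  simp only [sum_inner, inner_sum, real_inner_smul_left, real_inner_smul_right, hw]
  exact Finset.sum_congr rfl fun i _ => by simp [sq]

/-- An injective linear map differs from a linear automorphism by an isometry. -/
theorem exists_isometric_factor {n : ℕ} {V : Type*} [NormedAddCommGroup V] [InnerProductSpace ℝ V]
    {L : Eu n →L[ℝ] V} (hL : Function.Injective L) :
    ∃ P : Eu n →L[ℝ] Eu n, (∀ v, ‖P v‖ = ‖L v‖) ∧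
      |LinearMap.det (P : Eu n →ₗ[ℝ] Eu n)| =
        √(gramOf (innerSL ℝ) fun i => L (stdVec i)).det := by
  obtain ⟨u, A, hA, hu, hLu, -⟩ :=
    isInnerForm_innerSL.exists_orthonormal (linearIndependent_map_stdVec hL)
  let b := (EuclideanSpace.basisFun (Fin n) ℝ).toBasis
  have hb : ∀ i, b i = stdVec i := fun i => by
    simp only [b, OrthonormalBasis.coe_toBasis, basisFun_eq_stdVec]
  let P := Matrix.toLin b b A.transpose
  have hP : ∀ i, P (stdVec i) = ∑ j, A i j • (stdVec j : Eu n) := fun i => by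
    rw [← hb, Matrix.toLin_self]
    simp only [hb, Matrix.transpose_apply]
  refine ⟨LinearMap.toContinuousLinearMap P, fun v => ?_, ?_⟩
  · have hu' : ∀ i j, inner ℝ (u i) (u j) = if i = j then (1 : ℝ) else 0 := fun i j => by
      have h := congrFun (congrFun hu i) j
      rw [Matrix.one_apply] at h
      exact h
    have hLv : L v = ∑ j, (∑ i, v i * A i j) • u j := by
      conv_lhs => rw [← sum_smul_stdVec v]
      rw [map_sum]
      have : ∀ i, L (v i • stdVec i) = ∑ j, (v i * A i j) • u j := fun i => by
        rw [map_smul, congrFun hLu i, combo, Finset.smul_sum]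
        simp only [smul_smul]
      simp only [this]
      rw [Finset.sum_comm]
      simp only [Finset.sum_smul]
    have hPv : P v = ∑ j, (∑ i, v i * A i j) • (stdVec j : Eu n) := by
      conv_lhs => rw [← sum_smul_stdVec v]
      rw [map_sum]
      have : ∀ i, P (v i • stdVec i) = ∑ j, (v i * A i j) • (stdVec j : Eu n) := fun i => by
        rw [map_smul, hP, Finset.smul_sum]
        simp only [smul_smul]
      simp only [this]
      rw [Finset.sum_comm]
      simp only [Finset.sum_smul]
    have hs : ∀ i j : Fin n, inner ℝ (stdVec i : Eu n) (stdVec j) = if i = j then (1 : ℝ) else 0 :=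
      fun i j => by simp only [← basisFun_eq_stdVec, OrthonormalBasis.inner_eq_ite]
    have h2 : ‖P v‖ ^ 2 = ‖L v‖ ^ 2 := by
      rw [hPv, hLv, norm_sq_sum_smul hs, norm_sq_sum_smul hu']
    exact (sq_eq_sq₀ (norm_nonneg _) (norm_nonneg _)).1 h2
  · rw [hLu, sqrt_det_gramOf_combo, hu, Matrix.det_one, Real.sqrt_one, mul_one]
    have h1 : LinearMap.det P = A.det := by
      rw [LinearMap.det_toLin, Matrix.det_transpose]
    rw [← h1]
    rfl

/-- Lipschitz maps with constant `K` increase the `n`-dimensional measure at most by the factor `K ^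
n`. -/
theorem euclideanHausdorffMeasure_image_le {X Y : Type*} [MetricSpace X] [MeasurableSpace X]
    [BorelSpace X] [MetricSpace Y] [MeasurableSpace Y] [BorelSpace Y] {n : ℕ} {K : NNReal}
    {f : X → Y} {s : Set X} (hf : LipschitzOnWith K f s) :
    (μHE[n] : Measure Y) (f '' s) ≤ (K : ℝ≥0∞) ^ n * (μHE[n] : Measure X) s := by
  rw [Measure.euclideanHausdorffMeasure_def, Measure.euclideanHausdorffMeasure_def,
    Measure.smul_apply, Measure.smul_apply, mul_smul_comm]
  have h := hf.hausdorffMeasure_image_le (d := n) (Nat.cast_nonneg n)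
  rw [ENNReal.rpow_natCast] at h
  exact smul_le_smul_of_nonneg_left h (zero_le)

/-- Near a point, an immersion is almost an isometry followed by a linear automorphism; hence it
distorts volumes by almost exactly its Jacobian. -/
theorem exists_nhds_hausdorff_image {m n : ℕ} {ψ : Eu n → Eu m} {y : Eu n}
    (hψ : ContDiffAt ℝ 1 ψ y) (hinj : Function.Injective (fderiv ℝ ψ y)) {K : NNReal}
    (hK : 1 < K) : ∃ N ∈ 𝓝 y, ∀ A ⊆ N, InjOn ψ A →
      (μHE[n] : Measure (Eu m)) (ψ '' A) ≤ (K : ℝ≥0∞) ^ n * (ENNReal.ofReal (jacobian ψ y) * volume A) ∧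
      ENNReal.ofReal (jacobian ψ y) * volume A ≤ (K : ℝ≥0∞) ^ n * (μHE[n] : Measure (Eu m)) (ψ '' A) := by
  obtain ⟨P, hP, hdet⟩ := exists_isometric_factor hinj
  have hK' : (1 : ℝ) < K := by exact_mod_cast hK
  -- chosen so that `(1 - ε)⁻¹ = K` and `1 + ε ≤ K`
  set ε : ℝ := 1 - 1 / K with hε
  have hε0 : 0 < ε := by rw [hε, sub_pos, div_lt_one (by linarith)]; exact hK'
  have hKε : K * (1 - ε) = (1 : ℝ) := by rw [hε]; field_simp; ring
  have hKε' : 1 + ε ≤ K := by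
    have : 0 ≤ ((K : ℝ) - 1) ^ 2 / K := by positivity
    have h2 : (K : ℝ) - (1 + ε) = ((K : ℝ) - 1) ^ 2 / K := by rw [hε]; field_simp; ring
    linarith
  have hPinj : Function.Injective P := by
    refine (injective_iff_map_eq_zero P).2 fun v hv => ?_
    have : ‖fderiv ℝ ψ y v‖ = 0 := by rw [← hP, hv, norm_zero]
    exact (injective_iff_map_eq_zero _).1 hinj v (norm_eq_zero.1 this)
  obtain ⟨k, hk, hPk⟩ := (P : Eu n →ₗ[ℝ] Eu n).exists_antilipschitzWith
    (LinearMap.ker_eq_bot.2 hPinj)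
  have hPk' : ∀ v, ‖v‖ ≤ k * ‖P v‖ := fun v => by
    have := hPk.le_mul_dist v 0
    simpa using this
  have hstrict := (hψ.hasStrictFDerivAt (by simp)).isLittleO
  have hk0 : (0 : ℝ) < k := by exact_mod_cast hk
  have h1 := hstrict.def (c := ε / k) (by positivity)
  rw [nhds_prod_eq] at h1
  obtain ⟨N, hN, h2⟩ := (Filter.eventually_prod_self_iff (r := fun z z' =>
    ‖ψ z - ψ z' - fderiv ℝ ψ y (z - z')‖ ≤ ε / k * ‖z - z'‖)).1 h1
  have h3 : ∀ z ∈ N, ∀ z' ∈ N, ‖ψ z - ψ z' - fderiv ℝ ψ y (z - z')‖ ≤ ε * ‖P (z - z')‖ := by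
    intro z hz z' hz'
    refine (h2 z hz z' hz').trans ?_
    rw [div_mul_eq_mul_div, div_le_iff₀ hk0]
    calc ε * ‖z - z'‖ ≤ ε * (k * ‖P (z - z')‖) := by gcongr; exact hPk' _
      _ = _ := by ring
  have hup : ∀ z ∈ N, ∀ z' ∈ N, ‖ψ z - ψ z'‖ ≤ K * ‖P (z - z')‖ := by
    intro z hz z' hz'
    have h4 := norm_le_norm_add_norm_sub' (ψ z - ψ z') (fderiv ℝ ψ y (z - z'))
    rw [← hP] at h4
    have h5 : (1 + ε) * ‖P (z - z')‖ ≤ K * ‖P (z - z')‖ := by gcongr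
    linarith [h3 z hz z' hz']
  have hlo : ∀ z ∈ N, ∀ z' ∈ N, ‖P (z - z')‖ ≤ K * ‖ψ z - ψ z'‖ := by
    intro z hz z' hz'
    have h4 := norm_le_norm_add_norm_sub (ψ z - ψ z') (fderiv ℝ ψ y (z - z'))
    rw [← hP] at h4
    have h5 : (1 - ε) * ‖P (z - z')‖ ≤ ‖ψ z - ψ z'‖ := by linarith [h3 z hz z' hz']
    calc ‖P (z - z')‖ = K * ((1 - ε) * ‖P (z - z')‖) := by rw [← mul_assoc, hKε, one_mul]
      _ ≤ _ := by gcongr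
  have hvol : ∀ A : Set (Eu n), (μHE[n] : Measure (Eu n)) (P '' A) =
      ENNReal.ofReal (jacobian ψ y) * volume A := fun A => by
    rw [EuclideanSpace.euclideanHausdorffMeasure_eq_volume,
      Measure.addHaar_image_continuousLinearMap, hdet]
    rfl
  refine ⟨N, hN, fun A hA hinjA => ⟨?_, ?_⟩⟩
  · rw [← hvol]
    obtain ⟨Q, hQ⟩ := hPinj.hasLeftInverse
    have h4 : ψ '' A = (ψ ∘ Q) '' (P '' A) := by
      rw [image_image]
      exact image_congr fun z _ => by simp only [Function.comp, hQ z]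
    rw [h4]
    refine euclideanHausdorffMeasure_image_le (LipschitzOnWith.of_dist_le_mul ?_)
    rintro _ ⟨z, hz, rfl⟩ _ ⟨z', hz', rfl⟩
    simp only [Function.comp, hQ z, hQ z', dist_eq_norm, ← map_sub]
    exact hup z (hA hz) z' (hA hz')
  · rw [← hvol]
    have h4 : P '' A = (P ∘ Function.invFunOn ψ A) '' (ψ '' A) := by
      rw [image_image]
      exact image_congr fun z hz => by
        simp only [Function.comp, hinjA.leftInvOn_invFunOn hz]
    rw [h4]
    refine euclideanHausdorffMeasure_image_le (LipschitzOnWith.of_dist_le_mul ?_)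
    rintro _ ⟨z, hz, rfl⟩ _ ⟨z', hz', rfl⟩
    simp only [Function.comp, hinjA.leftInvOn_invFunOn hz, hinjA.leftInvOn_invFunOn hz',
      dist_eq_norm, ← map_sub]
    exact hlo z (hA hz) z' (hA hz')

theorem continuousOn_jacobian {m n : ℕ} {ψ : Eu n → Eu m} {U : Set (Eu n)} (hU : IsOpen U)
    (hψ : ContDiffOn ℝ 1 ψ U) : ContinuousOn (jacobian ψ) U := by
  have h1 : ContinuousOn (fderiv ℝ ψ) U := hψ.continuousOn_fderiv_of_isOpen hU le_rfl
  have h2 : ∀ i, ContinuousOn (fun y => fderiv ℝ ψ y (stdVec i)) U := fun i =>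
    h1.clm_apply continuousOn_const
  refine Real.continuous_sqrt.comp_continuousOn ?_
  refine (Continuous.matrix_det continuous_id).comp_continuousOn ?_
  exact continuousOn_pi.2 fun i => continuousOn_pi.2 fun j => (h2 i).inner (h2 j)

/-- The area formula for injective immersions. -/
theorem euclideanHausdorffMeasure_image_eq {m n : ℕ} {ψ : Eu n → Eu m} {U A : Set (Eu n)}
    (hU : IsOpen U) (hψ : ContDiffOn ℝ 1 ψ U) (hinj : InjOn ψ U)
    (hd : ∀ y ∈ U, Function.Injective (fderiv ℝ ψ y)) (hA : MeasurableSet A) (hAU : A ⊆ U) :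
    (μHE[n] : Measure (Eu m)) (ψ '' A) = ∫⁻ y in A, ENNReal.ofReal (jacobian ψ y) := by
  have hJpos : ∀ y ∈ U, 0 < jacobian ψ y := fun y hy => Real.sqrt_pos.2
    (isInnerForm_innerSL.posDef_gramOf (linearIndependent_map_stdVec (hd y hy))).det_pos
  -- Both sides agree up to a factor `K ^ (n + 1)`, for each `K > 1`.
  have key : ∀ K : NNReal, 1 < K →
      (μHE[n] : Measure (Eu m)) (ψ '' A) ≤
        (K : ℝ≥0∞) ^ (n + 1) * ∫⁻ y in A, ENNReal.ofReal (jacobian ψ y) ∧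
      ∫⁻ y in A, ENNReal.ofReal (jacobian ψ y) ≤
        (K : ℝ≥0∞) ^ (n + 1) * (μHE[n] : Measure (Eu m)) (ψ '' A) := by
    intro K hK
    have hK' : (1 : ℝ) < K := by exact_mod_cast hK
    have hloc : ∀ y : Eu n, ∃ N : Set (Eu n), IsOpen N ∧ (y ∈ U → y ∈ N) ∧
        ∀ A ⊆ N, MeasurableSet A → A ⊆ U →
        (μHE[n] : Measure (Eu m)) (ψ '' A) ≤
          (K : ℝ≥0∞) ^ (n + 1) * ∫⁻ y in A, ENNReal.ofReal (jacobian ψ y) ∧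
        ∫⁻ y in A, ENNReal.ofReal (jacobian ψ y) ≤
          (K : ℝ≥0∞) ^ (n + 1) * (μHE[n] : Measure (Eu m)) (ψ '' A) := by
      intro y
      by_cases hy : y ∈ U
      swap
      · refine ⟨∅, isOpen_empty, fun h => absurd h hy, fun A hA _ _ => ?_⟩
        rw [subset_empty_iff.1 hA]; simp
      obtain ⟨N, hN, h1⟩ := exists_nhds_hausdorff_image (hψ.contDiffAt (hU.mem_nhds hy)) (hd y hy) hK
      have hc : ContinuousAt (jacobian ψ) y :=
        (continuousOn_jacobian hU hψ).continuousAt (hU.mem_nhds hy)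
      have h2 : ∀ᶠ z in 𝓝 y, jacobian ψ z < K * jacobian ψ y ∧ jacobian ψ y < K * jacobian ψ z :=
        (hc.eventually_lt continuousAt_const (by nlinarith [hJpos y hy])).and
          (continuousAt_const.eventually_lt (hc.const_mul _) (by nlinarith [hJpos y hy]))
      obtain ⟨N', hN', hN'o, hyN'⟩ := mem_nhds_iff.1 (Filter.inter_mem hN h2)
      refine ⟨N', hN'o, fun _ => hyN', fun A hA hAm hAU => ?_⟩
      obtain ⟨h3, h4⟩ := h1 A (fun z hz => (hN' (hA hz)).1) (hinj.mono hAU)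
      have h5 : ENNReal.ofReal (jacobian ψ y) * volume A ≤
          K * ∫⁻ y in A, ENNReal.ofReal (jacobian ψ y) := by
        rw [← setLIntegral_const, ← lintegral_const_mul' _ _ ENNReal.coe_ne_top]
        refine setLIntegral_mono' hAm fun z hz => ?_
        rw [← ENNReal.ofReal_coe_nnreal, ← ENNReal.ofReal_mul K.coe_nonneg]
        exact ENNReal.ofReal_le_ofReal (hN' (hA hz)).2.2.le
      have h6 : ∫⁻ y in A, ENNReal.ofReal (jacobian ψ y) ≤
          K * (ENNReal.ofReal (jacobian ψ y) * volume A) := by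
        rw [← setLIntegral_const, ← lintegral_const_mul' _ _ ENNReal.coe_ne_top]
        refine setLIntegral_mono' hAm fun z hz => ?_
        rw [← ENNReal.ofReal_coe_nnreal, ← ENNReal.ofReal_mul K.coe_nonneg]
        exact ENNReal.ofReal_le_ofReal (hN' (hA hz)).2.1.le
      constructor
      · refine h3.trans ?_
        rw [pow_succ, mul_assoc]
        gcongr
      · refine h6.trans ?_
        rw [pow_succ', mul_assoc]
        gcongr
    choose N hNo hyN hN using hloc
    obtain ⟨T, hTU, hTc, hT⟩ := TopologicalSpace.isOpen_biUnion_countable U N fun i _ => hNo i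
    have hcov : U ⊆ ⋃ i ∈ T, N i := by
      rw [hT]; exact fun y hy => mem_biUnion hy (hyN y hy)
    rcases T.eq_empty_or_nonempty with hTe | hTne
    · have : A = ∅ := by
        refine subset_empty_iff.1 (hAU.trans ?_)
        simpa [hTe] using hcov
      simp [this]
    obtain ⟨f, hf⟩ := hTc.exists_eq_range hTne
    -- `A` is cut into countably many pieces on each of which the local estimate holds
    let M : ℕ → Set (Eu n) := disjointed fun k => N (f k)
    have hMm : ∀ k, MeasurableSet (M k) := fun k =>
      MeasurableSet.disjointed (fun k => (hNo (f k)).measurableSet) k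
    have hMd : Pairwise (Function.onFun Disjoint fun k => A ∩ M k) := fun i j hij =>
      ((disjoint_disjointed fun k => N (f k)) hij).mono inter_subset_right inter_subset_right
    have hAM : A = ⋃ k, A ∩ M k := by
      rw [← inter_iUnion, iUnion_disjointed]
      refine (inter_eq_left.2 fun y hy => ?_).symm
      obtain ⟨i, hi, hy'⟩ := mem_iUnion₂.1 (hcov (hAU hy))
      rw [hf] at hi
      obtain ⟨k, rfl⟩ := hi
      exact mem_iUnion.2 ⟨k, hy'⟩
    have hAk : ∀ k, MeasurableSet (A ∩ M k) := fun k => hA.inter (hMm k)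
    have hAkU : ∀ k, A ∩ M k ⊆ U := fun k => inter_subset_left.trans hAU
    have h1 : (μHE[n] : Measure (Eu m)) (ψ '' A) =
        ∑' k, (μHE[n] : Measure (Eu m)) (ψ '' (A ∩ M k)) := by
      conv_lhs => rw [hAM, image_iUnion]
      refine measure_iUnion (fun i j hij => ?_) fun k => ?_
      · exact disjoint_image_image fun a ha b hb hab =>
          (hMd hij).ne_of_mem ha hb (hinj (hAkU i ha) (hAkU j hb) hab)
      · exact (hAk k).image_of_continuousOn_injOn (hψ.continuousOn.mono (hAkU k))
          (hinj.mono (hAkU k))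
    have h2 : ∫⁻ y in A, ENNReal.ofReal (jacobian ψ y) =
        ∑' k, ∫⁻ y in A ∩ M k, ENNReal.ofReal (jacobian ψ y) := by
      conv_lhs => rw [hAM]
      exact lintegral_iUnion hAk hMd _
    have h3 := fun k => hN (f k) (A ∩ M k)
      (inter_subset_right.trans (disjointed_subset _ k)) (hAk k) (hAkU k)
    rw [h1, h2, ← ENNReal.tsum_mul_left, ← ENNReal.tsum_mul_left]
    exact ⟨ENNReal.tsum_le_tsum fun k => (h3 k).1, ENNReal.tsum_le_tsum fun k => (h3 k).2⟩
  have hlim : ∀ a b : ℝ≥0∞, (∀ K : NNReal, 1 < K → a ≤ (K : ℝ≥0∞) ^ (n + 1) * b) → a ≤ b := by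
    intro a b h
    have h1 : Tendsto (fun K : NNReal => ((K ^ (n + 1) : NNReal) : ℝ≥0∞) * b) (𝓝[>] 1)
        (𝓝 (((1 ^ (n + 1) : NNReal) : ℝ≥0∞) * b)) := by
      refine ENNReal.Tendsto.mul_const ?_ (Or.inl (by simp))
      exact (ENNReal.continuous_coe.tendsto _).comp
        ((((continuous_pow (n + 1)).tendsto (1 : NNReal))).mono_left nhdsWithin_le_nhds)
    rw [one_pow, ENNReal.coe_one, one_mul] at h1
    have : (𝓝[>] (1 : NNReal)).NeBot := inferInstance
    refine ge_of_tendsto h1 (eventually_nhdsWithin_of_forall fun K hK => ?_)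
    rw [ENNReal.coe_pow]
    exact h K hK
  exact le_antisymm (hlim _ _ fun K hK => (key K hK).1) (hlim _ _ fun K hK => (key K hK).2)

/-! ### Charts of a hypersurface -/

/-- A chart of the hypersurface `S`: a parametrization `ψ` of `S ∩ Ω` by the open set `U ⊆ ℝⁿ`
whose inverse is the restriction of a smooth retraction `χ : Ω → U`. -/
structure SurfChart {n : ℕ} (S : Set (Eu (n + 1))) where
  U : Set (Eu n)
  Ω : Set (Eu (n + 1))
  ψ : Eu n → Eu (n + 1)
  χ : Eu (n + 1) → Eu n
  isOpen_U : IsOpen U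
  isOpen_Ω : IsOpen Ω
  smooth_ψ : ContDiffOn ℝ ∞ ψ U
  smooth_χ : ContDiffOn ℝ ∞ χ Ω
  mapsTo_ψ : MapsTo ψ U (S ∩ Ω)
  mapsTo_χ : MapsTo χ Ω U
  left_inv : ∀ y ∈ U, χ (ψ y) = y
  right_inv : ∀ x ∈ S ∩ Ω, ψ (χ x) = x

/-- The coordinate vector fields `∂_i ψ`. -/
def partials {n : ℕ} {V : Type*} [NormedAddCommGroup V] [NormedSpace ℝ V] (ψ : Eu n → V)
    (y : Eu n) (i : Fin n) : V := fderiv ℝ ψ y (stdVec i)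

/-- The area element of the parametrization `ψ` for the metric `B`, which at the point `y` is the
inner product `B y`. -/
def areaElt {n : ℕ} {V : Type*} [NormedAddCommGroup V] [NormedSpace ℝ V]
    (B : Eu n → V →L[ℝ] V →L[ℝ] ℝ) (ψ : Eu n → V) (y : Eu n) : ℝ :=
  √(gramOf (B y) (partials ψ y)).det

theorem continuousOn_partials {n : ℕ} {V : Type*} [NormedAddCommGroup V] [NormedSpace ℝ V]
    {ψ : Eu n → V} {U : Set (Eu n)} (hU : IsOpen U) (hψ : ContDiffOn ℝ 1 ψ U) (i : Fin n) :
    ContinuousOn (fun y => partials ψ y i) U :=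
  (hψ.continuousOn_fderiv_of_isOpen hU le_rfl).clm_apply continuousOn_const

theorem continuousOn_areaElt {n : ℕ} {V : Type*} [NormedAddCommGroup V] [NormedSpace ℝ V]
    {B : Eu n → V →L[ℝ] V →L[ℝ] ℝ} {ψ : Eu n → V} {U : Set (Eu n)} (hU : IsOpen U)
    (hB : ContinuousOn B U) (hψ : ContDiffOn ℝ 1 ψ U) : ContinuousOn (areaElt B ψ) U := by
  refine Real.continuous_sqrt.comp_continuousOn ?_
  refine (Continuous.matrix_det continuous_id).comp_continuousOn ?_
  exact continuousOn_pi.2 fun i => continuousOn_pi.2 fun j =>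
    (hB.clm_apply (continuousOn_partials hU hψ i)).clm_apply (continuousOn_partials hU hψ j)

theorem RiemMetric.isInnerForm {m : ℕ} {D : Set (Eu m)} (g : RiemMetric D) {x : Eu m} (hx : x ∈ D) :
    IsInnerForm (g.inner x) := ⟨g.symm x hx, g.pos x hx⟩

/-- The Riemannian area measure of the hypersurface `S`. -/
def surfMeasure {n : ℕ} {D : Set (Eu (n + 1))} (g : RiemMetric D) (S : Set (Eu (n + 1))) :
    Measure (Eu (n + 1)) :=
  ((μHE[n] : Measure (Eu (n + 1))).restrict S).withDensity
    fun x => ENNReal.ofReal (areaDensity g S x)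

theorem hypVol_eq_surfMeasure {n : ℕ} {D : Set (Eu (n + 1))} (g : RiemMetric D)
    (S A : Set (Eu (n + 1))) (hA : MeasurableSet A) : hypVol g S A = surfMeasure g S A := by
  rw [hypVol, surfMeasure, withDensity_apply _ hA, Measure.restrict_restrict hA]

namespace SurfChart

variable {n : ℕ} {S : Set (Eu (n + 1))} (c : SurfChart S)

/-- The restriction of a chart to an open set. -/
def restr {O : Set (Eu (n + 1))} (hO : IsOpen O) : SurfChart S where
  U := c.U ∩ c.ψ ⁻¹' O
  Ω := (c.Ω ∩ O) ∩ (c.Ω ∩ c.χ ⁻¹' (c.U ∩ c.ψ ⁻¹' O))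
  ψ := c.ψ
  χ := c.χ
  isOpen_U := c.smooth_ψ.continuousOn.isOpen_inter_preimage c.isOpen_U hO
  isOpen_Ω := (c.isOpen_Ω.inter hO).inter (c.smooth_χ.continuousOn.isOpen_inter_preimage c.isOpen_Ω
    (c.smooth_ψ.continuousOn.isOpen_inter_preimage c.isOpen_U hO))
  smooth_ψ := c.smooth_ψ.mono inter_subset_left
  smooth_χ := c.smooth_χ.mono fun _ h => h.1.1
  mapsTo_ψ := fun y hy => ⟨(c.mapsTo_ψ hy.1).1, ⟨(c.mapsTo_ψ hy.1).2, hy.2⟩,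
    (c.mapsTo_ψ hy.1).2, by rw [mem_preimage, c.left_inv y hy.1]; exact hy⟩
  mapsTo_χ := fun _ hx => hx.2.2
  left_inv := fun y hy => c.left_inv y hy.1
  right_inv := fun x hx => c.right_inv x ⟨hx.1, hx.2.1.1⟩

theorem mem_restr {O : Set (Eu (n + 1))} (hO : IsOpen O) {p : Eu (n + 1)} (hp : p ∈ S)
    (hpc : p ∈ c.Ω) (hpO : p ∈ O) : p ∈ (c.restr hO).Ω :=
  ⟨⟨hpc, hpO⟩, hpc, c.mapsTo_χ hpc, by rw [mem_preimage, c.right_inv p ⟨hp, hpc⟩]; exact hpO⟩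

theorem restr_Ω_subset {O : Set (Eu (n + 1))} (hO : IsOpen O) : (c.restr hO).Ω ⊆ c.Ω ∩ O :=
  inter_subset_left

theorem image_ψ (A : Set (Eu (n + 1))) : c.ψ '' (c.U ∩ c.ψ ⁻¹' A) = A ∩ (S ∩ c.Ω) := by
  ext x
  constructor
  · rintro ⟨y, ⟨hy, hyA⟩, rfl⟩
    exact ⟨hyA, c.mapsTo_ψ hy⟩
  · rintro ⟨hxA, hx⟩
    exact ⟨c.χ x, ⟨c.mapsTo_χ hx.2, by rw [mem_preimage, c.right_inv x hx]; exact hxA⟩,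
      c.right_inv x hx⟩

theorem injOn_ψ : InjOn c.ψ c.U := LeftInvOn.injOn fun y hy => c.left_inv y hy

theorem contDiffAt_ψ {y : Eu n} (hy : y ∈ c.U) : ContDiffAt ℝ ∞ c.ψ y :=
  c.smooth_ψ.contDiffAt (c.isOpen_U.mem_nhds hy)

theorem hasFDerivAt_ψ {y : Eu n} (hy : y ∈ c.U) : HasFDerivAt c.ψ (fderiv ℝ c.ψ y) y :=
  ((c.contDiffAt_ψ hy).differentiableAt (by simp)).hasFDerivAt

theorem hasFDerivAt_χ {x : Eu (n + 1)} (hx : x ∈ c.Ω) : HasFDerivAt c.χ (fderiv ℝ c.χ x) x :=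
  ((c.smooth_χ.contDiffAt (c.isOpen_Ω.mem_nhds hx)).differentiableAt (by simp)).hasFDerivAt

theorem fderiv_injective {y : Eu n} (hy : y ∈ c.U) : Function.Injective (fderiv ℝ c.ψ y) := by
  have h1 := (c.hasFDerivAt_χ (c.mapsTo_ψ hy).2).comp y (c.hasFDerivAt_ψ hy)
  have h2 : c.χ ∘ c.ψ =ᶠ[𝓝 y] id := by
    filter_upwards [c.isOpen_U.mem_nhds hy] with z hz using c.left_inv z hz
  have h3 := (h1.congr_of_eventuallyEq h2.symm).unique (hasFDerivAt_id y)
  exact Function.LeftInverse.injective (g := fderiv ℝ c.χ (c.ψ y))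
    fun v => DFunLike.congr_fun h3 v

theorem linearIndependent_partials {y : Eu n} (hy : y ∈ c.U) :
    LinearIndependent ℝ (partials c.ψ y) := linearIndependent_map_stdVec (c.fderiv_injective hy)

/-- The tangent space, which is defined by velocities of curves in `S`, is spanned by the coordinate
vectors. -/
theorem tangentSpaceAt_eq {y : Eu n} (hy : y ∈ c.U) :
    tangentSpaceAt S (c.ψ y) = Submodule.span ℝ (range (partials c.ψ y)) := by
  have hrange : ∀ v, fderiv ℝ c.ψ y v ∈ Submodule.span ℝ (range (partials c.ψ y)) := fun v => by
    rw [← sum_smul_stdVec v, map_sum]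
    refine Submodule.sum_mem _ fun i _ => ?_
    rw [map_smul]
    exact Submodule.smul_mem _ _ (Submodule.subset_span (mem_range_self i))
  apply le_antisymm
  · refine Submodule.span_le.2 fun v hv => ?_
    have hx := (c.mapsTo_ψ hy).2
    have h1 : HasFDerivAt (c.ψ ∘ c.χ) ((fderiv ℝ c.ψ y).comp (fderiv ℝ c.χ (c.ψ y))) (c.ψ y) := by
      refine HasFDerivAt.comp _ ?_ (c.hasFDerivAt_χ hx)
      rw [c.left_inv y hy]
      exact c.hasFDerivAt_ψ hy
    have h2 : HasFDerivWithinAt (c.ψ ∘ c.χ) (ContinuousLinearMap.id ℝ _) S (c.ψ y) := by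
      refine (hasFDerivWithinAt_id _ _).congr_of_eventuallyEq ?_ ?_
      · filter_upwards [inter_mem_nhdsWithin S (c.isOpen_Ω.mem_nhds hx)] with z hz
        exact c.right_inv z hz
      · exact c.right_inv _ (c.mapsTo_ψ hy)
    have h3 := h1.hasFDerivWithinAt.unique_on h2 hv
    rw [SetLike.mem_coe]
    have h4 : fderiv ℝ c.ψ y (fderiv ℝ c.χ (c.ψ y) v) = v := h3
    rw [← h4]
    exact hrange _
  · refine Submodule.span_le.2 ?_
    rintro _ ⟨i, rfl⟩
    refine Submodule.subset_span ?_
    have h1 := (c.hasFDerivAt_ψ hy).hasFDerivWithinAt (s := c.U) |>.mapsTo_tangent_cone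
    have h2 : tangentConeAt ℝ c.U y = univ := tangentConeAt_of_mem_nhds (c.isOpen_U.mem_nhds hy)
    have h3 := h1 (x := stdVec i) (by rw [h2]; trivial)
    exact tangentConeAt_mono (image_subset_iff.2 fun z hz => (c.mapsTo_ψ hz).1) h3

theorem finrank_tangentSpaceAt {y : Eu n} (hy : y ∈ c.U) :
    Module.finrank ℝ (tangentSpaceAt S (c.ψ y)) = n := by
  rw [c.tangentSpaceAt_eq hy, finrank_span_eq_card (c.linearIndependent_partials hy),
    Fintype.card_fin]

/-- The coordinate vectors in terms of the orthonormal basis of the tangent space that occurs in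
the definition of the area density. -/
theorem exists_combo_stdOrthonormalBasis {y : Eu n} (hy : y ∈ c.U) :
    ∃ (σ : Fin n ≃ Fin (Module.finrank ℝ (tangentSpaceAt S (c.ψ y)))) (A : Matrix (Fin n) (Fin n) ℝ),
      IsUnit A.det ∧ partials c.ψ y = combo A
        ((fun i => (stdOrthonormalBasis ℝ (tangentSpaceAt S (c.ψ y)) i : Eu (n + 1))) ∘ σ) := by
  let b := stdOrthonormalBasis ℝ (tangentSpaceAt S (c.ψ y))
  let σ := finCongr (c.finrank_tangentSpaceAt hy).symm
  refine ⟨σ, exists_combo_of_span_eq ?_ ?_⟩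
  · have h1 : LinearIndependent ℝ (b ∘ σ) := b.orthonormal.linearIndependent.comp _ σ.injective
    exact h1.map' (Submodule.subtype _) (Submodule.ker_subtype _)
  · rw [← c.tangentSpaceAt_eq hy, σ.surjective.range_comp]
    have h1 : Submodule.span ℝ (range b) = ⊤ := by
      rw [← b.coe_toBasis]; exact b.toBasis.span_eq
    have h2 := congrArg (Submodule.map (Submodule.subtype _)) h1
    rw [Submodule.map_span, Submodule.map_top, Submodule.range_subtype, ← range_comp] at h2
    exact h2.symm

/-- The area density is defined by an orthonormal basis of the tangent space for the Euclidean
metric. Both Gram determinants of the coordinate vectors contain the square of the same transition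
determinant, so that the product with the Euclidean Jacobian is the Riemannian area element. -/
theorem areaDensity_mul_jacobian {D : Set (Eu (n + 1))} (g : RiemMetric D) {y : Eu n}
    (hy : y ∈ c.U) :
    areaDensity g S (c.ψ y) * jacobian c.ψ y = areaElt (fun y => g.inner (c.ψ y)) c.ψ y := by
  obtain ⟨σ, A, hA, h⟩ := c.exists_combo_stdOrthonormalBasis hy
  set b := fun i => (stdOrthonormalBasis ℝ (tangentSpaceAt S (c.ψ y)) i : Eu (n + 1)) with hb
  have h1 : jacobian c.ψ y = |A.det| := by
    have h2 : gramOf (innerSL ℝ) (b ∘ σ) = 1 := by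
      ext i j
      have h3 := orthonormal_iff_ite.1 (stdOrthonormalBasis ℝ (tangentSpaceAt S (c.ψ y))).orthonormal
        (σ i) (σ j)
      simp only [σ.injective.eq_iff] at h3
      rw [Matrix.one_apply, ← h3]
      rfl
    rw [jacobian_eq]
    change √(gramOf (innerSL ℝ) (partials c.ψ y)).det = _
    rw [h, sqrt_det_gramOf_combo, h2, Matrix.det_one, Real.sqrt_one, mul_one]
  have h2 : areaDensity g S (c.ψ y) = √(gramOf (g.inner (c.ψ y)) (b ∘ σ)).det := by
    have h3 : gramOf (g.inner (c.ψ y)) (b ∘ σ) = (gramOf (g.inner (c.ψ y)) b).submatrix σ σ := rfl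
    rw [h3, Matrix.det_submatrix_equiv_self]
    rfl
  rw [h1, h2, areaElt, h, sqrt_det_gramOf_combo, mul_comm]

theorem jacobian_pos {y : Eu n} (hy : y ∈ c.U) : 0 < jacobian c.ψ y := Real.sqrt_pos.2
  (isInnerForm_innerSL.posDef_gramOf (c.linearIndependent_partials hy)).det_pos

theorem measurableSet_inter : MeasurableSet (S ∩ c.Ω) := by
  have h := c.image_ψ univ
  rw [preimage_univ, inter_univ, univ_inter] at h
  rw [← h]
  exact c.isOpen_U.measurableSet.image_of_continuousOn_injOn c.smooth_ψ.continuousOn c.injOn_ψ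

theorem aemeasurable_ψ {f : Eu n → ℝ≥0∞} :
    AEMeasurable c.ψ ((volume.restrict c.U).withDensity f) :=
  (c.smooth_ψ.continuousOn.aemeasurable c.isOpen_U.measurableSet).mono_ac
    (withDensity_absolutelyContinuous _ _)

theorem measurableSet_preimage {A : Set (Eu (n + 1))} (hA : MeasurableSet A) :
    MeasurableSet (c.U ∩ c.ψ ⁻¹' A) := by
  have h := c.isOpen_U.measurableSet.subtype_image
    (c.smooth_ψ.continuousOn.domRestrict.measurable hA)
  convert h using 1
  ext y
  simp [and_comm]

/-- The area formula: Hausdorff measure on `S ∩ Ω` is the image of the Jacobian. -/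
theorem restrict_hausdorff_eq_map :
    (μHE[n] : Measure (Eu (n + 1))).restrict (S ∩ c.Ω) =
      ((volume.restrict c.U).withDensity fun y => ENNReal.ofReal (jacobian c.ψ y)).map c.ψ := by
  ext A hA
  have hm := c.measurableSet_preimage hA
  have hn : NullMeasurableSet (c.ψ ⁻¹' A) (volume.restrict c.U) :=
    (c.smooth_ψ.continuousOn.aemeasurable c.isOpen_U.measurableSet).nullMeasurable hA
  rw [Measure.restrict_apply hA, Measure.map_apply_of_aemeasurable c.aemeasurable_ψ hA,
    ← c.image_ψ A, euclideanHausdorffMeasure_image_eq c.isOpen_U (c.smooth_ψ.of_le (by simp))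
      c.injOn_ψ (fun y hy => c.fderiv_injective hy) hm inter_subset_left,
    withDensity_apply₀ _ hn, Measure.restrict_restrict₀ hn, inter_comm]

theorem continuousOn_areaElt {D : Set (Eu (n + 1))} (g : RiemMetric D) (hΩ : c.Ω ⊆ D) :
    ContinuousOn (areaElt (fun y => g.inner (c.ψ y)) c.ψ) c.U := by
  refine _root_.continuousOn_areaElt c.isOpen_U ?_ (c.smooth_ψ.of_le (by simp))
  exact g.smooth.continuousOn.comp c.smooth_ψ.continuousOn fun y hy => hΩ (c.mapsTo_ψ hy).2

/-- In a chart, the area measure of `S` is the image of the Riemannian area element. -/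
theorem restrict_surfMeasure_eq_map {D : Set (Eu (n + 1))} (g : RiemMetric D) (hΩ : c.Ω ⊆ D) :
    (surfMeasure g S).restrict c.Ω =
      ((volume.restrict c.U).withDensity
        fun y => ENNReal.ofReal (areaElt (fun y => g.inner (c.ψ y)) c.ψ y)).map c.ψ := by
  have hj : ContinuousOn (jacobian c.ψ) c.U :=
    continuousOn_jacobian c.isOpen_U (c.smooth_ψ.of_le (by simp))
  let d : Eu (n + 1) → ℝ := fun x =>
    areaElt (fun y => g.inner (c.ψ y)) c.ψ (c.χ x) / jacobian c.ψ (c.χ x)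
  have hd : ContinuousOn d c.Ω :=
    ((c.continuousOn_areaElt g hΩ).div hj fun y hy => (c.jacobian_pos hy).ne').comp
      c.smooth_χ.continuousOn c.mapsTo_χ
  have hdS : ∀ y ∈ c.U, areaDensity g S (c.ψ y) = d (c.ψ y) := fun y hy => by
    simp only [d, c.left_inv y hy, ← c.areaDensity_mul_jacobian g hy]
    field_simp [(c.jacobian_pos hy).ne']
  have hdS' : ∀ x ∈ S ∩ c.Ω, areaDensity g S x = d x := fun x hx => by
    rw [← c.right_inv x hx]; exact hdS _ (c.mapsTo_χ hx.2)
  ext A hA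
  have hAΩ := hA.inter c.isOpen_Ω.measurableSet
  have hm := c.measurableSet_preimage hA
  have hn : NullMeasurableSet (c.ψ ⁻¹' A) (volume.restrict c.U) :=
    (c.smooth_ψ.continuousOn.aemeasurable c.isOpen_U.measurableSet).nullMeasurable hA
  rw [Measure.restrict_apply hA, surfMeasure, withDensity_apply _ hAΩ,
    Measure.restrict_restrict hAΩ, Measure.map_apply_of_aemeasurable c.aemeasurable_ψ hA,
    withDensity_apply₀ _ hn, inter_assoc, inter_comm c.Ω S,
    ← Measure.restrict_restrict hA, c.restrict_hausdorff_eq_map]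
  have h1 : ∀ᵐ x ∂((volume.restrict c.U).withDensity
      fun y => ENNReal.ofReal (jacobian c.ψ y)).map c.ψ,
      ENNReal.ofReal (areaDensity g S x) = ENNReal.ofReal (d x) := by
    rw [← c.restrict_hausdorff_eq_map]
    filter_upwards [ae_restrict_mem c.measurableSet_inter] with x hx
    rw [hdS' x hx]
  have hdm : AEMeasurable (fun x => ENNReal.ofReal (d x)) (((volume.restrict c.U).withDensity
      fun y => ENNReal.ofReal (jacobian c.ψ y)).map c.ψ) := by
    rw [← c.restrict_hausdorff_eq_map]
    exact ((hd.mono inter_subset_right).aemeasurable c.measurableSet_inter).ennreal_ofReal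
  have hjm : AEMeasurable (fun y => ENNReal.ofReal (jacobian c.ψ y)) (volume.restrict c.U) :=
    (hj.aemeasurable c.isOpen_U.measurableSet).ennreal_ofReal
  rw [setLIntegral_congr_fun_ae hA (h1.mono fun x hx _ => hx), ← lintegral_indicator hA,
    lintegral_map' (hdm.indicator hA) c.aemeasurable_ψ, ← lintegral_indicator₀ hn]
  refine (lintegral_withDensity_eq_lintegral_mul₀' hjm ((hdm.indicator hA).comp_aemeasurable
    c.aemeasurable_ψ)).trans ?_
  refine lintegral_congr_ae ?_
  filter_upwards [ae_restrict_mem c.isOpen_U.measurableSet] with y hy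
  by_cases hyA : c.ψ y ∈ A
  · simp only [Pi.mul_apply, Function.comp, indicator_of_mem hyA, indicator_of_mem (mem_preimage.2 hyA)]
    rw [← c.areaDensity_mul_jacobian g hy, ← hdS y hy, mul_comm,
      ENNReal.ofReal_mul' (c.jacobian_pos hy).le]
  · simp only [Pi.mul_apply, Function.comp, indicator_of_notMem hyA,
      indicator_of_notMem (show y ∉ c.ψ ⁻¹' A from hyA), mul_zero]

/-- Integration against the area measure in a chart. -/
theorem lintegral_surfMeasure {D : Set (Eu (n + 1))} (g : RiemMetric D) (hΩ : c.Ω ⊆ D)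
    {A : Set (Eu (n + 1))} (hA : MeasurableSet A) (hAΩ : A ⊆ c.Ω) :
    surfMeasure g S A = ∫⁻ y in c.U ∩ c.ψ ⁻¹' A,
      ENNReal.ofReal (areaElt (fun y => g.inner (c.ψ y)) c.ψ y) := by
  have hn : NullMeasurableSet (c.ψ ⁻¹' A) (volume.restrict c.U) :=
    (c.smooth_ψ.continuousOn.aemeasurable c.isOpen_U.measurableSet).nullMeasurable hA
  rw [← Measure.restrict_eq_self _ hAΩ, c.restrict_surfMeasure_eq_map g hΩ,
    Measure.map_apply_of_aemeasurable c.aemeasurable_ψ hA, withDensity_apply₀ _ hn,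
    Measure.restrict_restrict₀ hn, inter_comm]

/-- The image under a chart of the measure with density `J`. -/
def mapMeasure (J : Eu n → ℝ) : Measure (Eu (n + 1)) :=
  ((volume.restrict c.U).withDensity fun y => ENNReal.ofReal (J y)).map c.ψ

theorem aestronglyMeasurable_mapMeasure {J : Eu n → ℝ} {f : Eu (n + 1) → ℝ}
    (hc : ContinuousOn (f ∘ c.ψ) c.U) : AEStronglyMeasurable f (c.mapMeasure J) := by
  have hmem : ∀ᵐ x ∂(c.mapMeasure J), x ∈ S ∩ c.Ω :=
    (ae_map_iff c.aemeasurable_ψ c.measurableSet_inter).2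
      ((withDensity_absolutelyContinuous _ _).ae_le
        ((ae_restrict_mem c.isOpen_U.measurableSet).mono fun y hy => c.mapsTo_ψ hy))
  have h1 : ContinuousOn ((f ∘ c.ψ) ∘ c.χ) (S ∩ c.Ω) :=
    (hc.comp c.smooth_χ.continuousOn c.mapsTo_χ).mono inter_subset_right
  have h2 := h1.aestronglyMeasurable (μ := c.mapMeasure J) c.measurableSet_inter
  rw [Measure.restrict_eq_self_of_ae_mem hmem] at h2
  exact h2.congr (hmem.mono fun x hx => congrArg f (c.right_inv x hx))

theorem integral_mapMeasure {J : Eu n → ℝ} (hJ : ContinuousOn J c.U) (hJ0 : ∀ y, 0 ≤ J y)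
    {f : Eu (n + 1) → ℝ} (hc : ContinuousOn (f ∘ c.ψ) c.U) :
    ∫ x, f x ∂(c.mapMeasure J) = ∫ y in c.U, J y * f (c.ψ y) := by
  rw [mapMeasure, integral_map c.aemeasurable_ψ (c.aestronglyMeasurable_mapMeasure hc),
    integral_withDensity_eq_integral_toReal_smul₀
      (hJ.aemeasurable c.isOpen_U.measurableSet).ennreal_ofReal (by simp)]
  simp only [ENNReal.toReal_ofReal (hJ0 _), smul_eq_mul]

theorem integrable_mapMeasure {J : Eu n → ℝ} (hJ : ContinuousOn J c.U) (hJ0 : ∀ y, 0 ≤ J y)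
    {f : Eu (n + 1) → ℝ} (hc : ContinuousOn (f ∘ c.ψ) c.U) :
    Integrable f (c.mapMeasure J) ↔ IntegrableOn (fun y => J y * f (c.ψ y)) c.U := by
  rw [mapMeasure, integrable_map_measure (c.aestronglyMeasurable_mapMeasure hc) c.aemeasurable_ψ,
    integrable_withDensity_iff_integrable_smul₀'
      (hJ.aemeasurable c.isOpen_U.measurableSet).ennreal_ofReal (by simp)]
  simp only [ENNReal.toReal_ofReal (hJ0 _), smul_eq_mul]
  rfl

theorem areaElt_nonneg {V : Type*} [NormedAddCommGroup V] [NormedSpace ℝ V]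
    (B : Eu n → V →L[ℝ] V →L[ℝ] ℝ) (φ : Eu n → V) (y : Eu n) : 0 ≤ areaElt B φ y :=
  Real.sqrt_nonneg _

/-- The Bochner integral against the area measure in a chart. -/
theorem integral_surfMeasure {D : Set (Eu (n + 1))} (g : RiemMetric D) (hΩ : c.Ω ⊆ D)
    {f : Eu (n + 1) → ℝ} (hf : ∀ x ∉ c.Ω, f x = 0) (hc : ContinuousOn (f ∘ c.ψ) c.U) :
    ∫ x, f x ∂surfMeasure g S =
      ∫ y in c.U, areaElt (fun y => g.inner (c.ψ y)) c.ψ y * f (c.ψ y) := by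
  rw [← c.integral_mapMeasure (c.continuousOn_areaElt g hΩ) (areaElt_nonneg _ _) hc, mapMeasure,
    ← c.restrict_surfMeasure_eq_map g hΩ, setIntegral_eq_integral_of_forall_compl_eq_zero hf]

theorem integrable_surfMeasure {D : Set (Eu (n + 1))} (g : RiemMetric D) (hΩ : c.Ω ⊆ D)
    {f : Eu (n + 1) → ℝ} (hf : ∀ x ∉ c.Ω, f x = 0) (hc : ContinuousOn (f ∘ c.ψ) c.U)
    (hi : IntegrableOn (fun y => areaElt (fun y => g.inner (c.ψ y)) c.ψ y * f (c.ψ y)) c.U) :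
    Integrable f (surfMeasure g S) := by
  have h := (c.integrable_mapMeasure (c.continuousOn_areaElt g hΩ) (areaElt_nonneg _ _) hc).2 hi
  rw [mapMeasure, ← c.restrict_surfMeasure_eq_map g hΩ] at h
  exact (integrableOn_iff_integrable_of_support_subset fun x hx =>
    not_not.1 fun h => hx (hf x h)).1 h

theorem integral_hausdorff {f : Eu (n + 1) → ℝ} (hf : ∀ x ∉ c.Ω, f x = 0)
    (hc : ContinuousOn (f ∘ c.ψ) c.U) (hS : MeasurableSet S) :
    ∫ x in S, f x ∂μHE[n] = ∫ y in c.U, jacobian c.ψ y * f (c.ψ y) := by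
  rw [← c.integral_mapMeasure (continuousOn_jacobian c.isOpen_U (c.smooth_ψ.of_le (by simp)))
    (fun _ => Real.sqrt_nonneg _) hc, mapMeasure, ← c.restrict_hausdorff_eq_map, inter_comm,
    ← Measure.restrict_restrict c.isOpen_Ω.measurableSet,
    setIntegral_eq_integral_of_forall_compl_eq_zero hf]

end SurfChart

theorem IsHypersurface.measurableSet {n : ℕ} {D S : Set (Eu (n + 1))} (hD : IsOpen D)
    (hS : IsHypersurface D S) : MeasurableSet S := by
  have h : S = closure S ∩ D :=
    Subset.antisymm (fun x hx => ⟨subset_closure hx, hS.subset hx⟩) hS.closed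
  rw [h]
  exact isClosed_closure.measurableSet.inter hD.measurableSet

/-- The inclusion `y ↦ (y, 0)`. -/
def inclLast (n : ℕ) : Eu n →L[ℝ] Eu (n + 1) :=
  LinearMap.toContinuousLinearMap
    { toFun := fun y => WithLp.toLp 2 (Fin.snoc (α := fun _ => ℝ) y.ofLp 0)
      map_add' := fun x y => by
        ext i
        refine Fin.lastCases ?_ (fun j => ?_) i <;> simp
      map_smul' := fun a y => by
        ext i
        refine Fin.lastCases ?_ (fun j => ?_) i <;> simp }

/-- The projection that forgets the last coordinate. -/
def projInit (n : ℕ) : Eu (n + 1) →L[ℝ] Eu n :=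
  LinearMap.toContinuousLinearMap
    { toFun := fun x => WithLp.toLp 2 fun i => x i.castSucc
      map_add' := fun x y => rfl
      map_smul' := fun a y => rfl }

theorem projInit_apply {n : ℕ} (x : Eu (n + 1)) (i : Fin n) :
    projInit n x i = x i.castSucc := rfl

theorem inclLast_castSucc {n : ℕ} (y : Eu n) (i : Fin n) : inclLast n y i.castSucc = y i := by
  simp [inclLast]

theorem projInit_inclLast {n : ℕ} (y : Eu n) : projInit n (inclLast n y) = y := by
  ext i
  rw [projInit_apply, inclLast_castSucc]

theorem inclLast_last {n : ℕ} (y : Eu n) : inclLast n y (Fin.last n) = 0 := by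
  simp [inclLast]

theorem inclLast_projInit {n : ℕ} {x : Eu (n + 1)} (hx : x (Fin.last n) = 0) :
    inclLast n (projInit n x) = x := by
  ext i
  refine Fin.lastCases ?_ (fun j => ?_) i
  · rw [inclLast_last, hx]
  · rw [inclLast_castSucc, projInit_apply]

theorem IsInteriorPt.exists_surfChart {n : ℕ} {S : Set (Eu (n + 1))} {p : Eu (n + 1)}
    (hp : IsInteriorPt S p) : ∃ c : SurfChart S, p ∈ c.Ω := by
  obtain ⟨hpS, Θ, hpΘ, hΘ, hΘs, hS⟩ := hp
  have hUo : IsOpen (inclLast n ⁻¹' Θ.target) := Θ.open_target.preimage (inclLast n).continuous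
  have hχ : ContDiffOn ℝ ∞ (fun x => projInit n (Θ x)) Θ.source :=
    (projInit n).contDiff.comp_contDiffOn hΘ
  have hψ : ∀ y ∈ inclLast n ⁻¹' Θ.target, Θ.symm (inclLast n y) ∈ S ∩ (Θ.source ∩
      (fun x => projInit n (Θ x)) ⁻¹' (inclLast n ⁻¹' Θ.target)) := fun y hy => by
    have h1 := Θ.map_target hy
    have h2 := Θ.right_inv hy
    refine ⟨(hS _ h1).2 ?_, h1, ?_⟩
    · rw [h2, inclLast_last]
    · simp only [mem_preimage, h2, projInit_inclLast]
      exact hy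
  refine ⟨{
    U := inclLast n ⁻¹' Θ.target
    Ω := Θ.source ∩ (fun x => projInit n (Θ x)) ⁻¹' (inclLast n ⁻¹' Θ.target)
    ψ := fun y => Θ.symm (inclLast n y)
    χ := fun x => projInit n (Θ x)
    isOpen_U := hUo
    isOpen_Ω := hχ.continuousOn.isOpen_inter_preimage Θ.open_source hUo
    smooth_ψ := hΘs.comp (inclLast n).contDiff.contDiffOn fun y hy => hy
    smooth_χ := hχ.mono inter_subset_left
    mapsTo_ψ := hψ
    mapsTo_χ := fun x hx => hx.2
    left_inv := fun y hy => by rw [Θ.right_inv hy, projInit_inclLast]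
    right_inv := fun x hx => by
      rw [inclLast_projInit ((hS x hx.2.1).1 hx.1), Θ.left_inv hx.2.1] }, hpΘ, ?_⟩
  simp only [mem_preimage]
  rw [inclLast_projInit ((hS p hpΘ).1 hpS)]
  exact Θ.map_source hpΘ

/-! ### Local comparison of areas -/

/-- Smooth cutoff functions. -/
theorem exists_cutoff {F : Type*} [NormedAddCommGroup F] [NormedSpace ℝ F] [FiniteDimensional ℝ F]
    {K O : Set F} (hK : IsCompact K) (hO : IsOpen O) (hKO : K ⊆ O) :
    ∃ b : F → ℝ, ContDiff ℝ ∞ b ∧ HasCompactSupport b ∧ tsupport b ⊆ O ∧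
      (∀ x, 0 ≤ b x ∧ b x ≤ 1) ∧ ∃ N, IsOpen N ∧ K ⊆ N ∧ ∀ x ∈ N, b x = 1 := by
  obtain ⟨K1, hK1, hKK1, hK1O⟩ := exists_compact_between hK hO hKO
  obtain ⟨K2, hK2, hK12, hK2O⟩ := exists_compact_between hK1 hO hK1O
  obtain ⟨b, hb, hbr, hbs, hb1⟩ := exists_contMDiff_support_eq_eq_one_iff
    (modelWithCornersSelf ℝ F) (n := (⊤ : ℕ∞)) isOpen_interior hK1.isClosed hK12
  have hts : tsupport b ⊆ K2 := by
    rw [tsupport, hbs]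
    exact closure_minimal interior_subset hK2.isClosed
  refine ⟨b, hb.contDiff, hK2.of_isClosed_subset (isClosed_tsupport b) hts, hts.trans hK2O,
    fun x => ?_, interior K1, isOpen_interior, hKK1, fun x hx => (hb1 x).1 (interior_subset hx)⟩
  exact hbr (mem_range_self x)

theorem contDiff_smul_of_tsupport_subset {F V : Type*} [NormedAddCommGroup F] [NormedSpace ℝ F]
    [NormedAddCommGroup V] [NormedSpace ℝ V] {k : WithTop ℕ∞} {b : F → ℝ} {f : F → V} {O : Set F}
    (hO : IsOpen O) (hb : ContDiff ℝ k b) (hbO : tsupport b ⊆ O) (hf : ContDiffOn ℝ k f O) :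
    ContDiff ℝ k fun x => b x • f x := by
  rw [contDiff_iff_contDiffAt]
  intro x
  by_cases hx : x ∈ O
  · exact hb.contDiffAt.smul (hf.contDiffAt (hO.mem_nhds hx))
  · have h1 : (fun x => b x • f x) =ᶠ[𝓝 x] fun _ => 0 := by
      filter_upwards [(isClosed_tsupport b).isOpen_compl.mem_nhds fun h => hx (hbO h)] with z hz
      rw [image_eq_zero_of_notMem_tsupport hz, zero_smul]
    exact contDiffAt_const.congr_of_eventuallyEq h1

theorem continuousOn_pullbackAt {m n : ℕ} {φ : Eu n → Eu m} {α : DForm m n} {U : Set (Eu n)}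
    (hU : IsOpen U) (hφ : ContDiffOn ℝ ∞ φ U) (hα : Continuous α) :
    ContinuousOn (pullbackAt φ α) U := by
  exact continuousOn_form_apply (hα.comp_continuousOn hφ.continuousOn) fun i =>
    continuousOn_partials hU (hφ.of_le (by simp)) i

/-- The reflection in the first coordinate. A current of the form `∫ f^*α - ∫ h^*α` is written as a
sum of two push-forwards by composing `h` with this reflection, which reverses the orientation. -/
def reflZero (k : ℕ) : Eu (k + 1) ≃ₗᵢ[ℝ] Eu (k + 1) :=
  (Submodule.span ℝ {(stdVec 0 : Eu (k + 1))})ᗮ.reflection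

theorem reflZero_stdVec_zero (k : ℕ) : reflZero k (stdVec 0) = -stdVec 0 :=
  Submodule.reflection_orthogonalComplement_singleton_eq_neg _

theorem reflZero_stdVec_of_ne {k : ℕ} {i : Fin (k + 1)} (hi : i ≠ 0) :
    reflZero k (stdVec i) = stdVec i := by
  refine Submodule.reflection_mem_subspace_eq_self ?_
  rw [Submodule.mem_orthogonal_singleton_iff_inner_right]
  rw [← basisFun_eq_stdVec, ← basisFun_eq_stdVec, OrthonormalBasis.inner_eq_ite, if_neg hi.symm]

/-- The reflection changes the sign of the pull-back. -/
theorem pullbackAt_comp_reflZero {m k : ℕ} {h : Eu (k + 1) → Eu m} (hh : Differentiable ℝ h)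
    (α : DForm m (k + 1)) (y : Eu (k + 1)) :
    pullbackAt (h ∘ reflZero k) α y = -pullbackAt h α (reflZero k y) := by
  have h1 : fderiv ℝ (h ∘ reflZero k) y =
      (fderiv ℝ h (reflZero k y)).comp (reflZero k : Eu (k + 1) →L[ℝ] Eu (k + 1)) := by
    exact ((hh _).hasFDerivAt.comp y
      ((reflZero k : Eu (k + 1) →L[ℝ] Eu (k + 1)).hasFDerivAt)).fderiv
  have h2 : (fun i => fderiv ℝ (h ∘ reflZero k) y (stdVec i)) =
      Function.update (fun i => fderiv ℝ h (reflZero k y) (stdVec i)) 0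
        (-fderiv ℝ h (reflZero k y) (stdVec 0)) := by
    ext1 i
    rw [h1]
    by_cases hi : i = 0
    · subst hi
      simp [reflZero_stdVec_zero]
    · simp [hi, reflZero_stdVec_of_ne hi]
  rw [pullbackAt, h2, pullbackAt]
  have h3 := (α (h (reflZero k y))).map_update_neg
    (fun i => fderiv ℝ h (reflZero k y) (stdVec i)) 0 (fderiv ℝ h (reflZero k y) (stdVec 0))
  rw [Function.update_eq_self] at h3
  exact h3

theorem lintegral_jacobian_lt_top {m n : ℕ} {f : Eu n → Eu m} (hf : ContDiff ℝ ∞ f)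
    {C : Set (Eu n)} (hC : IsCompact C) : ∫⁻ y in C, ENNReal.ofReal (jacobian f y) < ⊤ := by
  have h1 : ContinuousOn (jacobian f) C :=
    (continuousOn_jacobian isOpen_univ ((hf.of_le (by simp)).contDiffOn)).mono (subset_univ _)
  exact Integrable.lintegral_lt_top (h1.integrableOn_compact hC)

/-- The difference of the push-forwards of a compact set under two maps is rectifiable. -/
theorem isIntegerRectifiable_sub {m k : ℕ} {f h : Eu (k + 1) → Eu m} {C : Set (Eu (k + 1))}
    {K : Set (Eu m)} (hC : IsCompact C) (hf : ContDiff ℝ ∞ f) (hfc : HasCompactSupport f)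
    (hh : ContDiff ℝ ∞ h) (hhc : HasCompactSupport h) (hfK : MapsTo f C K) (hhK : MapsTo h C K) :
    IsIntegerRectifiable K
      fun α : DForm m (k + 1) => (∫ y in C, pullbackAt f α y) - ∫ y in C, pullbackAt h α y := by
  let ρ := reflZero k
  have hρC : IsCompact (ρ ⁻¹' C) := ρ.toHomeomorph.isCompact_preimage.2 hC
  have hhρ : ContDiff ℝ ∞ (h ∘ ρ) := hh.comp ρ.contDiff
  let A : ℕ → Set (Eu (k + 1)) := fun i => if i = 0 then C else if i = 1 then ρ ⁻¹' C else ∅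
  let φ : ℕ → Eu (k + 1) → Eu m := fun i => if i = 0 then f else if i = 1 then h ∘ ρ else fun _ => 0
  have h2 : ∀ i, i ∉ Finset.range 2 → A i = ∅ := fun i hi => by
    simp only [Finset.mem_range, not_lt] at hi
    simp only [A]
    rw [if_neg (by omega), if_neg (by omega)]
  have hA0 : A 0 = C := rfl
  have hA1 : A 1 = ρ ⁻¹' C := rfl
  have hφ0 : φ 0 = f := rfl
  have hφ1 : φ 1 = h ∘ ρ := rfl
  refine ⟨A, φ, fun i => ?_, ?_, fun α hα => ?_⟩
  · rcases i with _ | _ | i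
    · exact ⟨hC.measurableSet, hC.isBounded,
        hf.lipschitzWith_of_hasCompactSupport hfc (by simp), hfK⟩
    · refine ⟨hρC.measurableSet, hρC.isBounded, ?_, fun y hy => hhK hy⟩
      obtain ⟨c, hc⟩ := hh.lipschitzWith_of_hasCompactSupport hhc (by simp)
      exact ⟨c * 1, hc.comp ρ.lipschitz⟩
    · have h3 : A (i + 1 + 1) = ∅ := h2 _ (by simp)
      rw [h3]
      refine ⟨MeasurableSet.empty, Bornology.isBounded_empty, ⟨0, ?_⟩, mapsTo_empty _ _⟩
      exact LipschitzWith.const 0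
  · rw [tsum_eq_sum (s := Finset.range 2) fun i hi => by rw [h2 i hi]; simp]
    rw [Finset.sum_range_succ, Finset.sum_range_one, hA0, hA1, hφ0, hφ1]
    exact ENNReal.add_lt_top.2 ⟨lintegral_jacobian_lt_top hf hC, lintegral_jacobian_lt_top hhρ hρC⟩
  · rw [tsum_eq_sum (s := Finset.range 2) fun i hi => by rw [h2 i hi]; simp]
    rw [Finset.sum_range_succ, Finset.sum_range_one, hA0, hA1, hφ0, hφ1]
    refine (sub_eq_add_neg _ _).trans ?_
    congr 1
    rw [← integral_neg]
    have h3 : ∀ y, pullbackAt (h ∘ ρ) α y = -pullbackAt h α (ρ y) :=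
      pullbackAt_comp_reflZero (hh.differentiable (by simp)) α
    simp only [h3]
    exact (ρ.measurePreserving.setIntegral_preimage_emb ρ.toHomeomorph.measurableEmbedding
      (fun y => -pullbackAt h α y) C).symm

/-- The difference of the push-forwards of a compact set under two maps that agree off this set
is a cycle, by Stokes' theorem. -/
theorem isCycle_sub {m k : ℕ} {f h : Eu (k + 1) → Eu m} {C : Set (Eu (k + 1))}
    (hC : IsCompact C) (hf : ContDiff ℝ ∞ f) (hh : ContDiff ℝ ∞ h) (hfh : ∀ y ∉ C, f y = h y) :
    IsCycle fun α : DForm m (k + 1) => (∫ y in C, pullbackAt f α y) - ∫ y in C, pullbackAt h α y := by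
  intro η hη
  -- the pull-back of `η` under `φ`; those for `f` and `h` differ by a form with support in `C`
  let P : (Eu (k + 1) → Eu m) → DForm (k + 1) k := fun φ y =>
    (η (φ y)).compContinuousLinearMap (fderiv ℝ φ y)
  have hP : ∀ φ : Eu (k + 1) → Eu m, ContDiff ℝ ∞ φ → ContDiff ℝ ∞ (P φ) := fun φ hφ =>
    contDiff_form fun v => contDiff_form_apply (hη.1.comp hφ)
      (w := fun i y => fderiv ℝ φ y (v i)) fun i =>
        (hφ.fderiv_right (m := ∞) (by simp)).clm_apply contDiff_const
  have hpb : ∀ φ : Eu (k + 1) → Eu m, ContDiff ℝ ∞ φ → ∀ y,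
      pullbackAt φ (extDeriv η) y = extDeriv (P φ) y fun i => stdVec i := fun φ hφ y => by
    rw [extDeriv_pullback (r := ∞) (hη.1.differentiable (by simp) _) hφ.contDiffAt
      (by simpa using (mod_cast le_top : ((2 : ℕ∞) : WithTop ℕ∞) ≤ ((⊤ : ℕ∞) : WithTop ℕ∞)))]
    rfl
  have hcont : ∀ φ : Eu (k + 1) → Eu m, ContDiff ℝ ∞ φ →
      IntegrableOn (fun y => pullbackAt φ (extDeriv η) y) C := fun φ hφ => by
    refine ContinuousOn.integrableOn_compact hC ?_
    have h1 : ContDiff ℝ ∞ fun y => ∑ i : Fin (k + 1), (-1 : ℝ) ^ (i : ℕ) *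
        fderiv ℝ (fun x => P φ x (i.removeNth fun i => stdVec i)) y (stdVec i) := by
      refine ContDiff.sum fun i _ => contDiff_const.mul ?_
      exact ((contDiff_form_apply (hP φ hφ) fun _ => contDiff_const).fderiv_right
        (m := ∞) (by simp)).clm_apply contDiff_const
    refine h1.continuous.continuousOn.congr fun y _ => ?_
    rw [hpb φ hφ, extDeriv_apply ((hP φ hφ).differentiable (by simp) y)]
    exact Finset.sum_congr rfl fun i _ => by rw [zsmul_eq_mul]; push_cast; rfl
  have hPfh : ∀ y ∉ C, P f y - P h y = 0 := fun y hy => by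
    have h1 : f =ᶠ[𝓝 y] h := by
      filter_upwards [hC.isClosed.isOpen_compl.mem_nhds hy] with z hz using hfh z hz
    simp only [P, h1.fderiv_eq, h1.eq_of_nhds, sub_self]
  have hsub : ∀ y, extDeriv (fun y => P f y - P h y) y =
      extDeriv (P f) y - extDeriv (P h) y := fun y => by
    have h1 := (hP f hf).differentiable (by simp) y
    have h2 := (hP h hh).differentiable (by simp) y
    have h3 : (fun y => P f y - P h y) = P f + (-1 : ℝ) • P h := by
      ext1 y; rw [Pi.add_apply, Pi.smul_apply, neg_one_smul ℝ (P h y), sub_eq_add_neg]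
    rw [h3, extDeriv_add h1 (h2.const_smul (-1 : ℝ)), extDeriv_smul]
    rw [neg_one_smul ℝ (extDeriv (P h) y), sub_eq_add_neg]
  have h1 : ∀ y ∉ C, extDeriv (fun y => P f y - P h y) y (fun i => stdVec i) = 0 := fun y hy => by
    have h2 : (fun y => P f y - P h y) =ᶠ[𝓝 y] fun _ => 0 := by
      filter_upwards [hC.isClosed.isOpen_compl.mem_nhds hy] with z hz using hPfh z hz
    rw [h2.extDeriv_eq, extDeriv_apply (differentiableAt_const _)]
    simp
  change (∫ y in C, pullbackAt f (extDeriv η) y) - ∫ y in C, pullbackAt h (extDeriv η) y = 0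
  rw [← integral_sub (hcont f hf) (hcont h hh)]
  have h3 : ∀ y, pullbackAt f (extDeriv η) y - pullbackAt h (extDeriv η) y =
      extDeriv (fun y => P f y - P h y) y fun i => stdVec i := fun y => by
    rw [hpb f hf, hpb h hh, hsub]; rfl
  simp only [h3]
  rw [setIntegral_eq_integral_of_forall_compl_eq_zero h1]
  exact integral_extDeriv_eq_zero (((hP f hf).sub (hP h hh)).of_le (by simp))
    (HasCompactSupport.intro hC hPfh)

/-- Forms of comass at most one are bounded by the area element. -/
theorem enorm_pullbackAt_le {m n : ℕ} {D W : Set (Eu m)} (g : RiemMetric D) {α : DForm m n}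
    (hα : α ∈ testForms n W)
    (hα1 : ∀ x ∈ W, ∀ v : Fin n → Eu m,
      (∀ i j, g.inner x (v i) (v j) = if i = j then 1 else 0) → |α x v| ≤ 1)
    (φ : Eu n → Eu m) (y : Eu n) (hWD : W ⊆ D) :
    ‖pullbackAt φ α y‖ₑ ≤ (φ ⁻¹' W).indicator
      (fun y => ENNReal.ofReal (areaElt (fun y => g.inner (φ y)) φ y)) y := by
  by_cases hy : φ y ∈ W
  · rw [indicator_of_mem (mem_preimage.2 hy), ← ofReal_norm, Real.norm_eq_abs]
    exact ENNReal.ofReal_le_ofReal (abs_alternating_le_sqrt_det_gramOf (g.isInnerForm (hWD hy))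
      (α (φ y)) (fun u hu => hα1 _ hy u hu) _)
  · have h1 : α (φ y) = 0 := image_eq_zero_of_notMem_tsupport fun h => hy (hα.2.2 h)
    rw [pullbackAt, h1]
    simp

theorem contDiffOn_det {F : Type*} [NormedAddCommGroup F] [NormedSpace ℝ F] {n : ℕ}
    {k : WithTop ℕ∞} {M : F → Fin n → Fin n → ℝ} {s : Set F}
    (hM : ∀ i j, ContDiffOn ℝ k (fun x => M x i j) s) :
    ContDiffOn ℝ k (fun x => (Matrix.of fun i j => M x i j).det) s := by
  simp only [Matrix.det_apply']
  exact ContDiffOn.sum fun σ _ => contDiffOn_const.mul (contDiffOn_prod fun i _ => hM _ _)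

/-- The determinant as an alternating form on `ℝⁿ`. -/
def detForm (n : ℕ) : Eu n [⋀^Fin n]→L[ℝ] ℝ :=
  { (EuclideanSpace.basisFun (Fin n) ℝ).toBasis.det with
    cont := by
      change Continuous fun w : Fin n → Eu n => (EuclideanSpace.basisFun (Fin n) ℝ).toBasis.det w
      simp only [Module.Basis.det_apply]
      refine Continuous.matrix_det (continuous_pi fun i => continuous_pi fun j => ?_)
      exact (EuclideanSpace.proj (𝕜 := ℝ) i).continuous.comp (continuous_apply j) }

theorem detForm_apply {n : ℕ} (w : Fin n → Eu n) :
    detForm n w = (Matrix.of fun i j => w j i).det := by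
  change (EuclideanSpace.basisFun (Fin n) ℝ).toBasis.det w = _
  rw [Module.Basis.det_apply]
  rfl

namespace SurfChart

variable {n : ℕ} {S : Set (Eu (n + 1))} (c : SurfChart S)

theorem isCompact_preimage {K : Set (Eu (n + 1))} (hK : IsCompact K) (hKΩ : K ⊆ c.Ω) :
    IsCompact (c.U ∩ c.ψ ⁻¹' K) := by
  have h1 : ContinuousOn (fun x => c.ψ (c.χ x) - x) c.Ω :=
    (c.smooth_ψ.continuousOn.comp c.smooth_χ.continuousOn c.mapsTo_χ).sub continuousOn_id
  have h2 : IsCompact (K ∩ (fun x => c.ψ (c.χ x) - x) ⁻¹' {0}) :=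
    hK.of_isClosed_subset ((h1.mono hKΩ).preimage_isClosed_of_isClosed hK.isClosed
      isClosed_singleton) inter_subset_left
  have heq : c.U ∩ c.ψ ⁻¹' K = c.χ '' (K ∩ (fun x => c.ψ (c.χ x) - x) ⁻¹' {0}) := by
    apply Subset.antisymm
    · rintro y ⟨hy, hyK⟩
      exact ⟨c.ψ y, ⟨hyK, by simp [c.left_inv y hy]⟩, c.left_inv y hy⟩
    · rintro _ ⟨x, ⟨hxK, hx⟩, rfl⟩
      have hx' : c.ψ (c.χ x) = x := sub_eq_zero.1 hx
      exact ⟨c.mapsTo_χ (hKΩ hxK), by rw [mem_preimage, hx']; exact hxK⟩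
  rw [heq]
  exact h2.image_of_continuousOn (c.smooth_χ.continuousOn.mono (inter_subset_left.trans hKΩ))

/-- The chart is compatible, up to the constant sign `s`, with the unit normal `ν`. -/
def IsOriented (ν : Eu (n + 1) → Eu (n + 1)) (s : ℝ) : Prop :=
  (s = 1 ∨ s = -1) ∧ ∀ y ∈ c.U, (frameMat (ν (c.ψ y)) (partials c.ψ y)).det = s * jacobian c.ψ y

theorem normal_orthogonal {ν : Eu (n + 1) → Eu (n + 1)} (hν : IsUnitNormal S ν) {y : Eu n}
    (hy : y ∈ c.U) (i : Fin n) : inner ℝ (ν (c.ψ y)) (partials c.ψ y i) = 0 := by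
  refine (hν.2 _ (c.mapsTo_ψ hy).1).2 _ ?_
  rw [c.tangentSpaceAt_eq hy]
  exact Submodule.subset_span (mem_range_self i)

/-- Around each of its points, a chart can be shrunk so as to be oriented. -/
theorem exists_isOriented {ν : Eu (n + 1) → Eu (n + 1)} (hν : IsUnitNormal S ν) {p : Eu (n + 1)}
    (hp : p ∈ S) (hpΩ : p ∈ c.Ω) :
    ∃ (c' : SurfChart S) (s : ℝ), p ∈ c'.Ω ∧ c'.Ω ⊆ c.Ω ∧ c'.IsOriented ν s := by
  let d : Eu n → ℝ := fun y => (frameMat (ν (c.ψ y)) (partials c.ψ y)).det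
  have hd : ContinuousOn d c.U := by
    refine (Continuous.matrix_det continuous_id).comp_continuousOn ?_
    refine continuousOn_pi.2 fun i => continuousOn_pi.2 fun j => ?_
    have h1 : ContinuousOn (fun y => (Fin.cons (ν (c.ψ y)) (partials c.ψ y) :
        Fin (n + 1) → Eu (n + 1)) i) c.U := by
      refine Fin.cases ?_ (fun k => ?_) i
      · exact hν.1.comp c.smooth_ψ.continuousOn fun y hy => (c.mapsTo_ψ hy).1
      · exact continuousOn_partials c.isOpen_U (c.smooth_ψ.of_le (by simp)) k
    exact (EuclideanSpace.proj (𝕜 := ℝ) j).continuous.comp_continuousOn h1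
  have hsq : ∀ y ∈ c.U, d y ^ 2 = jacobian c.ψ y ^ 2 := fun y hy => by
    rw [det_frameMat_sq (hν.2 _ (c.mapsTo_ψ hy).1).1 (c.normal_orthogonal hν hy), jacobian_eq,
      Real.sq_sqrt (det_gramOf_nonneg isInnerForm_innerSL _)]
    rfl
  have hy0 := c.mapsTo_χ hpΩ
  have hd0 : d (c.χ p) ≠ 0 := fun h => by
    have := hsq _ hy0
    rw [h] at this
    have h2 := c.jacobian_pos hy0
    nlinarith
  obtain ⟨s, hs, hs0⟩ : ∃ s : ℝ, (s = 1 ∨ s = -1) ∧ 0 < s * d (c.χ p) := by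
    rcases lt_or_gt_of_ne hd0 with h | h
    · exact ⟨-1, Or.inr rfl, by linarith⟩
    · exact ⟨1, Or.inl rfl, by linarith⟩
  have hV : IsOpen (c.U ∩ (fun y => s * d y) ⁻¹' Ioi 0) :=
    (continuousOn_const.mul hd).isOpen_inter_preimage c.isOpen_U isOpen_Ioi
  have hO : IsOpen (c.Ω ∩ c.χ ⁻¹' (c.U ∩ (fun y => s * d y) ⁻¹' Ioi 0)) :=
    c.smooth_χ.continuousOn.isOpen_inter_preimage c.isOpen_Ω hV
  refine ⟨c.restr hO, s, c.mem_restr hO hp hpΩ ⟨hpΩ, hy0, hs0⟩,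
    (c.restr_Ω_subset hO).trans inter_subset_left, hs, fun y hy => ?_⟩
  have hyU : y ∈ c.U := hy.1
  have h1 : 0 < s * d y := by
    have h2 := hy.2.2.2
    rwa [c.left_inv y hyU] at h2
  have h2 := hsq y hyU
  have h3 := c.jacobian_pos hyU
  have h4 : s * d y = jacobian c.ψ y := by
    have h5 : (s * d y) ^ 2 = jacobian c.ψ y ^ 2 := by
      rw [mul_pow, h2]; rcases hs with rfl | rfl <;> ring
    exact (sq_eq_sq₀ h1.le h3.le).1 h5
  change d y = s * jacobian c.ψ y
  rw [← h4]
  rcases hs with rfl | rfl <;> ring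

/-- In an oriented chart, the current `[[S]]` is integration of the pull-back. -/
theorem integrationCurrent_eq {ν : Eu (n + 1) → Eu (n + 1)} (hν : IsUnitNormal S ν) {s : ℝ}
    (hs : c.IsOriented ν s) (hS : MeasurableSet S) {α : DForm (n + 1) n}
    (hα : α ∈ testForms n c.Ω) :
    integrationCurrent S ν α = s * ∫ y in c.U, pullbackAt c.ψ α y := by
  have h0 : ∀ x ∉ c.Ω, normalPairing (ν x) (α x) = 0 := fun x hx => by
    rw [image_eq_zero_of_notMem_tsupport fun h => hx (hα.2.2 h)]
    simp [normalPairing]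
  have hc : ContinuousOn ((fun x => normalPairing (ν x) (α x)) ∘ c.ψ) c.U := by
    refine ContinuousOn.comp (t := S) ?_ c.smooth_ψ.continuousOn fun y hy => (c.mapsTo_ψ hy).1
    refine continuousOn_finsetSum _ fun i _ => ContinuousOn.mul (continuousOn_const.mul ?_) ?_
    · exact (EuclideanSpace.proj (𝕜 := ℝ) i).continuous.comp_continuousOn hν.1
    · exact continuousOn_form_apply hα.1.continuous.continuousOn fun _ => continuousOn_const
  have h1 := c.integral_hausdorff h0 hc hS
  change ∫ x in S, normalPairing (ν x) (α x) ∂μHE[n] = _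
  rw [h1, ← integral_const_mul]
  refine setIntegral_congr_fun c.isOpen_U.measurableSet fun y hy => ?_
  have h2 := form_eq_det_mul_normalPairing (hν.2 _ (c.mapsTo_ψ hy).1).1 (α (c.ψ y))
    (c.normal_orthogonal hν hy)
  rw [hs.2 y hy] at h2
  change _ = s * α (c.ψ y) (partials c.ψ y)
  rw [h2]
  rcases hs.1 with rfl | rfl <;> ring

/-- The calibration of `S ∩ Ω`: at `x` it maps the vectors `v j` to
`det (g (e i, v j)) / √det (g (e i, e j))`, where `e` is the coordinate frame of the chart, extended
to `Ω` so as to be constant along the fibres of the retraction. It is multiplied by a cutoff function `b` and a sign `s`. -/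
def calibration {D : Set (Eu (n + 1))} (g : RiemMetric D) (b : Eu (n + 1) → ℝ) (s : ℝ) :
    DForm (n + 1) n := fun x =>
  (b x * (s * (√(gramOf (g.inner x) (partials c.ψ (c.χ x))).det)⁻¹)) •
    (detForm n).compContinuousLinearMap
      (∑ i, (g.inner x (partials c.ψ (c.χ x) i)).smulRight (stdVec i))

theorem calibration_apply {D : Set (Eu (n + 1))} (g : RiemMetric D) (b : Eu (n + 1) → ℝ) (s : ℝ)
    (x : Eu (n + 1)) (v : Fin n → Eu (n + 1)) :
    c.calibration g b s x v = b x * ((s * (√(gramOf (g.inner x) (partials c.ψ (c.χ x))).det)⁻¹) *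
      (Matrix.of fun i j => g.inner x (partials c.ψ (c.χ x) i) (v j)).det) := by
  have h : detForm n (fun j => (∑ i, (g.inner x (partials c.ψ (c.χ x) i)).smulRight
      (stdVec i : Eu n)) (v j)) =
      (Matrix.of fun i j => g.inner x (partials c.ψ (c.χ x) i) (v j)).det := by
    rw [detForm_apply]
    congr 1
    ext i j
    simp only [Matrix.of_apply, _root_.sum_apply, ContinuousLinearMap.smulRight_apply,
      WithLp.ofLp_sum, WithLp.ofLp_smul, Finset.sum_apply, Pi.smul_apply, stdVec,
      PiLp.single_apply, smul_eq_mul, mul_ite, mul_one, mul_zero, Finset.sum_ite_eq,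
      Finset.mem_univ, if_true]
  change (b x * (s * (√(gramOf (g.inner x) (partials c.ψ (c.χ x))).det)⁻¹)) * detForm n _ = _
  rw [← h]
  exact mul_assoc _ _ _

theorem det_gramOf_partials_pos {D : Set (Eu (n + 1))} (g : RiemMetric D) (hΩ : c.Ω ⊆ D)
    {x : Eu (n + 1)} (hx : x ∈ c.Ω) :
    0 < (gramOf (g.inner x) (partials c.ψ (c.χ x))).det :=
  ((g.isInnerForm (hΩ hx)).posDef_gramOf (c.linearIndependent_partials (c.mapsTo_χ hx))).det_pos

theorem contDiffOn_partials_χ (i : Fin n) :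
    ContDiffOn ℝ ∞ (fun x => partials c.ψ (c.χ x) i) c.Ω := by
  have h : ContDiffOn ℝ ∞ (fun y => partials c.ψ y i) c.U :=
    (c.smooth_ψ.fderiv_of_isOpen c.isOpen_U (m := ∞) (by simp)).clm_apply contDiffOn_const
  exact h.comp c.smooth_χ c.mapsTo_χ

theorem calibration_mem_testForms {D W : Set (Eu (n + 1))} (g : RiemMetric D) (hΩ : c.Ω ⊆ D)
    {b : Eu (n + 1) → ℝ} (hb : ContDiff ℝ ∞ b) (hbc : HasCompactSupport b) (hbW : tsupport b ⊆ W)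
    (hW : W ⊆ c.Ω) (s : ℝ) : c.calibration g b s ∈ testForms n W := by
  have hsub : Function.support (c.calibration g b s) ⊆ Function.support b := fun x hx hbx => hx (by
    rw [calibration, hbx, zero_mul, zero_smul])
  have hg : ContDiffOn ℝ ∞ g.inner c.Ω := g.smooth.mono hΩ
  refine ⟨contDiff_form fun v => ?_, hbc.mono hsub,
    (closure_mono hsub).trans hbW⟩
  simp only [c.calibration_apply]
  refine contDiff_smul_of_tsupport_subset c.isOpen_Ω hb (hbW.trans hW) ?_
  refine (contDiffOn_const.mul (ContDiffOn.inv (ContDiffOn.sqrt ?_ ?_) ?_)).mul ?_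
  · exact contDiffOn_det fun i j =>
      (hg.clm_apply (c.contDiffOn_partials_χ i)).clm_apply (c.contDiffOn_partials_χ j)
  · exact fun x hx => (c.det_gramOf_partials_pos g hΩ hx).ne'
  · exact fun x hx => (Real.sqrt_pos.2 (c.det_gramOf_partials_pos g hΩ hx)).ne'
  · exact contDiffOn_det fun i j =>
      (hg.clm_apply (c.contDiffOn_partials_χ i)).clm_apply contDiffOn_const

/-- The comass of the calibration is at most one; the metric is evaluated at `x` in numerator and
denominator, so that this is the Cauchy–Schwarz inequality for Gram determinants. -/
theorem abs_calibration_le_one {D : Set (Eu (n + 1))} (g : RiemMetric D) (hΩ : c.Ω ⊆ D)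
    {b : Eu (n + 1) → ℝ} (hb : ∀ x, 0 ≤ b x ∧ b x ≤ 1) {s : ℝ} (hs : s = 1 ∨ s = -1)
    {x : Eu (n + 1)} (hx : x ∈ c.Ω) {v : Fin n → Eu (n + 1)}
    (hv : ∀ i j, g.inner x (v i) (v j) = if i = j then 1 else 0) :
    |c.calibration g b s x v| ≤ 1 := by
  have hpos := Real.sqrt_pos.2 (c.det_gramOf_partials_pos g hΩ hx)
  have hv' : gramOf (g.inner x) v = 1 := by
    ext i j
    rw [Matrix.one_apply]
    exact hv i j
  have h1 := (g.isInnerForm (hΩ hx)).abs_det_pairing_le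
    (c.linearIndependent_partials (c.mapsTo_χ hx)) hv'
  have hs1 : |s| = 1 := by rcases hs with rfl | rfl <;> simp
  rw [calibration_apply, abs_mul, abs_mul, abs_mul, hs1, one_mul, abs_inv, abs_of_pos hpos,
    abs_of_nonneg (hb x).1]
  refine mul_le_one₀ (hb x).2 (by positivity) ?_
  rw [inv_mul_le_iff₀ hpos, mul_one]
  exact h1

/-- On `S` the calibration is the area form. -/
theorem pullbackAt_calibration {D : Set (Eu (n + 1))} (g : RiemMetric D)
    (b : Eu (n + 1) → ℝ) (s : ℝ) {y : Eu n} (hy : y ∈ c.U) :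
    pullbackAt c.ψ (c.calibration g b s) y =
      s * (b (c.ψ y) * areaElt (fun y => g.inner (c.ψ y)) c.ψ y) := by
  change c.calibration g b s (c.ψ y) (partials c.ψ y) = _
  rw [calibration_apply, c.left_inv y hy, areaElt, gramOf]
  set d := (Matrix.of fun i j => g.inner (c.ψ y) (partials c.ψ y i) (partials c.ψ y j)).det
  have h : (√d)⁻¹ * d = √d := by
    rcases le_or_gt d 0 with h | h
    · rw [Real.sqrt_eq_zero_of_nonpos h]; simp
    · rw [inv_mul_eq_iff_eq_mul₀ (Real.sqrt_pos.2 h).ne', Real.mul_self_sqrt h.le]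
  rw [mul_assoc s, h]
  ring

/-- The mass of `[[S]]` is at least the area; this is the calibration inequality. -/
theorem lintegral_compact_le_mass {D W K : Set (Eu (n + 1))} (g : RiemMetric D) (hΩ : c.Ω ⊆ D)
    {ν : Eu (n + 1) → Eu (n + 1)} (hν : IsUnitNormal S ν) {s : ℝ} (hs : c.IsOriented ν s)
    (hS : MeasurableSet S) (hW : IsOpen W) (hWΩ : W ⊆ c.Ω) (hK : IsCompact K) (hKW : K ⊆ W) :
    ∫⁻ y in c.U ∩ c.ψ ⁻¹' K, ENNReal.ofReal (areaElt (fun y => g.inner (c.ψ y)) c.ψ y) ≤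
      mass g W (integrationCurrent S ν) := by
  obtain ⟨b, hb, hbc, hbW, hb01, N, -, hKN, hbN⟩ := exists_cutoff hK hW hKW
  have hα := c.calibration_mem_testForms g hΩ hb hbc hbW hWΩ s
  refine le_trans ?_ (le_iSup₂_of_le (c.calibration g b s) ⟨hα, fun x hx v hv =>
    c.abs_calibration_le_one g hΩ hb01 hs.1 (hWΩ hx) hv⟩ le_rfl)
  let J := areaElt (fun y => g.inner (c.ψ y)) c.ψ
  have hJ : ContinuousOn J c.U := c.continuousOn_areaElt g hΩ
  have hJ0 : ∀ y, 0 ≤ J y := areaElt_nonneg _ _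
  have h1 : integrationCurrent S ν (c.calibration g b s) = ∫ y in c.U, b (c.ψ y) * J y := by
    rw [c.integrationCurrent_eq hν hs hS ⟨hα.1, hα.2.1, hα.2.2.trans hWΩ⟩, ← integral_const_mul]
    refine setIntegral_congr_fun c.isOpen_U.measurableSet fun y hy => ?_
    change s * pullbackAt _ _ _ = _
    rw [c.pullbackAt_calibration g b s hy, ← mul_assoc]
    rcases hs.1 with rfl | rfl <;> simp [J]
  have hcont : ContinuousOn (fun y => b (c.ψ y) * J y) c.U :=
    (hb.continuous.comp_continuousOn c.smooth_ψ.continuousOn).mul hJ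
  have hint : IntegrableOn (fun y => b (c.ψ y) * J y) c.U := by
    have hC := c.isCompact_preimage hbc (hbW.trans hWΩ)
    refine ((hcont.mono inter_subset_left).integrableOn_compact hC).of_forall_sdiff_eq_zero
      c.isOpen_U.measurableSet fun y hy => ?_
    have : b (c.ψ y) = 0 := image_eq_zero_of_notMem_tsupport fun h => hy.2 ⟨hy.1, h⟩
    rw [this, zero_mul]
  rw [h1, ofReal_integral_eq_lintegral_ofReal hint
    (ae_of_all _ fun y => mul_nonneg (hb01 _).1 (hJ0 y))]
  refine le_trans (le_of_eq ?_) (lintegral_mono_set (inter_subset_left (t := c.ψ ⁻¹' K)))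
  refine setLIntegral_congr_fun (c.measurableSet_preimage hK.measurableSet) fun y hy => ?_
  rw [hbN _ (hKN hy.2), one_mul]

/-- The calibration inequality for an open set, exhausted by closed ones. -/
theorem lintegral_le_mass {D W : Set (Eu (n + 1))} (g : RiemMetric D) (hΩ : c.Ω ⊆ D)
    {ν : Eu (n + 1) → Eu (n + 1)} (hν : IsUnitNormal S ν) {s : ℝ} (hs : c.IsOriented ν s)
    (hS : MeasurableSet S) (hW : IsOpen W) (hWc : IsCompact (closure W)) (hWΩ : W ⊆ c.Ω) :
    ∫⁻ y in c.U ∩ c.ψ ⁻¹' W, ENNReal.ofReal (areaElt (fun y => g.inner (c.ψ y)) c.ψ y) ≤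
      mass g W (integrationCurrent S ν) := by
  obtain ⟨F, hF, hFW, hFU, hFm⟩ := hW.exists_iUnion_isClosed
  have h : c.U ∩ c.ψ ⁻¹' W = ⋃ j, c.U ∩ c.ψ ⁻¹' F j := by
    rw [← hFU, preimage_iUnion, inter_iUnion]
  rw [h, setLIntegral_iUnion_of_directed _ (Monotone.directed_le fun i j hij =>
    inter_subset_inter_right _ (preimage_mono (hFm hij)))]
  exact iSup_le fun j => c.lintegral_compact_le_mass g hΩ hν hs hS hW hWΩ
    (hWc.of_isClosed_subset (hF j) ((hFW j).trans subset_closure)) (hFW j)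

/-- A form of comass at most one with support in the chart, integrated over the hypersurface
that is modified in the compact set `C`. -/
theorem ofReal_integral_le {D W : Set (Eu (n + 1))} (g : RiemMetric D) (hWD : W ⊆ D)
    (hWm : MeasurableSet W) {α : DForm (n + 1) n} (hα : α ∈ testForms n W)
    (hα1 : ∀ x ∈ W, ∀ v : Fin n → Eu (n + 1),
      (∀ i j, g.inner x (v i) (v j) = if i = j then 1 else 0) → |α x v| ≤ 1)
    {C : Set (Eu n)} (hC : IsCompact C) (ζ : Eu n → Eu (n + 1)) {s : ℝ} (hs : s = 1 ∨ s = -1) :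
    ENNReal.ofReal (s * ((∫ y in c.U \ C, pullbackAt c.ψ α y) + ∫ y in C, pullbackAt ζ α y)) ≤
      (∫⁻ y in (c.U ∩ c.ψ ⁻¹' W) \ C, ENNReal.ofReal (areaElt (fun y => g.inner (c.ψ y)) c.ψ y)) +
        ∫⁻ y in C, ENNReal.ofReal (areaElt (fun y => g.inner (ζ y)) ζ y) := by
  have hs1 : ‖s‖ₑ = 1 := by rcases hs with rfl | rfl <;> simp
  refine (Real.ofReal_le_enorm _).trans ?_
  rw [enorm_mul, hs1, one_mul]
  refine (enorm_add_le _ _).trans (add_le_add ?_ ?_)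
  · have hW := c.measurableSet_preimage hWm
    refine (enorm_integral_le_lintegral_enorm _).trans ?_
    have h1 : (c.U ∩ c.ψ ⁻¹' W) \ C = (c.U ∩ c.ψ ⁻¹' W) ∩ (c.U \ C) := by
      ext y; simp only [mem_inter_iff, Set.mem_sdiff]; tauto
    rw [h1, ← Measure.restrict_restrict hW, ← lintegral_indicator hW]
    refine setLIntegral_mono' (c.isOpen_U.measurableSet.diff hC.measurableSet) fun y hy => ?_
    refine (enorm_pullbackAt_le g hα hα1 c.ψ y hWD).trans (le_of_eq ?_)
    by_cases hyW : y ∈ c.ψ ⁻¹' W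
    · rw [indicator_of_mem hyW, indicator_of_mem (show y ∈ c.U ∩ c.ψ ⁻¹' W from ⟨hy.1, hyW⟩)]
    · rw [indicator_of_notMem hyW, indicator_of_notMem fun h : y ∈ c.U ∩ c.ψ ⁻¹' W => hyW h.2]
  · refine (enorm_integral_le_lintegral_enorm _).trans (lintegral_mono fun y => ?_)
    exact (enorm_pullbackAt_le g hα hα1 ζ y hWD).trans (indicator_le_self _ _ y)

/-- Local minimality: a modification of the hypersurface in a compact part of a chart does not
decrease the area. -/
theorem area_le {D : Set (Eu (n + 1))} (hn : 1 ≤ n) (g : RiemMetric D) (hΩ : c.Ω ⊆ D)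
    {ν : Eu (n + 1) → Eu (n + 1)} (hν : IsUnitNormal S ν) (hS : MeasurableSet S)
    (hmin : ∀ W : Set (Eu (n + 1)), IsOpen W → IsCompact (closure W) → closure W ⊆ D →
      ∀ K ⊆ W, IsCompact K →
      ∀ T : Current (n + 1) n, IsIntegerRectifiable K T → IsCycle T →
        mass g W (integrationCurrent S ν) ≤ mass g W (integrationCurrent S ν + T))
    {s : ℝ} (hs : c.IsOriented ν s) {C : Set (Eu n)} (hC : IsCompact C) (hCU : C ⊆ c.U)
    {ζ : Eu n → Eu (n + 1)} (hζ : ContDiffOn ℝ ∞ ζ c.U) (hζψ : ∀ y ∈ c.U, y ∉ C → ζ y = c.ψ y)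
    (hζC : MapsTo ζ C c.Ω) :
    ∫⁻ y in C, ENNReal.ofReal (areaElt (fun y => g.inner (c.ψ y)) c.ψ y) ≤
      ∫⁻ y in C, ENNReal.ofReal (areaElt (fun y => g.inner (ζ y)) ζ y) := by
  -- rectifiable currents are images under globally Lipschitz maps, hence the cutoff
  obtain ⟨b, hb, hbc, hbU, -, N, hN, hCN, hbN⟩ := exists_cutoff hC c.isOpen_U hCU
  let f : Eu n → Eu (n + 1) := fun y => b y • ζ y
  let h : Eu n → Eu (n + 1) := fun y => b y • c.ψ y
  have hf : ContDiff ℝ ∞ f := contDiff_smul_of_tsupport_subset c.isOpen_U hb hbU hζ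
  have hh : ContDiff ℝ ∞ h := contDiff_smul_of_tsupport_subset c.isOpen_U hb hbU c.smooth_ψ
  have hfc : HasCompactSupport f := hbc.smul_right
  have hhc : HasCompactSupport h := hbc.smul_right
  have hfζ : ∀ y ∈ C, f =ᶠ[𝓝 y] ζ := fun y hy => by
    filter_upwards [hN.mem_nhds (hCN hy)] with z hz
    simp [f, hbN z hz]
  have hhψ : ∀ y ∈ C, h =ᶠ[𝓝 y] c.ψ := fun y hy => by
    filter_upwards [hN.mem_nhds (hCN hy)] with z hz
    simp [h, hbN z hz]
  have hfh : ∀ y ∉ C, f y = h y := fun y hy => by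
    by_cases hyU : y ∈ c.U
    · simp only [f, h, hζψ y hyU hy]
    · have : b y = 0 := image_eq_zero_of_notMem_tsupport fun h => hyU (hbU h)
      simp [f, h, this]
  -- the support of the competitor, and a relatively compact neighbourhood
  let K : Set (Eu (n + 1)) := c.ψ '' C ∪ ζ '' C
  have hK : IsCompact K := (hC.image_of_continuousOn (c.smooth_ψ.continuousOn.mono hCU)).union
    (hC.image_of_continuousOn (hζ.continuousOn.mono hCU))
  have hKΩ : K ⊆ c.Ω := union_subset (fun x ⟨y, hy, hxy⟩ => hxy ▸ (c.mapsTo_ψ (hCU hy)).2)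
    (image_subset_iff.2 hζC)
  obtain ⟨K', hK', hKK', hK'Ω⟩ := exists_compact_between hK c.isOpen_Ω hKΩ
  let W := interior K'
  have hWK' : closure W ⊆ K' := closure_minimal interior_subset hK'.isClosed
  have hWc : IsCompact (closure W) := hK'.of_isClosed_subset isClosed_closure hWK'
  have hWΩ : W ⊆ c.Ω := interior_subset.trans hK'Ω
  have hfK : MapsTo f C K := fun y hy => by
    rw [(hfζ y hy).eq_of_nhds]; exact Or.inr (mem_image_of_mem _ hy)
  have hhK : MapsTo h C K := fun y hy => by
    rw [(hhψ y hy).eq_of_nhds]; exact Or.inl (mem_image_of_mem _ hy)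
  have hpf : ∀ α : DForm (n + 1) n, ∫ y in C, pullbackAt f α y = ∫ y in C, pullbackAt ζ α y :=
    fun α => setIntegral_congr_fun hC.measurableSet fun y hy => by
      simp only [pullbackAt, (hfζ y hy).fderiv_eq, (hfζ y hy).eq_of_nhds]
  have hph : ∀ α : DForm (n + 1) n, ∫ y in C, pullbackAt h α y = ∫ y in C, pullbackAt c.ψ α y :=
    fun α => setIntegral_congr_fun hC.measurableSet fun y hy => by
      simp only [pullbackAt, (hhψ y hy).fderiv_eq, (hhψ y hy).eq_of_nhds]
  -- the difference of the competitor and `[[S]]`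
  obtain ⟨T, hT, hTc, hTα⟩ : ∃ T : Current (n + 1) n, IsIntegerRectifiable K T ∧ IsCycle T ∧
      ∀ α, T α = s * ((∫ y in C, pullbackAt ζ α y) - ∫ y in C, pullbackAt c.ψ α y) := by
    obtain ⟨k, rfl⟩ : ∃ k, n = k + 1 := ⟨n - 1, by omega⟩
    rcases hs.1 with rfl | rfl
    · refine ⟨_, isIntegerRectifiable_sub hC hf hfc hh hhc hfK hhK, isCycle_sub hC hf hh hfh,
        fun α => ?_⟩
      rw [hpf, hph, one_mul]
    · refine ⟨_, isIntegerRectifiable_sub hC hh hhc hf hfc hhK hfK,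
        isCycle_sub hC hh hf fun y hy => (hfh y hy).symm, fun α => ?_⟩
      rw [hpf, hph]
      ring
  -- the mass of the competitor is at most its area
  have key : mass g W (integrationCurrent S ν + T) ≤
      (∫⁻ y in (c.U ∩ c.ψ ⁻¹' W) \ C, ENNReal.ofReal (areaElt (fun y => g.inner (c.ψ y)) c.ψ y)) +
        ∫⁻ y in C, ENNReal.ofReal (areaElt (fun y => g.inner (ζ y)) ζ y) := by
    refine iSup₂_le fun α hα => ?_
    have hαΩ : α ∈ testForms n c.Ω := ⟨hα.1.1, hα.1.2.1, hα.1.2.2.trans hWΩ⟩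
    have hint : IntegrableOn (pullbackAt c.ψ α) c.U := by
      have hC' := c.isCompact_preimage hαΩ.2.1 hαΩ.2.2
      refine (((continuousOn_pullbackAt c.isOpen_U c.smooth_ψ hα.1.1.continuous).mono
        inter_subset_left).integrableOn_compact hC').of_forall_sdiff_eq_zero
        c.isOpen_U.measurableSet fun y hy => ?_
      have : α (c.ψ y) = 0 := image_eq_zero_of_notMem_tsupport fun h => hy.2 ⟨hy.1, h⟩
      rw [pullbackAt, this]
      rfl
    have hsplit : (integrationCurrent S ν + T) α =
        s * ((∫ y in c.U \ C, pullbackAt c.ψ α y) + ∫ y in C, pullbackAt ζ α y) := by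
      rw [Pi.add_apply, c.integrationCurrent_eq hν hs hS hαΩ, hTα,
        setIntegral_sdiff hC.measurableSet hint hCU]
      ring
    rw [hsplit]
    exact c.ofReal_integral_le g (hWΩ.trans hΩ) isOpen_interior.measurableSet hα.1 hα.2 hC ζ hs.1
  -- the area outside `C` occurs on both sides and is finite, so it cancels
  have hlow := c.lintegral_le_mass g hΩ hν hs hS isOpen_interior hWc hWΩ
  have hCW : C ⊆ c.U ∩ c.ψ ⁻¹' W := fun y hy => ⟨hCU hy, hKK' (Or.inl (mem_image_of_mem _ hy))⟩
  have hfin : ∫⁻ y in (c.U ∩ c.ψ ⁻¹' W) \ C,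
      ENNReal.ofReal (areaElt (fun y => g.inner (c.ψ y)) c.ψ y) ≠ ⊤ := by
    have hC' := c.isCompact_preimage hK' hK'Ω
    have h1 := ((c.continuousOn_areaElt g hΩ).mono inter_subset_left).integrableOn_compact
      (μ := volume) hC'
    exact ((h1.mono_set (sdiff_subset.trans (inter_subset_inter_right _
      (preimage_mono interior_subset)))).lintegral_lt_top).ne
  have h2 := (hlow.trans (hmin W isOpen_interior hWc (hWK'.trans (hK'Ω.trans hΩ)) K hKK' hK T hT
    hTc)).trans key
  rw [← lintegral_inter_add_sdiff (μ := volume) _ (c.U ∩ c.ψ ⁻¹' W) hC.measurableSet,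
    inter_eq_right.2 hCW, add_comm] at h2
  exact (ENNReal.add_le_add_iff_left hfin).1 h2

end SurfChart

/-! ### The first variation of area -/

/-- Jacobi's formula. -/
theorem hasDerivAt_matrix_det {ι : Type*} [Fintype ι] [DecidableEq ι] {A : ℝ → ι → ι → ℝ}
    {A' : ι → ι → ℝ} {t : ℝ} (h : ∀ i j, HasDerivAt (fun t => A t i j) (A' i j) t) :
    HasDerivAt (fun t => (Matrix.of (A t)).det)
      ((Matrix.of (A t)).adjugate * Matrix.of A').trace t := by
  have h1 : HasDerivAt (fun t => (Matrix.of (A t)).det)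
      (∑ i, ((Matrix.of (A t)).updateCol i fun j => A' j i).det) t := by
    simp only [Matrix.det_apply']
    rw [Finset.sum_comm]
    refine HasDerivAt.fun_sum fun σ _ => ?_
    rw [← Finset.mul_sum]
    refine HasDerivAt.const_mul _ ?_
    have h2 := HasDerivAt.fun_finsetProd (u := Finset.univ)
      (f := fun i t => A t (σ i) i) (f' := fun i => A' (σ i) i) (x := t) fun i _ => h (σ i) i
    have h3 : ∀ i, ∏ x, (Matrix.of (A t)).updateCol i (fun j => A' j i) (σ x) x =
        (∏ j ∈ Finset.univ.erase i, A t (σ j) j) • A' (σ i) i := fun i => by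
      rw [← Finset.mul_prod_erase _ _ (Finset.mem_univ i), smul_eq_mul, mul_comm,
        Matrix.updateCol_self]
      congr 1
      refine Finset.prod_congr rfl fun j hj => ?_
      rw [Matrix.updateCol_ne (Finset.ne_of_mem_erase hj), Matrix.of_apply]
    simp only [h3]
    exact h2
  convert h1 using 1
  rw [Matrix.trace]
  refine Finset.sum_congr rfl fun i _ => ?_
  rw [← Matrix.cramer_apply, Matrix.cramer_eq_adjugate_mulVec]
  rfl

theorem hasDerivAt_sqrt_det_gram {V ι : Type*} [NormedAddCommGroup V] [NormedSpace ℝ V]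
    [Fintype ι] [DecidableEq ι] {B : V →L[ℝ] V →L[ℝ] ℝ} {C : V →L[ℝ] V →L[ℝ] ℝ} {e : ι → V}
    {A : ℝ → ι → ι → ℝ} {t : ℝ} (hA : Matrix.of (A t) = gramOf B e)
    (h : ∀ i j, HasDerivAt (fun t => A t i j) (C (e i) (e j)) t) (hpos : 0 < (gramOf B e).det) :
    HasDerivAt (fun t => √(Matrix.of (A t)).det)
      (√(gramOf B e).det * (1 / 2 * traceOn B C e)) t := by
  have h1 := (hasDerivAt_matrix_det (A' := fun i j => C (e i) (e j)) h).sqrt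
    (by rw [hA]; exact hpos.ne')
  convert h1 using 1
  rw [hA, traceOn, Matrix.inv_def, Ring.inverse_eq_inv', Matrix.smul_mul, Matrix.trace_smul,
    smul_eq_mul]
  have h2 := Real.sqrt_pos.2 hpos
  have h3 := Real.mul_self_sqrt hpos.le
  set T := ((gramOf B e).adjugate * gramOf C e).trace
  set d := (gramOf B e).det
  have h4 : ((gramOf B e).adjugate * Matrix.of fun i j => C (e i) (e j)).trace = T := rfl
  rw [h4]
  field_simp
  rw [pow_two, h3]

/-- Differentiation under the integral sign over a compact set. -/
theorem hasDerivAt_setIntegral_of_contDiffOn {n : ℕ} {C : Set (Eu n)} (hC : IsCompact C)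
    {V : Set (ℝ × Eu n)} (hV : IsOpen V) {f : ℝ × Eu n → ℝ} (hf : ContDiffOn ℝ 1 f V)
    (hCV : ∀ y ∈ C, ((0 : ℝ), y) ∈ V) :
    HasDerivAt (fun t => ∫ y in C, f (t, y)) (∫ y in C, fderiv ℝ f (0, y) (1, 0)) 0 := by
  obtain ⟨u, v, hu, -, h0u, hCv, huv⟩ := generalized_tube_lemma
    (isCompact_singleton (x := (0 : ℝ))) hC hV (by rintro ⟨t, y⟩ ⟨rfl, hy⟩; exact hCV y hy)
  obtain ⟨ε, hε, hεu⟩ := Metric.isOpen_iff.1 hu 0 (h0u rfl)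
  have hsub : Metric.closedBall (0 : ℝ) (ε / 2) ×ˢ C ⊆ V := fun p hp =>
    huv ⟨hεu (Metric.closedBall_subset_ball (by linarith) hp.1), hCv hp.2⟩
  have hf' : ContinuousOn (fun p => fderiv ℝ f p (1, 0)) V :=
    (hf.continuousOn_fderiv_of_isOpen hV le_rfl).clm_apply continuousOn_const
  obtain ⟨M, hM⟩ := ((isCompact_closedBall (0 : ℝ) (ε / 2)).prod hC).exists_bound_of_continuousOn
    (hf'.mono hsub)
  have hmem : ∀ t ∈ Metric.closedBall (0 : ℝ) (ε / 2), ∀ y ∈ C, (t, y) ∈ V := fun t ht y hy =>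
    hsub ⟨ht, hy⟩
  have hpair : ∀ t : ℝ, Continuous fun y : Eu n => (t, y) := fun t => by fun_prop
  have h0 : (0 : ℝ) ∈ Metric.closedBall (0 : ℝ) (ε / 2) := Metric.mem_closedBall_self (by linarith)
  refine (hasDerivAt_integral_of_dominated_loc_of_deriv_le (bound := fun _ => M)
    (F := fun t y => f (t, y)) (F' := fun t y => fderiv ℝ f (t, y) (1, 0))
    (Metric.closedBall_mem_nhds 0 (by linarith : (0 : ℝ) < ε / 2)) ?_ ?_ ?_ ?_ ?_ ?_).2
  · filter_upwards [Metric.closedBall_mem_nhds (0 : ℝ) (by linarith : (0 : ℝ) < ε / 2)] with t ht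
    exact (hf.continuousOn.comp (hpair t).continuousOn (hmem t ht)).aestronglyMeasurable
      hC.measurableSet
  · exact (hf.continuousOn.comp (hpair 0).continuousOn (hmem 0 h0)).integrableOn_compact hC
  · exact (hf'.comp (hpair 0).continuousOn (hmem 0 h0)).aestronglyMeasurable hC.measurableSet
  · refine (ae_restrict_mem hC.measurableSet).mono fun y hy t ht => hM (t, y) ⟨ht, hy⟩
  · exact integrableOn_const hC.measure_lt_top.ne
  · refine (ae_restrict_mem hC.measurableSet).mono fun y hy t ht => ?_
    have h1 := ((hf.contDiffAt (hV.mem_nhds (hmem t ht y hy))).differentiableAt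
      (by simp)).hasFDerivAt
    exact h1.comp_hasDerivAt t ((hasDerivAt_id t).prodMk (hasDerivAt_const t y))

/-- The Lie derivative of the metric `g` along the vector field `X`. -/
def lieForm {V : Type*} [NormedAddCommGroup V] [NormedSpace ℝ V] (g : V → V →L[ℝ] V →L[ℝ] ℝ)
    (X : V → V) (x : V) : V →L[ℝ] V →L[ℝ] ℝ :=
  fderiv ℝ g x (X x) + (g x).bilinearComp (fderiv ℝ X x) (ContinuousLinearMap.id ℝ V) +
    (g x).bilinearComp (ContinuousLinearMap.id ℝ V) (fderiv ℝ X x)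

theorem lieForm_apply {V : Type*} [NormedAddCommGroup V] [NormedSpace ℝ V]
    (g : V → V →L[ℝ] V →L[ℝ] ℝ) (X : V → V) (x v w : V) :
    lieForm g X x v w =
      fderiv ℝ g x (X x) v w + g x (fderiv ℝ X x v) w + g x v (fderiv ℝ X x w) := rfl

theorem lieForm_eq_zero {V : Type*} [NormedAddCommGroup V] [NormedSpace ℝ V]
    (g : V → V →L[ℝ] V →L[ℝ] ℝ) {X : V → V} {x : V} (hx : x ∉ tsupport X) :
    lieForm g X x = 0 := by
  have h1 : X x = 0 := image_eq_zero_of_notMem_tsupport hx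
  have h2 : fderiv ℝ X x = 0 := image_eq_zero_of_notMem_tsupport fun h =>
    hx (tsupport_fderiv_subset ℝ h)
  ext v w
  rw [lieForm_apply, h1, h2]
  simp

theorem lieForm_sum {V κ : Type*} [NormedAddCommGroup V] [NormedSpace ℝ V] [Fintype κ]
    (g : V → V →L[ℝ] V →L[ℝ] ℝ) {Z : κ → V → V} {X : V → V} (hX : ∀ x, X x = ∑ p, Z p x)
    (hZ : ∀ p, Differentiable ℝ (Z p)) (x : V) :
    lieForm g X x = ∑ p, lieForm g (Z p) x := by
  have hd : fderiv ℝ X x = ∑ p, fderiv ℝ (Z p) x := by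
    rw [show X = fun x => ∑ p, Z p x from funext hX]
    exact fderiv_fun_sum fun p _ => hZ p x
  ext v w
  simp only [_root_.sum_apply, lieForm_apply, hd, Finset.sum_add_distrib, hX x, map_sum]

theorem hasDerivAt_form_line {V : Type*} [NormedAddCommGroup V] [NormedSpace ℝ V]
    {g : V → V →L[ℝ] V →L[ℝ] ℝ} {x : V} (hg : DifferentiableAt ℝ g x) (u a a' b b' : V) :
    HasDerivAt (fun t : ℝ => g (x + t • u) (a + t • a') (b + t • b'))
      (fderiv ℝ g x u a b + g x a' b + g x a b') 0 := by
  have hlin : ∀ u v : V, HasDerivAt (fun t : ℝ => u + t • v) v 0 := fun u v => by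
    simpa using ((hasDerivAt_id (0 : ℝ)).smul_const v).const_add u
  have h3 : HasFDerivAt g (fderiv ℝ g x) (x + (0 : ℝ) • u) := by
    rw [zero_smul, add_zero]
    exact hg.hasFDerivAt
  have h5 : HasDerivAt (fun t : ℝ => g (x + t • u)) (fderiv ℝ g x u) 0 :=
    HasFDerivAt.comp_hasDerivAt (E := V →L[ℝ] V →L[ℝ] ℝ) (f := fun t : ℝ => x + t • u) (0 : ℝ) h3
      (hlin _ _)
  refine ((h5.clm_apply (hlin a a')).clm_apply (hlin b b')).congr_deriv ?_
  simp only [zero_smul, add_zero, _root_.add_apply]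

/-- The divergence along `S` of the vector field `X`. -/
def divS {m : ℕ} {D : Set (Eu m)} (g : RiemMetric D) (S : Set (Eu m)) (X : Eu m → Eu m)
    (x : Eu m) : ℝ :=
  1 / 2 * traceOn (g.inner x) (lieForm g.inner X x)
    fun i => (stdOrthonormalBasis ℝ (tangentSpaceAt S x) i : Eu m)

theorem divS_eq_zero {m : ℕ} {D : Set (Eu m)} (g : RiemMetric D) (S : Set (Eu m))
    {X : Eu m → Eu m} {x : Eu m} (hx : x ∉ tsupport X) : divS g S X x = 0 := by
  have h : ∀ (d : ℕ) (e : Fin d → Eu m), gramOf (0 : Eu m →L[ℝ] Eu m →L[ℝ] ℝ) e = 0 :=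
    fun d e => rfl
  rw [divS, lieForm_eq_zero g.inner hx, traceOn, h]
  simp

theorem divS_sum {m : ℕ} {κ : Type*} [Fintype κ] {D : Set (Eu m)} (g : RiemMetric D)
    (S : Set (Eu m)) {Z : κ → Eu m → Eu m} {X : Eu m → Eu m} (hX : ∀ x, X x = ∑ p, Z p x)
    (hZ : ∀ p, Differentiable ℝ (Z p)) : divS g S X = fun x => ∑ p, divS g S (Z p) x := by
  ext1 x
  rw [divS, lieForm_sum g.inner hX hZ, traceOn_sum, Finset.mul_sum]
  rfl

namespace SurfChart

variable {n : ℕ} {S : Set (Eu (n + 1))} (c : SurfChart S)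

theorem traceOn_tangentSpaceAt (B C : Eu (n + 1) →L[ℝ] Eu (n + 1) →L[ℝ] ℝ) {y : Eu n}
    (hy : y ∈ c.U) :
    traceOn B C (fun i => (stdOrthonormalBasis ℝ (tangentSpaceAt S (c.ψ y)) i : Eu (n + 1))) =
      traceOn B C (partials c.ψ y) := by
  obtain ⟨σ, A, hA, h⟩ := c.exists_combo_stdOrthonormalBasis hy
  rw [h, traceOn_combo _ _ hA, traceOn_comp_equiv]

theorem divS_ψ {D : Set (Eu (n + 1))} (g : RiemMetric D) (X : Eu (n + 1) → Eu (n + 1)) {y : Eu n}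
    (hy : y ∈ c.U) : divS g S X (c.ψ y) = 1 / 2 * traceOn (g.inner (c.ψ y))
      (lieForm g.inner X (c.ψ y)) (partials c.ψ y) := by
  rw [divS, c.traceOn_tangentSpaceAt _ _ hy]

theorem det_gramOf_ψ_pos {D : Set (Eu (n + 1))} (g : RiemMetric D) (hΩ : c.Ω ⊆ D) {y : Eu n}
    (hy : y ∈ c.U) : 0 < (gramOf (g.inner (c.ψ y)) (partials c.ψ y)).det :=
  ((g.isInnerForm (hΩ (c.mapsTo_ψ hy).2)).posDef_gramOf (c.linearIndependent_partials hy)).det_pos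

theorem continuousOn_traceOn {B C : Eu (n + 1) → Eu (n + 1) →L[ℝ] Eu (n + 1) →L[ℝ] ℝ}
    (hB : ContinuousOn B c.Ω) (hC : ContinuousOn C c.Ω) (hpos : ∀ x ∈ c.Ω, IsInnerForm (B x)) :
    ContinuousOn (fun y => traceOn (B (c.ψ y)) (C (c.ψ y)) (partials c.ψ y)) c.U := by
  have hΩ : MapsTo c.ψ c.U c.Ω := fun y hy => (c.mapsTo_ψ hy).2
  have hgram : ∀ B : Eu (n + 1) → Eu (n + 1) →L[ℝ] Eu (n + 1) →L[ℝ] ℝ, ContinuousOn B c.Ω →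
      ContinuousOn (fun y => gramOf (B (c.ψ y)) (partials c.ψ y)) c.U := fun B hB =>
    continuousOn_pi.2 fun i => continuousOn_pi.2 fun j =>
      ((hB.comp c.smooth_ψ.continuousOn hΩ).clm_apply
        (continuousOn_partials c.isOpen_U (c.smooth_ψ.of_le (by simp)) i)).clm_apply
        (continuousOn_partials c.isOpen_U (c.smooth_ψ.of_le (by simp)) j)
  have hdet : Continuous fun M : Matrix (Fin n) (Fin n) ℝ => M.det := continuous_id.matrix_det
  have hadj : Continuous fun p : Matrix (Fin n) (Fin n) ℝ × Matrix (Fin n) (Fin n) ℝ =>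
      (p.1.adjugate * p.2).trace :=
    Continuous.matrix_trace (continuous_fst.matrix_adjugate.matrix_mul continuous_snd)
  have h1 : ContinuousOn (fun y => ((gramOf (B (c.ψ y)) (partials c.ψ y)).det)⁻¹) c.U :=
    ContinuousOn.inv₀ (hdet.comp_continuousOn (hgram B hB)) fun y hy =>
      ((hpos _ (hΩ hy)).posDef_gramOf (c.linearIndependent_partials hy)).det_pos.ne'
  have h2 := hadj.comp_continuousOn ((hgram B hB).prodMk (hgram C hC))
  refine (h1.mul h2).congr fun y _ => ?_
  rw [traceOn, Matrix.inv_def, Ring.inverse_eq_inv', Matrix.smul_mul, Matrix.trace_smul,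
    smul_eq_mul]
  rfl

theorem continuousOn_divS {D : Set (Eu (n + 1))} (hD : IsOpen D) (g : RiemMetric D) (hΩ : c.Ω ⊆ D)
    {X : Eu (n + 1) → Eu (n + 1)} (hX : ContDiff ℝ ∞ X) :
    ContinuousOn (divS g S X ∘ c.ψ) c.U := by
  have hg := g.smooth.continuousOn.mono hΩ
  have hg' := (g.smooth.continuousOn_fderiv_of_isOpen hD (by simp)).mono hΩ
  have hX' : Continuous (fderiv ℝ X) := hX.continuous_fderiv (by simp)
  have hlie : ContinuousOn (lieForm g.inner X) c.Ω := by
    refine continuousOn_clm_apply.2 fun v => continuousOn_clm_apply.2 fun w => ?_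
    simp only [lieForm_apply]
    have hc : ∀ u : Eu (n + 1), ContinuousOn (fun _ : Eu (n + 1) => u) c.Ω :=
      fun u => continuousOn_const
    have hX'' : ∀ u, ContinuousOn (fun x => fderiv ℝ X x u) c.Ω := fun u =>
      (hX'.clm_apply continuous_const).continuousOn
    exact ((((hg'.clm_apply hX.continuous.continuousOn).clm_apply (hc v)).clm_apply (hc w)).add
      ((hg.clm_apply (hX'' v)).clm_apply (hc w))).add ((hg.clm_apply (hc v)).clm_apply (hX'' w))
  have h := c.continuousOn_traceOn hg hlie fun x hx => g.isInnerForm (hΩ hx)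
  exact (continuousOn_const.mul h).congr fun y hy => c.divS_ψ g X hy

/-- The chart `ψ`, moved by the time `t` along straight lines with velocity `X`. -/
def flow (X : Eu (n + 1) → Eu (n + 1)) (t : ℝ) (y : Eu n) : Eu (n + 1) := c.ψ y + t • X (c.ψ y)

/-- The first order Taylor polynomial in `t` of the coordinate vectors of `flow`; it is exact. -/
def flowPartials (X : Eu (n + 1) → Eu (n + 1)) (t : ℝ) (y : Eu n) (i : Fin n) : Eu (n + 1) :=
  partials c.ψ y i + t • fderiv ℝ X (c.ψ y) (partials c.ψ y i)

/-- The area element of the moved hypersurface. -/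
def flowArea {D : Set (Eu (n + 1))} (g : RiemMetric D) (X : Eu (n + 1) → Eu (n + 1))
    (p : ℝ × Eu n) : ℝ :=
  √(gramOf (g.inner (c.flow X p.1 p.2)) (c.flowPartials X p.1 p.2)).det

theorem contDiffOn_flow {X : Eu (n + 1) → Eu (n + 1)} (hX : ContDiff ℝ ∞ X) :
    ContDiffOn ℝ ∞ (fun p : ℝ × Eu n => c.flow X p.1 p.2) (univ ×ˢ c.U) := by
  have hψ2 : ContDiffOn ℝ ∞ (fun p : ℝ × Eu n => c.ψ p.2) (univ ×ˢ c.U) :=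
    c.smooth_ψ.comp contDiffOn_snd fun p hp => hp.2
  exact hψ2.add (contDiffOn_fst.smul (hX.comp_contDiffOn hψ2))

theorem contDiffOn_flowPartials {X : Eu (n + 1) → Eu (n + 1)} (hX : ContDiff ℝ ∞ X) (i : Fin n) :
    ContDiffOn ℝ ∞ (fun p : ℝ × Eu n => c.flowPartials X p.1 p.2 i) (univ ×ˢ c.U) := by
  have he : ContDiffOn ℝ ∞ (fun y => partials c.ψ y i) c.U :=
    (c.smooth_ψ.fderiv_of_isOpen c.isOpen_U (m := ∞) (by simp)).clm_apply contDiffOn_const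
  have hw : ContDiffOn ℝ ∞ (fun y => fderiv ℝ X (c.ψ y) (partials c.ψ y i)) c.U :=
    ((hX.fderiv_right (m := ∞) (by simp)).comp_contDiffOn c.smooth_ψ).clm_apply he
  exact (he.comp contDiffOn_snd fun p hp => hp.2).add
    (contDiffOn_fst.smul (hw.comp contDiffOn_snd fun p hp => hp.2))

theorem flow_zero (X : Eu (n + 1) → Eu (n + 1)) : c.flow X 0 = c.ψ := by
  ext1 y; simp [flow]

theorem flowPartials_zero (X : Eu (n + 1) → Eu (n + 1)) (y : Eu n) :
    c.flowPartials X 0 y = partials c.ψ y := by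
  ext1 y; simp [flowPartials]

/-- The area element of the moved hypersurface is smooth in time and space as long as the
hypersurface stays in the chart and its coordinate vectors stay independent. -/
theorem exists_contDiffOn_flowArea {D : Set (Eu (n + 1))} (g : RiemMetric D) (hΩ : c.Ω ⊆ D)
    {X : Eu (n + 1) → Eu (n + 1)} (hX : ContDiff ℝ ∞ X) :
    ∃ V : Set (ℝ × Eu n), IsOpen V ∧ (∀ y ∈ c.U, ((0 : ℝ), y) ∈ V) ∧
      (∀ p ∈ V, c.flow X p.1 p.2 ∈ c.Ω) ∧ ContDiffOn ℝ 1 (c.flowArea g X) V := by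
  have hη := c.contDiffOn_flow hX
  let V1 := (univ ×ˢ c.U) ∩ (fun p : ℝ × Eu n => c.flow X p.1 p.2) ⁻¹' c.Ω
  have hV1 : IsOpen V1 :=
    hη.continuousOn.isOpen_inter_preimage (isOpen_univ.prod c.isOpen_U) c.isOpen_Ω
  have hgη : ContDiffOn ℝ ∞ (fun p : ℝ × Eu n => g.inner (c.flow X p.1 p.2)) V1 :=
    (g.smooth.mono hΩ).comp (hη.mono inter_subset_left) fun p hp => hp.2
  have hdet : ContDiffOn ℝ ∞ (fun p : ℝ × Eu n =>
      (gramOf (g.inner (c.flow X p.1 p.2)) (c.flowPartials X p.1 p.2)).det) V1 :=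
    contDiffOn_det fun i j =>
      (hgη.clm_apply ((c.contDiffOn_flowPartials hX i).mono inter_subset_left)).clm_apply
        ((c.contDiffOn_flowPartials hX j).mono inter_subset_left)
  refine ⟨V1 ∩ (fun p : ℝ × Eu n => (gramOf (g.inner (c.flow X p.1 p.2))
      (c.flowPartials X p.1 p.2)).det) ⁻¹' Ioi 0,
    hdet.continuousOn.isOpen_inter_preimage hV1 isOpen_Ioi, fun y hy => ⟨⟨⟨mem_univ _, hy⟩, ?_⟩, ?_⟩,
    fun p hp => hp.1.2,
    ((hdet.mono inter_subset_left).sqrt fun p hp => (ne_of_gt hp.2)).of_le (by simp)⟩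
  · rw [mem_preimage, flow_zero]
    exact (c.mapsTo_ψ hy).2
  · rw [mem_preimage, flow_zero, flowPartials_zero]
    exact c.det_gramOf_ψ_pos g hΩ hy

/-- The moved chart `ψ + t X ∘ ψ` is affine in `t`, so that its coordinate vectors are
`flowPartials`. -/
theorem areaElt_flow {D : Set (Eu (n + 1))} (g : RiemMetric D) {X : Eu (n + 1) → Eu (n + 1)}
    (hX : ContDiff ℝ ∞ X) (t : ℝ) {y : Eu n} (hy : y ∈ c.U) :
    areaElt (fun y => g.inner (c.flow X t y)) (c.flow X t) y = c.flowArea g X (t, y) := by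
  have h1 : partials (c.flow X t) y = c.flowPartials X t y := by
    ext1 i
    have h2 := c.hasFDerivAt_ψ hy
    have h3 := (hX.differentiable (by simp) (c.ψ y)).hasFDerivAt.comp y h2
    have h4 := h2.add (h3.const_smul t)
    rw [partials, show c.flow X t = c.ψ + t • (X ∘ c.ψ) from rfl, h4.fderiv]
    rfl
  rw [areaElt, h1]
  rfl

/-- The logarithmic derivative of the area element at time `0` is the divergence along `S`. -/
theorem hasDerivAt_flowArea {D : Set (Eu (n + 1))} (hD : IsOpen D) (g : RiemMetric D)
    (hΩ : c.Ω ⊆ D) (X : Eu (n + 1) → Eu (n + 1)) {y : Eu n} (hy : y ∈ c.U) :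
    HasDerivAt (fun t => c.flowArea g X (t, y))
      (areaElt (fun y => g.inner (c.ψ y)) c.ψ y * divS g S X (c.ψ y)) 0 := by
  let A : ℝ → Fin n → Fin n → ℝ := fun t i j => g.inner (c.ψ y + t • X (c.ψ y))
    (c.flowPartials X t y i) (c.flowPartials X t y j)
  have hA0 : Matrix.of (A 0) = gramOf (g.inner (c.ψ y)) (partials c.ψ y) := by
    ext i j
    simp only [Matrix.of_apply, A, flowPartials_zero, zero_smul, add_zero, gramOf]
  have hA : ∀ i j, HasDerivAt (fun t => A t i j)
      (lieForm g.inner X (c.ψ y) (partials c.ψ y i) (partials c.ψ y j)) 0 := fun i j => by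
    exact hasDerivAt_form_line ((g.smooth.contDiffAt (hD.mem_nhds
      (hΩ (c.mapsTo_ψ hy).2))).differentiableAt (by simp)) _ _ _ _ _
  have h6 := hasDerivAt_sqrt_det_gram hA0 hA (c.det_gramOf_ψ_pos g hΩ hy)
  rw [c.divS_ψ g X hy]
  exact h6

/-- The first variation formula for vector fields with support in a chart. -/
theorem integral_divS_eq_zero {D : Set (Eu (n + 1))} (hD : IsOpen D) (hn : 1 ≤ n) (g : RiemMetric D)
    (hΩ : c.Ω ⊆ D)
    {ν : Eu (n + 1) → Eu (n + 1)} (hν : IsUnitNormal S ν) (hS : MeasurableSet S)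
    (hmin : ∀ W : Set (Eu (n + 1)), IsOpen W → IsCompact (closure W) → closure W ⊆ D →
      ∀ K ⊆ W, IsCompact K →
      ∀ T : Current (n + 1) n, IsIntegerRectifiable K T → IsCycle T →
        mass g W (integrationCurrent S ν) ≤ mass g W (integrationCurrent S ν + T))
    {s : ℝ} (hs : c.IsOriented ν s) {X : Eu (n + 1) → Eu (n + 1)} (hX : ContDiff ℝ ∞ X)
    (hXc : HasCompactSupport X) (hXΩ : tsupport X ⊆ c.Ω) :
    ∫ x, divS g S X x ∂surfMeasure g S = 0 ∧ Integrable (divS g S X) (surfMeasure g S) := by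
  let C : Set (Eu n) := c.U ∩ c.ψ ⁻¹' tsupport X
  have hC : IsCompact C := c.isCompact_preimage hXc hXΩ
  have hCU : C ⊆ c.U := inter_subset_left
  obtain ⟨V, hV, hUV, hVΩ, hf⟩ := c.exists_contDiffOn_flowArea g hΩ hX
  have hder := hasDerivAt_setIntegral_of_contDiffOn hC hV hf fun y hy => hUV y (hCU hy)
  have hfd : ∀ y ∈ c.U, fderiv ℝ (c.flowArea g X) (0, y) (1, 0) =
      areaElt (fun y => g.inner (c.ψ y)) c.ψ y * divS g S X (c.ψ y) := fun y hy => by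
    have h1 : HasFDerivAt (c.flowArea g X) (fderiv ℝ (c.flowArea g X) (0, y)) (0, y) :=
      ((hf.contDiffAt (hV.mem_nhds (hUV y hy))).differentiableAt (by simp)).hasFDerivAt
    have h2 := HasFDerivAt.comp_hasDerivAt (f := fun t : ℝ => (t, y)) (0 : ℝ) h1
      ((hasDerivAt_id (0 : ℝ)).prodMk (hasDerivAt_const (0 : ℝ) y))
    exact h2.unique (c.hasDerivAt_flowArea hD g hΩ X hy)
  -- the variation does not decrease the area
  have hmin0 : IsLocalMin (fun t => ∫ y in C, c.flowArea g X (t, y)) 0 := by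
    obtain ⟨u, v, hu, -, h0u, hCv, huv⟩ := generalized_tube_lemma
      (isCompact_singleton (x := (0 : ℝ))) hC hV
      (by rintro ⟨t, y⟩ ⟨rfl, hy⟩; exact hUV y (hCU hy))
    filter_upwards [hu.mem_nhds (h0u rfl)] with t ht
    have htV : ∀ y ∈ C, (t, y) ∈ V := fun y hy => huv ⟨ht, hCv hy⟩
    have hζ : ContDiffOn ℝ ∞ (c.flow X t) c.U :=
      c.smooth_ψ.add ((hX.comp_contDiffOn c.smooth_ψ).const_smul t)
    have h5 := c.area_le hn g hΩ hν hS hmin hs hC hCU hζ (fun y hy hyC => by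
      have : X (c.ψ y) = 0 := image_eq_zero_of_notMem_tsupport fun h => hyC ⟨hy, h⟩
      simp [flow, this]) fun y hy => hVΩ _ (htV y hy)
    have hint : ∀ r : ℝ, (∀ y ∈ C, (r, y) ∈ V) → ∫⁻ y in C, ENNReal.ofReal
        (areaElt (fun y => g.inner (c.flow X r y)) (c.flow X r) y) =
        ENNReal.ofReal (∫ y in C, c.flowArea g X (r, y)) := fun r hr => by
      rw [ofReal_integral_eq_lintegral_ofReal]
      · exact setLIntegral_congr_fun hC.measurableSet fun y hy => by
          simp only [c.areaElt_flow g hX r (hCU hy)]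
      · exact (hf.continuousOn.comp (by fun_prop) hr).integrableOn_compact hC
      · exact ae_of_all _ fun y => Real.sqrt_nonneg _
    have h6 := hint 0 fun y hy => hUV y (hCU hy)
    rw [c.flow_zero] at h6
    rw [h6, hint t htV] at h5
    exact (ENNReal.ofReal_le_ofReal_iff (integral_nonneg fun y => Real.sqrt_nonneg _)).1 h5
  have hzero := hmin0.hasDerivAt_eq_zero hder
  have hout : ∀ y ∈ c.U \ C,
      areaElt (fun y => g.inner (c.ψ y)) c.ψ y * divS g S X (c.ψ y) = 0 := fun y hy => by
    rw [divS_eq_zero g S fun h => hy.2 ⟨hy.1, h⟩, mul_zero]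
  have hcont := (c.continuousOn_areaElt g hΩ).mul (c.continuousOn_divS hD g hΩ hX)
  have hdiv0 : ∀ x ∉ c.Ω, divS g S X x = 0 := fun x hx => divS_eq_zero g S fun h => hx (hXΩ h)
  constructor
  · rw [c.integral_surfMeasure g hΩ hdiv0 (c.continuousOn_divS hD g hΩ hX),
      setIntegral_eq_of_subset_of_forall_sdiff_eq_zero c.isOpen_U.measurableSet hCU hout, ← hzero]
    exact setIntegral_congr_fun hC.measurableSet fun y hy => (hfd y (hCU hy)).symm
  · refine c.integrable_surfMeasure g hΩ hdiv0 (c.continuousOn_divS hD g hΩ hX) ?_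
    exact ((hcont.mono hCU).integrableOn_compact hC).of_forall_sdiff_eq_zero
      c.isOpen_U.measurableSet hout

end SurfChart

/-- The first variation formula for vector fields with support near a point. If the point lies
outside `S`, there is nothing to vary, because `S` is closed in `D`. -/
theorem exists_nhds_integral_divS_eq_zero {n : ℕ} {D S : Set (Eu (n + 1))} (hD : IsOpen D)
    (hn : 1 ≤ n) (g : RiemMetric D) (hS : IsHypersurface D S) (hmin : IsAreaMinimizing g S)
    {p : Eu (n + 1)} (hp : p ∈ D) (hpi : p ∈ S → IsInteriorPt S p) :
    ∃ B : Set (Eu (n + 1)), IsOpen B ∧ p ∈ B ∧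
      ∀ Z : Eu (n + 1) → Eu (n + 1), ContDiff ℝ ∞ Z → HasCompactSupport Z → tsupport Z ⊆ B →
      ∫ x, divS g S Z x ∂surfMeasure g S = 0 ∧ Integrable (divS g S Z) (surfMeasure g S) := by
  obtain ⟨ν, hν, hmin⟩ := hmin
  have hSm := hS.measurableSet hD
  by_cases hpS : p ∈ S
  · obtain ⟨c0, hc0⟩ := (hpi hpS).exists_surfChart
    obtain ⟨c, s, hpc, hc1, hs⟩ := (c0.restr hD).exists_isOriented hν hpS
      (c0.mem_restr hD hpS hc0 hp)
    exact ⟨c.Ω, c.isOpen_Ω, hpc, fun Z hZ hZc hZB => c.integral_divS_eq_zero hD hn g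
      (hc1.trans ((c0.restr_Ω_subset hD).trans inter_subset_right)) hν hSm hmin hs hZ hZc hZB⟩
  · refine ⟨D ∩ (closure S)ᶜ, hD.inter isClosed_closure.isOpen_compl,
      ⟨hp, fun h => hpS (hS.closed ⟨h, hp⟩)⟩, fun Z hZ hZc hZB => ?_⟩
    have h0 : divS g S Z =ᵐ[surfMeasure g S] 0 := by
      refine (withDensity_absolutelyContinuous _ _).ae_le ?_
      filter_upwards [ae_restrict_mem hSm] with x hx
      exact divS_eq_zero g S fun h => (hZB h).2 (subset_closure hx)
    exact ⟨by rw [integral_congr_ae h0]; simp, (integrable_zero _ _ _).congr h0.symm⟩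

/-- The first variation formula. -/
theorem integral_divS_eq_zero {n : ℕ} {D S O : Set (Eu (n + 1))} (hD : IsOpen D) (hn : 1 ≤ n)
    (g : RiemMetric D) (hS : IsHypersurface D S) (hmin : IsAreaMinimizing g S) (hOD : O ⊆ D)
    (hOS : ∀ p ∈ S ∩ O, IsInteriorPt S p) {X : Eu (n + 1) → Eu (n + 1)} (hX : ContDiff ℝ ∞ X)
    (hXc : HasCompactSupport X) (hXO : tsupport X ⊆ O) :
    ∫ x, divS g S X x ∂surfMeasure g S = 0 ∧ Integrable (divS g S X) (surfMeasure g S) := by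
  choose! B hB hpB hBZ using fun p (hp : p ∈ tsupport X) =>
    exists_nhds_integral_divS_eq_zero hD hn g hS hmin (hOD (hXO hp)) fun h => hOS p ⟨h, hXO hp⟩
  obtain ⟨t, hcov⟩ := hXc.elim_nhds_subcover' (fun p hp => B p)
    fun p hp => (hB p hp).mem_nhds (hpB p hp)
  have hcov' : tsupport X ⊆ ⋃ p : t, B p := fun x hx => by
    obtain ⟨p, hp, hxp⟩ := mem_iUnion₂.1 (hcov hx)
    exact mem_iUnion.2 ⟨⟨p, hp⟩, hxp⟩
  obtain ⟨φ, hφ⟩ := SmoothPartitionOfUnity.exists_isSubordinate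
    (modelWithCornersSelf ℝ (Eu (n + 1))) (isClosed_tsupport X) (fun p : t => B p)
    (fun p => hB _ p.1.2) hcov'
  let Z : t → Eu (n + 1) → Eu (n + 1) := fun p x => φ p x • X x
  have hZ : ∀ p, ContDiff ℝ ∞ (Z p) := fun p => (φ p).contMDiff.contDiff.smul hX
  have hφs : ∀ x ∈ tsupport X, ∑ p, φ p x = 1 := fun x hx => by
    rw [← finsum_eq_sum_of_fintype]
    exact φ.sum_eq_one hx
  have hX' : ∀ x, X x = ∑ p, Z p x := fun x => by
    by_cases hx : x ∈ tsupport X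
    · rw [← Finset.sum_smul, hφs x hx, one_smul]
    · simp [Z, image_eq_zero_of_notMem_tsupport hx]
  rw [divS_sum g S hX' fun p => (hZ p).differentiable (by simp)]
  have hZc : ∀ p, HasCompactSupport (Z p) := fun p =>
    hXc.mono fun x hx hX0 => hx (by simp only [Z, hX0, smul_zero])
  have hZB : ∀ p : t, tsupport (Z p) ⊆ B p := fun p =>
    (closure_mono (show Function.support (Z p) ⊆ Function.support (φ p) from
      fun x hx hφ0 => hx (by simp only [Z, hφ0, zero_smul]))).trans (hφ p)
  have hZp : ∀ p : t, ∫ x, divS g S (Z p) x ∂surfMeasure g S = 0 ∧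
      Integrable (divS g S (Z p)) (surfMeasure g S) := fun p =>
    hBZ p.1 p.1.2 (Z p) (hZ p) (hZc p) (hZB p)
  refine ⟨?_, integrable_finsetSum _ fun p _ => (hZp p).2⟩
  rw [integral_finsetSum _ fun p _ => (hZp p).2]
  exact Finset.sum_eq_zero fun p _ => (hZp p).1

/-! ### The Levi-Civita connection -/

theorem contDiffOn_fderiv_form_apply {V W : Type*} [NormedAddCommGroup V] [NormedSpace ℝ V]
    [NormedAddCommGroup W] [NormedSpace ℝ W]
    {G : V → V →L[ℝ] V →L[ℝ] W} {D : Set V} (hD : IsOpen D) (hG : ContDiffOn ℝ ∞ G D) (a b c : V) :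
    ContDiffOn ℝ ∞ (fun x => fderiv ℝ G x a b c) D :=
  (((hG.fderiv_of_isOpen hD (m := ∞) (by simp)).clm_apply contDiffOn_const).clm_apply
    contDiffOn_const).clm_apply contDiffOn_const

namespace RiemMetric

variable {m : ℕ} {D : Set (Eu m)} (g : RiemMetric D)

theorem differentiableAt_inner (hD : IsOpen D) {x : Eu m} (hx : x ∈ D) :
    DifferentiableAt ℝ g.inner x :=
  (g.smooth.contDiffAt (hD.mem_nhds hx)).differentiableAt (by simp)

theorem fderiv_inner_apply (hD : IsOpen D) {x : Eu m} (hx : x ∈ D) (u v w : Eu m) :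
    fderiv ℝ g.inner x u v w = fderiv ℝ (fun y => g.inner y v w) x u := by
  have h := (((g.differentiableAt_inner hD hx).hasFDerivAt.clm_apply
    (hasFDerivAt_const v x)).clm_apply (hasFDerivAt_const w x)).fderiv
  rw [h]
  simp

theorem fderiv_symm (hD : IsOpen D) {x : Eu m} (hx : x ∈ D) (u v w : Eu m) :
    fderiv ℝ g.inner x u v w = fderiv ℝ g.inner x u w v := by
  rw [g.fderiv_inner_apply hD hx, g.fderiv_inner_apply hD hx]
  have h : (fun y => g.inner y v w) =ᶠ[𝓝 x] fun y => g.inner y w v := by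
    filter_upwards [hD.mem_nhds hx] with y hy using g.symm y hy v w
  rw [h.fderiv_eq]

theorem det_gram_pos {x : Eu m} (hx : x ∈ D) : 0 < (g.gram x).det :=
  ((g.isInnerForm hx).posDef_gramOf (v := fun i : Fin m => (stdVec i : Eu m)) (by
    have h := (EuclideanSpace.basisFun (Fin m) ℝ).toBasis.linearIndependent
    rw [OrthonormalBasis.coe_toBasis] at h
    have hf : ⇑(EuclideanSpace.basisFun (Fin m) ℝ) = fun i => stdVec i :=
      funext fun i => basisFun_eq_stdVec i
    rw [hf] at h
    exact h)).det_pos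

/-- The Christoffel symbols of the second kind are obtained from those of the first kind by raising
an index with the inverse Gram matrix. -/
theorem inner_christoffel (hD : IsOpen D) {x : Eu m} (hx : x ∈ D) (u v w : Eu m) :
    g.inner x (g.christoffel x u v) w = g.christoffelLow x u v w := by
  have h1 : ∀ j, g.inner x (g.christoffel x u v) (stdVec j) =
      g.christoffelLow x u v (stdVec j) := fun j => by
    have hinv : (g.gram x)⁻¹.transpose * g.gram x = 1 := by
      have hs : (g.gram x).transpose = g.gram x := by
        ext i k
        exact g.symm x hx _ _
      rw [Matrix.transpose_nonsing_inv, hs]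
      exact Matrix.nonsing_inv_mul _ (g.det_gram_pos hx).ne'.isUnit
    calc g.inner x (g.christoffel x u v) (stdVec j)
        = ∑ k, (∑ l, (g.gram x)⁻¹ k l * g.christoffelLow x u v (stdVec l)) * g.gram x k j := by
          simp only [christoffel, map_sum, map_smul, _root_.sum_apply, _root_.smul_apply,
            smul_eq_mul]
          rfl
      _ = ∑ l, ((g.gram x)⁻¹.transpose * g.gram x) l j * g.christoffelLow x u v (stdVec l) := by
          simp only [Matrix.mul_apply, Finset.sum_mul, Matrix.transpose_apply]
          rw [Finset.sum_comm]
          exact Finset.sum_congr rfl fun l _ => Finset.sum_congr rfl fun k _ => by ring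
      _ = g.christoffelLow x u v (stdVec j) := by
          rw [hinv]
          simp [Matrix.one_apply]
  have hw : w = ∑ j, w j • (stdVec j : Eu m) := (sum_smul_stdVec w).symm
  rw [hw, map_sum]
  simp only [map_smul, h1, christoffelLow, map_sum, _root_.sum_apply, _root_.smul_apply, smul_eq_mul,
    Finset.mul_sum, ← Finset.sum_add_distrib, ← Finset.sum_sub_distrib]
  exact Finset.sum_congr rfl fun j _ => by ring

theorem eq_of_inner_eq {x : Eu m} (hx : x ∈ D) {u v : Eu m}
    (h : ∀ w, g.inner x u w = g.inner x v w) : u = v := by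
  by_contra hne
  have h1 := g.pos x hx (u - v) (sub_ne_zero.2 hne)
  have h2 : g.inner x (u - v) (u - v) = 0 := by
    rw [map_sub (g.inner x) u v, _root_.sub_apply, h (u - v), sub_self]
  exact h1.ne' h2

theorem christoffel_symm (hD : IsOpen D) {x : Eu m} (hx : x ∈ D) (u v : Eu m) :
    g.christoffel x u v = g.christoffel x v u := by
  refine g.eq_of_inner_eq hx fun w => ?_
  rw [g.inner_christoffel hD hx, g.inner_christoffel hD hx, christoffelLow, christoffelLow,
    g.fderiv_symm hD hx w u v]
  ring

/-- The connection is compatible with the metric. -/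
theorem fderiv_inner_eq (hD : IsOpen D) {x : Eu m} (hx : x ∈ D) (u v w : Eu m) :
    fderiv ℝ g.inner x u v w =
      g.inner x (g.christoffel x u v) w + g.inner x v (g.christoffel x u w) := by
  rw [g.symm x hx v, g.inner_christoffel hD hx, g.inner_christoffel hD hx, christoffelLow,
    christoffelLow, g.fderiv_symm hD hx u w v, g.fderiv_symm hD hx v u w]
  ring

/-- The Christoffel symbols of the second kind, as a bilinear map. -/
def chr (x : Eu m) : Eu m →L[ℝ] Eu m →L[ℝ] Eu m :=
  LinearMap.toContinuousLinearMap
    { toFun := fun u => LinearMap.toContinuousLinearMap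
        { toFun := fun v => g.christoffel x u v
          map_add' := fun v v' => by
            simp only [christoffel, christoffelLow, map_add, _root_.add_apply, ← Finset.sum_add_distrib,
              ← add_smul, ← mul_add]
            refine Finset.sum_congr rfl fun k _ => ?_
            congr 1
            exact Finset.sum_congr rfl fun l _ => by ring
          map_smul' := fun a v => by
            simp only [christoffel, christoffelLow, map_smul, _root_.smul_apply, smul_eq_mul,
              Finset.smul_sum, smul_smul, Finset.mul_sum, RingHom.id_apply]
            refine Finset.sum_congr rfl fun k _ => ?_
            congr 1
            exact Finset.sum_congr rfl fun l _ => by ring }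
      map_add' := fun u u' => by
        ext1 v
        change g.christoffel x (u + u') v = g.christoffel x u v + g.christoffel x u' v
        simp only [christoffel, christoffelLow, map_add, _root_.add_apply, ← Finset.sum_add_distrib,
          ← add_smul, ← mul_add]
        refine Finset.sum_congr rfl fun k _ => ?_
        congr 1
        exact Finset.sum_congr rfl fun l _ => by ring
      map_smul' := fun a u => by
        ext1 v
        change g.christoffel x (a • u) v = a • g.christoffel x u v
        simp only [christoffel, christoffelLow, map_smul, _root_.smul_apply, smul_eq_mul,
          Finset.smul_sum, smul_smul, Finset.mul_sum]
        refine Finset.sum_congr rfl fun k _ => ?_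
        congr 1
        exact Finset.sum_congr rfl fun l _ => by ring }

theorem chr_apply (x u v : Eu m) : g.chr x u v = g.christoffel x u v := rfl

theorem contDiffOn_chr (hD : IsOpen D) : ContDiffOn ℝ ∞ g.chr D := by
  refine contDiffOn_clm_apply.2 fun u => contDiffOn_clm_apply.2 fun v => ?_
  simp only [chr_apply, christoffel]
  have hgram : ∀ i j, ContDiffOn ℝ ∞ (fun x => g.gram x i j) D := fun i j =>
    (g.smooth.clm_apply contDiffOn_const).clm_apply contDiffOn_const
  have hlow : ∀ a b c : Eu m, ContDiffOn ℝ ∞ (fun x => fderiv ℝ g.inner x a b c) D :=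
    contDiffOn_fderiv_form_apply hD g.smooth
  have hdet : ContDiffOn ℝ ∞ (fun x => ((g.gram x).det)⁻¹) D :=
    (contDiffOn_det (M := fun x i j => g.gram x i j) hgram).inv fun x hx => (g.det_gram_pos hx).ne'
  have hadj : ∀ i j, ContDiffOn ℝ ∞ (fun x => (g.gram x).adjugate i j) D := fun i j => by
    simp only [Matrix.adjugate_apply]
    refine contDiffOn_det (M := fun x a b => (g.gram x).updateRow j (Pi.single i 1) a b)
      fun a b => ?_
    by_cases ha : a = j
    · subst ha
      simp only [Matrix.updateRow_self]
      exact contDiffOn_const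
    · simp only [Matrix.updateRow_ne ha]
      exact hgram a b
  refine ContDiffOn.sum fun k _ => ContDiffOn.fun_smul (ContDiffOn.sum fun l _ => ?_) contDiffOn_const
  refine ContDiffOn.mul ?_ (contDiffOn_const.mul (((hlow _ _ _).add (hlow _ _ _)).sub (hlow _ _ _)))
  simp only [Matrix.inv_def, Ring.inverse_eq_inv', Matrix.smul_apply, smul_eq_mul]
  exact hdet.mul (hadj k l)

/-- The curvature tensor in terms of the bilinear map `chr`. Its derivative is taken as a map into
bilinear maps, instead of one pair of vectors at a time. -/
theorem curvature_eq (hD : IsOpen D) {x : Eu m} (hx : x ∈ D) (u v w : Eu m) :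
    g.curvature x u v w = fderiv ℝ g.chr x u v w - fderiv ℝ g.chr x v u w
      + g.chr x u (g.chr x v w) - g.chr x v (g.chr x u w) := by
  have h : ∀ a b c, fderiv ℝ (fun y => g.christoffel y a b) x c = fderiv ℝ g.chr x c a b :=
    fun a b c => by
    have h1 : HasFDerivAt g.chr (fderiv ℝ g.chr x) x := (((g.contDiffOn_chr hD).contDiffAt
      (hD.mem_nhds hx)).differentiableAt (by simp)).hasFDerivAt
    have h2 := ((h1.clm_apply (hasFDerivAt_const a x)).clm_apply (hasFDerivAt_const b x)).fderiv
    change fderiv ℝ (fun y => g.chr y a b) x c = _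
    rw [h2]
    simp
  rw [curvature, h, h]
  rfl

/-- An upper bound for the sectional curvature, in the form in which it enters the Jacobi
equation. -/
theorem inner_curvature_ge (hD : IsOpen D) {κ : ℝ} (hκ : 0 < κ) {x : Eu m} (hx : x ∈ D)
    (hsec : ∀ u v : Eu m, LinearIndependent ℝ ![u, v] → g.sec x u v ≤ κ) (u v : Eu m) :
    -(κ * g.inner x u u * g.inner x v v) ≤ g.inner x (g.curvature x u v u) v := by
  have hB := g.isInnerForm hx
  have hanti : g.curvature x u v u = -g.curvature x v u u := by
    rw [g.curvature_eq hD hx, g.curvature_eq hD hx]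
    abel
  have huu := hB.nonneg u
  have hvv := hB.nonneg v
  by_cases hli : LinearIndependent ℝ ![v, u]
  · have h1 := hsec v u hli
    have hpd := (hB.posDef_gramOf hli).det_pos
    rw [Matrix.det_fin_two] at hpd
    have h2 : 0 < g.inner x v v * g.inner x u u - g.inner x v u ^ 2 := by
      have h3 : gramOf (g.inner x) ![v, u] 1 0 = g.inner x v u := g.symm x hx u v
      rw [h3] at hpd
      rw [pow_two]
      exact hpd
    rw [sec, div_le_iff₀ h2] at h1
    rw [hanti, map_neg, _root_.neg_apply]
    nlinarith [sq_nonneg (g.inner x v u), mul_nonneg hκ.le (sq_nonneg (g.inner x v u))]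
  · have h0 : g.curvature x u v u = 0 := by
      rw [g.curvature_eq hD hx]
      rw [LinearIndependent.pair_iff] at hli
      push Not at hli
      obtain ⟨a, b, hab, hne⟩ := hli
      by_cases ha : a = 0
      · subst ha
        have hb : b ≠ 0 := hne rfl
        have hu0 : u = 0 := by simpa [hb] using hab
        simp [hu0]
      · have hv : v = (-(a⁻¹ * b)) • u := by
          have h1 : a • v = -(b • u) := eq_neg_of_add_eq_zero_left hab
          rw [neg_smul, mul_smul, ← smul_neg, ← h1, smul_smul, inv_mul_cancel₀ ha, one_smul]
        rw [hv]
        simp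
    rw [h0]
    simp only [map_zero, _root_.zero_apply]
    have := mul_nonneg (mul_nonneg hκ.le huu) hvv
    linarith

end RiemMetric

/-! ### Calculus along radial geodesics -/

namespace RiemMetric

variable {m : ℕ} {D : Set (Eu m)} (g : RiemMetric D)

theorem hasDerivAt_chr_comp (hD : IsOpen D) {c A B : ℝ → Eu m} {c' A' B' : Eu m} {t : ℝ}
    (hcD : c t ∈ D) (hc : HasDerivAt c c' t) (hA : HasDerivAt A A' t) (hB : HasDerivAt B B' t) :
    HasDerivAt (fun t => g.chr (c t) (A t) (B t))
      (fderiv ℝ g.chr (c t) c' (A t) (B t) + g.chr (c t) A' (B t) + g.chr (c t) (A t) B') t := by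
  have h1 : HasFDerivAt g.chr (fderiv ℝ g.chr (c t)) (c t) := (((g.contDiffOn_chr hD).contDiffAt
    (hD.mem_nhds hcD)).differentiableAt (by simp)).hasFDerivAt
  have h2 := HasFDerivAt.comp_hasDerivAt (E := Eu m →L[ℝ] Eu m →L[ℝ] Eu m) (f := c) t h1 hc
  refine ((h2.clm_apply hA).clm_apply hB).congr_deriv ?_
  simp only [_root_.add_apply, Function.comp_apply]

/-- The product rule for the covariant derivative along a curve. -/
theorem hasDerivAt_inner_comp (hD : IsOpen D) {c A B : ℝ → Eu m} {c' A' B' : Eu m} {t : ℝ}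
    (hcD : c t ∈ D) (hc : HasDerivAt c c' t) (hA : HasDerivAt A A' t) (hB : HasDerivAt B B' t) :
    HasDerivAt (fun t => g.inner (c t) (A t) (B t))
      (g.inner (c t) (A' + g.chr (c t) c' (A t)) (B t) +
        g.inner (c t) (A t) (B' + g.chr (c t) c' (B t))) t := by
  have h1 := (g.differentiableAt_inner hD hcD).hasFDerivAt
  have h2 := HasFDerivAt.comp_hasDerivAt (E := Eu m →L[ℝ] Eu m →L[ℝ] ℝ) (f := c) t h1 hc
  refine ((h2.clm_apply hA).clm_apply hB).congr_deriv ?_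
  simp only [_root_.add_apply, Function.comp_apply, map_add]
  rw [g.fderiv_inner_eq hD hcD, chr_apply, chr_apply]
  ring

/-- `V` is a Jacobi field, with derivative `V₁`, along the geodesic `c` with velocity `T`. The second
order equation is written in coordinates. -/
structure IsJacobi (c T V V₁ : ℝ → Eu m) (s : Set ℝ) : Prop where
  mem : ∀ t ∈ s, c t ∈ D
  curve : ∀ t ∈ s, HasDerivAt c (T t) t
  velocity : ∀ t ∈ s, HasDerivAt T (-g.chr (c t) (T t) (T t)) t
  field : ∀ t ∈ s, HasDerivAt V (V₁ t) t
  field₁ : ∀ t ∈ s, HasDerivAt V₁ (-(fderiv ℝ g.chr (c t) (V t) (T t) (T t) +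
    g.chr (c t) (V₁ t) (T t) + g.chr (c t) (T t) (V₁ t))) t

namespace IsJacobi

variable {g} {c T V V₁ : ℝ → Eu m} {s : Set ℝ}

theorem hasDerivAt_speed (hD : IsOpen D) (h : g.IsJacobi c T V V₁ s) {t : ℝ} (ht : t ∈ s) :
    HasDerivAt (fun t => g.inner (c t) (T t) (T t)) 0 t := by
  have h1 := g.hasDerivAt_inner_comp hD (h.mem t ht) (h.curve t ht) (h.velocity t ht)
    (h.velocity t ht)
  simpa using h1

theorem hasDerivAt_inner_velocity (hD : IsOpen D) (h : g.IsJacobi c T V V₁ s) {t : ℝ}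
    (ht : t ∈ s) : HasDerivAt (fun t => g.inner (c t) (T t) (V t))
      (g.inner (c t) (T t) (V₁ t + g.chr (c t) (T t) (V t))) t := by
  have h1 := g.hasDerivAt_inner_comp hD (h.mem t ht) (h.curve t ht) (h.velocity t ht)
    (h.field t ht)
  simpa using h1

theorem hasDerivAt_normSq (hD : IsOpen D) (h : g.IsJacobi c T V V₁ s) {t : ℝ} (ht : t ∈ s) :
    HasDerivAt (fun t => g.inner (c t) (V t) (V t))
      (2 * g.inner (c t) (V₁ t + g.chr (c t) (T t) (V t)) (V t)) t := by
  refine (g.hasDerivAt_inner_comp hD (h.mem t ht) (h.curve t ht) (h.field t ht)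
    (h.field t ht)).congr_deriv ?_
  rw [g.symm _ (h.mem t ht) (V t)]
  ring

/-- The Jacobi equation. -/
theorem hasDerivAt_covariant (hD : IsOpen D) (h : g.IsJacobi c T V V₁ s) {t : ℝ} (ht : t ∈ s) :
    HasDerivAt (fun t => V₁ t + g.chr (c t) (T t) (V t))
      (g.curvature (c t) (T t) (V t) (T t) -
        g.chr (c t) (T t) (V₁ t + g.chr (c t) (T t) (V t))) t := by
  have hm := h.mem t ht
  refine ((h.field₁ t ht).add (g.hasDerivAt_chr_comp hD hm (h.curve t ht) (h.velocity t ht)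
    (h.field t ht))).congr_deriv ?_
  rw [g.curvature_eq hD hm]
  have e1 : g.chr (c t) (V t) (g.chr (c t) (T t) (T t)) =
      g.chr (c t) (g.chr (c t) (T t) (T t)) (V t) := g.christoffel_symm hD hm _ _
  have e2 : g.chr (c t) (V₁ t) (T t) = g.chr (c t) (T t) (V₁ t) := g.christoffel_symm hD hm _ _
  have e3 : g.chr (c t) (V t) (T t) = g.chr (c t) (T t) (V t) := g.christoffel_symm hD hm _ _
  have e4 : fderiv ℝ g.chr (c t) (T t) (V t) (T t) = fderiv ℝ g.chr (c t) (T t) (T t) (V t) := by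
    have h1 : HasFDerivAt g.chr (fderiv ℝ g.chr (c t)) (c t) := (((g.contDiffOn_chr hD).contDiffAt
      (hD.mem_nhds hm)).differentiableAt (by simp)).hasFDerivAt
    have h2 : ∀ a b : Eu m, fderiv ℝ g.chr (c t) (T t) a b =
        fderiv ℝ (fun y => g.chr y a b) (c t) (T t) := fun a b => by
      rw [((h1.clm_apply (hasFDerivAt_const a _)).clm_apply (hasFDerivAt_const b _)).fderiv]
      simp
    have h3 : (fun y => g.chr y (V t) (T t)) =ᶠ[𝓝 (c t)] fun y => g.chr y (T t) (V t) := by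
      filter_upwards [hD.mem_nhds hm] with y hy using g.christoffel_symm hD hy _ _
    rw [h2, h2, h3.fderiv_eq]
  rw [e1, e2, e3, e4]
  simp only [map_add, map_neg, _root_.neg_apply]
  abel

theorem hasDerivAt_normSq_deriv (hD : IsOpen D) (h : g.IsJacobi c T V V₁ s) {t : ℝ} (ht : t ∈ s) :
    HasDerivAt (fun t => 2 * g.inner (c t) (V₁ t + g.chr (c t) (T t) (V t)) (V t))
      (2 * g.inner (c t) (g.curvature (c t) (T t) (V t) (T t)) (V t) +
        2 * g.inner (c t) (V₁ t + g.chr (c t) (T t) (V t)) (V₁ t + g.chr (c t) (T t) (V t))) t := by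
  refine ((g.hasDerivAt_inner_comp hD (h.mem t ht) (h.curve t ht) (h.hasDerivAt_covariant hD ht)
    (h.field t ht)).const_mul 2).congr_deriv ?_
  rw [sub_add_cancel]
  ring

end IsJacobi

end RiemMetric

theorem IsInnerForm.cauchy_schwarz {V : Type*} [NormedAddCommGroup V] [NormedSpace ℝ V]
    {B : V →L[ℝ] V →L[ℝ] ℝ} (hB : IsInnerForm B) (u v : V) : B u v ^ 2 ≤ B u u * B v v := by
  have h : ∀ t : ℝ, 0 ≤ B v v * (t * t) + 2 * B u v * t + B u u := fun t => by
    have h1 := hB.nonneg (u + t • v)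
    simp only [map_add, map_smul, _root_.add_apply, _root_.smul_apply, smul_eq_mul] at h1
    rw [hB.symm v u] at h1
    linarith
  have := discrim_le_zero h
  rw [discrim] at this
  nlinarith

/-- A form of the Rauch comparison theorem: here `a` is the squared length of a Jacobi field divided
by `t²`, and the differential inequality comes from a curvature bound. -/
theorem rauch_comparison {a N N' N'' : ℝ → ℝ} {k : ℝ} (hk : 0 ≤ k) (hk2 : k ≤ 2)
    (ha : ∀ t ∈ Icc (0 : ℝ) 1, 0 < a t) (had : ∀ t ∈ Icc (0 : ℝ) 1, DifferentiableAt ℝ a t)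
    (hac : ContinuousOn (deriv a) (Icc 0 1)) (hN : ∀ t ∈ Ioo (0 : ℝ) 1, N t = t ^ 2 * a t)
    (hN' : ∀ t ∈ Ioo (0 : ℝ) 1, HasDerivAt N (N' t) t)
    (hN'' : ∀ t ∈ Ioo (0 : ℝ) 1, HasDerivAt N' (N'' t) t)
    (hineq : ∀ t ∈ Ioo (0 : ℝ) 1, N' t ^ 2 - 4 * k * N t ^ 2 ≤ 2 * N t * N'' t) :
    0 ≤ deriv a 1 + 2 * k * a 1 := by
  -- with `L = √N`, a multiple of `(t L' - L + k t² L) exp (-k t² / 2)`, which vanishes for `t = 0`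
  -- and is non-decreasing
  let w : ℝ → ℝ := fun t =>
    t ^ 2 * (deriv a t + 2 * k * t * a t) / √(a t) * Real.exp (-(k * t ^ 2 / 2))
  let P : ℝ → ℝ := fun t => t * N' t - 2 * N t + 2 * k * t ^ 2 * N t
  have hac' : ContinuousOn a (Icc 0 1) := fun t ht => (had t ht).continuousAt.continuousWithinAt
  have hw : ContinuousOn w (Icc 0 1) := by
    refine ContinuousOn.mul (ContinuousOn.div ?_ hac'.sqrt fun t ht =>
      (Real.sqrt_pos.2 (ha t ht)).ne') (by fun_prop)
    exact (continuous_pow 2).continuousOn.mul (hac.add ((by fun_prop :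
      Continuous fun t : ℝ => 2 * k * t).continuousOn.mul hac'))
  have hNpos : ∀ t ∈ Ioo (0 : ℝ) 1, 0 < N t := fun t ht => by
    rw [hN t ht]
    exact mul_pos (pow_pos ht.1 2) (ha t (Ioo_subset_Icc_self ht))
  have hwP : ∀ t ∈ Ioo (0 : ℝ) 1, w t = P t / √(N t) * Real.exp (-(k * t ^ 2 / 2)) := by
    intro t ht
    have h1 := had t (Ioo_subset_Icc_self ht)
    have h2 : HasDerivAt N (2 * t * a t + t ^ 2 * deriv a t) t := by
      have h3 := ((hasDerivAt_pow 2 t).mul h1.hasDerivAt)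
      refine (h3.congr_of_eventuallyEq ?_).congr_deriv (by simp)
      filter_upwards [isOpen_Ioo.mem_nhds ht] with r hr using hN r hr
    have h4 : √(N t) = t * √(a t) := by
      rw [hN t ht, Real.sqrt_mul (sq_nonneg t), Real.sqrt_sq ht.1.le]
    have h5 := Real.sqrt_pos.2 (ha t (Ioo_subset_Icc_self ht))
    have h6 := ht.1
    simp only [w, P]
    rw [(hN' t ht).unique h2, h4, hN t ht]
    congr 1
    field_simp
    ring
  have hwd : ∀ t ∈ Ioo (0 : ℝ) 1, ∃ w', HasDerivAt w w' t ∧ 0 ≤ w' := by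
    intro t ht
    have hp := hNpos t ht
    have hs := Real.sqrt_pos.2 hp
    have hPd : HasDerivAt P (t * N'' t - N' t + 4 * k * t * N t + 2 * k * t ^ 2 * N' t) t := by
      refine ((((hasDerivAt_id t).mul (hN'' t ht)).sub ((hN' t ht).const_mul 2)).add
        (((hasDerivAt_pow 2 t).const_mul (2 * k)).mul (hN' t ht))).congr_deriv ?_
      simp only [id, Nat.cast_ofNat, Nat.add_one_sub_one, pow_one, one_mul]
      ring
    have hexp : HasDerivAt (fun t : ℝ => Real.exp (-(k * t ^ 2 / 2)))
        (Real.exp (-(k * t ^ 2 / 2)) * (-(k * t))) t := by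
      refine HasDerivAt.exp ?_
      refine (((hasDerivAt_pow 2 t).const_mul k).div_const 2).neg.congr_deriv ?_
      simp only [Nat.cast_ofNat, Nat.add_one_sub_one, pow_one]
      ring
    have h1 := (hPd.div ((hN' t ht).sqrt hp.ne') hs.ne').mul hexp
    refine ⟨_, h1.congr_of_eventuallyEq ?_, ?_⟩
    · filter_upwards [isOpen_Ioo.mem_nhds ht] with r hr using hwP r hr
    · have h2 := hineq t ht
      have hsq : √(N t) ^ 2 = N t := Real.sq_sqrt hp.le
      set E := Real.exp (-(k * t ^ 2 / 2))
      have hE : 0 < E := Real.exp_pos _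
      set σ := √(N t)
      -- the numerator of the derivative of `w`
      have h3 : 0 ≤ (t * N'' t - N' t + 4 * k * t * N t + 2 * k * t ^ 2 * N' t) * (2 * N t) -
          P t * N' t - 2 * k * t * P t * N t := by
        have ht0 := ht.1
        have h4 : k * t ^ 2 ≤ 2 := by
          have : t ^ 2 ≤ 1 := by nlinarith [ht.2]
          nlinarith
        have h5 : t * (N' t ^ 2 - 4 * k * N t ^ 2) ≤ t * (2 * N t * N'' t) :=
          mul_le_mul_of_nonneg_left h2 ht0.le
        have h6 : 0 ≤ 4 * k * t * N t ^ 2 * (2 - k * t ^ 2) :=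
          mul_nonneg (by positivity) (by linarith)
        simp only [P]
        nlinarith
      have h7 : (t * N'' t - N' t + 4 * k * t * N t + 2 * k * t ^ 2 * N' t) * σ -
          P t * (N' t / (2 * σ)) - k * t * P t * σ =
          ((t * N'' t - N' t + 4 * k * t * N t + 2 * k * t ^ 2 * N' t) * (2 * N t) -
          P t * N' t - 2 * k * t * P t * N t) / (2 * σ) := by
        rw [← hsq]
        field_simp
      have h8 : ((t * N'' t - N' t + 4 * k * t * N t + 2 * k * t ^ 2 * N' t) * σ -
          P t * (N' t / (2 * σ))) / σ ^ 2 * E + P t / σ * (E * (-(k * t))) =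
          ((t * N'' t - N' t + 4 * k * t * N t + 2 * k * t ^ 2 * N' t) * σ -
          P t * (N' t / (2 * σ)) - k * t * P t * σ) * E / σ ^ 2 := by
        field_simp
        ring
      change 0 ≤ ((t * N'' t - N' t + 4 * k * t * N t + 2 * k * t ^ 2 * N' t) * σ -
          P t * (N' t / (2 * σ))) / σ ^ 2 * E + P t / σ * (E * (-(k * t)))
      rw [h8, h7]
      positivity
  have hmono : MonotoneOn w (Icc 0 1) := by
    refine monotoneOn_of_deriv_nonneg (convex_Icc 0 1) hw ?_ ?_
    · rw [interior_Icc]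
      exact fun t ht => (hwd t ht).choose_spec.1.differentiableAt.differentiableWithinAt
    · rw [interior_Icc]
      intro t ht
      rw [(hwd t ht).choose_spec.1.deriv]
      exact (hwd t ht).choose_spec.2
  have h01 := hmono (left_mem_Icc.2 zero_le_one) (right_mem_Icc.2 zero_le_one) zero_le_one
  have h1 : 0 < √(a 1) := Real.sqrt_pos.2 (ha 1 (right_mem_Icc.2 zero_le_one))
  simp only [w] at h01
  have h2 : 0 ≤ (deriv a 1 + 2 * k * a 1) / √(a 1) * Real.exp (-(k * 1 ^ 2 / 2)) := by
    simpa using h01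
  have h3 := nonneg_of_mul_nonneg_left h2 (Real.exp_pos _)
  have h4 := mul_nonneg h3 h1.le
  rwa [div_mul_cancel₀ _ h1.ne'] at h4

/-! ### The exponential map: Gauss lemma and comparison -/

theorem fderiv_fderiv_comm {F V : Type*} [NormedAddCommGroup F] [NormedSpace ℝ F]
    [NormedAddCommGroup V] [NormedSpace ℝ V] {f : F → V} {O : Set F} (hO : IsOpen O)
    (hf : ContDiffOn ℝ ∞ f O) {p : F} (hp : p ∈ O) (a b : F) :
    fderiv ℝ (fun p => fderiv ℝ f p a) p b = fderiv ℝ (fun p => fderiv ℝ f p b) p a := by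
  have h1 := hf.contDiffAt (hO.mem_nhds hp)
  have h2 : DifferentiableAt ℝ (fderiv ℝ f) p :=
    (h1.fderiv_right (m := ∞) (by simp)).differentiableAt (by simp)
  have h3 := h1.isSymmSndFDerivAt (by simpa using
    (mod_cast le_top : ((2 : ℕ∞) : WithTop ℕ∞) ≤ ((⊤ : ℕ∞) : WithTop ℕ∞))) a b
  rw [(h2.hasFDerivAt.clm_apply (hasFDerivAt_const a p)).fderiv,
    (h2.hasFDerivAt.clm_apply (hasFDerivAt_const b p)).fderiv]
  simpa using h3.symm

theorem contDiffOn_fderiv_apply {F V : Type*} [NormedAddCommGroup F] [NormedSpace ℝ F]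
    [NormedAddCommGroup V] [NormedSpace ℝ V] {f : F → V} {O : Set F} (hO : IsOpen O)
    (hf : ContDiffOn ℝ ∞ f O) (a : F) : ContDiffOn ℝ ∞ (fun p => fderiv ℝ f p a) O :=
  (hf.fderiv_of_isOpen hO (by simp)).clm_apply contDiffOn_const

theorem hasDerivAt_fst_of_contDiffOn {V : Type*} [NormedAddCommGroup V] [NormedSpace ℝ V]
    {f : ℝ × ℝ → V} {O : Set (ℝ × ℝ)} (hO : IsOpen O) (hf : ContDiffOn ℝ ∞ f O) {t s : ℝ}
    (hp : (t, s) ∈ O) : HasDerivAt (fun t => f (t, s)) (fderiv ℝ f (t, s) (1, 0)) t :=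
  HasFDerivAt.comp_hasDerivAt (f := fun t : ℝ => (t, s)) t
    ((hf.contDiffAt (hO.mem_nhds hp)).differentiableAt (by simp)).hasFDerivAt
    ((hasDerivAt_id t).prodMk (hasDerivAt_const t s))

theorem hasDerivAt_snd_of_contDiffOn {V : Type*} [NormedAddCommGroup V] [NormedSpace ℝ V]
    {f : ℝ × ℝ → V} {O : Set (ℝ × ℝ)} (hO : IsOpen O) (hf : ContDiffOn ℝ ∞ f O) {t s : ℝ}
    (hp : (t, s) ∈ O) : HasDerivAt (fun s => f (t, s)) (fderiv ℝ f (t, s) (0, 1)) s :=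
  HasFDerivAt.comp_hasDerivAt (f := fun s : ℝ => (t, s)) s
    ((hf.contDiffAt (hO.mem_nhds hp)).differentiableAt (by simp)).hasFDerivAt
    ((hasDerivAt_const s t).prodMk (hasDerivAt_id s))

namespace RiemMetric

variable {m : ℕ} {D : Set (Eu m)}

/-- `Φ` is the exponential map at `p`, as a diffeomorphism on the ball of radius `ρ`. -/
structure IsExpChart (g : RiemMetric D) (p : Eu m) (ρ : ℝ)
    (Φ : OpenPartialHomeomorph (Eu m) (Eu m)) : Prop where
  source_eq : Φ.source = {v | g.inner p v v < ρ ^ 2}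
  smooth : ContDiffOn ℝ ∞ Φ Φ.source
  smooth_symm : ContDiffOn ℝ ∞ Φ.symm Φ.target
  geodesic : ∀ v ∈ Φ.source, g.IsGeodesicOn (fun t => Φ (t • v)) (Icc 0 1) ∧
      Φ 0 = p ∧ deriv (fun t : ℝ => Φ (t • v)) 0 = v

namespace IsExpChart

variable {g : RiemMetric D} {p : Eu m} {ρ : ℝ} {Φ : OpenPartialHomeomorph (Eu m) (Eu m)}

theorem base_mem (h : g.IsExpChart p ρ Φ) {x : Eu m} (hx : x ∈ Φ.source) : p ∈ D := by
  have h1 := ((h.geodesic x hx).1 0 (left_mem_Icc.2 zero_le_one)).1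
  simp only [zero_smul, (h.geodesic x hx).2.1] at h1
  exact h1

theorem smul_mem (h : g.IsExpChart p ρ Φ) {x : Eu m} (hx : x ∈ Φ.source) {t : ℝ}
    (ht : t ∈ Icc (0 : ℝ) 1) : t • x ∈ Φ.source := by
  have h3 := (g.isInnerForm (h.base_mem hx)).nonneg x
  rw [h.source_eq] at hx ⊢
  simp only [Set.mem_ofPred_eq, map_smul, _root_.smul_apply, smul_eq_mul] at hx ⊢
  have h1 : t * (t * g.inner p x x) = t ^ 2 * g.inner p x x := by ring
  have h2 : t ^ 2 ≤ 1 := by nlinarith [ht.1, ht.2]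
  rw [h1]
  nlinarith

theorem map_mem (h : g.IsExpChart p ρ Φ) {x : Eu m} (hx : x ∈ Φ.source) : Φ x ∈ D := by
  have := ((h.geodesic x hx).1 1 (right_mem_Icc.2 zero_le_one)).1
  simpa using this

theorem hasFDerivAt (h : g.IsExpChart p ρ Φ) {x : Eu m} (hx : x ∈ Φ.source) :
    HasFDerivAt Φ (fderiv ℝ Φ x) x :=
  ((h.smooth.contDiffAt (Φ.open_source.mem_nhds hx)).differentiableAt (by simp)).hasFDerivAt

theorem zero_mem (h : g.IsExpChart p ρ Φ) (hρ : 0 < ρ) : (0 : Eu m) ∈ Φ.source := by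
  rw [h.source_eq]
  simpa using pow_pos hρ 2

theorem map_zero (h : g.IsExpChart p ρ Φ) (hρ : 0 < ρ) : Φ 0 = p :=
  (h.geodesic 0 (h.zero_mem hρ)).2.1

theorem fderiv_zero (h : g.IsExpChart p ρ Φ) (hρ : 0 < ρ) {x : Eu m} (hx : x ∈ Φ.source) :
    fderiv ℝ Φ 0 x = x := by
  have h1 : HasFDerivAt Φ (fderiv ℝ Φ 0) ((0 : ℝ) • x) := by
    rw [zero_smul]
    exact h.hasFDerivAt (h.zero_mem hρ)
  have h2 := HasFDerivAt.comp_hasDerivAt (f := fun t : ℝ => t • x) (0 : ℝ) h1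
    ((hasDerivAt_id (0 : ℝ)).smul_const x)
  have h3 := h2.deriv
  rw [one_smul] at h3
  rw [← h3]
  exact (h.geodesic x hx).2.2

/-- The variation `(t, s) ↦ Φ (t (x + s v))` of the radial geodesic `t ↦ Φ (t x)`. -/
def radial (Φ : OpenPartialHomeomorph (Eu m) (Eu m)) (x v : Eu m) (z : ℝ × ℝ) : Eu m :=
  Φ (z.1 • (x + z.2 • v))

theorem contDiff_radial_arg (x v : Eu m) :
    ContDiff ℝ ∞ fun z : ℝ × ℝ => z.1 • (x + z.2 • v) :=
  contDiff_fst.smul (contDiff_const.add (contDiff_snd.smul contDiff_const))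

/-- The open set on which the radial variation is defined. -/
def radialDom (Φ : OpenPartialHomeomorph (Eu m) (Eu m)) (x v : Eu m) : Set (ℝ × ℝ) :=
  (fun z : ℝ × ℝ => z.1 • (x + z.2 • v)) ⁻¹' Φ.source

theorem isOpen_radialDom (x v : Eu m) : IsOpen (radialDom Φ x v) :=
  Φ.open_source.preimage (contDiff_radial_arg x v).continuous

theorem contDiffOn_radial (h : g.IsExpChart p ρ Φ) (x v : Eu m) :
    ContDiffOn ℝ ∞ (radial Φ x v) (radialDom Φ x v) :=
  h.smooth.comp (contDiff_radial_arg x v).contDiffOn fun _ hz => hz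

theorem mem_radialDom (h : g.IsExpChart p ρ Φ) {x v : Eu m} {t s : ℝ} (ht : t ∈ Icc (0 : ℝ) 1)
    (hs : x + s • v ∈ Φ.source) : (t, s) ∈ radialDom Φ x v := h.smul_mem hs ht

theorem radial_fst (h : g.IsExpChart p ρ Φ) {x v : Eu m} {t s : ℝ}
    (hz : (t, s) ∈ radialDom Φ x v) :
    fderiv ℝ (radial Φ x v) (t, s) (1, 0) = fderiv ℝ Φ (t • (x + s • v)) (x + s • v) := by
  have h1 := hasDerivAt_fst_of_contDiffOn (isOpen_radialDom x v) (h.contDiffOn_radial x v) hz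
  have h2 := HasFDerivAt.comp_hasDerivAt (f := fun t : ℝ => t • (x + s • v)) t (h.hasFDerivAt hz)
    ((hasDerivAt_id t).smul_const _)
  rw [one_smul] at h2
  exact h1.unique h2

theorem radial_snd (h : g.IsExpChart p ρ Φ) {x v : Eu m} {t s : ℝ}
    (hz : (t, s) ∈ radialDom Φ x v) :
    fderiv ℝ (radial Φ x v) (t, s) (0, 1) = t • fderiv ℝ Φ (t • (x + s • v)) v := by
  have h1 := hasDerivAt_snd_of_contDiffOn (isOpen_radialDom x v) (h.contDiffOn_radial x v) hz
  have h2 := HasFDerivAt.comp_hasDerivAt (f := fun s : ℝ => t • (x + s • v)) s (h.hasFDerivAt hz)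
    ((((hasDerivAt_id s).smul_const v).const_add x).const_smul t)
  rw [one_smul, map_smul] at h2
  exact h1.unique h2

/-- The geodesic equation for the radial variation. -/
theorem radial_fst_fst (h : g.IsExpChart p ρ Φ) {x v : Eu m} {t s : ℝ} (ht : t ∈ Ioo (0 : ℝ) 1)
    (hs : x + s • v ∈ Φ.source) :
    fderiv ℝ (fun z => fderiv ℝ (radial Φ x v) z (1, 0)) (t, s) (1, 0) =
      -g.chr (radial Φ x v (t, s)) (fderiv ℝ (radial Φ x v) (t, s) (1, 0))
        (fderiv ℝ (radial Φ x v) (t, s) (1, 0)) := by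
  have hO := isOpen_radialDom (Φ := Φ) x v
  have hF := h.contDiffOn_radial x v
  have h1 : ∀ r ∈ Ioo (0 : ℝ) 1, deriv (fun r => Φ (r • (x + s • v))) r =
      fderiv ℝ (radial Φ x v) (r, s) (1, 0) := fun r hr =>
    (hasDerivAt_fst_of_contDiffOn hO hF (h.mem_radialDom (Ioo_subset_Icc_self hr) hs)).deriv
  have h2 : deriv (fun r => Φ (r • (x + s • v))) =ᶠ[𝓝 t]
      fun r => fderiv ℝ (radial Φ x v) (r, s) (1, 0) := by
    filter_upwards [isOpen_Ioo.mem_nhds ht] with r hr using h1 r hr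
  have h3 := (hasDerivAt_fst_of_contDiffOn hO (contDiffOn_fderiv_apply hO hF (1, 0))
    (h.mem_radialDom (Ioo_subset_Icc_self ht) hs)).deriv
  have h4 := ((h.geodesic _ hs).1 t (Ioo_subset_Icc_self ht)).2.2
  rw [h2.deriv_eq, h3, h1 t ht] at h4
  exact eq_neg_of_add_eq_zero_left h4

/-- The variation field of a family of radial geodesics is a Jacobi field: the geodesic equation is
differentiated with respect to the parameter. -/
theorem isJacobi (h : g.IsExpChart p ρ Φ) (hD : IsOpen D) {x : Eu m} (v : Eu m)
    (hx : x ∈ Φ.source) :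
    g.IsJacobi (fun t => radial Φ x v (t, 0)) (fun t => fderiv ℝ (radial Φ x v) (t, 0) (1, 0))
      (fun t => fderiv ℝ (radial Φ x v) (t, 0) (0, 1))
      (fun t => fderiv ℝ (fun z => fderiv ℝ (radial Φ x v) z (0, 1)) (t, 0) (1, 0))
      (Ioo 0 1) := by
  have hO := isOpen_radialDom (Φ := Φ) x v
  have hF := h.contDiffOn_radial x v
  have hF1 := contDiffOn_fderiv_apply hO hF (1, 0)
  have hF2 := contDiffOn_fderiv_apply hO hF (0, 1)
  have hx0 : x + (0 : ℝ) • v ∈ Φ.source := by simpa using hx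
  have hmem : ∀ t ∈ Ioo (0 : ℝ) 1, (t, (0 : ℝ)) ∈ radialDom Φ x v := fun t ht =>
    h.mem_radialDom (Ioo_subset_Icc_self ht) hx0
  refine ⟨fun t ht => h.map_mem (hmem t ht), fun t ht => hasDerivAt_fst_of_contDiffOn hO hF
    (hmem t ht), fun t ht => ?_, fun t ht => hasDerivAt_fst_of_contDiffOn hO hF2 (hmem t ht),
    fun t ht => ?_⟩
  · have h1 := hasDerivAt_fst_of_contDiffOn hO hF1 (hmem t ht)
    rwa [h.radial_fst_fst ht hx0] at h1
  · refine (hasDerivAt_fst_of_contDiffOn hO (contDiffOn_fderiv_apply hO hF2 (1, 0))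
      (hmem t ht)).congr_deriv ?_
    -- commute the derivatives, and differentiate the geodesic equation in the parameter
    have h1 : (fun z => fderiv ℝ (fun z => fderiv ℝ (radial Φ x v) z (0, 1)) z (1, 0))
        =ᶠ[𝓝 (t, 0)] fun z => fderiv ℝ (fun z => fderiv ℝ (radial Φ x v) z (1, 0)) z (0, 1) := by
      filter_upwards [hO.mem_nhds (hmem t ht)] with z hz using fderiv_fderiv_comm hO hF hz _ _
    rw [h1.fderiv_eq, fderiv_fderiv_comm hO hF1 (hmem t ht)]
    have h2 := (hasDerivAt_snd_of_contDiffOn hO (contDiffOn_fderiv_apply hO hF1 (1, 0))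
      (hmem t ht))
    have hnhds : ∀ᶠ s : ℝ in 𝓝 0, x + s • v ∈ Φ.source := by
      have hc : ContinuousAt (fun s : ℝ => x + s • v) 0 := by fun_prop
      exact hc.preimage_mem_nhds (Φ.open_source.mem_nhds hx0)
    have h3 : (fun s => fderiv ℝ (fun z => fderiv ℝ (radial Φ x v) z (1, 0)) (t, s) (1, 0))
        =ᶠ[𝓝 0] fun s => -g.chr (radial Φ x v (t, s)) (fderiv ℝ (radial Φ x v) (t, s) (1, 0))
        (fderiv ℝ (radial Φ x v) (t, s) (1, 0)) := by
      filter_upwards [hnhds] with s hs using h.radial_fst_fst ht hs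
    have h4 := h3.hasDerivAt_iff.1 h2
    have h5 := (g.hasDerivAt_chr_comp hD (c := fun s => radial Φ x v (t, s))
      (h.map_mem (hmem t ht)) (hasDerivAt_snd_of_contDiffOn hO hF (hmem t ht))
      (hasDerivAt_snd_of_contDiffOn hO hF1 (hmem t ht))
      (hasDerivAt_snd_of_contDiffOn hO hF1 (hmem t ht))).neg
    rw [h4.unique h5, fderiv_fderiv_comm hO hF (hmem t ht) (1, 0) (0, 1)]

/-- Radial geodesics have constant speed. -/
theorem speed_eq (h : g.IsExpChart p ρ Φ) (hρ : 0 < ρ) (hD : IsOpen D) {x : Eu m}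
    (hx : x ∈ Φ.source) {t : ℝ} (ht : t ∈ Icc (0 : ℝ) 1) :
    g.inner (Φ (t • x)) (fderiv ℝ Φ (t • x) x) (fderiv ℝ Φ (t • x) x) = g.inner p x x := by
  rcases eq_or_lt_of_le ht.1 with h0 | h0
  · rw [← h0, zero_smul, h.fderiv_zero hρ hx, h.map_zero hρ]
  let f : ℝ → ℝ := fun t => g.inner (Φ (t • x)) (fderiv ℝ Φ (t • x) x) (fderiv ℝ Φ (t • x) x)
  have hsmul : ContinuousOn (fun t : ℝ => t • x) (Icc 0 t) := by fun_prop
  have hmaps : MapsTo (fun t : ℝ => t • x) (Icc 0 t) Φ.source := fun r hr =>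
    h.smul_mem hx ⟨hr.1, hr.2.trans ht.2⟩
  have hd : ContinuousOn (fun t : ℝ => fderiv ℝ Φ (t • x) x) (Icc 0 t) :=
    ((h.smooth.continuousOn_fderiv_of_isOpen Φ.open_source (by simp)).comp hsmul hmaps).clm_apply
      continuousOn_const
  have hgc : ContinuousOn (fun t : ℝ => g.inner (Φ (t • x))) (Icc 0 t) :=
    g.smooth.continuousOn.comp (h.smooth.continuousOn.comp hsmul hmaps) fun r hr =>
      h.map_mem (hmaps hr)
  have hf : ContinuousOn f (Icc 0 t) := (hgc.clm_apply hd).clm_apply hd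
  have hder : ∀ r ∈ Ioo (0 : ℝ) t, HasDerivAt f 0 r := fun r hr => by
    have hr1 : r ∈ Ioo (0 : ℝ) 1 := ⟨hr.1, hr.2.trans_le ht.2⟩
    refine ((h.isJacobi hD 0 hx).hasDerivAt_speed hD hr1).congr_of_eventuallyEq ?_
    filter_upwards [isOpen_Ioo.mem_nhds hr1] with r' hr'
    rw [h.radial_fst (h.mem_radialDom (Ioo_subset_Icc_self hr') (by simpa using hx))]
    simp [f, radial]
  obtain ⟨r, -, hr⟩ := exists_hasDerivAt_eq_slope f (fun _ => 0) h0 hf hder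
  have h1 : f t = f 0 := by
    rw [eq_comm, div_eq_zero_iff] at hr
    rcases hr with h2 | h2 <;> linarith
  calc f t = f 0 := h1
    _ = _ := by simp only [f]; rw [zero_smul, h.fderiv_zero hρ hx, h.map_zero hρ]

/-- The Gauss lemma. -/
theorem gauss (h : g.IsExpChart p ρ Φ) (hρ : 0 < ρ) (hD : IsOpen D) {x : Eu m}
    (hx : x ∈ Φ.source) (v : Eu m) :
    g.inner (Φ x) (fderiv ℝ Φ x x) (fderiv ℝ Φ x v) = g.inner p x v := by
  have hpD : p ∈ D := h.map_zero hρ ▸ h.map_mem (h.zero_mem hρ)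
  have hO := isOpen_radialDom (Φ := Φ) x v
  have hF := h.contDiffOn_radial x v
  have hF1 := contDiffOn_fderiv_apply hO hF (1, 0)
  have hx0 : x + (0 : ℝ) • v ∈ Φ.source := by simpa using hx
  have hmem : ∀ t ∈ Icc (0 : ℝ) 1, (t, (0 : ℝ)) ∈ radialDom Φ x v := fun t ht =>
    h.mem_radialDom ht hx0
  have hJ := h.isJacobi hD v hx
  -- the product of the velocity with the variation field is affine in `t`
  let f : ℝ → ℝ := fun t => g.inner (Φ (t • x)) (fderiv ℝ Φ (t • x) x) (t • fderiv ℝ Φ (t • x) v)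
  have hsmul : ContinuousOn (fun t : ℝ => t • x) (Icc 0 1) := by fun_prop
  have hmaps : MapsTo (fun t : ℝ => t • x) (Icc 0 1) Φ.source := fun r hr => h.smul_mem hx hr
  have hd : ∀ u, ContinuousOn (fun t : ℝ => fderiv ℝ Φ (t • x) u) (Icc 0 1) := fun u =>
    ((h.smooth.continuousOn_fderiv_of_isOpen Φ.open_source (by simp)).comp hsmul hmaps).clm_apply
      continuousOn_const
  have hgc : ContinuousOn (fun t : ℝ => g.inner (Φ (t • x))) (Icc 0 1) :=
    g.smooth.continuousOn.comp (h.smooth.continuousOn.comp hsmul hmaps) fun r hr =>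
      h.map_mem (hmaps hr)
  have hf : ContinuousOn f (Icc 0 1) :=
    (hgc.clm_apply (hd x)).clm_apply (continuousOn_id.smul (hd v))
  have hder : ∀ t ∈ Ioo (0 : ℝ) 1, HasDerivAt f (g.inner p x v) t := fun t ht => by
    have htc := Ioo_subset_Icc_self ht
    have h1 := hJ.hasDerivAt_inner_velocity hD ht
    have h2 : HasDerivAt f (g.inner (radial Φ x v (t, 0)) (fderiv ℝ (radial Φ x v) (t, 0) (1, 0))
        (fderiv ℝ (fun z => fderiv ℝ (radial Φ x v) z (0, 1)) (t, 0) (1, 0) +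
          g.chr (radial Φ x v (t, 0)) (fderiv ℝ (radial Φ x v) (t, 0) (1, 0))
            (fderiv ℝ (radial Φ x v) (t, 0) (0, 1)))) t := by
      refine h1.congr_of_eventuallyEq ?_
      filter_upwards [isOpen_Ioo.mem_nhds ht] with r hr
      rw [h.radial_fst (hmem r (Ioo_subset_Icc_self hr)),
        h.radial_snd (hmem r (Ioo_subset_Icc_self hr))]
      simp [f, radial]
    refine h2.congr_deriv ?_
    -- the speed of the neighbouring geodesics
    have h3 := g.hasDerivAt_inner_comp hD (c := fun s => radial Φ x v (t, s))
      (h.map_mem (hmem t htc)) (hasDerivAt_snd_of_contDiffOn hO hF (hmem t htc))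
      (hasDerivAt_snd_of_contDiffOn hO hF1 (hmem t htc))
      (hasDerivAt_snd_of_contDiffOn hO hF1 (hmem t htc))
    have hnhds : ∀ᶠ s : ℝ in 𝓝 0, x + s • v ∈ Φ.source := by
      have hc : ContinuousAt (fun s : ℝ => x + s • v) 0 := by fun_prop
      exact hc.preimage_mem_nhds (Φ.open_source.mem_nhds hx0)
    have h4 : (fun s => g.inner (radial Φ x v (t, s)) (fderiv ℝ (radial Φ x v) (t, s) (1, 0))
        (fderiv ℝ (radial Φ x v) (t, s) (1, 0))) =ᶠ[𝓝 0]
        fun s => g.inner p (x + s • v) (x + s • v) := by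
      filter_upwards [hnhds] with s hs
      rw [h.radial_fst (h.mem_radialDom htc hs)]
      exact h.speed_eq hρ hD hs htc
    have h5 := h4.hasDerivAt_iff.1 h3
    have h6 : HasDerivAt (fun s : ℝ => g.inner p (x + s • v) (x + s • v))
        (2 * g.inner p x v) 0 := by
      have hlin : HasDerivAt (fun s : ℝ => x + s • v) v 0 := by
        simpa using ((hasDerivAt_id (0 : ℝ)).smul_const v).const_add x
      have h7 := ((g.inner p).hasFDerivAt.comp_hasDerivAt (0 : ℝ) hlin).clm_apply hlin
      refine h7.congr_deriv ?_
      simp only [Function.comp_apply, zero_smul, add_zero]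
      rw [g.symm p hpD v x]
      ring
    have h8 := h5.unique h6
    rw [fderiv_fderiv_comm hO hF (hmem t htc) (1, 0) (0, 1)] at h8
    have hmD : radial Φ x v (t, 0) ∈ D := h.map_mem (hmem t htc)
    rw [g.symm _ hmD _ (fderiv ℝ (radial Φ x v) (t, 0) (1, 0)), chr_apply,
      g.christoffel_symm hD hmD, ← chr_apply] at h8
    linarith
  obtain ⟨r, -, hr⟩ := exists_hasDerivAt_eq_slope f (fun _ => g.inner p x v) zero_lt_one hf hder
  simp only [f, zero_smul, one_smul, _root_.map_zero, sub_zero, div_one] at hr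
  exact hr.symm

/-- The comparison estimate for the pulled back metric in normal coordinates. The variation field of
the radial geodesics with initial velocities `x + s v` at time `t` is `t` times the image of `v`, so
that `rauch_comparison` applies to the squared length of the image of `v`. -/
theorem comparison (h : g.IsExpChart p ρ Φ) (hρ : 0 < ρ) (hD : IsOpen D) {κ : ℝ} (hκ : 0 < κ)
    (hsec : ∀ x ∈ D, ∀ u v : Eu m, LinearIndependent ℝ ![u, v] → g.sec x u v ≤ κ)
    {x : Eu m} (hx : x ∈ Φ.source) (hxκ : κ * g.inner p x x ≤ 2) (v : Eu m) :
    0 ≤ fderiv ℝ (fun y => g.inner (Φ y) (fderiv ℝ Φ y v) (fderiv ℝ Φ y v)) x x +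
      2 * (κ * g.inner p x x) * g.inner (Φ x) (fderiv ℝ Φ x v) (fderiv ℝ Φ x v) := by
  have hpD : p ∈ D := h.map_zero hρ ▸ h.map_mem (h.zero_mem hρ)
  by_cases hv : v = 0
  · subst hv
    simp
  let a0 : Eu m → ℝ := fun y => g.inner (Φ y) (fderiv ℝ Φ y v) (fderiv ℝ Φ y v)
  have ha0 : ContDiffOn ℝ ∞ a0 Φ.source := by
    have hd := contDiffOn_fderiv_apply Φ.open_source h.smooth v
    exact ((g.smooth.comp h.smooth fun y hy => h.map_mem hy).clm_apply hd).clm_apply hd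
  let a : ℝ → ℝ := fun t => a0 (t • x)
  have hmaps : MapsTo (fun t : ℝ => t • x) (Icc 0 1) Φ.source := fun r hr => h.smul_mem hx hr
  have had : ∀ t ∈ Icc (0 : ℝ) 1, HasDerivAt a (fderiv ℝ a0 (t • x) x) t := fun t ht => by
    have h1 := HasFDerivAt.comp_hasDerivAt (f := fun t : ℝ => t • x) t
      ((ha0.contDiffAt (Φ.open_source.mem_nhds (hmaps ht))).differentiableAt
        (by simp)).hasFDerivAt ((hasDerivAt_id t).smul_const x)
    rwa [one_smul] at h1
  have hinj : ∀ y ∈ Φ.source, fderiv ℝ Φ y v ≠ 0 := fun y hy h0 => hv (by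
    have h1 : HasFDerivAt Φ.symm (fderiv ℝ Φ.symm (Φ y)) (Φ y) :=
      ((h.smooth_symm.contDiffAt (Φ.open_target.mem_nhds (Φ.map_source hy))).differentiableAt
        (by simp)).hasFDerivAt
    have h2 := h1.comp y (h.hasFDerivAt hy)
    have h3 : HasFDerivAt (Φ.symm ∘ Φ) (ContinuousLinearMap.id ℝ (Eu m)) y := by
      refine (hasFDerivAt_id y).congr_of_eventuallyEq ?_
      filter_upwards [Φ.open_source.mem_nhds hy] with z hz using Φ.left_inv hz
    have h4 := DFunLike.congr_fun (h2.unique h3) v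
    simpa [h0] using h4.symm)
  have hJ := h.isJacobi hD v hx
  have hmem : ∀ t ∈ Ioo (0 : ℝ) 1, (t, (0 : ℝ)) ∈ radialDom Φ x v := fun t ht =>
    h.mem_radialDom (Ioo_subset_Icc_self ht) (by simpa using hx)
  have hk : 0 ≤ κ * g.inner p x x := mul_nonneg hκ.le ((g.isInnerForm hpD).nonneg x)
  have key := rauch_comparison (a := a) hk hxκ
    (fun t ht => g.pos _ (h.map_mem (hmaps ht)) _ (hinj _ (hmaps ht)))
    (fun t ht => (had t ht).differentiableAt) ?_ ?_
    (fun t ht => hJ.hasDerivAt_normSq hD ht) (fun t ht => hJ.hasDerivAt_normSq_deriv hD ht) ?_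
  · rw [(had 1 (right_mem_Icc.2 zero_le_one)).deriv] at key
    simpa [a] using key
  · have h1 : ContinuousOn (fun t : ℝ => fderiv ℝ a0 (t • x) x) (Icc 0 1) :=
      ((ha0.continuousOn_fderiv_of_isOpen Φ.open_source (by simp)).comp (by fun_prop)
        hmaps).clm_apply continuousOn_const
    exact h1.congr fun t ht => (had t ht).deriv
  · intro t ht
    rw [h.radial_snd (hmem t ht)]
    simp only [a, a0, radial, zero_smul, add_zero, map_smul, _root_.smul_apply, smul_eq_mul]
    ring
  · intro t ht
    have hcD := hJ.mem t ht
    have hB := g.isInnerForm hcD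
    have h1 := g.inner_curvature_ge hD hκ hcD (hsec _ hcD)
      (fderiv ℝ (radial Φ x v) (t, 0) (1, 0)) (fderiv ℝ (radial Φ x v) (t, 0) (0, 1))
    have h2 : g.inner (radial Φ x v (t, 0)) (fderiv ℝ (radial Φ x v) (t, 0) (1, 0))
        (fderiv ℝ (radial Φ x v) (t, 0) (1, 0)) = g.inner p x x := by
      rw [h.radial_fst (hmem t ht)]
      simpa [radial] using h.speed_eq hρ hD hx (Ioo_subset_Icc_self ht)
    rw [h2] at h1
    have h3 := hB.cauchy_schwarz (fderiv ℝ (fun z => fderiv ℝ (radial Φ x v) z (0, 1)) (t, 0) (1, 0)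
      + g.chr (radial Φ x v (t, 0)) (fderiv ℝ (radial Φ x v) (t, 0) (1, 0))
        (fderiv ℝ (radial Φ x v) (t, 0) (0, 1))) (fderiv ℝ (radial Φ x v) (t, 0) (0, 1))
    have h4 := hB.nonneg (fderiv ℝ (radial Φ x v) (t, 0) (0, 1))
    nlinarith [mul_le_mul_of_nonneg_right h1 h4]

end IsExpChart

end RiemMetric

/-! ### The radial vector field -/

theorem contDiff_of_contDiffOn_of_eq_zero {F V : Type*} [NormedAddCommGroup F] [NormedSpace ℝ F]
    [NormedAddCommGroup V] [NormedSpace ℝ V] {k : WithTop ℕ∞} {f : F → V} {K O : Set F}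
    (hO : IsOpen O) (hK : IsClosed K) (hKO : K ⊆ O) (hf : ContDiffOn ℝ k f O)
    (h0 : ∀ x ∉ K, f x = 0) : ContDiff ℝ k f := by
  rw [contDiff_iff_contDiffAt]
  intro x
  by_cases hx : x ∈ O
  · exact hf.contDiffAt (hO.mem_nhds hx)
  · refine (contDiffAt_const (c := (0 : V))).congr_of_eventuallyEq ?_
    filter_upwards [hK.isOpen_compl.mem_nhds fun h => hx (hKO h)] with y hy using h0 y hy

/-- An inner product on a finite dimensional space bounds the norm. -/
theorem IsInnerForm.exists_norm_sq_le {m : ℕ} {B : Eu m →L[ℝ] Eu m →L[ℝ] ℝ} (hB : IsInnerForm B) :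
    ∃ C : ℝ, 0 < C ∧ ∀ x, ‖x‖ ^ 2 ≤ C * B x x := by
  have hc : Continuous fun x : Eu m => B x x := B.continuous.clm_apply continuous_id
  by_cases hne : (Metric.sphere (0 : Eu m) 1).Nonempty
  · obtain ⟨z, hz, hmin⟩ := (isCompact_sphere (0 : Eu m) 1).exists_isMinOn hne hc.continuousOn
    have hz0 : z ≠ 0 := by
      rintro rfl
      simp at hz
    have hpos := hB.pos z hz0
    refine ⟨(B z z)⁻¹, inv_pos.2 hpos, fun x => ?_⟩
    by_cases hx : x = 0
    · simp [hx]
    · have hx' : 0 < ‖x‖ := norm_pos_iff.2 hx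
      have h1 : B z z ≤ B (‖x‖⁻¹ • x) (‖x‖⁻¹ • x) :=
        hmin (by simp [norm_smul, hx'.ne'])
      simp only [map_smul, _root_.smul_apply, smul_eq_mul] at h1
      rw [inv_mul_eq_div, le_div_iff₀ hpos]
      calc ‖x‖ ^ 2 * B z z ≤ ‖x‖ ^ 2 * (‖x‖⁻¹ * (‖x‖⁻¹ * B x x)) := by gcongr
        _ = B x x := by field_simp
  · refine ⟨1, one_pos, fun x => ?_⟩
    by_cases hx : x = 0
    · simp [hx]
    · exact absurd ⟨‖x‖⁻¹ • x, by simp [norm_smul, hx]⟩ hne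

/-- The Lie derivative of the metric is natural. -/
theorem lieForm_map {V : Type*} [NormedAddCommGroup V] [NormedSpace ℝ V]
    {g : V → V →L[ℝ] V →L[ℝ] ℝ} {Φ X Z : V → V} {O : Set V} (hO : IsOpen O)
    (hΦ : ContDiffOn ℝ ∞ Φ O) {ξ : V} (hξ : ξ ∈ O) (hg : DifferentiableAt ℝ g (Φ ξ))
    (hX : DifferentiableAt ℝ X (Φ ξ)) (hZ : DifferentiableAt ℝ Z ξ)
    (hsymm : ∀ v w, g (Φ ξ) v w = g (Φ ξ) w v)
    (hXZ : ∀ η ∈ O, X (Φ η) = fderiv ℝ Φ η (Z η)) (v : V) :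
    lieForm g X (Φ ξ) (fderiv ℝ Φ ξ v) (fderiv ℝ Φ ξ v) =
      fderiv ℝ (fun η => g (Φ η) (fderiv ℝ Φ η v) (fderiv ℝ Φ η v)) ξ (Z ξ) +
        2 * g (Φ ξ) (fderiv ℝ Φ ξ (fderiv ℝ Z ξ v)) (fderiv ℝ Φ ξ v) := by
  have hΦξ := hΦ.contDiffAt (hO.mem_nhds hξ)
  have h1 : HasFDerivAt Φ (fderiv ℝ Φ ξ) ξ := (hΦξ.differentiableAt (by simp)).hasFDerivAt
  have h2 : HasFDerivAt (fderiv ℝ Φ) (fderiv ℝ (fderiv ℝ Φ) ξ) ξ :=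
    ((hΦξ.fderiv_right (m := ∞) (by simp)).differentiableAt (by simp)).hasFDerivAt
  have hs : fderiv ℝ (fderiv ℝ Φ) ξ v (Z ξ) = fderiv ℝ (fderiv ℝ Φ) ξ (Z ξ) v :=
    hΦξ.isSymmSndFDerivAt (by simpa using
      (mod_cast le_top : ((2 : ℕ∞) : WithTop ℕ∞) ≤ ((⊤ : ℕ∞) : WithTop ℕ∞))) _ _
  have h3 : HasFDerivAt (fun η => fderiv ℝ Φ η v) ((fderiv ℝ (fderiv ℝ Φ) ξ).flip v) ξ := by
    refine (h2.clm_apply (hasFDerivAt_const v ξ)).congr_fderiv ?_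
    ext u
    simp
  have h4 := ((HasFDerivAt.comp (G := V →L[ℝ] V →L[ℝ] ℝ) ξ hg.hasFDerivAt h1).clm_apply
    h3).clm_apply h3
  have h5 : fderiv ℝ X (Φ ξ) (fderiv ℝ Φ ξ v) =
      fderiv ℝ (fderiv ℝ Φ) ξ v (Z ξ) + fderiv ℝ Φ ξ (fderiv ℝ Z ξ v) := by
    have h6 := (hX.hasFDerivAt.comp ξ h1).congr_of_eventuallyEq
      (f₁ := fun η => fderiv ℝ Φ η (Z η)) (by
        filter_upwards [hO.mem_nhds hξ] with η hη using (hXZ η hη).symm)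
    have h7 := h6.unique (h2.clm_apply hZ.hasFDerivAt)
    have h8 := DFunLike.congr_fun h7 v
    simp only [ContinuousLinearMap.comp_apply, _root_.add_apply,
      ContinuousLinearMap.flip_apply] at h8
    rw [h8, add_comm]
  rw [show (fun η => g (Φ η) (fderiv ℝ Φ η v) (fderiv ℝ Φ η v)) =
    fun η => (g ∘ Φ) η (fderiv ℝ Φ η v) (fderiv ℝ Φ η v) from rfl, h4.fderiv, lieForm_apply, h5,
    hXZ ξ hξ, hs, hsymm (fderiv ℝ Φ ξ v)]
  simp only [ContinuousLinearMap.comp_apply, _root_.add_apply, ContinuousLinearMap.flip_apply,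
    Function.comp_apply, map_add]
  rw [hsymm (fderiv ℝ Φ ξ v)]
  ring

namespace RiemMetric.IsExpChart

variable {m : ℕ} {D : Set (Eu m)} {g : RiemMetric D} {p : Eu m} {ρ : ℝ}
  {Φ : OpenPartialHomeomorph (Eu m) (Eu m)}

/-- The squared geodesic distance from the base point. -/
def radSq (g : RiemMetric D) (p : Eu m) (Φ : OpenPartialHomeomorph (Eu m) (Eu m)) (x : Eu m) : ℝ :=
  g.inner p (Φ.symm x) (Φ.symm x)

/-- The closed geodesic ball of radius `b` about the base point. -/
def closedBall (g : RiemMetric D) (p : Eu m) (Φ : OpenPartialHomeomorph (Eu m) (Eu m)) (b : ℝ) :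
    Set (Eu m) := Φ '' {v | g.inner p v v ≤ b ^ 2}

theorem continuous_normSq (g : RiemMetric D) (p : Eu m) : Continuous fun v => g.inner p v v :=
  (g.inner p).continuous.clm_apply continuous_id

theorem isCompact_normSq_le (hp : p ∈ D) (b : ℝ) : IsCompact {v | g.inner p v v ≤ b ^ 2} := by
  obtain ⟨C, hC, h⟩ := (g.isInnerForm hp).exists_norm_sq_le
  refine (isCompact_closedBall (0 : Eu m) (√(C * b ^ 2))).of_isClosed_subset
    (isClosed_le (continuous_normSq g p) continuous_const) fun v hv => ?_
  rw [mem_closedBall_zero_iff]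
  exact Real.le_sqrt_of_sq_le ((h v).trans (mul_le_mul_of_nonneg_left hv hC.le))

theorem subset_source (h : g.IsExpChart p ρ Φ) {b : ℝ} (hb : 0 ≤ b) (hbρ : b < ρ) :
    {v | g.inner p v v ≤ b ^ 2} ⊆ Φ.source := by
  rw [h.source_eq]
  intro v hv
  have : b ^ 2 < ρ ^ 2 := by nlinarith
  exact lt_of_le_of_lt hv this

theorem isCompact_closedBall (h : g.IsExpChart p ρ Φ) (hp : p ∈ D) {b : ℝ} (hb : 0 ≤ b)
    (hbρ : b < ρ) : IsCompact (closedBall g p Φ b) :=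
  (isCompact_normSq_le hp b).image_of_continuousOn
    (h.smooth.continuousOn.mono (h.subset_source hb hbρ))

theorem closedBall_subset (h : g.IsExpChart p ρ Φ) {b : ℝ} (hb : 0 ≤ b) (hbρ : b < ρ) :
    closedBall g p Φ b ⊆ Φ.target :=
  image_subset_iff.2 fun _ hv => Φ.map_source (h.subset_source hb hbρ hv)

theorem mem_closedBall_iff (h : g.IsExpChart p ρ Φ) {b : ℝ} (hb : 0 ≤ b) (hbρ : b < ρ)
    {x : Eu m} : x ∈ closedBall g p Φ b ↔ x ∈ Φ.target ∧ radSq g p Φ x ≤ b ^ 2 := by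
  constructor
  · rintro ⟨v, hv, rfl⟩
    have hvs := h.subset_source hb hbρ hv
    exact ⟨Φ.map_source hvs, by rw [radSq, Φ.left_inv hvs]; exact hv⟩
  · rintro ⟨hx, hxb⟩
    exact ⟨Φ.symm x, hxb, Φ.right_inv hx⟩

theorem contDiffOn_radSq (h : g.IsExpChart p ρ Φ) : ContDiffOn ℝ ∞ (radSq g p Φ) Φ.target :=
  (contDiffOn_const.clm_apply h.smooth_symm).clm_apply h.smooth_symm

/-- The radial vector field `η(r²) r ∂/∂r`. -/
def radialField (g : RiemMetric D) (p : Eu m) (Φ : OpenPartialHomeomorph (Eu m) (Eu m))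
    (η : ℝ → ℝ) (x : Eu m) : Eu m := by
  classical
  exact if x ∈ Φ.target then η (radSq g p Φ x) • fderiv ℝ Φ (Φ.symm x) (Φ.symm x) else 0

theorem radialField_of_mem {η : ℝ → ℝ} {x : Eu m} (hx : x ∈ Φ.target) :
    radialField g p Φ η x = η (radSq g p Φ x) • fderiv ℝ Φ (Φ.symm x) (Φ.symm x) := by
  rw [radialField, if_pos hx]

theorem radialField_eq_zero (h : g.IsExpChart p ρ Φ) {η : ℝ → ℝ} {b : ℝ} (hb : 0 ≤ b)
    (hbρ : b < ρ) (hηb : ∀ s, b ^ 2 ≤ s → η s = 0) {x : Eu m} (hx : x ∉ closedBall g p Φ b) :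
    radialField g p Φ η x = 0 := by
  by_cases hxt : x ∈ Φ.target
  · rw [radialField_of_mem hxt, hηb, zero_smul]
    by_contra! hlt
    exact hx ((h.mem_closedBall_iff hb hbρ).2 ⟨hxt, hlt.le⟩)
  · rw [radialField, if_neg hxt]

theorem tsupport_radialField (h : g.IsExpChart p ρ Φ) (hp : p ∈ D) {η : ℝ → ℝ} {b : ℝ} (hb : 0 ≤ b)
    (hbρ : b < ρ) (hηb : ∀ s, b ^ 2 ≤ s → η s = 0) :
    tsupport (radialField g p Φ η) ⊆ closedBall g p Φ b :=
  closure_minimal (fun _ hx => not_not.1 fun hn => hx (h.radialField_eq_zero hb hbρ hηb hn))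
    (h.isCompact_closedBall hp hb hbρ).isClosed

theorem contDiff_radialField (h : g.IsExpChart p ρ Φ) (hp : p ∈ D) {η : ℝ → ℝ}
    (hη : ContDiff ℝ ∞ η) {b : ℝ} (hb : 0 ≤ b) (hbρ : b < ρ) (hηb : ∀ s, b ^ 2 ≤ s → η s = 0) :
    ContDiff ℝ ∞ (radialField g p Φ η) := by
  refine contDiff_of_contDiffOn_of_eq_zero Φ.open_target
    (h.isCompact_closedBall hp hb hbρ).isClosed (h.closedBall_subset hb hbρ) ?_
    fun x hx => h.radialField_eq_zero hb hbρ hηb hx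
  have h1 : ContDiffOn ℝ ∞ (fun x => fderiv ℝ Φ (Φ.symm x) (Φ.symm x)) Φ.target :=
    ((h.smooth.fderiv_of_isOpen Φ.open_source (m := ∞) (by simp)).comp h.smooth_symm
      fun x hx => Φ.map_target hx).clm_apply h.smooth_symm
  exact ((hη.comp_contDiffOn h.contDiffOn_radSq).fun_smul h1).congr fun x hx =>
    radialField_of_mem hx

/-- The Lie derivative of the metric along a radial vector field, estimated by the comparison
theorem and the Gauss lemma. -/
theorem lieForm_radialField_ge (h : g.IsExpChart p ρ Φ) (hρ : 0 < ρ) (hD : IsOpen D) {κ : ℝ}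
    (hκ : 0 < κ) (hsec : ∀ x ∈ D, ∀ u v : Eu m, LinearIndependent ℝ ![u, v] → g.sec x u v ≤ κ)
    {η : ℝ → ℝ} (hη : ContDiff ℝ ∞ η) {b : ℝ} (hb : 0 ≤ b) (hbρ : b < ρ)
    (hηb : ∀ s, b ^ 2 ≤ s → η s = 0) (hη0 : ∀ s, 0 ≤ η s) {x : Eu m} (hx : x ∈ Φ.target)
    (hxκ : κ * radSq g p Φ x ≤ 2) (u : Eu m) :
    2 * (η (radSq g p Φ x) * (1 - κ * radSq g p Φ x)) * g.inner x u u +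
      4 * deriv η (radSq g p Φ x) * g.inner x (fderiv ℝ Φ (Φ.symm x) (Φ.symm x)) u ^ 2 ≤
    lieForm g.inner (radialField g p Φ η) x u u := by
  obtain ⟨ξ, hξ, rfl⟩ : ∃ ξ ∈ Φ.source, Φ ξ = x := ⟨_, Φ.map_target hx, Φ.right_inv hx⟩
  have hq : radSq g p Φ (Φ ξ) = g.inner p ξ ξ := by rw [radSq, Φ.left_inv hξ]
  have hp : p ∈ D := h.base_mem hξ
  have hxD := h.map_mem hξ
  rw [Φ.left_inv hξ, hq]
  rw [hq] at hxκ
  obtain ⟨v, rfl⟩ : ∃ v, fderiv ℝ Φ ξ v = u := by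
    have h1 : HasFDerivAt Φ.symm (fderiv ℝ Φ.symm (Φ ξ)) (Φ ξ) :=
      ((h.smooth_symm.contDiffAt (Φ.open_target.mem_nhds hx)).differentiableAt
        (by simp)).hasFDerivAt
    have h2 : HasFDerivAt Φ (fderiv ℝ Φ ξ) (Φ.symm (Φ ξ)) := by
      rw [Φ.left_inv hξ]; exact h.hasFDerivAt hξ
    have h3 := h2.comp (Φ ξ) h1
    have h4 : HasFDerivAt (Φ ∘ Φ.symm) (ContinuousLinearMap.id ℝ (Eu m)) (Φ ξ) := by
      refine (hasFDerivAt_id _).congr_of_eventuallyEq ?_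
      filter_upwards [Φ.open_target.mem_nhds hx] with z hz using Φ.right_inv hz
    exact ⟨fderiv ℝ Φ.symm (Φ ξ) u, DFunLike.congr_fun (h3.unique h4) u⟩
  let Z : Eu m → Eu m := fun y => η (g.inner p y y) • y
  have hqd : HasFDerivAt (fun y => g.inner p y y) (2 • g.inner p ξ) ξ := by
    refine ((g.inner p).hasFDerivAt.clm_apply (hasFDerivAt_id ξ)).congr_fderiv ?_
    ext w
    have := g.symm p hp w ξ
    simp [this]
    ring
  have hηd : HasDerivAt η (deriv η (g.inner p ξ ξ)) (g.inner p ξ ξ) :=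
    (hη.differentiable (by simp) _).hasDerivAt
  have hZd : HasFDerivAt Z _ ξ :=
    (HasDerivAt.comp_hasFDerivAt (f := fun y => g.inner p y y) ξ hηd hqd).smul (hasFDerivAt_id ξ)
  have hZd' : fderiv ℝ Z ξ v = η (g.inner p ξ ξ) • v +
      (2 * deriv η (g.inner p ξ ξ) * g.inner p ξ v) • ξ := by
    rw [hZd.fderiv]
    simp
    ring_nf
  have hmap := lieForm_map (g := g.inner) (X := radialField g p Φ η) (Z := Z) Φ.open_source h.smooth
    hξ (g.differentiableAt_inner hD hxD)
    ((h.contDiff_radialField hp hη hb hbρ hηb).differentiable (by simp) _)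
    hZd.differentiableAt (g.symm _ hxD) (fun y hy => by
      rw [radialField_of_mem (Φ.map_source hy), radSq, Φ.left_inv hy, map_smul]) v
  have hcomp := h.comparison hρ hD hκ hsec hξ hxκ v
  have hgauss := h.gauss hρ hD hξ v
  rw [hmap, hZd', hgauss]
  simp only [Z, map_smul, map_add, _root_.add_apply, _root_.smul_apply, smul_eq_mul, hgauss]
  have h1 := mul_nonneg (hη0 (g.inner p ξ ξ)) hcomp
  nlinarith

/-- The divergence of a radial vector field along a hypersurface. The term with `η'` has a favourable
sign because of Bessel's inequality for the radial vector, whose squared length is `r²`. -/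
theorem divS_radialField_ge {n : ℕ} {D S : Set (Eu (n + 1))} {g : RiemMetric D} {p : Eu (n + 1)}
    {ρ : ℝ} {Φ : OpenPartialHomeomorph (Eu (n + 1)) (Eu (n + 1))} (h : g.IsExpChart p ρ Φ)
    (hρ : 0 < ρ) (hD : IsOpen D) {κ : ℝ} (hκ : 0 < κ)
    (hsec : ∀ x ∈ D, ∀ u v : Eu (n + 1), LinearIndependent ℝ ![u, v] → g.sec x u v ≤ κ)
    {η : ℝ → ℝ} (hη : ContDiff ℝ ∞ η) {b : ℝ} (hb : 0 ≤ b) (hbρ : b < ρ)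
    (hηb : ∀ s, b ^ 2 ≤ s → η s = 0) (hη0 : ∀ s, 0 ≤ η s) (hη' : ∀ s, deriv η s ≤ 0)
    {x : Eu (n + 1)} (hxi : IsInteriorPt S x) (hx : x ∈ Φ.target)
    (hxκ : κ * radSq g p Φ x ≤ 2) :
    n * (η (radSq g p Φ x) * (1 - κ * radSq g p Φ x)) +
      2 * radSq g p Φ x * deriv η (radSq g p Φ x) ≤ divS g S (radialField g p Φ η) x := by
  have hxD : x ∈ D := by
    rw [← Φ.right_inv hx]
    exact h.map_mem (Φ.map_target hx)
  have hB := g.isInnerForm hxD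
  obtain ⟨c, hxc⟩ := hxi.exists_surfChart
  have hy := c.mapsTo_χ hxc
  have hyx : c.ψ (c.χ x) = x := c.right_inv x ⟨hxi.1, hxc⟩
  have h1 := c.divS_ψ g (radialField g p Φ η) hy
  obtain ⟨u, A, hA, hu, hAu, -⟩ := hB.exists_orthonormal (c.linearIndependent_partials hy)
  rw [hyx, hAu, traceOn_combo _ _ hA, traceOn_orthonormal _ _ hu] at h1
  rw [h1]
  have h2 : ∀ i, 2 * (η (radSq g p Φ x) * (1 - κ * radSq g p Φ x)) +
      4 * deriv η (radSq g p Φ x) * g.inner x (fderiv ℝ Φ (Φ.symm x) (Φ.symm x)) (u i) ^ 2 ≤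
      lieForm g.inner (radialField g p Φ η) x (u i) (u i) := fun i => by
    have h3 := h.lieForm_radialField_ge hρ hD hκ hsec hη hb hbρ hηb hη0 hx hxκ (u i)
    have h4 : g.inner x (u i) (u i) = 1 := by
      have := congrFun (congrFun hu i) i
      rwa [Matrix.one_apply_eq] at this
    rwa [h4, mul_one] at h3
  have h5 := Finset.sum_le_sum fun i (_ : i ∈ Finset.univ) => h2 i
  rw [Finset.sum_add_distrib, Finset.sum_const, Finset.card_univ, Fintype.card_fin, nsmul_eq_mul,
    ← Finset.mul_sum] at h5
  have h6 := hB.bessel hu (fderiv ℝ Φ (Φ.symm x) (Φ.symm x))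
  have h7 : g.inner x (fderiv ℝ Φ (Φ.symm x) (Φ.symm x)) (fderiv ℝ Φ (Φ.symm x) (Φ.symm x)) =
      radSq g p Φ x := by
    have h8 := h.gauss hρ hD (Φ.map_target hx) (Φ.symm x)
    rwa [Φ.right_inv hx] at h8
  rw [h7] at h6
  nlinarith [mul_le_mul_of_nonpos_left h6 (hη' (radSq g p Φ x))]

end RiemMetric.IsExpChart

/-! ### The distribution of the squared distance -/

/-- The area measure is finite on compact sets that contain only interior points of `S`. -/
theorem surfMeasure_lt_top {n : ℕ} {D S K : Set (Eu (n + 1))} (hD : IsOpen D)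
    (g : RiemMetric D) (hS : IsHypersurface D S) (hK : IsCompact K) (hKD : K ⊆ D)
    (hKS : ∀ p ∈ S ∩ K, IsInteriorPt S p) : surfMeasure g S K < ⊤ := by
  refine hK.measure_lt_top_of_nhdsWithin fun p hp => ?_
  by_cases hpS : p ∈ S
  · obtain ⟨c0, hc0⟩ := (hKS p ⟨hpS, hp⟩).exists_surfChart
    let c := c0.restr hD
    have hpc : p ∈ c.Ω := c0.mem_restr hD hpS hc0 (hKD hp)
    have hcD : c.Ω ⊆ D := (c0.restr_Ω_subset hD).trans inter_subset_right
    obtain ⟨K', hK', hpK', hK'Ω⟩ := exists_compact_subset c.isOpen_Ω hpc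
    refine ⟨K', mem_nhdsWithin_of_mem_nhds (mem_interior_iff_mem_nhds.1 hpK'), ?_⟩
    rw [c.lintegral_surfMeasure g hcD hK'.measurableSet hK'Ω]
    exact (((c.continuousOn_areaElt g hcD).mono inter_subset_left).integrableOn_compact
      (c.isCompact_preimage hK' hK'Ω)).lintegral_lt_top
  · refine ⟨(closure S)ᶜ, mem_nhdsWithin_of_mem_nhds (isClosed_closure.isOpen_compl.mem_nhds
      fun h => hpS (hS.closed ⟨h, hKD hp⟩)), ?_⟩
    have h0 : (μHE[n] : Measure (Eu (n + 1))).restrict S (closure S)ᶜ = 0 := by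
      rw [Measure.restrict_apply isClosed_closure.isOpen_compl.measurableSet,
        disjoint_compl_left.mono_right subset_closure |>.inter_eq, measure_empty]
    exact lt_of_eq_of_lt (withDensity_absolutelyContinuous _ _ h0) ENNReal.zero_lt_top

open RiemMetric.IsExpChart in
/-- The first variation formula for radial fields, as an inequality for the distribution of the
squared distance. -/
theorem integral_radial_le {n : ℕ} {D S : Set (Eu (n + 1))} {g : RiemMetric D} {p : Eu (n + 1)}
    {ρ : ℝ} {Φ : OpenPartialHomeomorph (Eu (n + 1)) (Eu (n + 1))} (h : g.IsExpChart p ρ Φ)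
    (hn : 1 ≤ n) (hρ : 0 < ρ) (hD : IsOpen D) {κ : ℝ} (hκ : 0 < κ)
    (hsec : ∀ x ∈ D, ∀ u v : Eu (n + 1), LinearIndependent ℝ ![u, v] → g.sec x u v ≤ κ)
    (hS : IsHypersurface D S) (hmin : IsAreaMinimizing g S) {b B : ℝ} (hb : 0 ≤ b) (hbB : b ≤ B)
    (hBρ : B < ρ) (hBκ : κ * B ^ 2 ≤ 2) (hBS : ∀ x ∈ S ∩ closedBall g p Φ B, IsInteriorPt S x)
    {η : ℝ → ℝ} (hη : ContDiff ℝ ∞ η) (hηb : ∀ s, b ^ 2 ≤ s → η s = 0) (hη0 : ∀ s, 0 ≤ η s)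
    (hη' : ∀ s, deriv η s ≤ 0) :
    ∫ s, (n * (η s * (1 - κ * s)) + 2 * s * deriv η s)
      ∂(((surfMeasure g S).restrict (closedBall g p Φ B)).map (radSq g p Φ)) ≤ 0 := by
  have hB : 0 ≤ B := hb.trans hbB
  have hp : p ∈ D := h.base_mem (h.zero_mem hρ)
  have hK := h.isCompact_closedBall hp hB hBρ
  have hKt := h.closedBall_subset hB hBρ
  have htD : Φ.target ⊆ D := fun x hx => by
    rw [← Φ.right_inv hx]
    exact h.map_mem (Φ.map_target hx)
  have hbbB : b ^ 2 ≤ B ^ 2 := by nlinarith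
  have hX := h.contDiff_radialField hp hη hB hBρ fun s hs => hηb s (hbbB.trans hs)
  have hXt := h.tsupport_radialField hp hB hBρ fun s hs => hηb s (hbbB.trans hs)
  have hfin := surfMeasure_lt_top hD g hS hK (hKt.trans htD) hBS
  have hrm : AEMeasurable (radSq g p Φ) ((surfMeasure g S).restrict (closedBall g p Φ B)) :=
    (h.contDiffOn_radSq.continuousOn.mono hKt).aemeasurable hK.measurableSet
  let f : ℝ → ℝ := fun s => n * (η s * (1 - κ * s)) + 2 * s * deriv η s
  have hf : Continuous f := by
    have h1 := hη.continuous
    have h2 := hη.continuous_deriv (by simp)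
    fun_prop
  have hint : IntegrableOn (fun x => f (radSq g p Φ x)) (closedBall g p Φ B) (surfMeasure g S) := by
    have : IsFiniteMeasure ((surfMeasure g S).restrict (closedBall g p Φ B)) :=
      ⟨by rwa [Measure.restrict_apply_univ]⟩
    have hc : ContinuousOn (fun x => f (radSq g p Φ x)) (closedBall g p Φ B) :=
      hf.comp_continuousOn (h.contDiffOn_radSq.continuousOn.mono hKt)
    obtain ⟨C, hC⟩ := hK.exists_bound_of_continuousOn hc
    exact Integrable.of_bound (hc.aestronglyMeasurable hK.measurableSet) C
      ((ae_restrict_mem hK.measurableSet).mono hC)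
  obtain ⟨h0, hdiv⟩ := integral_divS_eq_zero hD hn g hS hmin (hKt.trans htD) hBS hX
    (hK.of_isClosed_subset (isClosed_tsupport _) hXt) hXt
  rw [← setIntegral_eq_integral_of_forall_compl_eq_zero (s := closedBall g p Φ B)
    fun x hx => divS_eq_zero g S fun hxt => hx (hXt hxt)] at h0
  rw [integral_map hrm hf.aestronglyMeasurable, ← h0]
  have hSae : ∀ᵐ x ∂surfMeasure g S, x ∈ S :=
    (withDensity_absolutelyContinuous _ _).ae_le (ae_restrict_mem (hS.measurableSet hD))
  refine setIntegral_mono_ae_restrict hint hdiv.integrableOn ?_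
  filter_upwards [ae_restrict_of_ae hSae, ae_restrict_mem hK.measurableSet] with x hxS hxK
  have hxK' := (h.mem_closedBall_iff hB hBρ).1 hxK
  exact h.divS_radialField_ge hρ hD hκ hsec hη hB hBρ (fun s hs => hηb s (hbbB.trans hs)) hη0 hη'
    (hBS x ⟨hxS, hxK⟩) hxK'.1 ((mul_le_mul_of_nonneg_left hxK'.2 hκ.le).trans hBκ)

/-- The smooth approximation `s ↦ smoothTransition (j (1 - s))` of the indicator function of
`s < 1`. -/
def ramp (j : ℕ) (s : ℝ) : ℝ := Real.smoothTransition (j * (1 - s))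

theorem contDiff_ramp (j : ℕ) : ContDiff ℝ ∞ (ramp j) :=
  Real.smoothTransition.contDiff.comp (contDiff_const.mul (contDiff_const.sub contDiff_id))

theorem ramp_eq_zero (j : ℕ) {s : ℝ} (hs : 1 ≤ s) : ramp j s = 0 :=
  Real.smoothTransition.zero_of_nonpos
    (mul_nonpos_of_nonneg_of_nonpos (Nat.cast_nonneg j) (by linarith))

theorem ramp_nonneg (j : ℕ) (s : ℝ) : 0 ≤ ramp j s := Real.smoothTransition.nonneg _

theorem ramp_le_one (j : ℕ) (s : ℝ) : ramp j s ≤ 1 := Real.smoothTransition.le_one _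

theorem antitone_ramp (j : ℕ) : Antitone (ramp j) := fun _ _ hst =>
  Real.smoothTransition.monotone (mul_le_mul_of_nonneg_left (by linarith) (Nat.cast_nonneg j))

theorem tendsto_ramp (s : ℝ) : Tendsto (fun j => ramp j s) atTop (𝓝 ((Iio 1).indicator 1 s)) := by
  by_cases hs : s < 1
  · rw [indicator_of_mem (show s ∈ Iio 1 from hs)]
    refine tendsto_const_nhds.congr' ?_
    obtain ⟨N, hN⟩ := exists_nat_ge (1 / (1 - s))
    filter_upwards [eventually_ge_atTop N] with j hj
    have h1 : 0 < 1 - s := by linarith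
    rw [div_le_iff₀ h1] at hN
    have h2 : (N : ℝ) ≤ j := by exact_mod_cast hj
    exact (Real.smoothTransition.one_of_one_le (hN.trans (by gcongr))).symm
  · rw [indicator_of_notMem (show s ∉ Iio 1 from hs)]
    exact tendsto_const_nhds.congr fun j => (ramp_eq_zero j (not_lt.1 hs)).symm

/-- The monotonicity formula, for the distribution `τ` of the squared distance. With a ramp `η` and
`φ l = ∫ η (s / l) dτ`, the hypothesis for the function `s ↦ η (s / l)` is a differential inequality
`k φ ≤ 2 l φ'`, where `k = n (1 - κ b²)`, so that `φ l / l ^ (k / 2)` is monotone for `l ≤ b²`. The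
ramps are then replaced by the indicator function of `s < 1`. -/
theorem measure_Iio_mul_le {τ : Measure ℝ} [IsFiniteMeasure τ] (hτ : τ (Iio 0) = 0) {n : ℕ}
    {κ b : ℝ} (hκ : 0 ≤ κ)
    (hle : ∀ η : ℝ → ℝ, ContDiff ℝ ∞ η → (∀ s, b ^ 2 ≤ s → η s = 0) → (∀ s, 0 ≤ η s) →
      (∀ s, deriv η s ≤ 0) → ∫ s, (n * (η s * (1 - κ * s)) + 2 * s * deriv η s) ∂τ ≤ 0)
    {a : ℝ} (ha : 0 < a) (hab : a ≤ b) :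
    τ.real (Iio (a ^ 2)) * b ^ (n * (1 - κ * b ^ 2) : ℝ) ≤
      τ.real (Iio (b ^ 2)) * a ^ (n * (1 - κ * b ^ 2) : ℝ) := by
  set k : ℝ := n * (1 - κ * b ^ 2) with hk
  have hb : 0 < b := ha.trans_le hab
  have hτ0 : ∀ᵐ s ∂τ, 0 ≤ s := by
    rw [ae_iff]
    simp only [not_le]
    exact hτ
  -- `τ` lives on `[0, ∞)`, hence only the values on a compact interval count
  have hbound : ∀ {f : ℝ → ℝ}, Continuous f → ∀ C, (∀ s, C ≤ s → f s = 0) → Integrable f τ := by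
    intro f hf C hC
    obtain ⟨M, hM⟩ := (isCompact_Icc (a := (0 : ℝ)) (b := C)).exists_bound_of_continuousOn
      hf.continuousOn
    refine Integrable.of_bound hf.aestronglyMeasurable (max M 0) ?_
    filter_upwards [hτ0] with s hs
    by_cases hsC : s ≤ C
    · exact (hM s ⟨hs, hsC⟩).trans (le_max_left _ _)
    · rw [hC s (not_le.1 hsC).le, norm_zero]
      exact le_max_right _ _
  -- the inequality for a smooth approximation of the indicator function
  have hsmooth : ∀ j : ℕ, (∫ s, ramp j (s / a ^ 2) ∂τ) * b ^ k ≤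
      (∫ s, ramp j (s / b ^ 2) ∂τ) * a ^ k := by
    intro j
    let η := ramp j
    have hη := contDiff_ramp j
    have hηc : Continuous (deriv η) := hη.continuous_deriv (by simp)
    have hη1 : ∀ s, 1 < s → deriv η s = 0 := fun s hs => by
      have : η =ᶠ[𝓝 s] fun _ => 0 := by
        filter_upwards [isOpen_Ioi.mem_nhds hs] with r hr using ramp_eq_zero j (le_of_lt hr)
      rw [this.deriv_eq]
      simp
    have hη1' : ∀ s, 1 ≤ s → deriv η s = 0 := fun s hs => by
      rcases hs.eq_or_lt with rfl | hs
      · have h1 : Tendsto (deriv η) (𝓝[>] 1) (𝓝 (deriv η 1)) :=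
          hηc.continuousAt.tendsto.mono_left nhdsWithin_le_nhds
        exact tendsto_nhds_unique h1 (tendsto_const_nhds.congr'
          (by filter_upwards [self_mem_nhdsWithin] with r hr using (hη1 r hr).symm))
      · exact hη1 s hs
    obtain ⟨M, hM⟩ := (isCompact_Icc (a := (0 : ℝ)) (b := 1)).exists_bound_of_continuousOn
      hηc.continuousOn
    have hη' : ∀ s, deriv η s ≤ 0 := fun s => (antitone_ramp j).deriv_nonpos
    let φ : ℝ → ℝ := fun l => ∫ s, η (s / l) ∂τ
    have hφd : ∀ l, 0 < l → HasDerivAt φ (∫ s, -(s / l ^ 2) * deriv η (s / l) ∂τ) l := by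
      intro l hl
      have hM0 : 0 ≤ M := (norm_nonneg _).trans (hM 0 (left_mem_Icc.2 zero_le_one))
      refine (hasDerivAt_integral_of_dominated_loc_of_deriv_le
        (F := fun l s => η (s / l)) (F' := fun l s => -(s / l ^ 2) * deriv η (s / l))
        (bound := fun _ => 2 / l * M) (isOpen_Ioi.mem_nhds (half_lt_self hl)) ?_ ?_ ?_ ?_ ?_ ?_).2
      · exact Eventually.of_forall fun r =>
          (hη.continuous.comp (continuous_id.div_const r)).aestronglyMeasurable
      · refine hbound (hη.continuous.comp (continuous_id.div_const l)) l fun s hs => ?_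
        exact ramp_eq_zero j ((one_le_div hl).2 hs)
      · exact (Continuous.mul (by fun_prop)
          (hηc.comp (continuous_id.div_const l))).aestronglyMeasurable
      · filter_upwards [hτ0] with s hs r hr
        have hr0 : 0 < r := lt_trans (by linarith) hr
        by_cases hsr : s / r ≤ 1
        · rw [norm_mul, norm_neg]
          refine mul_le_mul ?_ (hM _ ⟨div_nonneg hs hr0.le, hsr⟩) (norm_nonneg _) (by positivity)
          rw [Real.norm_eq_abs, abs_of_nonneg (by positivity)]
          calc s / r ^ 2 = s / r / r := by rw [pow_two, div_div]
            _ ≤ 1 / r := by gcongr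
            _ ≤ 1 / (l / 2) := one_div_le_one_div_of_le (by linarith) (le_of_lt hr)
            _ = 2 / l := by field_simp
        · rw [hη1 _ (not_le.1 hsr), mul_zero, norm_zero]
          positivity
      · exact integrable_const _
      · refine Eventually.of_forall fun s r hr => ?_
        have hr0 : r ≠ 0 := (lt_trans (by linarith : (0 : ℝ) < l / 2) hr).ne'
        have h1 : HasDerivAt (fun r => s / r) (-(s / r ^ 2)) r := by
          refine ((hasDerivAt_inv hr0).const_mul s).congr_deriv ?_
          field_simp
        have h2 := HasDerivAt.comp r
          ((hη.differentiable (by simp) (s / r)).hasDerivAt) h1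
        rw [mul_comm] at h2
        exact h2
    have hineq : ∀ l, 0 < l → l ≤ b ^ 2 →
        k * φ l ≤ 2 * l * ∫ s, -(s / l ^ 2) * deriv η (s / l) ∂τ := by
      intro l hl hlb
      have hd : ∀ s, deriv (fun s => η (s / l)) s = deriv η (s / l) / l := fun s => by
        have h2 := HasDerivAt.comp s ((hη.differentiable (by simp) (s / l)).hasDerivAt)
          ((hasDerivAt_id s).div_const l)
        rw [show (fun s => η (s / l)) = η ∘ fun s => id s / l from rfl, h2.deriv]
        change deriv η (s / l) * (1 / l) = _
        ring
      have h1 := hle (fun s => η (s / l)) (hη.comp (contDiff_id.div_const l))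
        (fun s hs => ramp_eq_zero j ((one_le_div hl).2 (hlb.trans hs))) (fun s => ramp_nonneg j _)
        (fun s => by rw [hd]; exact div_nonpos_of_nonpos_of_nonneg (hη' _) hl.le)
      simp only [hd] at h1
      have hi1 : Integrable (fun s => n * (η (s / l) * (1 - κ * s))) τ :=
        hbound (continuous_const.mul ((hη.continuous.comp (continuous_id.div_const l)).mul
          (by fun_prop))) l fun s hs => by
            simp [η, ramp_eq_zero j ((one_le_div hl).2 hs)]
      have hi2 : Integrable (fun s => 2 * s * (deriv η (s / l) / l)) τ :=
        hbound (Continuous.mul (by fun_prop) ((hηc.comp (continuous_id.div_const l)).div_const l)) l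
          fun s hs => by rw [hη1' _ ((one_le_div hl).2 hs)]; simp
      have hi3 : Integrable (fun s => k * η (s / l)) τ :=
        hbound (continuous_const.mul (hη.continuous.comp (continuous_id.div_const l))) l
          fun s hs => by simp [η, ramp_eq_zero j ((one_le_div hl).2 hs)]
      rw [integral_add hi1 hi2] at h1
      have h2 : ∫ s, k * η (s / l) ∂τ ≤ ∫ s, n * (η (s / l) * (1 - κ * s)) ∂τ := by
        refine integral_mono hi3 hi1 fun s => ?_
        change k * η (s / l) ≤ n * (η (s / l) * (1 - κ * s))
        by_cases hs : s ≤ b ^ 2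
        · have h3 : κ * s ≤ κ * b ^ 2 := mul_le_mul_of_nonneg_left hs hκ
          have h4 : (0 : ℝ) ≤ n * η (s / l) := mul_nonneg (Nat.cast_nonneg n) (ramp_nonneg j _)
          rw [hk]
          nlinarith
        · have h3 : η (s / l) = 0 :=
            ramp_eq_zero j ((one_le_div hl).2 (hlb.trans (not_le.1 hs).le))
          rw [h3]
          simp
      have h3 : 2 * l * ∫ s, -(s / l ^ 2) * deriv η (s / l) ∂τ =
          -∫ s, 2 * s * (deriv η (s / l) / l) ∂τ := by
        rw [← integral_const_mul, ← integral_neg]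
        congr 1
        ext s
        field_simp
      rw [integral_const_mul] at h2
      rw [h3]
      linarith
    -- the quotient `φ l / l ^ (k / 2)` is monotone
    let w : ℝ → ℝ := fun l => φ l * l ^ (-(k / 2))
    have hwd : ∀ l, 0 < l → HasDerivAt w ((∫ s, -(s / l ^ 2) * deriv η (s / l) ∂τ) *
        l ^ (-(k / 2)) + φ l * (-(k / 2) * l ^ (-(k / 2) - 1))) l := fun l hl =>
      (hφd l hl).mul (Real.hasDerivAt_rpow_const (Or.inl hl.ne'))
    have ha2 : 0 < a ^ 2 := by positivity
    have hab2 : a ^ 2 ≤ b ^ 2 := by nlinarith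
    have hmono : MonotoneOn w (Icc (a ^ 2) (b ^ 2)) := by
      refine monotoneOn_of_deriv_nonneg (convex_Icc _ _)
        (fun l hl => (hwd l (ha2.trans_le hl.1)).continuousAt.continuousWithinAt) ?_ ?_
      · rw [interior_Icc]
        exact fun l hl => (hwd l (ha2.trans hl.1)).differentiableAt.differentiableWithinAt
      · rw [interior_Icc]
        intro l hl
        have hl0 := ha2.trans hl.1
        rw [(hwd l hl0).deriv, Real.rpow_sub_one hl0.ne']
        have h1 := hineq l hl0 hl.2.le
        have h2 : (∫ s, -(s / l ^ 2) * deriv η (s / l) ∂τ) * l ^ (-(k / 2)) +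
            φ l * (-(k / 2) * (l ^ (-(k / 2)) / l)) = l ^ (-(k / 2)) / (2 * l) *
            (2 * l * (∫ s, -(s / l ^ 2) * deriv η (s / l) ∂τ) - k * φ l) := by
          field_simp
          ring
        rw [h2]
        have h3 := Real.rpow_pos_of_pos hl0 (-(k / 2))
        exact mul_nonneg (by positivity) (by linarith)
    have h1 := hmono (left_mem_Icc.2 hab2) (right_mem_Icc.2 hab2) hab2
    have hpow : ∀ r : ℝ, 0 < r → (r ^ 2) ^ (-(k / 2)) = (r ^ k)⁻¹ := fun r hr => by
      rw [← Real.rpow_natCast, ← Real.rpow_mul hr.le, ← Real.rpow_neg hr.le]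
      congr 1
      push_cast
      ring
    simp only [w] at h1
    rw [hpow a ha, hpow b hb, ← div_eq_mul_inv, ← div_eq_mul_inv,
      div_le_div_iff₀ (Real.rpow_pos_of_pos ha k) (Real.rpow_pos_of_pos hb k)] at h1
    exact h1
  have hlim : ∀ r : ℝ, 0 < r →
      Tendsto (fun j => ∫ s, ramp j (s / r ^ 2) ∂τ) atTop (𝓝 (τ.real (Iio (r ^ 2)))) := by
    intro r hr
    have h1 : τ.real (Iio (r ^ 2)) = ∫ s, (Iio (1 : ℝ)).indicator 1 (s / r ^ 2) ∂τ := by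
      rw [← integral_indicator_one measurableSet_Iio]
      congr 1
      ext s
      simp only [indicator, mem_Iio, div_lt_one (pow_pos hr 2)]
      rfl
    rw [h1]
    refine tendsto_integral_of_dominated_convergence (fun _ => 1) (fun j => ?_)
      (integrable_const _) (fun j => ae_of_all _ fun s => ?_) (ae_of_all _ fun s => tendsto_ramp _)
    · exact ((contDiff_ramp j).continuous.comp (continuous_id.div_const _)).aestronglyMeasurable
    · rw [Real.norm_eq_abs, abs_of_nonneg (ramp_nonneg j _)]
      exact ramp_le_one j _
  exact le_of_tendsto_of_tendsto' ((hlim a ha).mul_const _) ((hlim b hb).mul_const _) hsmooth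

/-! ### Metric balls are geodesic balls -/

namespace RiemMetric.IsExpChart

variable {m : ℕ} {D : Set (Eu m)} {g : RiemMetric D} {p : Eu m} {ρ : ℝ}
  {Φ : OpenPartialHomeomorph (Eu m) (Eu m)}

/-- The open geodesic ball of radius `b` about the base point. -/
def openBall (g : RiemMetric D) (p : Eu m) (Φ : OpenPartialHomeomorph (Eu m) (Eu m)) (b : ℝ) :
    Set (Eu m) := Φ.target ∩ radSq g p Φ ⁻¹' Iio (b ^ 2)

theorem isOpen_openBall (h : g.IsExpChart p ρ Φ) (b : ℝ) : IsOpen (openBall g p Φ b) :=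
  h.contDiffOn_radSq.continuousOn.isOpen_inter_preimage Φ.open_target isOpen_Iio

theorem target_subset (h : g.IsExpChart p ρ Φ) : Φ.target ⊆ D := fun x hx => by
  rw [← Φ.right_inv hx]
  exact h.map_mem (Φ.map_target hx)

/-- The geodesic distance has a gradient of length one, by the Gauss lemma. -/
theorem fderiv_radSq_sq_le (h : g.IsExpChart p ρ Φ) (hρ : 0 < ρ) (hD : IsOpen D) {x : Eu m}
    (hx : x ∈ Φ.target) (u : Eu m) :
    fderiv ℝ (radSq g p Φ) x u ^ 2 ≤ 4 * radSq g p Φ x * g.inner x u u := by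
  obtain ⟨ξ, hξ, rfl⟩ : ∃ ξ ∈ Φ.source, Φ ξ = x := ⟨_, Φ.map_target hx, Φ.right_inv hx⟩
  have hq : radSq g p Φ (Φ ξ) = g.inner p ξ ξ := by rw [radSq, Φ.left_inv hξ]
  have hp : p ∈ D := h.base_mem hξ
  have hd := ((h.contDiffOn_radSq.contDiffAt (Φ.open_target.mem_nhds hx)).differentiableAt
    (by simp)).hasFDerivAt
  obtain ⟨v, rfl⟩ : ∃ v, fderiv ℝ Φ ξ v = u := by
    have h1 : HasFDerivAt Φ.symm (fderiv ℝ Φ.symm (Φ ξ)) (Φ ξ) :=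
      ((h.smooth_symm.contDiffAt (Φ.open_target.mem_nhds hx)).differentiableAt
        (by simp)).hasFDerivAt
    have h2 : HasFDerivAt Φ (fderiv ℝ Φ ξ) (Φ.symm (Φ ξ)) := by
      rw [Φ.left_inv hξ]; exact h.hasFDerivAt hξ
    have h3 := h2.comp (Φ ξ) h1
    have h4 : HasFDerivAt (Φ ∘ Φ.symm) (ContinuousLinearMap.id ℝ (Eu m)) (Φ ξ) := by
      refine (hasFDerivAt_id _).congr_of_eventuallyEq ?_
      filter_upwards [Φ.open_target.mem_nhds hx] with z hz using Φ.right_inv hz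
    exact ⟨fderiv ℝ Φ.symm (Φ ξ) u, DFunLike.congr_fun (h3.unique h4) u⟩
  have hqd : HasFDerivAt (fun y => g.inner p y y) (2 • g.inner p ξ) ξ := by
    refine ((g.inner p).hasFDerivAt.clm_apply (hasFDerivAt_id ξ)).congr_fderiv ?_
    ext w
    have := g.symm p hp w ξ
    simp [this]
    ring
  have h5 : HasFDerivAt (fun y => g.inner p y y) _ ξ :=
    (hd.comp ξ (h.hasFDerivAt hξ)).congr_of_eventuallyEq (by
      filter_upwards [Φ.open_source.mem_nhds hξ] with y hy
      simp [radSq, Φ.left_inv hy])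
  have h6 := DFunLike.congr_fun (hqd.unique h5) v
  have h7 : fderiv ℝ (radSq g p Φ) (Φ ξ) (fderiv ℝ Φ ξ v) = 2 * g.inner p ξ v := by
    simpa using h6.symm
  have h8 := (g.isInnerForm (h.map_mem hξ)).cauchy_schwarz (fderiv ℝ Φ ξ ξ) (fderiv ℝ Φ ξ v)
  rw [h.gauss hρ hD hξ, h.gauss hρ hD hξ] at h8
  rw [h7, hq]
  nlinarith

/-- A curve that starts at the base point and stays in a geodesic ball until time `t` is at least
as long as the geodesic distance at time `t`. -/
theorem le_length (h : g.IsExpChart p ρ Φ) (hρ : 0 < ρ) (hD : IsOpen D) {γ : ℝ → Eu m} {t : ℝ}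
    (ht : t ∈ Icc (0 : ℝ) 1) (hγ : ContDiffOn ℝ 1 γ (Icc 0 1)) (hγ0 : γ 0 = p)
    (hmaps : MapsTo γ (Icc 0 t) Φ.target) :
    ENNReal.ofReal (√(radSq g p Φ (γ t))) ≤ g.length γ := by
  have hrad0 : radSq g p Φ p = 0 := by
    rw [radSq, show Φ.symm p = 0 by
      rw [← h.map_zero hρ, Φ.left_inv (h.zero_mem hρ)]]
    simp
  have hradn : ∀ x ∈ Φ.target, 0 ≤ radSq g p Φ x := fun x hx =>
    (g.isInnerForm (h.base_mem (Φ.map_target hx))).nonneg _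
  -- the square root is regularized by `ε`
  have key : ∀ ε : ℝ, 0 < ε →
      ENNReal.ofReal (√(radSq g p Φ (γ t) + ε ^ 2) - ε) ≤ g.length γ := by
    intro ε hε
    let f : ℝ → ℝ := fun s => √(radSq g p Φ (γ s) + ε ^ 2)
    have hsub : Icc (0 : ℝ) t ⊆ Icc 0 1 := Icc_subset_Icc_right ht.2
    have hpos : ∀ s ∈ Icc (0 : ℝ) t, 0 < radSq g p Φ (γ s) + ε ^ 2 := fun s hs =>
      add_pos_of_nonneg_of_pos (hradn _ (hmaps hs)) (by positivity)
    have hf : ContDiffOn ℝ 1 f (Icc 0 t) := by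
      refine ContDiffOn.sqrt (ContDiffOn.add ?_ contDiffOn_const) fun s hs => (hpos s hs).ne'
      exact (h.contDiffOn_radSq.of_le (by simp)).comp (hγ.mono hsub) hmaps
    have h1 := enorm_sub_le_lintegral_deriv_of_contDiffOn_Icc hf ht.1
    have h2 : f 0 = ε := by simp only [f, hγ0, hrad0, zero_add, Real.sqrt_sq hε.le]
    rw [h2] at h1
    have h1' : ENNReal.ofReal (f t - ε) ≤ ‖f t - ε‖ₑ := by
      rw [← ofReal_norm]
      exact ENNReal.ofReal_le_ofReal (le_abs_self _)
    refine h1'.trans (h1.trans ?_)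
    rw [← setLIntegral_congr (Ioo_ae_eq_Icc (a := (0 : ℝ)) (b := t)), length]
    refine (setLIntegral_mono_ae' measurableSet_Ioo (ae_of_all _ fun s hs => ?_)).trans
      (lintegral_mono_set (Ioo_subset_Icc_self.trans hsub))
    have hs' := Ioo_subset_Icc_self hs
    have hγd : HasDerivAt γ (deriv γ s) s :=
      ((hγ.contDiffAt (Icc_mem_nhds hs.1 (hs.2.trans_le ht.2))).differentiableAt
        one_ne_zero).hasDerivAt
    have hxt := hmaps hs'
    have h3 := HasFDerivAt.comp_hasDerivAt (f := γ) s
      ((h.contDiffOn_radSq.contDiffAt (Φ.open_target.mem_nhds hxt)).differentiableAt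
        (by simp)).hasFDerivAt hγd
    have h4 := (h3.add_const (ε ^ 2)).sqrt (hpos s hs').ne'
    rw [show f = fun s => √((radSq g p Φ ∘ γ) s + ε ^ 2) from rfl, h4.deriv, ← ofReal_norm]
    refine ENNReal.ofReal_le_ofReal (Real.le_sqrt_of_sq_le ?_)
    have h5 := h.fderiv_radSq_sq_le hρ hD hxt (deriv γ s)
    have h6 := (g.isInnerForm (h.target_subset hxt)).nonneg (deriv γ s)
    have hp := hpos s hs'
    have hp' := hradn _ hxt
    rw [Real.norm_eq_abs, sq_abs, div_pow, mul_pow, Function.comp_apply, Real.sq_sqrt hp.le,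
      div_le_iff₀ (by positivity)]
    nlinarith [mul_nonneg h6 (sq_nonneg ε)]
  have hlim : Tendsto (fun ε : ℝ => ENNReal.ofReal (√(radSq g p Φ (γ t) + ε ^ 2) - ε)) (𝓝[>] 0)
      (𝓝 (ENNReal.ofReal (√(radSq g p Φ (γ t))))) := by
    have : Continuous fun ε : ℝ => ENNReal.ofReal (√(radSq g p Φ (γ t) + ε ^ 2) - ε) :=
      ENNReal.continuous_ofReal.comp (by fun_prop)
    have h1 := this.tendsto 0
    simp only [ne_eq, OfNat.ofNat_ne_zero, not_false_eq_true, zero_pow, add_zero, sub_zero] at h1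
    exact h1.mono_left nhdsWithin_le_nhds
  exact le_of_tendsto hlim (by filter_upwards [self_mem_nhdsWithin] with ε hε using key ε hε)

/-- Metric balls are geodesic balls. A curve that leaves the geodesic ball has at least the length
`r` when it first does so, and inside the ball the radial geodesics realize the distance. -/
theorem ball_eq (h : g.IsExpChart p ρ Φ) (hρ : 0 < ρ) (hD : IsOpen D) {r : ℝ} (hr : 0 < r)
    (hrρ : r < ρ) : g.ball p r = openBall g p Φ r := by
  have hp : p ∈ D := h.base_mem (h.zero_mem hρ)
  ext x
  constructor
  · rintro ⟨hxD, hx⟩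
    rw [edist] at hx
    simp only [iInf_lt_iff] at hx
    obtain ⟨γ, ⟨hγ, hγD, hγ0, hγ1⟩, hl⟩ := hx
    by_contra hxb
    -- the first time at which the curve leaves the ball
    let C : Set ℝ := Icc 0 1 ∩ γ ⁻¹' (openBall g p Φ r)ᶜ
    have hC : IsClosed C :=
      hγ.continuousOn.preimage_isClosed_of_isClosed isClosed_Icc (h.isOpen_openBall r).isClosed_compl
    have hCne : C.Nonempty := ⟨1, right_mem_Icc.2 zero_le_one, by
      rw [mem_preimage, hγ1]
      exact hxb⟩
    have hCb : BddBelow C := ⟨0, fun s hs => hs.1.1⟩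
    have ht := hC.csInf_mem hCne hCb
    set t := sInf C
    have hlt : ∀ s ∈ Ico (0 : ℝ) t, γ s ∈ closedBall g p Φ r := fun s hs => by
      have h1 : γ s ∈ openBall g p Φ r := by
        by_contra h2
        exact absurd (csInf_le hCb ⟨⟨hs.1, hs.2.le.trans ht.1.2⟩, h2⟩) (not_le.2 hs.2)
      exact (h.mem_closedBall_iff hr.le hrρ).2 ⟨h1.1, le_of_lt h1.2⟩
    have ht0 : 0 < t := by
      refine lt_of_le_of_ne ht.1.1 fun h0 => ht.2 ?_
      rw [← h0, hγ0, openBall]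
      refine ⟨?_, ?_⟩
      · rw [← h.map_zero hρ]
        exact Φ.map_source (h.zero_mem hρ)
      · rw [mem_preimage, radSq, show Φ.symm p = 0 by
          rw [← h.map_zero hρ, Φ.left_inv (h.zero_mem hρ)]]
        simpa using pow_pos hr 2
    have hγt : γ t ∈ closedBall g p Φ r := by
      have h1 : Tendsto γ (𝓝[<] t) (𝓝 (γ t)) :=
        (hγ.continuousOn t ht.1).tendsto.mono_left (nhdsWithin_le_of_mem (by
          filter_upwards [Ioo_mem_nhdsLT ht0] with s hs using ⟨hs.1.le, hs.2.le.trans ht.1.2⟩))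
      exact (h.isCompact_closedBall hp hr.le hrρ).isClosed.mem_of_tendsto h1 (by
        filter_upwards [Ioo_mem_nhdsLT ht0] with s hs using hlt s ⟨hs.1.le, hs.2⟩)
    have hmaps : MapsTo γ (Icc 0 t) Φ.target := fun s hs => by
      refine h.closedBall_subset hr.le hrρ ?_
      rcases hs.2.eq_or_lt with h1 | h1
      · rwa [h1]
      · exact hlt s ⟨hs.1, h1⟩
    have h1 := (h.le_length hρ hD ht.1 hγ hγ0 hmaps).trans_lt hl
    rw [ENNReal.ofReal_lt_ofReal_iff hr, Real.sqrt_lt' hr] at h1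
    exact ht.2 ⟨hmaps (right_mem_Icc.2 ht0.le), h1⟩
  · rintro ⟨hx, hxr⟩
    refine ⟨h.target_subset hx, ?_⟩
    obtain ⟨ξ, hξ, rfl⟩ : ∃ ξ ∈ Φ.source, Φ ξ = x := ⟨_, Φ.map_target hx, Φ.right_inv hx⟩
    rw [mem_preimage, radSq, Φ.left_inv hξ, mem_Iio] at hxr
    have hmaps : MapsTo (fun t : ℝ => t • ξ) (Icc 0 1) Φ.source := fun t ht => h.smul_mem hξ ht
    have hlen : g.length (fun t : ℝ => Φ (t • ξ)) = ENNReal.ofReal (√(g.inner p ξ ξ)) := by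
      rw [length, setLIntegral_congr_fun measurableSet_Icc (g := fun _ =>
        ENNReal.ofReal (√(g.inner p ξ ξ)))]
      · simp
      · intro t ht
        have h1 := HasFDerivAt.comp_hasDerivAt (f := fun t : ℝ => t • ξ) t
          (h.hasFDerivAt (hmaps ht)) ((hasDerivAt_id t).smul_const ξ)
        have h2 : deriv (fun t : ℝ => Φ (t • ξ)) t = fderiv ℝ Φ (t • ξ) ξ := by
          rw [one_smul] at h1
          exact h1.deriv
        simp only [h2]
        rw [h.speed_eq hρ hD hξ ht]
    have hle : g.edist p (Φ ξ) ≤ g.length (fun t : ℝ => Φ (t • ξ)) := by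
      refine iInf₂_le (fun t : ℝ => Φ (t • ξ))
        ⟨?_, fun t ht => h.map_mem (hmaps ht), ?_, ?_⟩
      · exact (h.smooth.of_le (by simp)).comp (contDiff_id.smul contDiff_const).contDiffOn hmaps
      · simp only [zero_smul, h.map_zero hρ]
      · simp only [one_smul]
    refine hle.trans_lt ?_
    rw [hlen, ENNReal.ofReal_lt_ofReal_iff hr, Real.sqrt_lt' hr]
    exact hxr

end RiemMetric.IsExpChart

/-! ### Monotonicity of the area ratio -/

namespace RiemMetric.IsExpChart

variable {n : ℕ} {D S : Set (Eu (n + 1))} {g : RiemMetric D} {p : Eu (n + 1)} {ρ : ℝ}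
  {Φ : OpenPartialHomeomorph (Eu (n + 1)) (Eu (n + 1))}

theorem openBall_subset_closedBall (h : g.IsExpChart p ρ Φ) {a b : ℝ} (ha : 0 ≤ a) (hab : a ≤ b)
    (hbρ : b < ρ) : openBall g p Φ a ⊆ closedBall g p Φ b := fun x hx =>
  (h.mem_closedBall_iff (ha.trans hab) hbρ).2 ⟨hx.1, (le_of_lt hx.2).trans (by gcongr)⟩

theorem closedBall_mono {a b : ℝ} (ha : 0 ≤ a) (hab : a ≤ b) :
    closedBall g p Φ a ⊆ closedBall g p Φ b :=
  image_mono fun v (hv : g.inner p v v ≤ a ^ 2) => hv.trans (by gcongr)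

theorem closedBall_subset_openBall (h : g.IsExpChart p ρ Φ) {a b : ℝ} (ha : 0 ≤ a) (hab : a < b)
    (haρ : a < ρ) : closedBall g p Φ a ⊆ openBall g p Φ b := fun x hx => by
  obtain ⟨h1, h2⟩ := (h.mem_closedBall_iff ha haρ).1 hx
  exact ⟨h1, lt_of_le_of_lt h2 (by gcongr)⟩

theorem hypVol_ball (h : g.IsExpChart p ρ Φ) (hρ : 0 < ρ) (hD : IsOpen D)
    {r : ℝ} (hr : 0 < r) (hrρ : r < ρ) :
    hypVol g S (g.ball p r) = surfMeasure g S (openBall g p Φ r) := by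
  rw [h.ball_eq hρ hD hr hrρ, hypVol_eq_surfMeasure _ _ _ (h.isOpen_openBall r).measurableSet]

theorem hypVol_ball_lt_top (h : g.IsExpChart p ρ Φ) (hρ : 0 < ρ) (hD : IsOpen D)
    (hS : IsHypersurface D S) {r : ℝ} (hr : 0 < r) (hrρ : r < ρ)
    (hrS : ∀ x ∈ S ∩ closedBall g p Φ r, IsInteriorPt S x) :
    hypVol g S (g.ball p r) < ⊤ := by
  have hp : p ∈ D := h.base_mem (h.zero_mem hρ)
  rw [h.hypVol_ball hρ hD hr hrρ]
  exact (measure_mono (h.openBall_subset_closedBall hr.le le_rfl hrρ)).trans_lt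
    (surfMeasure_lt_top hD g hS (h.isCompact_closedBall hp hr.le hrρ)
      ((h.closedBall_subset hr.le hrρ).trans h.target_subset) hrS)

/-- The monotonicity formula for balls of radius at most `b`, with the exponent `n (1 - κ b²)` in
place of `n`. -/
theorem hypVol_ball_mul_le (h : g.IsExpChart p ρ Φ) (hn : 1 ≤ n) (hρ : 0 < ρ) (hD : IsOpen D)
    {κ : ℝ} (hκ : 0 < κ)
    (hsec : ∀ x ∈ D, ∀ u v : Eu (n + 1), LinearIndependent ℝ ![u, v] → g.sec x u v ≤ κ)
    (hS : IsHypersurface D S) (hmin : IsAreaMinimizing g S) {a b : ℝ} (ha : 0 < a) (hab : a ≤ b)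
    (hbρ : b < ρ) (hbκ : κ * b ^ 2 ≤ 2) (hbS : ∀ x ∈ S ∩ closedBall g p Φ b, IsInteriorPt S x) :
    (hypVol g S (g.ball p a)).toReal * b ^ (n * (1 - κ * b ^ 2) : ℝ) ≤
      (hypVol g S (g.ball p b)).toReal * a ^ (n * (1 - κ * b ^ 2) : ℝ) := by
  have hb : 0 < b := ha.trans_le hab
  have hp : p ∈ D := h.base_mem (h.zero_mem hρ)
  have hK := h.isCompact_closedBall hp hb.le hbρ
  have hKt := h.closedBall_subset hb.le hbρ
  have hfin := surfMeasure_lt_top hD g hS hK (hKt.trans h.target_subset) hbS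
  have : IsFiniteMeasure ((surfMeasure g S).restrict (closedBall g p Φ b)) :=
    ⟨by rwa [Measure.restrict_apply_univ]⟩
  have hrm : AEMeasurable (radSq g p Φ) ((surfMeasure g S).restrict (closedBall g p Φ b)) :=
    (h.contDiffOn_radSq.continuousOn.mono hKt).aemeasurable hK.measurableSet
  let τ := ((surfMeasure g S).restrict (closedBall g p Φ b)).map (radSq g p Φ)
  have hτ : ∀ s, τ (Iio s) = surfMeasure g S (closedBall g p Φ b ∩ radSq g p Φ ⁻¹' Iio s) := by
    intro s
    rw [Measure.map_apply_of_aemeasurable hrm measurableSet_Iio,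
      Measure.restrict_apply' hK.measurableSet, inter_comm]
  have hV : ∀ r, 0 < r → r ≤ b → τ.real (Iio (r ^ 2)) = (hypVol g S (g.ball p r)).toReal := by
    intro r hr hrb
    rw [h.hypVol_ball hρ hD hr (hrb.trans_lt hbρ), measureReal_def, hτ]
    congr 2
    ext x
    constructor
    · exact fun hx => ⟨hKt hx.1, hx.2⟩
    · exact fun hx => ⟨h.openBall_subset_closedBall hr.le hrb hbρ hx, hx.2⟩
  rw [← hV a ha hab, ← hV b hb le_rfl]
  refine measure_Iio_mul_le ?_ hκ.le (fun η hη hηb hη0 hη' => integral_radial_le h hn hρ hD hκ hsec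
    hS hmin hb.le le_rfl hbρ hbκ hbS hη hηb hη0 hη') ha hab
  rw [hτ, show closedBall g p Φ b ∩ radSq g p Φ ⁻¹' Iio 0 = ∅ from ?_, measure_empty]
  rw [eq_empty_iff_forall_notMem]
  exact fun x hx => not_lt.2 ((g.isInnerForm hp).nonneg (Φ.symm x)) hx.2

theorem _root_.monoWeight_pos (n : ℕ) (κ : ℝ) {r : ℝ} (hr : 0 < r) : 0 < monoWeight n κ r :=
  mul_pos (pow_pos hr n) (Real.exp_pos _)

/-- Monotonicity of the area ratio. The exponent `n (1 - κ b²)` in `hypVol_ball_mul_le` differs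
from `n` by little enough for the exponential factor to make up for it when `b ≤ 2 a`: then
`(b / a) ^ (n κ b²) ≤ exp (n κ b² (b - a) / a)` and `κ b² ≤ √κ a`. Larger quotients are reached by
halving the radius repeatedly. -/
theorem areaRatio_le (h : g.IsExpChart p ρ Φ) (hn : 1 ≤ n) (hρ : 0 < ρ) (hD : IsOpen D)
    {κ : ℝ} (hκ : 0 < κ)
    (hsec : ∀ x ∈ D, ∀ u v : Eu (n + 1), LinearIndependent ℝ ![u, v] → g.sec x u v ≤ κ)
    (hS : IsHypersurface D S) (hmin : IsAreaMinimizing g S) {a b : ℝ} (ha : 0 < a) (hab : a ≤ b)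
    (hbρ : b < ρ) (hbκ : √κ * b ≤ 1 / 2)
    (hbS : ∀ x ∈ S ∩ closedBall g p Φ b, IsInteriorPt S x) :
    (hypVol g S (g.ball p a)).toReal / monoWeight n κ a ≤
      (hypVol g S (g.ball p b)).toReal / monoWeight n κ b := by
  have hsκ : 0 < √κ := Real.sqrt_pos.2 hκ
  have hnR : (1 : ℝ) ≤ n := by exact_mod_cast hn
  have step : ∀ b, a ≤ b → ∀ a', a ≤ a' → a' ≤ b → b ≤ 2 * a' → b < ρ → √κ * b ≤ 1 / 2 →
      (∀ x ∈ S ∩ closedBall g p Φ b, IsInteriorPt S x) →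
      (hypVol g S (g.ball p a')).toReal / monoWeight n κ a' ≤
        (hypVol g S (g.ball p b)).toReal / monoWeight n κ b := by
    intro b _ a ha' hab hba hbρ hbκ hbS
    replace ha : 0 < a := by linarith
    have hb : 0 < b := ha.trans_le hab
    have hκb : κ * b ^ 2 = (√κ * b) ^ 2 := by rw [mul_pow, Real.sq_sqrt hκ.le]
    have hsb : 0 < √κ * b := by positivity
    have h1 := h.hypVol_ball_mul_le hn hρ hD hκ hsec hS hmin ha hab hbρ (by rw [hκb]; nlinarith) hbS
    set k : ℝ := n * (1 - κ * b ^ 2) with hk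
    rw [div_le_div_iff₀ (monoWeight_pos n κ ha) (monoWeight_pos n κ hb)]
    have h2 : a ^ k * monoWeight n κ b ≤ b ^ k * monoWeight n κ a := by
      have h3 : (b / a) ^ (n * (κ * b ^ 2) : ℝ) ≤ Real.exp (√κ * n ^ 2 * (b - a)) := by
        have h4 : b / a ≤ Real.exp ((b - a) / a) := by
          have := Real.add_one_le_exp ((b - a) / a)
          have h5 : (b - a) / a + 1 = b / a := by
            field_simp
            ring
          rwa [h5] at this
        calc (b / a) ^ (n * (κ * b ^ 2) : ℝ)
            ≤ Real.exp ((b - a) / a) ^ (n * (κ * b ^ 2) : ℝ) :=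
              Real.rpow_le_rpow (by positivity) h4 (by positivity)
          _ = Real.exp ((b - a) / a * (n * (κ * b ^ 2))) := by rw [← Real.exp_mul]
          _ ≤ _ := by
            refine Real.exp_le_exp.2 ?_
            rw [div_mul_eq_mul_div, div_le_iff₀ ha, hκb]
            have h5 : (√κ * b) ^ 2 ≤ √κ * a := by nlinarith
            have h6 : (0 : ℝ) ≤ (b - a) * n := mul_nonneg (by linarith) (by linarith)
            calc (b - a) * (n * (√κ * b) ^ 2) = (b - a) * n * (√κ * b) ^ 2 := by ring
              _ ≤ (b - a) * n * (√κ * a) := mul_le_mul_of_nonneg_left h5 h6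
              _ ≤ (b - a) * n * (√κ * a) * n := le_mul_of_one_le_right (by positivity) hnR
              _ = _ := by ring
      have hbk : b ^ (n * (κ * b ^ 2) : ℝ) * b ^ k = b ^ n := by
        rw [← Real.rpow_add hb, hk, ← mul_add, add_sub_cancel, mul_one, Real.rpow_natCast]
      have hak : a ^ (n * (κ * b ^ 2) : ℝ) * a ^ k = a ^ n := by
        rw [← Real.rpow_add ha, hk, ← mul_add, add_sub_cancel, mul_one, Real.rpow_natCast]
      rw [Real.div_rpow hb.le ha.le, div_le_iff₀ (Real.rpow_pos_of_pos ha _)] at h3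
      rw [monoWeight, monoWeight, ← hbk, ← hak]
      have h7 : Real.exp (-√κ * n ^ 2 * a) =
          Real.exp (√κ * n ^ 2 * (b - a)) * Real.exp (-√κ * n ^ 2 * b) := by
        rw [← Real.exp_add]
        congr 1
        ring
      rw [h7]
      have h8 : 0 ≤ a ^ k * b ^ k * Real.exp (-√κ * n ^ 2 * b) := by positivity
      have h9 := mul_le_mul_of_nonneg_left h3 h8
      calc _ = a ^ k * b ^ k * Real.exp (-√κ * n ^ 2 * b) * b ^ (n * (κ * b ^ 2) : ℝ) := by ring
        _ ≤ _ := h9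
        _ = _ := by ring
    have hbk : 0 < b ^ k := Real.rpow_pos_of_pos hb k
    have h3 := mul_le_mul_of_nonneg_left h2
      (ENNReal.toReal_nonneg (a := hypVol g S (g.ball p b)))
    have h4 := mul_le_mul_of_nonneg_right h1 (monoWeight_pos n κ hb).le
    refine le_of_mul_le_mul_right ?_ hbk
    nlinarith
  have main : ∀ N : ℕ, ∀ b, a ≤ b → b ≤ 2 ^ N * a → b < ρ → √κ * b ≤ 1 / 2 →
      (∀ x ∈ S ∩ closedBall g p Φ b, IsInteriorPt S x) →
      (hypVol g S (g.ball p a)).toReal / monoWeight n κ a ≤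
        (hypVol g S (g.ball p b)).toReal / monoWeight n κ b := by
    intro N
    induction N with
    | zero =>
      intro b hab hba _ _ _
      rw [le_antisymm hab (by simpa using hba)]
    | succ N ih =>
      intro b hab hba hbρ hbκ hbS
      have hc : max a (b / 2) ≤ b := max_le hab (by linarith)
      refine (ih (max a (b / 2)) (le_max_left _ _) (max_le ?_ ?_) (hc.trans_lt hbρ)
        ((mul_le_mul_of_nonneg_left hc hsκ.le).trans hbκ) fun x hx => hbS x ⟨hx.1,
          closedBall_mono (ha.le.trans (le_max_left _ _)) hc hx.2⟩).trans
        (step b hab _ (le_max_left _ _) hc ?_ hbρ hbκ hbS)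
      · exact le_mul_of_one_le_left ha.le (one_le_pow₀ one_le_two)
      · rw [pow_succ] at hba
        linarith
      · have := le_max_right a (b / 2)
        linarith
  obtain ⟨N, hN⟩ := pow_unbounded_of_one_lt (b / a) one_lt_two
  exact main N b hab ((div_le_iff₀ ha).1 hN.le) hbρ hbκ hbS

end RiemMetric.IsExpChart

/-! ### The density at the centre -/

/-- An inner product pulled back by an injective linear map is Euclidean after a linear change of
coordinates, whose determinant is the area element. -/
theorem IsInnerForm.exists_linearMap_norm {n : ℕ} {V : Type*} [NormedAddCommGroup V]
    [NormedSpace ℝ V] {B : V →L[ℝ] V →L[ℝ] ℝ} (hB : IsInnerForm B) {L : Eu n →L[ℝ] V}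
    (hL : LinearIndependent ℝ fun i => L (stdVec i)) :
    ∃ T : Eu n →ₗ[ℝ] Eu n, LinearMap.det T ≠ 0 ∧ (∀ z, B (L z) (L z) = ‖T z‖ ^ 2) ∧
      √(gramOf B fun i => L (stdVec i)).det = |LinearMap.det T| := by
  obtain ⟨u, A, hA, hu, hLu, -⟩ := hB.exists_orthonormal hL
  have hdet : LinearMap.det (Matrix.toEuclideanLin A.transpose) = A.det := by
    rw [Matrix.toEuclideanLin_eq_toLin_orthonormal, LinearMap.det_toLin, Matrix.det_transpose]
  refine ⟨Matrix.toEuclideanLin A.transpose, ?_, fun z => ?_, ?_⟩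
  · rw [hdet]
    exact hA.ne_zero
  · have h1 : L z = ∑ j, (Matrix.toEuclideanLin A.transpose z) j • u j := by
      conv_lhs => rw [← sum_smul_stdVec z, map_sum]
      simp only [map_smul]
      have h2 : ∀ i, L (stdVec i) = ∑ j, A i j • u j := fun i => congrFun hLu i
      simp only [h2, Finset.smul_sum, smul_smul]
      rw [Finset.sum_comm]
      refine Finset.sum_congr rfl fun j _ => ?_
      rw [← Finset.sum_smul]
      congr 1
      simp [Matrix.toLpLin_apply, Matrix.mulVec, dotProduct, mul_comm]
    rw [h1, EuclideanSpace.norm_sq_eq]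
    have h3 : ∀ i j, B (u i) (u j) = if i = j then 1 else 0 := fun i j => by
      have := congrFun (congrFun hu i) j
      simpa [gramOf, Matrix.one_apply] using this
    simp [_root_.sum_apply, h3, pow_two]
  · rw [hLu, sqrt_det_gramOf_combo, hu, Matrix.det_one, Real.sqrt_one, mul_one, hdet]

/-- Blow-up of an integral over a family of small neighbourhoods of a point. After the substitution
`y = y₀ + r z`, the domains `Q < r²` converge to the ellipsoid `‖T z‖ < 1`. -/
theorem tendsto_setIntegral_div_pow {n : ℕ} {y₀ : Eu n} {J Q : Eu n → ℝ} {U : Set (Eu n)}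
    (hU : IsOpen U) (hy₀ : y₀ ∈ U) (hJ : ContinuousOn J U) (hQ : ContinuousOn Q U)
    {T : Eu n →ₗ[ℝ] Eu n} (hT : LinearMap.det T ≠ 0)
    (hlim : ∀ z, Tendsto (fun r : ℝ => Q (y₀ + r • z) / r ^ 2) (𝓝[>] 0) (𝓝 (‖T z‖ ^ 2)))
    {C : ℝ} (hC : ∀ᶠ r : ℝ in 𝓝[>] 0, ∀ y ∈ U, Q y < r ^ 2 → ‖y - y₀‖ ≤ C * r) :
    Tendsto (fun r : ℝ => (∫ y in U ∩ Q ⁻¹' Iio (r ^ 2), J y) / r ^ n) (𝓝[>] 0)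
      (𝓝 (J y₀ * (|(LinearMap.det T)⁻¹| * unitBallVol n))) := by
  let A : ℝ → Set (Eu n) := fun r => U ∩ Q ⁻¹' Iio (r ^ 2)
  have hAm : ∀ r, MeasurableSet (A r) := fun r =>
    (hQ.isOpen_inter_preimage hU isOpen_Iio).measurableSet
  have hAJ : ∀ r, AEStronglyMeasurable ((A r).indicator J) volume := fun r =>
    (aestronglyMeasurable_indicator_iff (hAm r)).2
      ((hJ.mono inter_subset_left).aestronglyMeasurable (hAm r))
  have hmv : ∀ r : ℝ, 0 < r → (∫ y in A r, J y) / r ^ n =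
      ∫ z, (A r).indicator J (y₀ + r • z) := by
    intro r hr
    rw [Measure.integral_comp_smul volume (fun z => (A r).indicator J (y₀ + z)) r,
      integral_add_left_eq_self, integral_indicator (hAm r), finrank_euclideanSpace_fin,
      abs_of_nonneg (by positivity), smul_eq_mul, div_eq_inv_mul]
  -- the limit as an integral
  have hTm : Continuous T := T.continuous_of_finiteDimensional
  have hI : J y₀ * (|(LinearMap.det T)⁻¹| * unitBallVol n) =
      ∫ z, (T ⁻¹' Metric.ball 0 1).indicator (fun _ => J y₀) z := by
    rw [integral_indicator (hTm.measurable Metric.isOpen_ball.measurableSet), setIntegral_const,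
      measureReal_def, Measure.addHaar_preimage_linearMap _ hT, ENNReal.toReal_mul,
      ENNReal.toReal_ofReal (abs_nonneg _), unitBallVol, measureReal_def, smul_eq_mul, mul_comm]
  rw [hI]
  have hnull : volume (T ⁻¹' Metric.sphere (0 : Eu n) 1) = 0 := by
    rw [Measure.addHaar_preimage_linearMap _ hT, Measure.addHaar_sphere_of_ne_zero _ _ one_ne_zero,
      mul_zero]
  obtain ⟨δ, hδ, M, hM⟩ : ∃ δ > 0, ∃ M, ∀ y ∈ Metric.ball y₀ δ, |J y| ≤ M := by
    have h1 : ∀ᶠ y in 𝓝 y₀, |J y| < |J y₀| + 1 :=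
      ((hJ.continuousAt (hU.mem_nhds hy₀)).abs).eventually_lt_const (by linarith)
    obtain ⟨δ, hδ, h⟩ := Metric.eventually_nhds_iff_ball.1 h1
    exact ⟨δ, hδ, _, fun y hy => (h y hy).le⟩
  have hM0 : 0 ≤ M := (abs_nonneg _).trans (hM y₀ (Metric.mem_ball_self hδ))
  have hmove : ∀ z : Eu n, Tendsto (fun r : ℝ => y₀ + r • z) (𝓝[>] 0) (𝓝 y₀) := fun z => by
    have h1 : Continuous fun r : ℝ => y₀ + r • z := by fun_prop
    have h2 := h1.tendsto 0
    simp only [zero_smul, add_zero] at h2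
    exact h2.mono_left nhdsWithin_le_nhds
  refine Tendsto.congr' (f₁ := fun r => ∫ z, (A r).indicator J (y₀ + r • z)) ?_ ?_
  · filter_upwards [self_mem_nhdsWithin] with r hr using (hmv r hr).symm
  refine tendsto_integral_filter_of_dominated_convergence
    (bound := (Metric.closedBall (0 : Eu n) C).indicator fun _ => M) ?_ ?_ ?_ ?_
  · filter_upwards [self_mem_nhdsWithin] with r hr
    have hr0 : r ≠ 0 := ne_of_gt hr
    exact (hAJ r).comp_quasiMeasurePreserving
      (((measurePreserving_add_left volume y₀).quasiMeasurePreserving).comp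
        (Measure.quasiMeasurePreserving_smul volume hr0))
  · have hsmall : ∀ᶠ r : ℝ in 𝓝[>] 0, C * r < δ := by
      have h1 : Tendsto (fun r : ℝ => C * r) (𝓝[>] 0) (𝓝 (C * 0)) :=
        (continuous_const.mul continuous_id).continuousAt.tendsto.mono_left nhdsWithin_le_nhds
      exact h1.eventually_lt_const (by simpa using hδ)
    filter_upwards [hC, hsmall, self_mem_nhdsWithin] with r hCr hrδ hr
    refine ae_of_all _ fun z => ?_
    by_cases hz : y₀ + r • z ∈ A r
    · have h1 := hCr _ hz.1 hz.2
      rw [add_sub_cancel_left] at h1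
      have h2 : z ∈ Metric.closedBall (0 : Eu n) C := by
        rw [norm_smul, Real.norm_eq_abs, abs_of_pos hr, mul_comm] at h1
        exact mem_closedBall_zero_iff.2 (le_of_mul_le_mul_right h1 hr)
      rw [indicator_of_mem hz, indicator_of_mem h2]
      refine hM _ ?_
      rw [Metric.mem_ball, dist_eq_norm, add_sub_cancel_left]
      exact h1.trans_lt hrδ
    · rw [indicator_of_notMem hz, norm_zero]
      exact indicator_nonneg (fun _ _ => hM0) _
  · exact (integrable_indicator_iff measurableSet_closedBall).2
      (integrableOn_const (isCompact_closedBall _ _).measure_lt_top.ne)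
  · -- pointwise convergence may fail on the boundary of the ellipsoid, which is a null set
    have h1 : ∀ᵐ z, z ∉ T ⁻¹' Metric.sphere (0 : Eu n) 1 := by
      rw [ae_iff]
      simp only [not_not]
      exact hnull
    filter_upwards [h1] with z hz
    have hUz := (hmove z).eventually (hU.mem_nhds hy₀)
    rw [mem_preimage, mem_sphere_zero_iff_norm] at hz
    rcases lt_or_gt_of_ne hz with hlt | hgt
    · rw [indicator_of_mem (show z ∈ T ⁻¹' Metric.ball 0 1 from mem_ball_zero_iff.2 hlt)]
      refine Tendsto.congr' (f₁ := fun r => J (y₀ + r • z)) ?_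
        ((hJ.continuousAt (hU.mem_nhds hy₀)).tendsto.comp (hmove z))
      have h2 := (hlim z).eventually_lt_const (show ‖T z‖ ^ 2 < 1 by
        nlinarith [norm_nonneg (T z)])
      filter_upwards [hUz, h2, self_mem_nhdsWithin] with r hr1 hr2 hr
      have hr' : 0 < r := hr
      rw [div_lt_one (by positivity)] at hr2
      exact (indicator_of_mem (show y₀ + r • z ∈ A r from ⟨hr1, hr2⟩) J).symm
    · rw [indicator_of_notMem (show z ∉ T ⁻¹' Metric.ball 0 1 from fun h =>
        not_lt.2 hgt.le (mem_ball_zero_iff.1 h))]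
      refine tendsto_const_nhds.congr' ?_
      have h2 := (hlim z).eventually_const_lt (show 1 < ‖T z‖ ^ 2 by nlinarith)
      filter_upwards [h2, self_mem_nhdsWithin] with r hr2 hr
      have hr' : 0 < r := hr
      rw [one_lt_div (by positivity)] at hr2
      exact (indicator_of_notMem (show y₀ + r • z ∉ A r from fun h => not_lt.2 hr2.le h.2) J).symm

namespace RiemMetric.IsExpChart

/-- The derivative of the exponential map at the origin is the identity. -/
theorem hasFDerivAt_zero {m : ℕ} {D : Set (Eu m)} {g : RiemMetric D} {p : Eu m} {ρ : ℝ}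
    {Φ : OpenPartialHomeomorph (Eu m) (Eu m)} (h : g.IsExpChart p ρ Φ) (hρ : 0 < ρ) :
    HasFDerivAt Φ (ContinuousLinearMap.id ℝ (Eu m)) 0 := by
  refine (h.hasFDerivAt (h.zero_mem hρ)).congr_fderiv ?_
  ext1 x
  have h1 : ∀ᶠ t : ℝ in 𝓝 0, t • x ∈ Φ.source := by
    have h2 : Continuous fun t : ℝ => t • x := by fun_prop
    refine h2.continuousAt.eventually (Φ.open_source.mem_nhds ?_)
    simpa using h.zero_mem hρ
  obtain ⟨t, ht, ht0⟩ := ((h1.filter_mono (nhdsWithin_le_nhds (s := {0}ᶜ))).and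
    self_mem_nhdsWithin).exists
  have h3 := h.fderiv_zero hρ ht
  rw [map_smul] at h3
  exact smul_right_injective _ ht0 h3

variable {n : ℕ} {D S : Set (Eu (n + 1))} {g : RiemMetric D} {p : Eu (n + 1)} {ρ : ℝ}
  {Φ : OpenPartialHomeomorph (Eu (n + 1)) (Eu (n + 1))}

/-- An interior point of a hypersurface has density one. The squared distance in a chart is
asymptotic to a quadratic form, namely the pull-back of the inner product at `p` to the tangent
space, since the exponential map has the identity as derivative. -/
theorem tendsto_hypVol_div_pow (h : g.IsExpChart p ρ Φ) (hρ : 0 < ρ) (hD : IsOpen D)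
    (hp : IsInteriorPt S p) :
    Tendsto (fun r : ℝ => (hypVol g S (g.ball p r)).toReal / r ^ n) (𝓝[>] 0)
      (𝓝 (unitBallVol n)) := by
  have hpD : p ∈ D := h.base_mem (h.zero_mem hρ)
  have hpt : p ∈ Φ.target := by
    rw [← h.map_zero hρ]
    exact Φ.map_source (h.zero_mem hρ)
  have hsp : Φ.symm p = 0 := by
    rw [← h.map_zero hρ, Φ.left_inv (h.zero_mem hρ)]
  have hB := g.isInnerForm hpD
  obtain ⟨c0, hc0⟩ := hp.exists_surfChart
  let c := c0.restr Φ.open_target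
  have hpc : p ∈ c.Ω := c0.mem_restr Φ.open_target hp.1 hc0 hpt
  have hct : c.Ω ⊆ Φ.target := (c0.restr_Ω_subset Φ.open_target).trans inter_subset_right
  have hcD : c.Ω ⊆ D := hct.trans h.target_subset
  let y₀ := c.χ p
  have hy₀ : y₀ ∈ c.U := c.mapsTo_χ hpc
  have hψ₀ : c.ψ y₀ = p := c.right_inv p ⟨hp.1, hpc⟩
  have hψΩ : ∀ y ∈ c.U, c.ψ y ∈ c.Ω := fun y hy => (c.mapsTo_ψ hy).2
  let L := fderiv ℝ c.ψ y₀
  have hLi : LinearIndependent ℝ fun i => L (stdVec i) := c.linearIndependent_partials hy₀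
  obtain ⟨T, hT, hTn, hTd⟩ := hB.exists_linearMap_norm hLi
  let ξ : Eu n → Eu (n + 1) := fun y => Φ.symm (c.ψ y)
  have hξ₀ : ξ y₀ = 0 := by simp only [ξ, hψ₀, hsp]
  have hξd : HasFDerivAt ξ L y₀ := by
    have h1 : HasFDerivAt Φ.symm (ContinuousLinearMap.id ℝ (Eu (n + 1))) (c.ψ y₀) := by
      rw [hψ₀]
      refine Φ.hasFDerivAt_symm (f' := ContinuousLinearEquiv.refl ℝ (Eu (n + 1))) hpt ?_
      rw [hsp]
      exact h.hasFDerivAt_zero hρ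
    exact h1.comp y₀ (c.hasFDerivAt_ψ hy₀)
  let J : Eu n → ℝ := areaElt (fun y => g.inner (c.ψ y)) c.ψ
  let Q : Eu n → ℝ := fun y => radSq g p Φ (c.ψ y)
  have hJ : ContinuousOn J c.U := c.continuousOn_areaElt g hcD
  have hJ0 : ∀ y, 0 ≤ J y := fun y => Real.sqrt_nonneg _
  have hQ : ContinuousOn Q c.U := h.contDiffOn_radSq.continuousOn.comp
    c.smooth_ψ.continuousOn fun y hy => hct (hψΩ y hy)
  obtain ⟨C, hC, hCq⟩ := hB.exists_norm_sq_le
  have hnorm : ∀ v r, 0 < r → g.inner p v v < r ^ 2 → ‖v‖ ≤ √C * r := fun v r hr hv => by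
    refine (abs_le_of_sq_le_sq' (b := √C * r) ?_ (by positivity)).2
    rw [mul_pow, Real.sq_sqrt hC.le]
    exact (hCq v).trans (mul_le_mul_of_nonneg_left hv.le hC.le)
  -- near the origin `χ ∘ Φ` is Lipschitz continuous
  have hF : ContDiffAt ℝ 1 (fun v => c.χ (Φ v)) 0 := by
    have h1 : ContDiffAt ℝ 1 Φ 0 :=
      (h.smooth.contDiffAt (Φ.open_source.mem_nhds (h.zero_mem hρ))).of_le (by simp)
    have h2 : ContDiffAt ℝ 1 c.χ (Φ 0) := by
      rw [h.map_zero hρ]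
      exact (c.smooth_χ.contDiffAt (c.isOpen_Ω.mem_nhds hpc)).of_le (by simp)
    exact h2.comp 0 h1
  obtain ⟨K, s, hs, hK⟩ := hF.exists_lipschitzOnWith
  have hΦΩ : ∀ᶠ v in 𝓝 (0 : Eu (n + 1)), v ∈ s ∧ v ∈ Φ ⁻¹' c.Ω := by
    refine (show ∀ᶠ v in 𝓝 0, v ∈ s from hs).and ?_
    have h1 := (h.hasFDerivAt (h.zero_mem hρ)).continuousAt
    refine h1.eventually (c.isOpen_Ω.mem_nhds ?_)
    rwa [h.map_zero hρ]
  obtain ⟨δ, hδ, hδs⟩ := Metric.eventually_nhds_iff_ball.1 hΦΩ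
  have hsmall : ∀ᶠ r : ℝ in 𝓝[>] 0, √C * r < δ := by
    have h1 : Tendsto (fun r : ℝ => √C * r) (𝓝[>] 0) (𝓝 (√C * 0)) :=
      (continuous_const.mul continuous_id).continuousAt.tendsto.mono_left nhdsWithin_le_nhds
    exact h1.eventually_lt_const (by simpa using hδ)
  have hlim : ∀ z, Tendsto (fun r : ℝ => Q (y₀ + r • z) / r ^ 2) (𝓝[>] 0) (𝓝 (‖T z‖ ^ 2)) := by
    intro z
    have h0 : HasFDerivAt ξ L (y₀ + (0 : ℝ) • z) := by rwa [zero_smul, add_zero]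
    have h1 := HasFDerivAt.comp_hasDerivAt (f := fun r : ℝ => y₀ + r • z) (0 : ℝ) h0
      (((hasDerivAt_id (0 : ℝ)).smul_const z).const_add y₀)
    rw [one_smul, hasDerivAt_iff_tendsto_slope_zero] at h1
    have h2 : Tendsto (fun r : ℝ => r⁻¹ • ξ (y₀ + r • z)) (𝓝[>] 0) (𝓝 (L z)) := by
      refine (h1.mono_left (nhdsWithin_mono _ fun r hr => ne_of_gt hr)).congr fun r => ?_
      simp [hξ₀]
    rw [← hTn z]
    refine (((continuous_normSq g p).tendsto (L z)).comp h2).congr' ?_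
    filter_upwards [self_mem_nhdsWithin] with r hr
    have hr' : r ≠ 0 := ne_of_gt hr
    simp only [Function.comp_apply, map_smul, _root_.smul_apply, smul_eq_mul, Q, radSq, ξ]
    field_simp
  have hdens : unitBallVol n = J y₀ * (|(LinearMap.det T)⁻¹| * unitBallVol n) := by
    have h1 : J y₀ = |LinearMap.det T| := by
      rw [← hTd]
      simp only [J, areaElt, hψ₀]
      rfl
    rw [h1, ← mul_assoc, ← abs_mul, mul_inv_cancel₀ hT, abs_one, one_mul]
  rw [hdens]
  refine (tendsto_setIntegral_div_pow c.isOpen_U hy₀ hJ hQ hT hlim (C := K * √C) ?_).congr' ?_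
  · filter_upwards [hsmall, self_mem_nhdsWithin] with r hrδ hr y hy hyr
    have h1 := hnorm _ r hr hyr
    have h2 := (hδs (Φ.symm (c.ψ y)) (mem_ball_zero_iff.2 (h1.trans_lt hrδ))).1
    have h3 := hK.dist_le_mul _ h2 _ (mem_of_mem_nhds hs)
    simp only [Φ.right_inv (hct (hψΩ y hy)), c.left_inv y hy, h.map_zero hρ] at h3
    rw [dist_eq_norm, dist_zero_right] at h3
    refine h3.trans ?_
    rw [mul_assoc]
    exact mul_le_mul_of_nonneg_left h1 K.2
  · have hrρ : ∀ᶠ r : ℝ in 𝓝[>] 0, r < ρ := nhdsWithin_le_nhds (gt_mem_nhds hρ)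
    filter_upwards [hsmall, hrρ, self_mem_nhdsWithin] with r hrδ hrρ hr
    have hsub : openBall g p Φ r ⊆ c.Ω := fun x hx => by
      have h1 := hnorm _ r hr hx.2
      have h2 := (hδs (Φ.symm x) (mem_ball_zero_iff.2 (h1.trans_lt hrδ))).2
      rwa [mem_preimage, Φ.right_inv hx.1] at h2
    rw [h.hypVol_ball hρ hD hr hrρ,
      c.lintegral_surfMeasure g hcD (h.isOpen_openBall r).measurableSet hsub]
    have hset : c.U ∩ c.ψ ⁻¹' openBall g p Φ r = c.U ∩ Q ⁻¹' Iio (r ^ 2) := by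
      ext y
      exact ⟨fun hy => ⟨hy.1, hy.2.2⟩, fun hy => ⟨hy.1, hct (hψΩ y hy.1), hy.2⟩⟩
    rw [hset, integral_eq_lintegral_of_nonneg_ae (ae_of_all _ hJ0)
      ((hJ.mono inter_subset_left).aestronglyMeasurable
        (hQ.isOpen_inter_preimage c.isOpen_U isOpen_Iio).measurableSet)]

end RiemMetric.IsExpChart

/-! ### Smooth second order equations with small initial velocity -/

/-- The inverse function theorem, with an inverse that is smooth on an open set. -/
theorem exists_openPartialHomeomorph_of_contDiffOn {F : Type*} [NormedAddCommGroup F]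
    [NormedSpace ℝ F] [CompleteSpace F] {f : F → F} {O : Set F} (hO : IsOpen O)
    (hf : ContDiffOn ℝ ∞ f O) {a : F} (ha : a ∈ O)
    (hfa : HasFDerivAt f (ContinuousLinearMap.id ℝ F) a) :
    ∃ Ψ : OpenPartialHomeomorph F F, a ∈ Ψ.source ∧ Ψ.source ⊆ O ∧ ⇑Ψ = f ∧
      ContDiffOn ℝ ∞ Ψ.symm Ψ.target := by
  have hfa' : HasFDerivAt f ((ContinuousLinearEquiv.refl ℝ F : F ≃L[ℝ] F) : F →L[ℝ] F) a := hfa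
  have hfc : ContDiffAt ℝ ∞ f a := hf.contDiffAt (hO.mem_nhds ha)
  let Ψ₀ := hfc.toOpenPartialHomeomorph f hfa' (by simp)
  have haΨ : a ∈ Ψ₀.source := hfc.mem_toOpenPartialHomeomorph_source hfa' (by simp)
  have hΨ₀ : ⇑Ψ₀ = f := rfl
  let N : Set F := O ∩ fderiv ℝ f ⁻¹' interior (range ((↑) : (F ≃L[ℝ] F) → F →L[ℝ] F))
  have hN : IsOpen N :=
    (hf.continuousOn_fderiv_of_isOpen hO (by simp)).isOpen_inter_preimage hO isOpen_interior
  have haN : a ∈ N := by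
    refine ⟨ha, mem_interior_iff_mem_nhds.2 ?_⟩
    rw [hfa'.fderiv]
    exact ContinuousLinearEquiv.nhds _
  refine ⟨Ψ₀.restrOpen N hN, ⟨haΨ, haN⟩, fun x hx => hx.2.1, hΨ₀, fun y hy => ?_⟩
  have hx : (Ψ₀.restrOpen N hN).symm y ∈ (Ψ₀.restrOpen N hN).source :=
    (Ψ₀.restrOpen N hN).map_target hy
  obtain ⟨e, he⟩ := interior_subset hx.2.2
  have hcx : ContDiffAt ℝ ∞ f ((Ψ₀.restrOpen N hN).symm y) :=
    hf.contDiffAt (hO.mem_nhds hx.2.1)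
  refine ((Ψ₀.restrOpen N hN).contDiffAt_symm (f₀' := e) hy ?_ hcx).contDiffWithinAt
  rw [he]
  exact (hcx.differentiableAt (by simp)).hasFDerivAt

section Nemytskii

variable {K : Type*} [TopologicalSpace K] [CompactSpace K]
  {E F : Type*} [NormedAddCommGroup E] [NormedSpace ℝ E] [NormedAddCommGroup F] [NormedSpace ℝ F]

/-- Pointwise application of operator-valued functions, as a bilinear map. -/
def clmApply (K : Type*) [TopologicalSpace K] [CompactSpace K] (E F : Type*)
    [NormedAddCommGroup E] [NormedSpace ℝ E] [NormedAddCommGroup F] [NormedSpace ℝ F] :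
    C(K, E →L[ℝ] F) →L[ℝ] C(K, E) →L[ℝ] C(K, F) :=
  LinearMap.mkContinuous₂
    (LinearMap.mk₂ ℝ (fun (A : C(K, E →L[ℝ] F)) (h : C(K, E)) =>
      (⟨fun t => A t (h t), A.continuous.clm_apply h.continuous⟩ : C(K, F)))
      (fun _ _ _ => rfl) (fun _ _ _ => rfl) (fun A _ _ => by ext t; exact map_add (A t) _ _)
      (fun c A _ => by ext t; exact map_smul (A t) c _)) 1
    fun A h => by
      rw [one_mul]
      refine (ContinuousMap.norm_le _ (by positivity)).2 fun t => ?_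
      exact ((A t).le_opNorm _).trans
        (mul_le_mul (A.norm_coe_le_norm t) (h.norm_coe_le_norm t) (norm_nonneg _) (norm_nonneg A))

theorem contDiff_clmApply {k : WithTop ℕ∞} : ContDiff ℝ k (clmApply K E F) :=
  ContinuousLinearMap.contDiff (𝕜 := ℝ) (E := C(K, E →L[ℝ] F)) (F := C(K, E) →L[ℝ] C(K, F))
    (n := k) (clmApply K E F)

/-- The derivative of composition on the left is pointwise application of `f'`. The remainder is
estimated uniformly by the mean value inequality, since `f'` is uniformly continuous near the
compact image of `γ`. -/
theorem hasFDerivAt_comp_left {f : C(E, F)} {f' : C(E, E →L[ℝ] F)}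
    (hf : ∀ x, HasFDerivAt f (f' x) x) (γ : C(K, E)) :
    HasFDerivAt (fun γ : C(K, E) => f.comp γ) (clmApply K E F (f'.comp γ)) γ := by
  rw [hasFDerivAt_iff_isLittleO_nhds_zero, Asymptotics.isLittleO_iff]
  intro ε hε
  obtain ⟨δ, hδ, h⟩ := (Metric.continuousAt_iff (α := C(K, E)) (β := C(K, E →L[ℝ] F))
    (f := fun γ => f'.comp γ) (a := γ)).1
    (ContinuousMap.continuous_postcomp f').continuousAt ε hε
  filter_upwards [Metric.ball_mem_nhds (0 : C(K, E)) hδ] with η hη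
  rw [mem_ball_zero_iff] at hη
  refine (ContinuousMap.norm_le _ (by positivity)).2 fun t => ?_
  -- the mean value inequality on the segment from `γ t` to `γ t + η t`
  have h1 : ∀ x ∈ segment ℝ (γ t) (γ t + η t), ‖f' x - f' (γ t)‖ ≤ ε := by
    rintro x hx
    rw [segment_eq_image'] at hx
    obtain ⟨s, hs, rfl⟩ := hx
    have h2 : dist (γ + s • η) γ < δ := by
      rw [dist_eq_norm, add_sub_cancel_left, norm_smul, Real.norm_eq_abs, abs_of_nonneg hs.1]
      exact (mul_le_of_le_one_left (norm_nonneg _) hs.2).trans_lt hη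
    have h3 := ((ContinuousMap.norm_coe_le_norm _ t).trans_lt
      ((dist_eq_norm _ _).symm.trans_lt (h h2))).le
    have h4 : γ t + s • (γ t + η t - γ t) = (γ + s • η) t := by simp
    change ‖f' (γ t + s • (γ t + η t - γ t)) - f' (γ t)‖ ≤ ε
    rw [h4]
    exact h3
  have h2 := (convex_segment (γ t) (γ t + η t)).norm_image_sub_le_of_norm_hasFDerivWithin_le'
    (fun x _ => (hf x).hasFDerivWithinAt) h1 (left_mem_segment ℝ _ _) (right_mem_segment ℝ _ _)
  rw [add_sub_cancel_left] at h2
  exact h2.trans (mul_le_mul_of_nonneg_left (η.norm_coe_le_norm t) hε.le)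

end Nemytskii

/-- Composition on the left with a smooth function is smooth, as an operator between spaces of
continuous functions. -/
theorem contDiff_comp_left.{u, v} {K : Type v} [TopologicalSpace K] [CompactSpace K] {E F : Type u}
    [NormedAddCommGroup E] [NormedSpace ℝ E] [NormedAddCommGroup F] [NormedSpace ℝ F] (f : C(E, F))
    (hf : ContDiff ℝ ∞ f) : ContDiff ℝ ∞ fun γ : C(K, E) => f.comp γ := by
  have key : ∀ (k : ℕ) {F : Type u} [NormedAddCommGroup F] [NormedSpace ℝ F] (f : C(E, F)),
      ContDiff ℝ ∞ f → ContDiff ℝ k fun γ : C(K, E) => f.comp γ := by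
    intro k
    induction k with
    | zero =>
      intro F _ _ f _
      exact contDiff_zero.2 (ContinuousMap.continuous_postcomp f)
    | succ k ih =>
      intro F _ _ f hf
      let f' : C(E, E →L[ℝ] F) := ⟨fderiv ℝ f, hf.continuous_fderiv (by simp)⟩
      have hf' : ContDiff ℝ ∞ f' := hf.fderiv_right (by simp)
      refine contDiff_succ_iff_hasFDerivAt.2 ⟨fun γ => clmApply K E F (f'.comp γ),
        ContDiff.comp (g := clmApply K E F) contDiff_clmApply (ih f' hf'),
        hasFDerivAt_comp_left fun x => ?_⟩
      exact (hf.differentiable (by simp) x).hasFDerivAt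
  exact contDiff_infty.2 fun k => key k f hf

section Integration

variable {E : Type*} [NormedAddCommGroup E] [NormedSpace ℝ E]

/-- The interval `[-1, 1]`. -/
abbrev SymmInterval : Type := Icc (-1 : ℝ) 1

/-- The extension of a function on `[-1, 1]` that is constant on both sides. -/
def extendSymm (a : C(SymmInterval, E)) : ℝ → E := IccExtend (by norm_num : (-1 : ℝ) ≤ 1) a

theorem continuous_extendSymm (a : C(SymmInterval, E)) : Continuous (extendSymm a) :=
  a.continuous.Icc_extend'

theorem extendSymm_coe (a : C(SymmInterval, E)) (t : SymmInterval) : extendSymm a t = a t :=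
  IccExtend_val _ _ t

theorem norm_extendSymm_le (a : C(SymmInterval, E)) (t : ℝ) : ‖extendSymm a t‖ ≤ ‖a‖ :=
  a.norm_coe_le_norm _

/-- The operator `a ↦ ∫₀ᵗ a`. -/
def primitive (E : Type*) [NormedAddCommGroup E] [NormedSpace ℝ E] :
    C(SymmInterval, E) →L[ℝ] C(SymmInterval, E) :=
  LinearMap.mkContinuous
    { toFun := fun a => ⟨fun t => ∫ s in (0 : ℝ)..t, extendSymm a s,
        (intervalIntegral.continuous_primitive
          (fun _ _ => (continuous_extendSymm a).intervalIntegrable _ _) 0).comp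
          continuous_subtype_val⟩
      map_add' := fun a b => by
        ext t
        exact intervalIntegral.integral_add ((continuous_extendSymm a).intervalIntegrable _ _)
          ((continuous_extendSymm b).intervalIntegrable _ _)
      map_smul' := fun c a => by
        ext t
        exact intervalIntegral.integral_smul c _ } 1
    fun a => by
      rw [one_mul]
      refine (ContinuousMap.norm_le _ (norm_nonneg a)).2 fun t => ?_
      refine (intervalIntegral.norm_integral_le_of_norm_le_const fun s _ =>
        norm_extendSymm_le a s).trans (mul_le_of_le_one_right (norm_nonneg a) ?_)
      rw [sub_zero]
      exact abs_le.2 t.2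

theorem contDiff_primitive : ContDiff ℝ ∞ (primitive E) :=
  ContinuousLinearMap.contDiff (E := C(SymmInterval, E)) (F := C(SymmInterval, E)) (primitive E)

theorem norm_primitive_le (a : C(SymmInterval, E)) : ‖primitive E a‖ ≤ ‖a‖ := by
  have h : ‖primitive E‖ ≤ 1 := LinearMap.mkContinuous_norm_le _ zero_le_one _
  exact ((primitive E).le_opNorm a).trans (mul_le_of_le_one_left (norm_nonneg a) h)

/-- Constant functions, as a linear map. -/
def constMap (E : Type*) [NormedAddCommGroup E] [NormedSpace ℝ E] :
    E →L[ℝ] C(SymmInterval, E) :=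
  LinearMap.mkContinuous
    { toFun := fun v => ContinuousMap.const _ v
      map_add' := fun _ _ => rfl
      map_smul' := fun _ _ => rfl } 1
    fun v => by
      rw [one_mul]
      exact (ContinuousMap.norm_le _ (norm_nonneg v)).2 fun t => le_rfl

theorem constMap_apply (v : E) (t : SymmInterval) : constMap E v t = v := rfl

/-- The function `t ↦ a (c t)`, where `|c| ≤ 1`. -/
def rescale (c : SymmInterval) (a : C(SymmInterval, E)) : C(SymmInterval, E) :=
  a.comp ⟨fun t => ⟨c * t, abs_le.1 (by
    rw [abs_mul]
    exact mul_le_one₀ (abs_le.2 c.2) (abs_nonneg _) (abs_le.2 t.2))⟩, by fun_prop⟩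

theorem extendSymm_rescale (c : SymmInterval) (a : C(SymmInterval, E)) {t : ℝ}
    (ht : t ∈ Icc (-1 : ℝ) 1) : extendSymm (rescale c a) t = extendSymm a (c * t) := by
  have h : (c : ℝ) * t ∈ Icc (-1 : ℝ) 1 := abs_le.1 (by
    rw [abs_mul]
    exact mul_le_one₀ (abs_le.2 c.2) (abs_nonneg _) (abs_le.2 ht))
  rw [extendSymm_coe _ ⟨t, ht⟩, extendSymm_coe a ⟨_, h⟩]
  rfl

/-- Substitution in the integral. -/
theorem primitive_rescale (c : SymmInterval) (a : C(SymmInterval, E)) :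
    (c : ℝ) • primitive E (rescale c a) = rescale c (primitive E a) := by
  ext t
  change (c : ℝ) • ∫ s in (0 : ℝ)..t, extendSymm (rescale c a) s =
    ∫ s in (0 : ℝ)..(c * t : ℝ), extendSymm a s
  rw [intervalIntegral.integral_congr (g := fun s => extendSymm a (c * s)),
    intervalIntegral.smul_integral_comp_mul_left, mul_zero]
  intro s hs
  exact extendSymm_rescale c a (uIcc_subset_Icc ⟨by norm_num, by norm_num⟩ t.2 hs)

theorem hasDerivAt_primitive [CompleteSpace E] (a : C(SymmInterval, E)) (t : ℝ) :
    HasDerivAt (fun t => ∫ s in (0 : ℝ)..t, extendSymm a s) (extendSymm a t) t :=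
  intervalIntegral.integral_hasDerivAt_right ((continuous_extendSymm a).intervalIntegrable _ _)
    ((continuous_extendSymm a).stronglyMeasurableAtFilter _ _)
    (continuous_extendSymm a).continuousAt

end Integration

section SecondOrder

variable {E : Type*} [NormedAddCommGroup E] [NormedSpace ℝ E]

/-- The velocity `t ↦ v + ∫₀ᵗ a` of a curve with initial velocity `v` and acceleration `a`. -/
def velocity (E : Type*) [NormedAddCommGroup E] [NormedSpace ℝ E] :
    E × C(SymmInterval, E) →L[ℝ] C(SymmInterval, E) :=
  (constMap E).comp (ContinuousLinearMap.fst ℝ _ _) +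
    (primitive E).comp (ContinuousLinearMap.snd ℝ _ _)

theorem contDiff_velocity : ContDiff ℝ ∞ (velocity E) :=
  ContinuousLinearMap.contDiff (E := E × C(SymmInterval, E)) (F := C(SymmInterval, E)) (velocity E)

theorem velocity_apply (z : E × C(SymmInterval, E)) :
    velocity E z = constMap E z.1 + primitive E z.2 := rfl

/-- The position of a curve with initial position `p`. -/
def position (p : E) (z : E × C(SymmInterval, E)) : C(SymmInterval, E) :=
  constMap E p + primitive E (velocity E z)

/-- The function `t ↦ Γ(x; w, w)` along a curve with position `x` and velocity `w`. -/
def connectionTerm (Γ : C(E, E →L[ℝ] E →L[ℝ] E)) (p : E) (z : E × C(SymmInterval, E)) :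
    C(SymmInterval, E) :=
  clmApply _ _ _ (clmApply _ _ _ (Γ.comp (position p z)) (velocity E z)) (velocity E z)

theorem connectionTerm_apply (Γ : C(E, E →L[ℝ] E →L[ℝ] E)) (p : E) (z : E × C(SymmInterval, E))
    (t : SymmInterval) : connectionTerm Γ p z t =
      Γ (position p z t) (velocity E z t) (velocity E z t) := rfl

theorem contDiff_position (p : E) : ContDiff ℝ ∞ (position p) :=
  contDiff_const.add (contDiff_primitive.comp contDiff_velocity)

theorem contDiff_clmApply_comp_position.{u} {E G : Type u} [NormedAddCommGroup E] [NormedSpace ℝ E]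
    [NormedAddCommGroup G] [NormedSpace ℝ G] {Γ : C(E, E →L[ℝ] G)} (hΓ : ContDiff ℝ ∞ Γ) (p : E) :
    ContDiff ℝ ∞ fun z : E × C(SymmInterval, E) =>
      clmApply _ _ _ (Γ.comp (position p z)) (velocity E z) := by
  have h1 : ContDiff ℝ ∞ fun z : E × C(SymmInterval, E) => Γ.comp (position p z) :=
    (contDiff_comp_left Γ hΓ).comp (contDiff_position p)
  exact (ContDiff.comp (g := clmApply SymmInterval E G) contDiff_clmApply h1).clm_apply
    contDiff_velocity

theorem contDiff_connectionTerm_fst {Γ : C(E, E →L[ℝ] E →L[ℝ] E)} (hΓ : ContDiff ℝ ∞ Γ) (p : E) :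
    ContDiff ℝ ∞ fun z : E × C(SymmInterval, E) =>
      clmApply _ _ _ (clmApply _ _ _ (Γ.comp (position p z)) (velocity E z)) :=
  ContDiff.comp (g := clmApply SymmInterval E E) contDiff_clmApply
    (contDiff_clmApply_comp_position (G := E →L[ℝ] E) hΓ p)

theorem contDiff_connectionTerm {Γ : C(E, E →L[ℝ] E →L[ℝ] E)} (hΓ : ContDiff ℝ ∞ Γ) (p : E) :
    ContDiff ℝ ∞ (connectionTerm Γ p) :=
  (contDiff_connectionTerm_fst hΓ p).clm_apply contDiff_velocity

/-- The connection term is quadratic in the velocity, so that its derivative at a curve at rest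
vanishes. -/
theorem hasFDerivAt_connectionTerm {Γ : C(E, E →L[ℝ] E →L[ℝ] E)} (hΓ : ContDiff ℝ ∞ Γ) (p : E) :
    HasFDerivAt (connectionTerm Γ p) (0 : E × C(SymmInterval, E) →L[ℝ] C(SymmInterval, E)) 0 := by
  have h1 := ((contDiff_connectionTerm_fst hΓ p).differentiable (by simp) 0).hasFDerivAt
  have h2 := h1.clm_apply (velocity E).hasFDerivAt
  refine h2.congr_fderiv ?_
  refine ContinuousLinearMap.ext fun z => ?_
  simp

variable {p : E} {Γ : C(E, E →L[ℝ] E →L[ℝ] E)}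

theorem rescale_add (c : SymmInterval) (a b : C(SymmInterval, E)) :
    rescale c (a + b) = rescale c a + rescale c b := rfl

/-- Slowing down a curve `x` to `x (c t)` multiplies velocities by `c` and accelerations by `c²`. -/
theorem velocity_rescale (c : SymmInterval) (v : E) (a : C(SymmInterval, E)) :
    velocity E ((c : ℝ) • v, (c : ℝ) ^ 2 • rescale c a) = (c : ℝ) • rescale c (velocity E (v, a)) := by
  rw [velocity_apply, velocity_apply, map_smul, pow_two, mul_smul, map_smul, map_smul,
    primitive_rescale, rescale_add, ← smul_add]
  rfl

theorem position_rescale (c : SymmInterval) (v : E) (a : C(SymmInterval, E)) :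
    position p ((c : ℝ) • v, (c : ℝ) ^ 2 • rescale c a) = rescale c (position p (v, a)) := by
  rw [position, position, velocity_rescale, map_smul, primitive_rescale, rescale_add]
  rfl

/-- The connection term scales like the acceleration, because it is quadratic in the velocity. This
is the reason for the homogeneity of the geodesic equation. -/
theorem connectionTerm_rescale (c : SymmInterval) (v : E) (a : C(SymmInterval, E)) :
    connectionTerm Γ p ((c : ℝ) • v, (c : ℝ) ^ 2 • rescale c a) =
      (c : ℝ) ^ 2 • rescale c (connectionTerm Γ p (v, a)) := by
  ext1 t
  rw [connectionTerm_apply, position_rescale, velocity_rescale]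
  simp only [ContinuousMap.smul_apply, map_smul, _root_.smul_apply, smul_smul, pow_two]
  rfl

/-- The accelerations of the solutions of `x'' + Γ(x; x', x') = 0` that start at `p` with small
velocities, by the inverse function theorem in the space of continuous functions. It is applied to
`(v, a) ↦ (v, a + Γ(x; x', x'))`, whose derivative at zero is the identity. -/
theorem exists_acceleration [CompleteSpace E] (hΓ : ContDiff ℝ ∞ Γ) (p : E) {ε : ℝ} (hε : 0 < ε) :
    ∃ δ > 0, ∃ A : E → C(SymmInterval, E), ContDiffOn ℝ ∞ A (Metric.ball 0 δ) ∧
      ∀ v ∈ Metric.ball (0 : E) δ, A v + connectionTerm Γ p (v, A v) = 0 ∧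
        (∀ t, ‖position p (v, A v) t - p‖ < ε) ∧
        ∀ c : SymmInterval, A ((c : ℝ) • v) = (c : ℝ) ^ 2 • rescale c (A v) := by
  let H : E × C(SymmInterval, E) → E × C(SymmInterval, E) := fun z =>
    (z.1, z.2 + connectionTerm Γ p z)
  have hH : ContDiff ℝ ∞ H := contDiff_fst.prodMk (contDiff_snd.add (contDiff_connectionTerm hΓ p))
  have hH' : HasFDerivAt H (ContinuousLinearMap.id ℝ (E × C(SymmInterval, E))) 0 := by
    refine (hasFDerivAt_fst.prodMk
      (hasFDerivAt_snd.add (hasFDerivAt_connectionTerm hΓ p))).congr_fderiv ?_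
    refine ContinuousLinearMap.ext fun z => ?_
    simp
  obtain ⟨Ψ, h0Ψ, -, hΨ, hΨs⟩ :=
    exists_openPartialHomeomorph_of_contDiffOn isOpen_univ hH.contDiffOn (mem_univ 0) hH'
  have hH0 : Ψ 0 = 0 := by
    rw [hΨ]
    have h1 : connectionTerm Γ p 0 = 0 := by
      rw [connectionTerm, map_zero, map_zero]
    simp only [H, h1]
    simp
  have h0t : (0 : E × C(SymmInterval, E)) ∈ Ψ.target := hH0 ▸ Ψ.map_source h0Ψ
  obtain ⟨ε₁, hε₁, hball⟩ := Metric.isOpen_iff.1 Ψ.open_source 0 h0Ψ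
  have hι : Continuous fun v : E => (v, (0 : C(SymmInterval, E))) := by fun_prop
  have hsmall : ∀ᶠ v in 𝓝 (0 : E), ((v, (0 : C(SymmInterval, E))) ∈ Ψ.target) ∧
      Ψ.symm (v, 0) ∈ Metric.ball 0 (min ε₁ (ε / 2)) := by
    refine (hι.continuousAt.eventually (Ψ.open_target.mem_nhds h0t)).and ?_
    have h1 : ContinuousAt (fun v : E => Ψ.symm (v, 0)) 0 :=
      ContinuousAt.comp (g := Ψ.symm) (Ψ.continuousAt_symm h0t) hι.continuousAt
    refine h1.eventually (Metric.isOpen_ball.mem_nhds ?_)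
    have h2 : Ψ.symm ((0 : E), (0 : C(SymmInterval, E))) = 0 := by
      have h3 := Ψ.left_inv h0Ψ
      rwa [hH0] at h3
    change Ψ.symm ((0 : E), (0 : C(SymmInterval, E))) ∈ _
    rw [h2]
    exact Metric.mem_ball_self (by positivity)
  obtain ⟨δ, hδ, hδs⟩ := Metric.eventually_nhds_iff_ball.1 hsmall
  let A : E → C(SymmInterval, E) := fun v => (Ψ.symm (v, 0)).2
  have hA : ∀ v ∈ Metric.ball (0 : E) δ, Ψ.symm (v, 0) = (v, A v) ∧
      A v + connectionTerm Γ p (v, A v) = 0 := by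
    intro v hv
    have h1 := Ψ.right_inv (hδs v hv).1
    rw [hΨ] at h1
    have h2 : (Ψ.symm (v, 0)).1 = v := congrArg Prod.fst h1
    have h3 : Ψ.symm (v, 0) = (v, A v) := Prod.ext h2 rfl
    rw [h3] at h1
    exact ⟨h3, congrArg Prod.snd h1⟩
  have hnorm : ∀ v ∈ Metric.ball (0 : E) δ, ‖v‖ < min ε₁ (ε / 2) ∧ ‖A v‖ < min ε₁ (ε / 2) := by
    intro v hv
    have h1 := (hδs v hv).2
    rw [(hA v hv).1, mem_ball_zero_iff, Prod.norm_def, max_lt_iff] at h1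
    exact h1
  refine ⟨δ, hδ, A, ?_, fun v hv => ⟨(hA v hv).2, fun t => ?_, fun c => ?_⟩⟩
  · exact contDiff_snd.comp_contDiffOn
      (hΨs.comp (contDiff_id.prodMk contDiff_const).contDiffOn fun v hv => (hδs v hv).1)
  · obtain ⟨h1, h2⟩ := hnorm v hv
    have h3 : position p (v, A v) t - p = primitive E (velocity E (v, A v)) t := by
      simp [position, constMap_apply]
    rw [h3]
    have hconst : ‖constMap E v‖ ≤ ‖v‖ :=
      (ContinuousMap.norm_le _ (norm_nonneg v)).2 fun t => le_rfl
    calc ‖primitive E (velocity E (v, A v)) t‖ ≤ ‖velocity E (v, A v)‖ :=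
          (ContinuousMap.norm_coe_le_norm _ t).trans (norm_primitive_le _)
      _ ≤ ‖v‖ + ‖A v‖ := (norm_add_le _ _).trans (add_le_add hconst (norm_primitive_le _))
      _ < ε := by
        have h4 := h1.trans_le (min_le_right _ _)
        have h5 := h2.trans_le (min_le_right _ _)
        linarith
  · obtain ⟨h1, h2⟩ := hnorm v hv
    have hc : |(c : ℝ)| ≤ 1 := abs_le.2 c.2
    have hcv : (c : ℝ) • v ∈ Metric.ball (0 : E) δ := by
      rw [mem_ball_zero_iff] at hv ⊢
      rw [norm_smul, Real.norm_eq_abs]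
      exact (mul_le_of_le_one_left (norm_nonneg v) hc).trans_lt hv
    have hnr : ‖(c : ℝ) ^ 2 • rescale c (A v)‖ ≤ ‖A v‖ := by
      rw [norm_smul, norm_pow, Real.norm_eq_abs]
      refine (mul_le_of_le_one_left (norm_nonneg _) (pow_le_one₀ (abs_nonneg _) hc)).trans ?_
      exact (ContinuousMap.norm_le _ (norm_nonneg _)).2 fun t => (A v).norm_coe_le_norm _
    -- both sides have the same image under the injective map `Ψ`
    have hmem : ((c : ℝ) • v, (c : ℝ) ^ 2 • rescale c (A v)) ∈ Ψ.source := by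
      refine hball ?_
      rw [mem_ball_zero_iff, Prod.norm_def, max_lt_iff]
      refine ⟨?_, hnr.trans_lt (h2.trans_le (min_le_left _ _))⟩
      exact ((hnorm _ hcv).1).trans_le (min_le_left _ _)
    have himg : Ψ ((c : ℝ) • v, (c : ℝ) ^ 2 • rescale c (A v)) = ((c : ℝ) • v, 0) := by
      rw [hΨ]
      refine Prod.ext rfl ?_
      change (c : ℝ) ^ 2 • rescale c (A v) + connectionTerm Γ p _ = 0
      rw [connectionTerm_rescale, ← smul_add, ← rescale_add, (hA v hv).2]
      exact smul_zero _
    have h3 := Ψ.left_inv hmem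
    rw [himg, (hA _ hcv).1] at h3
    exact congrArg Prod.snd h3

end SecondOrder

/-- Solutions of `x'' + Γ(x; x', x') = 0` with small initial velocities exist on `(-1, 1)`, depend
smoothly on the initial velocity, and are homogeneous. -/
theorem exists_smooth_solution {E : Type*} [NormedAddCommGroup E] [NormedSpace ℝ E]
    [CompleteSpace E] {Γ : C(E, E →L[ℝ] E →L[ℝ] E)} (hΓ : ContDiff ℝ ∞ Γ) (p : E) {ε : ℝ}
    (hε : 0 < ε) :
    ∃ δ > 0, ∃ c w : E → ℝ → E,
      (∀ t ∈ Ioo (-1 : ℝ) 1, ContDiffOn ℝ ∞ (fun v => c v t) (Metric.ball 0 δ)) ∧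
      (∀ v, c v 0 = p ∧ w v 0 = v) ∧ ∀ v ∈ Metric.ball (0 : E) δ,
        (∀ t ∈ Ioo (-1 : ℝ) 1, HasDerivAt (c v) (w v t) t ∧
          HasDerivAt (w v) (-Γ (c v t) (w v t) (w v t)) t ∧ c v t ∈ Metric.ball p ε) ∧
        ∀ s ∈ Icc (-1 : ℝ) 1, ∀ t ∈ Ioo (-1 : ℝ) 1, c (s • v) t = c v (s * t) := by
  obtain ⟨δ, hδ, A, hAs, hA⟩ := exists_acceleration hΓ p hε
  let c : E → ℝ → E := fun v t => p + ∫ s in (0 : ℝ)..t, extendSymm (velocity E (v, A v)) s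
  let w : E → ℝ → E := fun v t => v + ∫ s in (0 : ℝ)..t, extendSymm (A v) s
  have hc : ∀ v, ∀ t : SymmInterval, c v t = position p (v, A v) t := fun _ _ => rfl
  have hw : ∀ v, ∀ t : SymmInterval, w v t = velocity E (v, A v) t := fun _ _ => rfl
  refine ⟨δ, hδ, c, w, fun t ht => ?_, fun v => ⟨by simp [c], by simp [w]⟩,
    fun v hv => ⟨fun t ht => ⟨?_, ?_, ?_⟩, fun s hs t ht => ?_⟩⟩
  · have h1 : ContDiffOn ℝ ∞ (fun v => position p (v, A v)) (Metric.ball 0 δ) :=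
      (contDiff_position p).comp_contDiffOn (contDiffOn_id.prodMk hAs)
    have h2 : ContDiff ℝ ∞ fun a : C(SymmInterval, E) => a ⟨t, Ioo_subset_Icc_self ht⟩ :=
      ContinuousLinearMap.contDiff (E := C(SymmInterval, E))
        (ContinuousMap.evalCLM ℝ (⟨t, Ioo_subset_Icc_self ht⟩ : SymmInterval))
    exact h2.comp_contDiffOn h1
  · rw [hw v ⟨t, Ioo_subset_Icc_self ht⟩, ← extendSymm_coe]
    exact (hasDerivAt_primitive _ t).const_add p
  · have h1 := congrArg (fun a : C(SymmInterval, E) => a ⟨t, Ioo_subset_Icc_self ht⟩) (hA v hv).1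
    have h2 : A v ⟨t, Ioo_subset_Icc_self ht⟩ = -Γ (c v t) (w v t) (w v t) :=
      eq_neg_of_add_eq_zero_left h1
    rw [← h2, ← extendSymm_coe]
    exact (hasDerivAt_primitive _ t).const_add v
  · rw [mem_ball_iff_norm]
    exact (hA v hv).2.1 ⟨t, Ioo_subset_Icc_self ht⟩
  · have h1 := (hA v hv).2.2 ⟨s, hs⟩
    have h2 := hc (s • v) ⟨t, Ioo_subset_Icc_self ht⟩
    rw [h1, position_rescale ⟨s, hs⟩] at h2
    exact h2

/-! ### Positivity of the injectivity radius -/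

namespace RiemMetric

variable {m : ℕ} {D : Set (Eu m)}

/-- The injectivity radius is positive: the exponential map is defined and smooth near the origin,
and its derivative there is the identity. -/
theorem injRad_pos (g : RiemMetric D) (hD : IsOpen D) {p : Eu m} (hp : p ∈ D) :
    0 < g.injRad p := by
  -- The Christoffel symbols are extended to the whole space. The cutoff depends only on the position,
  -- so that the equation stays quadratic in the velocity.
  obtain ⟨b, hb, -, hbD, -, N, hN, hpN, hbN⟩ :=
    exists_cutoff (isCompact_singleton (x := p)) hD (singleton_subset_iff.2 hp)
  have hΓs : ContDiff ℝ ∞ fun x => b x • g.chr x :=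
    contDiff_smul_of_tsupport_subset hD hb hbD (g.contDiffOn_chr hD)
  let Γ : C(Eu m, Eu m →L[ℝ] Eu m →L[ℝ] Eu m) := ⟨fun x => b x • g.chr x, hΓs.continuous⟩
  obtain ⟨ε, hε, hεND⟩ := Metric.isOpen_iff.1 (hN.inter hD) p ⟨hpN rfl, hp⟩
  obtain ⟨δ, hδ, c, w, hcs, hc0, hcw⟩ := exists_smooth_solution (Γ := Γ) hΓs p hε
  have hΓ : ∀ x ∈ Metric.ball p ε, ∀ u v, Γ x u v = g.christoffel x u v := fun x hx u v => by
    change (b x • g.chr x) u v = _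
    rw [hbN x (hεND hx).1, one_smul, chr_apply]
  -- solutions exist on `(-1, 1)`; with half the time and twice the velocity, the end point of the
  -- unit interval becomes an inner point
  let F : Eu m → Eu m := fun v => c ((2 : ℝ) • v) (1 / 2)
  have hFs : ContDiffOn ℝ ∞ F (Metric.ball 0 (δ / 2)) := by
    refine (hcs (1 / 2) (by norm_num)).comp (contDiff_const_smul (2 : ℝ)).contDiffOn fun v hv => ?_
    rw [mem_ball_zero_iff] at hv ⊢
    rw [norm_smul, Real.norm_ofNat]
    linarith
  have hmem4 : ∀ v ∈ Metric.ball (0 : Eu m) (δ / 4), (4 : ℝ) • v ∈ Metric.ball (0 : Eu m) δ := by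
    intro v hv
    rw [mem_ball_zero_iff] at hv ⊢
    rw [norm_smul, Real.norm_ofNat]
    linarith
  -- radial lines are mapped to geodesics, also slightly beyond the end points
  have hF : ∀ v ∈ Metric.ball (0 : Eu m) (δ / 4), ∀ t ∈ Ioo (-2 : ℝ) 2,
      F (t • v) = c ((4 : ℝ) • v) (t / 4) := by
    intro v hv t ht
    have h1 := (hcw _ (hmem4 v hv)).2 (t / 2) ⟨by linarith [ht.1], by linarith [ht.2]⟩ (1 / 2)
      (by norm_num)
    rw [smul_smul] at h1
    simp only [F]
    rw [smul_smul, show (2 : ℝ) * t = t / 2 * 4 by ring, h1]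
    congr 1
    ring
  have hFd : ∀ v ∈ Metric.ball (0 : Eu m) (δ / 4), ∀ t ∈ Ioo (-2 : ℝ) 2,
      HasDerivAt (fun t : ℝ => F (t • v)) ((1 / 4 : ℝ) • w ((4 : ℝ) • v) (t / 4)) t := by
    intro v hv t ht
    have h1 := ((hcw _ (hmem4 v hv)).1 (t / 4) ⟨by linarith [ht.1], by linarith [ht.2]⟩).1
    refine (h1.scomp t ((hasDerivAt_id t).div_const 4)).congr_of_eventuallyEq ?_
    filter_upwards [isOpen_Ioo.mem_nhds ht] with s hs using hF v hv s hs
  have hFdd : ∀ v ∈ Metric.ball (0 : Eu m) (δ / 4), ∀ t ∈ Ioo (-2 : ℝ) 2,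
      deriv (deriv fun t : ℝ => F (t • v)) t +
        g.christoffel (F (t • v)) (deriv (fun t : ℝ => F (t • v)) t)
          (deriv (fun t : ℝ => F (t • v)) t) = 0 := by
    intro v hv t ht
    obtain ⟨-, h1, h2⟩ :=
      (hcw _ (hmem4 v hv)).1 (t / 4) ⟨by linarith [ht.1], by linarith [ht.2]⟩
    have h3 := (h1.scomp t ((hasDerivAt_id t).div_const 4)).const_smul (1 / 4 : ℝ)
    have h4 : deriv (deriv fun t : ℝ => F (t • v)) t = _ :=
      (h3.congr_of_eventuallyEq (f₁ := deriv fun t : ℝ => F (t • v)) (by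
        filter_upwards [isOpen_Ioo.mem_nhds ht] with s hs using (hFd v hv s hs).deriv)).deriv
    rw [h4, (hFd v hv t ht).deriv, hF v hv t ht, hΓ _ h2, ← chr_apply, ← chr_apply, map_smul,
      map_smul, _root_.smul_apply, smul_neg, smul_neg, neg_add_cancel]
  have h0b : (0 : Eu m) ∈ Metric.ball (0 : Eu m) (δ / 4) := Metric.mem_ball_self (by positivity)
  have h4b : Metric.ball (0 : Eu m) (δ / 4) ⊆ Metric.ball 0 (δ / 2) :=
    Metric.ball_subset_ball (by linarith)
  have hF0d : HasFDerivAt F (ContinuousLinearMap.id ℝ (Eu m)) 0 := by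
    have h1 : HasFDerivAt F (fderiv ℝ F 0) 0 :=
      ((hFs.contDiffAt (Metric.isOpen_ball.mem_nhds (h4b h0b))).differentiableAt
        (by simp)).hasFDerivAt
    have h2 : ∀ v ∈ Metric.ball (0 : Eu m) (δ / 4), fderiv ℝ F 0 v = v := fun v hv => by
      have h3 : HasFDerivAt F (fderiv ℝ F 0) ((0 : ℝ) • v) := by rwa [zero_smul]
      have h4 := HasFDerivAt.comp_hasDerivAt (f := fun t : ℝ => t • v) (0 : ℝ) h3
        ((hasDerivAt_id (0 : ℝ)).smul_const v)
      have h5 := h4.unique (hFd v hv 0 (by norm_num))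
      rw [one_smul, zero_div, (hc0 _).2, smul_smul] at h5
      rw [h5]
      norm_num
    refine h1.congr_fderiv (ContinuousLinearMap.ext fun v => ?_)
    have h3 : ∀ᶠ t : ℝ in 𝓝 0, t • v ∈ Metric.ball (0 : Eu m) (δ / 4) := by
      have h4 : Continuous fun t : ℝ => t • v := by fun_prop
      refine h4.continuousAt.eventually (Metric.isOpen_ball.mem_nhds ?_)
      simpa using hδ
    obtain ⟨t, ht, ht0⟩ := ((h3.filter_mono (nhdsWithin_le_nhds (s := {0}ᶜ))).and
      self_mem_nhdsWithin).exists
    have h5 := h2 _ ht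
    rw [map_smul] at h5
    exact smul_right_injective _ ht0 h5
  obtain ⟨Ψ, h0Ψ, hΨb, hΨ, hΨs⟩ := exists_openPartialHomeomorph_of_contDiffOn Metric.isOpen_ball
    (hFs.mono h4b) h0b hF0d
  obtain ⟨r, hr, hrΨ⟩ := Metric.isOpen_iff.1 Ψ.open_source 0 h0Ψ
  obtain ⟨C, hC, hCq⟩ := (g.isInnerForm hp).exists_norm_sq_le
  let ρ := r / √C
  have hρ : 0 < ρ := div_pos hr (Real.sqrt_pos.2 hC)
  have hqo : IsOpen {v : Eu m | g.inner p v v < ρ ^ 2} :=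
    isOpen_lt (IsExpChart.continuous_normSq g p) continuous_const
  have hqΨ : {v : Eu m | g.inner p v v < ρ ^ 2} ⊆ Ψ.source := fun v hv => by
    refine hrΨ (mem_ball_zero_iff.2 ?_)
    have h1 : C * g.inner p v v < C * ρ ^ 2 := mul_lt_mul_of_pos_left hv hC
    rw [div_pow, Real.sq_sqrt hC.le, mul_div_cancel₀ _ hC.ne'] at h1
    exact lt_of_pow_lt_pow_left₀ 2 hr.le ((hCq v).trans_lt h1)
  let Φ := Ψ.restrOpen _ hqo
  have hΦ : ⇑Φ = F := hΨ
  have hΦs : Φ.source = {v | g.inner p v v < ρ ^ 2} := inter_eq_right.2 hqΨ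
  have hexp : g.ExpIsDiffeo p ρ := by
    refine ⟨Φ, hΦs, ?_, ?_, fun v hv => ⟨fun t ht => ?_, ?_, ?_⟩⟩
    · rw [hΦ]
      exact hFs.mono fun v hv => h4b (hΨb hv.1)
    · exact hΨs.mono fun y hy => hy.1
    · have hvb := hΨb hv.1
      have ht2 : t ∈ Ioo (-2 : ℝ) 2 := ⟨by linarith [ht.1], by linarith [ht.2]⟩
      have htv : t • v ∈ Metric.ball (0 : Eu m) (δ / 2) := by
        refine h4b ?_
        rw [mem_ball_zero_iff] at hvb ⊢
        rw [norm_smul, Real.norm_eq_abs, abs_of_nonneg ht.1]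
        exact (mul_le_of_le_one_left (norm_nonneg v) ht.2).trans_lt hvb
      rw [hΦ]
      refine ⟨?_, ?_, hFdd v hvb t ht2⟩
      · change F (t • v) ∈ D
        rw [hF v hvb t ht2]
        exact (hεND ((hcw _ (hmem4 v hvb)).1 (t / 4)
          ⟨by linarith [ht.1], by linarith [ht.2]⟩).2.2).2
      · exact (hFs.contDiffAt (Metric.isOpen_ball.mem_nhds htv)).comp t
          (contDiff_id.smul contDiff_const).contDiffAt
    · have h1 := hF v (hΨb hv.1) 0 (by norm_num)
      rw [zero_smul, zero_div, (hc0 _).1] at h1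
      rw [hΦ, h1]
    · have hvb := hΨb hv.1
      rw [hΦ, (hFd v hvb 0 (by norm_num)).deriv, zero_div, (hc0 _).2, smul_smul]
      norm_num
  exact (ENNReal.ofReal_pos.2 hρ).trans_le (le_iSup₂_of_le ρ ⟨hρ, hexp⟩ le_rfl)

end RiemMetric

end

/-! ### Area bounds for minimizing hypersurfaces -/

theorem mainTheorem9 (n : ℕ) (hn : 1 ≤ n) (g : RiemMetric (unitDisk (n + 1)))
    (κ : ℝ) (hκ : 0 < κ)
    (hsec : ∀ x ∈ unitDisk (n + 1), ∀ u v : Eu (n + 1), LinearIndependent ℝ ![u, v] →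
      -κ ≤ g.sec x u v ∧ g.sec x u v ≤ κ)
    (R : ℝ) (hR : R = (min (g.injRad 0) (ENNReal.ofReal (1 / (2 * √κ)))).toReal)
    (S : Set (Eu (n + 1))) (hS : IsHypersurface (unitDisk (n + 1)) S)
    (hmin : IsAreaMinimizing g S) (h0 : (0 : Eu (n + 1)) ∈ S)
    (hbd : hypBoundary S ∩ g.ball 0 R = ∅) :
    (∀ r ∈ Ioo 0 R, hypVol g S (g.ball 0 r) ≠ ⊤) ∧
    MonotoneOn (fun r => (hypVol g S (g.ball 0 r)).toReal / monoWeight n κ r) (Ioo 0 R) ∧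
    Tendsto (fun r => (hypVol g S (g.ball 0 r)).toReal / monoWeight n κ r) (𝓝[>] 0)
      (𝓝 (unitBallVol n)) ∧
    (∀ r ∈ Ioo 0 R,
      ENNReal.ofReal (unitBallVol n * monoWeight n κ r) ≤ hypVol g S (g.ball 0 r)) ∧
    (∀ r : ℝ, 0 < r →
      ENNReal.ofReal r ≤ (1 / 2) * min (g.injRad 0) (ENNReal.ofReal (1 / (n ^ 2 * √κ))) →
      ENNReal.ofReal (unitBallVol n * monoWeight n κ r) ≤ hypVol g S (g.ball 0 r) ∧
      unitBallVol n * monoWeight n κ r =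
        unitBallVol n * r ^ n * Real.exp (-(n : ℝ) ^ 2 * √κ * r) ∧
      Real.exp (-1) * unitBallVol n * r ^ n ≤
        unitBallVol n * r ^ n * Real.exp (-(n : ℝ) ^ 2 * √κ * r)) := by
  have hD : IsOpen (unitDisk (n + 1)) := Metric.isOpen_ball
  have hp : (0 : Eu (n + 1)) ∈ unitDisk (n + 1) := Metric.mem_ball_self one_pos
  have hsκ : 0 < √κ := Real.sqrt_pos.2 hκ
  have hsec' : ∀ x ∈ unitDisk (n + 1), ∀ u v : Eu (n + 1), LinearIndependent ℝ ![u, v] →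
      g.sec x u v ≤ κ := fun x hx u v huv => (hsec x hx u v huv).2
  have hmtop : min (g.injRad 0) (ENNReal.ofReal (1 / (2 * √κ))) ≠ ⊤ :=
    ne_top_of_le_ne_top ENNReal.ofReal_ne_top (min_le_right _ _)
  have hRe : ENNReal.ofReal R = min (g.injRad 0) (ENNReal.ofReal (1 / (2 * √κ))) := by
    rw [hR, ENNReal.ofReal_toReal hmtop]
  have hRpos : 0 < R := by
    rw [← ENNReal.ofReal_pos, hRe]
    exact lt_min (g.injRad_pos hD hp) (ENNReal.ofReal_pos.2 (by positivity))
  have hRκ : √κ * R ≤ 1 / 2 := by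
    have h1 : ENNReal.ofReal R ≤ ENNReal.ofReal (1 / (2 * √κ)) := hRe.trans_le (min_le_right _ _)
    rw [ENNReal.ofReal_le_ofReal_iff (by positivity), le_div_iff₀ (by positivity)] at h1
    linarith
  -- radii below `R` are covered by charts in which `S` has no boundary
  have hchart : ∀ r ∈ Ioo 0 R, ∃ (ρ : ℝ) (Φ : OpenPartialHomeomorph (Eu (n + 1)) (Eu (n + 1))),
      g.IsExpChart 0 ρ Φ ∧ r < ρ ∧
      ∀ x ∈ S ∩ RiemMetric.IsExpChart.closedBall g 0 Φ r, IsInteriorPt S x := by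
    intro r hr
    have h1 : ENNReal.ofReal r < g.injRad 0 :=
      ((ENNReal.ofReal_lt_ofReal_iff hRpos).2 hr.2).trans_le (hRe.trans_le (min_le_left _ _))
    simp only [RiemMetric.injRad, lt_iSup_iff] at h1
    obtain ⟨ρ, ⟨hρ, Φ, h2, h3, h4, h5⟩, h6⟩ := h1
    have h : g.IsExpChart 0 ρ Φ := ⟨h2, h3, h4, h5⟩
    have hrρ : r < ρ := (ENNReal.ofReal_lt_ofReal_iff hρ).1 h6
    refine ⟨ρ, Φ, h, hrρ, fun x hx => (hS.local_form x hx.1).resolve_right fun hxb => ?_⟩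
    obtain ⟨b, hrb, hb⟩ := exists_between (lt_min hr.2 hrρ)
    have h7 : x ∈ g.ball 0 b := by
      rw [h.ball_eq hρ hD (hr.1.trans hrb) (hb.trans_le (min_le_right _ _))]
      exact h.closedBall_subset_openBall hr.1.le hrb hrρ hx.2
    have h8 : x ∈ hypBoundary S ∩ g.ball 0 R :=
      ⟨hxb, h7.1, h7.2.trans_le (ENNReal.ofReal_le_ofReal (hb.le.trans (min_le_left _ _)))⟩
    rw [hbd] at h8
    exact h8
  have hmono : MonotoneOn (fun r => (hypVol g S (g.ball 0 r)).toReal / monoWeight n κ r)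
      (Ioo 0 R) := by
    intro a ha b hb hab
    obtain ⟨ρ, Φ, h, hbρ, hbS⟩ := hchart b hb
    exact h.areaRatio_le hn (hb.1.trans hbρ) hD hκ hsec' hS hmin ha.1 hab hbρ
      ((mul_le_mul_of_nonneg_left hb.2.le hsκ.le).trans hRκ) hbS
  have hlim : Tendsto (fun r => (hypVol g S (g.ball 0 r)).toReal / monoWeight n κ r) (𝓝[>] 0)
      (𝓝 (unitBallVol n)) := by
    have hR2 : R / 2 ∈ Ioo 0 R := ⟨half_pos hRpos, half_lt_self hRpos⟩
    obtain ⟨ρ, Φ, h, hρ, hint⟩ := hchart (R / 2) hR2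
    have hρ0 : 0 < ρ := hR2.1.trans hρ
    have h0i : IsInteriorPt S 0 := hint 0 ⟨h0, 0, by simpa using sq_nonneg (R / 2), h.map_zero hρ0⟩
    have h1 := h.tendsto_hypVol_div_pow (S := S) hρ0 hD h0i
    have h2 : Tendsto (fun r : ℝ => Real.exp (-√κ * n ^ 2 * r)) (𝓝[>] 0) (𝓝 1) := by
      have h3 : Continuous fun r : ℝ => Real.exp (-√κ * n ^ 2 * r) := by fun_prop
      have h4 := h3.tendsto 0
      rw [mul_zero, Real.exp_zero] at h4
      exact h4.mono_left nhdsWithin_le_nhds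
    have h5 := h1.div h2 one_ne_zero
    rw [div_one] at h5
    refine h5.congr fun r => ?_
    rw [monoWeight, Pi.div_apply, div_div]
  have hlow : ∀ r ∈ Ioo 0 R,
      ENNReal.ofReal (unitBallVol n * monoWeight n κ r) ≤ hypVol g S (g.ball 0 r) := by
    intro r hr
    refine ENNReal.ofReal_le_of_le_toReal ?_
    rw [← le_div_iff₀ (monoWeight_pos n κ hr.1)]
    refine le_of_tendsto hlim ?_
    filter_upwards [Ioo_mem_nhdsGT hr.1] with s hs
    exact hmono ⟨hs.1, hs.2.trans hr.2⟩ hr hs.2.le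
  refine ⟨fun r hr => ?_, hmono, hlim, hlow, fun r hr hrle => ?_⟩
  · obtain ⟨ρ, Φ, h, hrρ, hrS⟩ := hchart r hr
    exact (h.hypVol_ball_lt_top (hr.1.trans hrρ) hD hS hr.1 hrρ hrS).ne
  have hnpos : (1 : ℝ) ≤ n := by exact_mod_cast hn
  have hle1 : ENNReal.ofReal r ≤ g.injRad 0 := by
    refine hrle.trans ((mul_le_mul_right (min_le_left _ _) _).trans ?_)
    exact mul_le_of_le_one_left' ENNReal.half_le_self
  have hle2 : 2 * (n ^ 2 * √κ * r) ≤ 1 := by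
    have h1 : ENNReal.ofReal r ≤ ENNReal.ofReal (1 / 2 * (1 / (n ^ 2 * √κ))) := by
      rw [ENNReal.ofReal_mul (by norm_num)]
      refine hrle.trans ((mul_le_mul_right (min_le_right _ _) _).trans_eq ?_)
      congr 1
      rw [ENNReal.ofReal_div_of_pos two_pos, ENNReal.ofReal_one, ENNReal.ofReal_ofNat]
    rw [ENNReal.ofReal_le_ofReal_iff (by positivity), ← mul_div_assoc, mul_one,
      le_div_iff₀ (by positivity)] at h1
    linarith
  have hrR : r ≤ R := by
    rw [← ENNReal.ofReal_le_ofReal_iff hRpos.le, hRe]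
    refine le_min hle1 (ENNReal.ofReal_le_ofReal ?_)
    rw [le_div_iff₀ (by positivity)]
    have h1 : √κ * r ≤ n ^ 2 * (√κ * r) := le_mul_of_one_le_left (by positivity) (one_le_pow₀ hnpos)
    linarith
  have hw : 0 ≤ unitBallVol n := measureReal_nonneg
  refine ⟨?_, ?_, ?_⟩
  · -- the radius may be equal to `R` if `n = 1`, so smaller radii are used
    have hcont : Continuous fun s => ENNReal.ofReal (unitBallVol n * monoWeight n κ s) := by
      unfold monoWeight
      exact ENNReal.continuous_ofReal.comp (by fun_prop)
    refine le_of_tendsto ((hcont.tendsto r).mono_left (nhdsWithin_le_nhds (s := Iio r))) ?_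
    filter_upwards [Ioo_mem_nhdsLT hr] with s hs
    refine (hlow s ⟨hs.1, hs.2.trans_le hrR⟩).trans (lintegral_mono_set ?_)
    exact inter_subset_inter_left _ fun x hx =>
      ⟨hx.1, hx.2.trans_le (ENNReal.ofReal_le_ofReal hs.2.le)⟩
  · rw [monoWeight, ← mul_assoc]
    congr 2
    ring
  · rw [mul_assoc, mul_comm]
    refine mul_le_mul_of_nonneg_left (Real.exp_le_exp.2 ?_) (by positivity)
    linarith
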